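/- Let $N\ge 1$, $\tau\in\mathbb C$ with $\mathrm{Im}\,\tau>0$, $\hbar\in\mathbb C\setminus(\mathbb Q+\mathbb Q\tau)$, and $\theta(z)=-\sum_{j\in\mathbb Z}\exp\big(i\pi(j+\tfrac12)^2\tau+2i\pi(j+\tfrac12)(z+\tfrac12)\big)$. Let $\mathfrak h$ be the Cartan subalgebra of $\mathfrak{sl}_N$, generated by $\epsilon_1,\dots,\epsilon_N$ with $\sum_i\epsilon_i=0$; for $\lambda=\sum_k c_k\epsilon_k$ put $\lambda_{ij}=c_i-c_j$. Let $\mathbb M$ be the field of meromorphic functions of $\lambda\in\mathfrak h$, and $Q_+\subset\mathfrak h$ the monoid of sums of simple roots $\epsilon_i-\epsilon_{i+1}$. A set of weights is *bounded* if it lies in a finite union of cones $\nu-Q_+$. Let $R^{ij}_{pq}(z;\lambda)$ be the coefficient of $v_p\otimes v_q$ in $R(z;\lambda)(v_i\otimes v_j)$, where $$R(z;\lambda)=\sum_iE_{ii}\otimes E_{ii}+\sum_{i\ne j}\Big(\tfrac{\theta(z)\theta(\lambda_{ij}-\hbar)}{\theta(z+\hbar)\theta(\lambda_{ij})}E_{ii}\otimes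 E_{jj}+\tfrac{\theta(z+\lambda_{ij})\theta(\hbar)}{\theta(z+\hbar)\theta(\lambda_{ij})}E_{ij}\otimes E_{ji}\Big).$$ **Modules.** A module $X=\bigoplus_{\alpha\in\mathfrak h}X[\alpha]$ is an $\mathfrak h$-graded $\mathbb M$-vector space with finite-dimensional weight spaces, with operators $L_{ij}(z)$ ($1\le i,j\le N$) whose matrix entries are meromorphic in $(z,\lambda)$, mapping $X[\gamma]$ to $X[\gamma+\epsilon_j-\epsilon_i]$ and satisfying $L_{ij}(z)g(\lambda)v=g(\lambda+\hbar\epsilon_j)L_{ij}(z)v$ and $$\sum_{p,q}\mu_l\big(R^{pq}_{mn}(z-w;\lambda)\big)L_{pi}(z)L_{qj}(w)=\sum_{p,q}\mu_r\big(R^{ij}_{pq}(z-w;\lambda)\big)L_{nq}(w)L_{mp}(z),$$ where $\mu_r(g)v=g(\lambda)v$ and $\mu_l(g)v=g(\lambda+\hbar\alpha)v$ for $v\in X[\alpha]$. Morphisms are graded $\mathbb M$-linear maps commuting with all $L_{ij}(z)$. The dynamical tensor product $X\tilde\otimes Y$ is the quotient of $X\otimes_{\mathbb C}Y$ by $g(\lambda)v\otimes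 w=v\otimes g(\lambda+\hbar\beta)w$ for $w\in Y[\beta]$, with $\mathbb M$ acting on the second factor, weights added, and $L_{ij}(z)=\sum_kL_{ik}(z)\tilde\otimes L_{kj}(z)$. **Category $\mathcal O$.** For $1\le k\le N$ put $\Theta_k(\lambda)=\prod_{N-k+1\le i<j\le N}\theta(\lambda_{ij})$ and $$D_k(z)=\frac{\mu_r(\Theta_k)}{\mu_l(\Theta_k)}\sum_\sigma \mathrm{sign}(\sigma)\,L_{\sigma(N),N}(z)L_{\sigma(N-1),N-1}(z+\hbar)\cdots L_{\sigma(N-k+1),N-k+1}(z+(k-1)\hbar),$$ $\sigma$ running over the permutations of $\{N-k+1,\dots,N\}$. A module $X$ is in $\mathcal O$ if its set of weights is bounded and every $X[\mu]$ has an ordered basis in which $D_1(z),\dots,D_N(z)$ are upper triangular with diagonal entries non-zero meromorphic functions of $z$, independent of $\lambda$. Write the diagonal entries at a basis vector $b$ uniquely as $f_{b,N}(z)f_{b,N-1}(z+\hbar)\cdots f_{b,N-k+1}(z+(k-1)\hbar)$. **q-characters.** Let $\mathcal M$ be the group of $N$-tuples of non-zero meromorphic functions of $z$ modulo tuples of constants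 with product $1$, and $\widehat{\mathcal M}=\mathcal M\times\mathfrak h$. Let $\mathcal M_t$ be the commutative ring of formal sums $\sum c_{\mathbf f}\mathbf f$ ($\mathbf f\in\widehat{\mathcal M}$, $c_{\mathbf f}\in\mathbb Z$) with finitely many terms over each $\mu\in\mathfrak h$ and bounded set of weights, the product being induced from that of $\widehat{\mathcal M}$. For $X$ in $\mathcal O$, $\chi_q(X)=\sum_\mu\sum_b(f_{b,1},\dots,f_{b,N};\mu)$, where $b$ runs over a basis of $X[\mu]$ as above. **Grothendieck group.** Put $\hat L_k(z)=L_{kk}(z)\prod_{j>k}\mu_r(\theta(\lambda_{kj}))/\mu_l(\theta(\lambda_{kj}))$. A module has highest weight $(f_1,\dots,f_N;\alpha)\in\widehat{\mathcal M}$ if it is irreducible and contains a non-zero $v\in X[\alpha]$ with $L_{ij}(z)v=0$ for $i>j$ and $\hat L_k(z)v=f_k(z)v$ for all $k$. Let $\mathcal R$ be the set of highest weights of irreducible modules in $\mathcal O$, and for $d\in\mathcal R$ fix an irreducible $S(d)$ in $\mathcal O$ of highest weight $d$. The completed Grothendieck group $K_0(\mathcal O)$ is the set of formal sums $\sum_{d\in\mathcal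 R}c_d[S(d)]$, $c_d\in\mathbb Z$, such that $\bigoplus_dS(d)^{\oplus|c_d|}$ is in $\mathcal O$. For $X$ in $\mathcal O$ put $[X]=\sum_dm_{d,X}[S(d)]$, where the multiplicity $m_{d,X}$ is the largest number of factors isomorphic to $S(d)$ in a finite chain of submodules of $X$. **Theorem.** 1. If $X,Y$ are in $\mathcal O$, then so is $X\tilde\otimes Y$. The q-character of an object of $\mathcal O$ is well defined, and $\chi_q(X\tilde\otimes Y)=\chi_q(X)\chi_q(Y)$. 2. $[X]\in K_0(\mathcal O)$ for all $X$ in $\mathcal O$, and there is a unique ring structure on $K_0(\mathcal O)$ whose addition is that of formal sums and with $[X][Y]=[X\tilde\otimes Y]$ for all $X,Y$ in $\mathcal O$. 3. There is an injective ring homomorphism $K_0(\mathcal O)\to\mathcal M_t$ sending $[X]$ to $\chi_q(X)$ for all $X$ in $\mathcal O$. In particular, $K_0(\mathcal O)$ is commutative. -/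

import Mathlib

noncomputable section

namespace EllipticO

/-! ### Meromorphic functions on complex vector spaces -/

section Meromorphic

variable {E F : Type} [NormedAddCommGroup E] [NormedSpace ℂ E]
  [NormedAddCommGroup F] [NormedSpace ℂ F]

variable (E) in
/-- The `ℂ`-algebra of entire functions on `E`. -/
def Ent : Subalgebra ℂ (E → ℂ) where
  carrier := {f | Differentiable ℂ f}
  mul_mem' hf hg := Differentiable.mul hf hg
  add_mem' hf hg := Differentiable.add hf hg
  algebraMap_mem' c := differentiable_const c

/-- The ring of entire functions has no zero divisors (restrict to a complex line). -/
instance : IsDomain (Ent E) := by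
  have : NoZeroDivisors (Ent E) := by
    refine ⟨fun {f g} hfg => ?_⟩
    by_contra hcon
    push Not at hcon
    obtain ⟨hf, hg⟩ := hcon
    have hf' : ∃ x, f.1 x ≠ 0 := by
      by_contra h
      push Not at h
      exact hf (Subtype.ext (funext h))
    have hg' : ∃ x, g.1 x ≠ 0 := by
      by_contra h
      push Not at h
      exact hg (Subtype.ext (funext h))
    obtain ⟨x, hx⟩ := hf'
    obtain ⟨y, hy⟩ := hg'
    have hline : Differentiable ℂ (fun t : ℂ => x + t • (y - x)) := by fun_prop
    have hF : Differentiable ℂ (fun t : ℂ => f.1 (x + t • (y - x))) :=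
      Differentiable.comp f.2 hline
    have hG : Differentiable ℂ (fun t : ℂ => g.1 (x + t • (y - x))) :=
      Differentiable.comp g.2 hline
    have hFa : AnalyticOnNhd ℂ (fun t : ℂ => f.1 (x + t • (y - x))) Set.univ :=
      fun t _ => hF.analyticAt t
    have hGa : AnalyticOnNhd ℂ (fun t : ℂ => g.1 (x + t • (y - x))) Set.univ :=
      fun t _ => hG.analyticAt t
    have hprod : ∀ t ∈ (Set.univ : Set ℂ),
        (fun t : ℂ => f.1 (x + t • (y - x))) t * (fun t : ℂ => g.1 (x + t • (y - x))) t = 0 := by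
      intro t _
      exact congrFun (congrArg Subtype.val hfg) (x + t • (y - x))
    rcases AnalyticOnNhd.eq_zero_or_eq_zero_of_mul_eq_zero hFa hGa hprod
      isPreconnected_univ with h | h
    · exact hx (by simpa using h 0 (Set.mem_univ _))
    · exact hy (by simpa using h 1 (Set.mem_univ _))
  exact NoZeroDivisors.to_isDomain _

variable (E) in
/-- The field of meromorphic functions on the finite-dimensional complex vector space `E`:
meromorphic functions on `ℂⁿ` are exactly the quotients of two entire functions. -/
abbrev Mer : Type := FractionRing (Ent E)

/-- An entire function, viewed as a meromorphic function. -/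
def ofEnt (f : E → ℂ) (hf : Differentiable ℂ f) : Mer E :=
  algebraMap (Ent E) (Mer E) ⟨f, hf⟩

/-- Composition of entire functions with a fixed entire map. -/
def entComp (φ : E → F) (hφ : Differentiable ℂ φ) : Ent F →+* Ent E where
  toFun f := ⟨fun x => f.1 (φ x), Differentiable.comp f.2 hφ⟩
  map_one' := rfl
  map_mul' _ _ := rfl
  map_zero' := rfl
  map_add' _ _ := rfl

theorem entComp_injective (φ : E → F) (hφ : Differentiable ℂ φ) (hs : Function.Surjective φ) :
    Function.Injective (entComp φ hφ) := by
  intro f g h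
  refine Subtype.ext (funext fun y => ?_)
  obtain ⟨x, rfl⟩ := hs y
  exact congrFun (congrArg Subtype.val h) x

/-- The substitution `f(y) ↦ f(φ(x))` of meromorphic functions along a surjective entire map. -/
def pull (φ : E → F) (hφ : Differentiable ℂ φ) (hs : Function.Surjective φ) :
    Mer F →+* Mer E :=
  IsFractionRing.map (entComp_injective φ hφ hs)

/-- The translation `f(x) ↦ f(x + u)`. -/
def shift (u : E) : Mer E →+* Mer E :=
  pull (fun x => x + u) (by fun_prop) (fun y => ⟨y - u, sub_add_cancel y u⟩)

end Meromorphic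

/-! ### The theta function -/

/-- The Jacobi theta function `θ(z|τ)`. -/
def theta (τ z : ℂ) : ℂ :=
  -∑' j : ℤ, Complex.exp (Complex.I * Real.pi * ((j : ℂ) + 1 / 2) ^ 2 * τ
    + 2 * Complex.I * Real.pi * ((j : ℂ) + 1 / 2) * (z + 1 / 2))

theorem theta_eq (τ z : ℂ) :
    theta τ z = -(Complex.exp (Complex.I * Real.pi * τ / 4 + Complex.I * Real.pi * (z + 1 / 2))
      * jacobiTheta₂ (z + 1 / 2 + τ / 2) τ) := by
  unfold theta jacobiTheta₂
  rw [← tsum_mul_left]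
  congr 1
  refine tsum_congr fun j => ?_
  rw [jacobiTheta₂_term, ← Complex.exp_add]
  congr 1
  ring

theorem differentiable_theta (τ : ℂ) : Differentiable ℂ (theta τ) := by
  have h : theta τ = fun z => -(Complex.exp (Complex.I * Real.pi * τ / 4
      + Complex.I * Real.pi * (z + 1 / 2)) * jacobiTheta₂ (z + 1 / 2 + τ / 2) τ) :=
    funext (theta_eq τ)
  rw [h]
  by_cases hτ : 0 < τ.im
  · have h2 : Differentiable ℂ (fun z : ℂ => jacobiTheta₂ (z + 1 / 2 + τ / 2) τ) := by
      intro z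
      exact DifferentiableAt.comp z (f := fun z : ℂ => z + 1 / 2 + τ / 2)
        (g := fun w => jacobiTheta₂ w τ) (differentiableAt_jacobiTheta₂_fst _ hτ) (by fun_prop)
    fun_prop
  · have h2 : (fun z : ℂ => jacobiTheta₂ (z + 1 / 2 + τ / 2) τ) = fun _ => 0 :=
      funext fun z => jacobiTheta₂_undef _ (not_lt.mp hτ)
    have h3 : Differentiable ℂ (fun z : ℂ => jacobiTheta₂ (z + 1 / 2 + τ / 2) τ) := by
      rw [h2]; fun_prop
    fun_prop

/-- The meromorphic function `x ↦ θ(f(x))` on `E`, for `f` entire on `E`. -/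
def thetaM {E : Type} [NormedAddCommGroup E] [NormedSpace ℂ E] (τ : ℂ) (f : E → ℂ)
    (hf : Differentiable ℂ f) : Mer E :=
  ofEnt (fun x => theta τ (f x)) ((differentiable_theta τ).comp hf)

/-! ### The Cartan subalgebra of `𝔰𝔩_N` -/

/-- The diagonal traceless matrices. -/
def cartan (N : ℕ) : Submodule ℂ (Fin N → ℂ) where
  carrier := {x | ∑ i, x i = 0}
  add_mem' {x y} hx hy := by
    simp only [Set.mem_ofPred_eq] at hx hy ⊢
    simp [Finset.sum_add_distrib, hx, hy]
  zero_mem' := by simp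
  smul_mem' c x hx := by
    simp only [Set.mem_ofPred_eq] at hx ⊢
    simp [← Finset.mul_sum, hx]

abbrev H (N : ℕ) : Type := cartan N

/-- The vector `ε_i`, the traceless part of the `i`-th coordinate vector. The `ε_i` span `H N`
and their only linear relation is that they add up to zero. -/
def ε {N : ℕ} (i : Fin N) : H N :=
  ⟨fun t => (if t = i then 1 else 0) - 1 / N, by
    have hN : (N : ℂ) ≠ 0 := by
      have : NeZero N := ⟨fun h => by subst h; exact i.elim0⟩
      exact NeZero.ne _
    change ∑ t, ((if t = i then (1 : ℂ) else 0) - 1 / N) = 0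
    simp [Finset.sum_sub_distrib, hN]⟩

/-- The linear form `λ ↦ λ_{ij}`, sending `∑ c_k ε_k` to `c_i - c_j`. -/
def ldiff {N : ℕ} (i j : Fin N) (x : H N) : ℂ := x.1 i - x.1 j

theorem differentiable_ldiff {N : ℕ} (i j : Fin N) : Differentiable ℂ (ldiff i j) := by
  have hl : ∀ k : Fin N, Differentiable ℂ (fun x : H N => x.1 k) := fun k =>
    ((ContinuousLinearMap.proj (R := ℂ) (φ := fun _ : Fin N => ℂ) k).comp
      (cartan N).subtypeL).differentiable
  exact (hl i).sub (hl j)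

/-- The simple roots `ε_i - ε_{i+1}`. -/
def simpleRoots (N : ℕ) : Set (H N) :=
  {x | ∃ i j : Fin N, (i : ℕ) + 1 = j ∧ x = ε i - ε j}

/-- The monoid of sums of simple roots. -/
def QPlus (N : ℕ) : AddSubmonoid (H N) := AddSubmonoid.closure (simpleRoots N)

/-- The set `S` of weights is contained in a finite union of cones `ν - Q₊`. -/
def InCones {N : ℕ} (S : Set (H N)) : Prop :=
  ∃ T : Finset (H N), ∀ μ ∈ S, ∃ ν ∈ T, ν - μ ∈ QPlus N

/-! ### Fields of meromorphic functions and substitutions -/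

/-- Meromorphic functions of `z`. -/
abbrev MC : Type := Mer ℂ
/-- Meromorphic functions of `λ`. -/
abbrev MH (N : ℕ) : Type := Mer (H N)
/-- Meromorphic functions of `(z, λ)`. -/
abbrev MZ (N : ℕ) : Type := Mer (ℂ × H N)
/-- Meromorphic functions of `(z, w, λ)`. -/
abbrev MZW (N : ℕ) : Type := Mer (ℂ × ℂ × H N)

/-- A function of `z`, viewed as a function of `(z, λ)`. -/
def ofC (N : ℕ) : MC →+* MZ N :=
  pull (fun x : ℂ × H N => x.1) (by fun_prop) (fun z => ⟨(z, 0), rfl⟩)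

/-- A function of `λ`, viewed as a function of `(z, λ)`. -/
def ofH (N : ℕ) : MH N →+* MZ N :=
  pull (fun x : ℂ × H N => x.2) (by fun_prop) (fun l => ⟨(0, l), rfl⟩)

/-- `f(z, λ)`, viewed as a function of `(z, w, λ)`. -/
def atZ (N : ℕ) : MZ N →+* MZW N :=
  pull (fun x : ℂ × ℂ × H N => (x.1, x.2.2)) (by fun_prop) (fun y => ⟨(y.1, 0, y.2), rfl⟩)

/-- `f(w, λ)`, viewed as a function of `(z, w, λ)`. -/
def atW (N : ℕ) : MZ N →+* MZW N :=
  pull (fun x : ℂ × ℂ × H N => (x.2.1, x.2.2)) (by fun_prop) (fun y => ⟨(0, y.1, y.2), rfl⟩)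

/-- `f(z - w, λ)`, viewed as a function of `(z, w, λ)`. -/
def atZsubW (N : ℕ) : MZ N →+* MZW N :=
  pull (fun x : ℂ × ℂ × H N => (x.1 - x.2.1, x.2.2)) (by fun_prop)
    (fun y => ⟨(y.1, 0, y.2), by simp⟩)

/-! ### The elliptic dynamical R-matrix -/

theorem differentiable_fst_add {N : ℕ} (c : ℂ) :
    Differentiable ℂ (fun x : ℂ × H N => x.1 + c) := by fun_prop

theorem differentiable_ldiff_snd {N : ℕ} (i j : Fin N) (c : ℂ) :
    Differentiable ℂ (fun x : ℂ × H N => ldiff i j x.2 + c) :=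
  ((differentiable_ldiff i j).comp differentiable_snd).add_const c

/-- `θ(z + c)`. -/
def thZ (N : ℕ) (τ c : ℂ) : MZ N := thetaM τ _ (differentiable_fst_add c)

/-- `θ(λ_{ij} + c)`, as a function of `(z, λ)`. -/
def thL {N : ℕ} (τ : ℂ) (i j : Fin N) (c : ℂ) : MZ N := thetaM τ _ (differentiable_ldiff_snd i j c)

/-- `θ(z + λ_{ij})`. -/
def thZL {N : ℕ} (τ : ℂ) (i j : Fin N) : MZ N :=
  thetaM τ (fun x : ℂ × H N => x.1 + ldiff i j x.2)
    (differentiable_fst.add ((differentiable_ldiff i j).comp differentiable_snd))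

/-- `θ(c)`, as a constant function of `(z, λ)`. -/
def thConst (N : ℕ) (τ c : ℂ) : MZ N := algebraMap ℂ (MZ N) (theta τ c)

/-- `θ(λ_{ij} + c)`, as a function of `λ`. -/
def thH {N : ℕ} (τ : ℂ) (i j : Fin N) (c : ℂ) : MH N :=
  thetaM τ (fun x : H N => ldiff i j x + c) ((differentiable_ldiff i j).add_const c)

/-- The coefficient `R_{pq}^{ij}(z;λ)` of `v_p ⊗ v_q` in `R(z;λ)(v_i ⊗ v_j)`, where `R(z;λ)` is
the sum of `E_{aa} ⊗ E_{aa}` over all `a` and, over all pairs `a ≠ b`, of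
`θ(z)θ(λ_{ab}-ħ)/(θ(z+ħ)θ(λ_{ab})) E_{aa} ⊗ E_{bb}` and
`θ(z+λ_{ab})θ(ħ)/(θ(z+ħ)θ(λ_{ab})) E_{ab} ⊗ E_{ba}`, with `E_{ab} v_b = v_a`. -/
def Rcoef {N : ℕ} (τ ħ : ℂ) (p q i j : Fin N) : MZ N :=
  if i = j then (if p = i ∧ q = i then 1 else 0)
  else if p = i ∧ q = j then
    thZ N τ 0 * thL τ i j (-ħ) / (thZ N τ ħ * thL τ i j 0)
  else if p = j ∧ q = i then
    thZL τ j i * thConst N τ ħ / (thZ N τ ħ * thL τ j i 0)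
  else 0

/-! ### Difference operators and modules

An `H`-graded vector space over the field `MH N` is described by a homogeneous basis `B` with its
weights; the underlying space is `B →₀ MH N`. An operator which depends meromorphically on
parameters sends a basis vector to a finite combination of basis vectors whose coefficients are
meromorphic functions of the parameters and `λ`. -/

/-- The action on `x = ∑ g_b(λ) b` of the difference operator whose value on the basis vector `b`
is `Φ b`: it is `∑ g_b(λ + ħβ) Φ b`, where `u` is `ħβ` placed in the coordinates of `E`. -/
def act {E : Type} [NormedAddCommGroup E] [NormedSpace ℂ E] {B : Type} (u : E)
    (Φ : B → B →₀ Mer E) (x : B →₀ Mer E) : B →₀ Mer E :=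
  x.sum fun b g => shift u g • Φ b

/-- Apply a substitution to all the coordinates of a vector. -/
def mapVec {E F : Type} [NormedAddCommGroup E] [NormedSpace ℂ E]
    [NormedAddCommGroup F] [NormedSpace ℂ F] {B : Type} (φ : Mer E →+* Mer F)
    (x : B →₀ Mer E) : B →₀ Mer F :=
  x.mapRange φ (map_zero φ)

/-- An `H`-graded `MH N`-vector space with a homogeneous basis `B`, together with difference
operators `L_{ij}(z)` of bi-degree `(ε_i, ε_j)` with meromorphic matrix entries:
`L i j b = L_{ij}(z) b`. -/
structure PreMod (N : ℕ) where
  B : Type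
  wt : B → H N
  L : Fin N → Fin N → B → B →₀ MZ N
  L_wt : ∀ i j b b', L i j b b' ≠ 0 → wt b' = wt b + ε j - ε i

namespace PreMod

variable {N : ℕ}

/-- The underlying vector space. -/
abbrev V (X : PreMod N) : Type := X.B →₀ MH N

/-- The set of weights. -/
def wts (X : PreMod N) : Set (H N) := Set.range X.wt

/-- The weight space `X[μ]`. -/
def wtSpace (X : PreMod N) (μ : H N) : Submodule (MH N) X.V :=
  Finsupp.supported (MH N) (MH N) {b | X.wt b = μ}

/-- A vector of `X`, viewed as a vector with coefficients depending on `(z, λ)`. -/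
def ext (X : PreMod N) (x : X.V) : X.B →₀ MZ N := mapVec (ofH N) x

/-- `L_{ij}(z + u)` acting on vectors with coefficients in meromorphic functions of `(z, λ)`. -/
def actL (X : PreMod N) (ħ : ℂ) (i j : Fin N) (u : ℂ) (x : X.B →₀ MZ N) : X.B →₀ MZ N :=
  act ((0, ħ • ε j) : ℂ × H N) (fun b => mapVec (shift ((u, 0) : ℂ × H N)) (X.L i j b)) x

/-- The dynamical RLL relation
`∑ μ_l(R^{pq}_{mn}(z-w;λ)) L_{pi}(z) L_{qj}(w) = ∑ μ_r(R^{ij}_{pq}(z-w;λ)) L_{nq}(w) L_{mp}(z)`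
(sums over `p, q`), evaluated at the basis vector `b` and read off at the coordinate `c`. Here
`μ_r(g)` multiplies by `g(λ)`, and `μ_l(g)` multiplies vectors of weight `α` by `g(λ + ħα)`. -/
def RLL (X : PreMod N) (τ ħ : ℂ) : Prop :=
  ∀ (i j m n : Fin N) (b c : X.B),
    ∑ p, ∑ q, shift ((0, 0, ħ • X.wt c) : ℂ × ℂ × H N) (atZsubW N (Rcoef τ ħ m n p q)) *
        act ((0, 0, ħ • ε i) : ℂ × ℂ × H N) (fun a => mapVec (atZ N) (X.L p i a))
          (mapVec (atW N) (X.L q j b)) c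
      = ∑ p, ∑ q, atZsubW N (Rcoef τ ħ p q i j) *
        act ((0, 0, ħ • ε q) : ℂ × ℂ × H N) (fun a => mapVec (atW N) (X.L n q a))
          (mapVec (atZ N) (X.L m p b)) c

/-- `X` is a module over the elliptic quantum group: its weight spaces are finite-dimensional and
the RLL relation holds. -/
structure IsRep (X : PreMod N) (τ ħ : ℂ) : Prop where
  finite : ∀ μ, {b | X.wt b = μ}.Finite
  rll : X.RLL τ ħ

/-! ### Elliptic quantum minors -/

/-- `L_{σ(N),N}(z) L_{σ(N-1),N-1}(z+ħ) ⋯ L_{σ(N-k+1),N-k+1}(z+(k-1)ħ) x`. -/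
def minorTerm (X : PreMod N) (ħ : ℂ) (σ : Equiv.Perm (Fin N)) (k : ℕ) (x : X.B →₀ MZ N) :
    X.B →₀ MZ N :=
  ((List.finRange N).take k).foldr
    (fun s y => X.actL ħ (σ (Fin.rev s)) (Fin.rev s) ((s : ℕ) * ħ) y) x

/-- `Θ_k(λ + v)`, where `Θ_k(λ)` is the product of the `θ(λ_{ij})`, `N-k+1 ≤ i < j ≤ N`
(one-based indices). -/
def Theta (τ : ℂ) (k : ℕ) (v : H N) : MZ N :=
  ∏ i : Fin N, ∏ j : Fin N, if N - k ≤ (i : ℕ) ∧ i < j then thL τ i j (ldiff i j v) else 1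

open Classical in
/-- The `k`-th elliptic quantum minor acting on vectors `x` of weight `μ`:
`Θ_k(λ)/Θ_k(λ+ħμ) ∑ sign(σ) L_{σ(N),N}(z) ⋯ L_{σ(N-k+1),N-k+1}(z+(k-1)ħ) x`, where `σ` runs over
the permutations of the last `k` indices. It preserves the weight. -/
def minor (X : PreMod N) (τ ħ : ℂ) (k : ℕ) (μ : H N) (x : X.B →₀ MZ N) : X.B →₀ MZ N :=
  (Theta τ k (0 : H N) / Theta τ k (ħ • μ)) •
    ∑ σ : Equiv.Perm (Fin N), if ∀ i : Fin N, (i : ℕ) < N - k → σ i = i then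
      ((Equiv.Perm.sign σ : ℤ) : MZ N) • X.minorTerm ħ σ k x else 0

/-- The ordered basis `v` of `X[μ]` makes the elliptic quantum minors `D_1(z), …, D_N(z)` upper
triangular, with diagonal entries the non-zero meromorphic functions
`f_N(z) f_{N-1}(z+ħ) ⋯ f_{N-k+1}(z+(k-1)ħ)` of `z` for `D_k(z)`, where `(f_1, …, f_N)` is attached
to the basis vector. (Any `N` non-zero functions of `z` are of this form for a unique
`(f_1, …, f_N)`, the diagonal entries of the operators `K_i(z)` defined by
`D_k(z) = K_N(z) K_{N-1}(z+ħ) ⋯ K_{N-k+1}(z+(k-1)ħ)`.) -/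
def IsTri (X : PreMod N) (τ ħ : ℂ) (μ : H N) {n : ℕ}
    (v : Module.Basis (Fin n) (MH N) (X.wtSpace μ)) (f : Fin n → Fin N → MCˣ) : Prop :=
  ∀ l : Fin N, ∃ U : Matrix (Fin n) (Fin n) (MZ N),
    (∀ r s, s < r → U r s = 0) ∧
    (∀ s, U s s = ofC N (∏ t : Fin N, if t ≤ l then
      shift (((t : ℕ) : ℂ) * ħ) (f s (Fin.rev t) : MC) else 1)) ∧
    ∀ s, X.minor τ ħ ((l : ℕ) + 1) μ (X.ext (v s)) = ∑ r, U r s • X.ext (v r)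

/-- `X` is in category `O`. -/
structure InO (X : PreMod N) (τ ħ : ℂ) : Prop where
  isRep : X.IsRep τ ħ
  cones : InCones X.wts
  tri : ∀ μ : H N, ∃ (n : ℕ) (v : Module.Basis (Fin n) (MH N) (X.wtSpace μ))
    (f : Fin n → Fin N → MCˣ), X.IsTri τ ħ μ v f

/-! ### Dynamical tensor product and direct sums -/

/-- The dynamical tensor product. It has the basis `b ⊗ c`, and in it
`g(λ) b ⊗ h(λ) c = g(λ + ħ wt(c)) h(λ) (b ⊗ c)`; the operators are
`L_{ij}(z) (b ⊗ c) = ∑_k L_{ik}(z) b ⊗ L_{kj}(z) c`. -/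
def tensor (ħ : ℂ) (X Y : PreMod N) : PreMod N where
  B := X.B × Y.B
  wt p := X.wt p.1 + Y.wt p.2
  L i j p := ∑ k, (X.L i k p.1).sum fun b g => (Y.L k j p.2).sum fun c h =>
    Finsupp.single (b, c) (shift ((0, ħ • Y.wt c) : ℂ × H N) g * h)
  L_wt := by
    classical
    intro i j p p' hne
    rw [Finsupp.finsetSum_apply] at hne
    obtain ⟨k, -, hk⟩ := Finset.exists_ne_zero_of_sum_ne_zero hne
    rw [Finsupp.sum_apply] at hk
    obtain ⟨b, hb, hk⟩ := Finset.exists_ne_zero_of_sum_ne_zero hk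
    beta_reduce at hk
    rw [Finsupp.sum_apply] at hk
    obtain ⟨c, hc, hk⟩ := Finset.exists_ne_zero_of_sum_ne_zero hk
    have hp : (b, c) = p' := by
      by_contra h
      exact hk (Finsupp.single_eq_of_ne (Ne.symm h))
    subst hp
    have h1 := X.L_wt i k p.1 b (Finsupp.mem_support_iff.mp hb)
    have h2 := Y.L_wt k j p.2 c (Finsupp.mem_support_iff.mp hc)
    simp only [h1, h2]
    abel

/-- The direct sum of a family. -/
def dsum {ι : Type} (X : ι → PreMod N) : PreMod N where
  B := Σ i, (X i).B
  wt p := (X p.1).wt p.2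
  L i j p := ((X p.1).L i j p.2).mapDomain (Sigma.mk p.1)
  L_wt := by
    classical
    rintro i j ⟨a, b⟩ ⟨a', b'⟩ hne
    have hmem := Finsupp.mapDomain_support (Finsupp.mem_support_iff.mpr hne)
    obtain ⟨c, hc, hEq⟩ := Finset.mem_image.mp hmem
    obtain ⟨rfl, h⟩ := Sigma.mk.inj_iff.mp hEq
    obtain rfl := eq_of_heq h
    exact (X a).L_wt i j b c (Finsupp.mem_support_iff.mp hc)

/-! ### Morphisms, irreducible modules, multiplicities -/

/-- A morphism of modules: a linear map respecting the gradings and commuting with the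
`L_{ij}(z)`. -/
structure Hom (ħ : ℂ) (X Y : PreMod N) where
  map : X.V →ₗ[MH N] Y.V
  map_wt : ∀ μ, ∀ x ∈ X.wtSpace μ, map x ∈ Y.wtSpace μ
  comm : ∀ i j b, ((X.L i j b).sum fun b' g => g • Y.ext (map (Finsupp.single b' 1))) =
    Y.actL ħ i j 0 (Y.ext (map (Finsupp.single b 1)))

/-- `X` is non-zero and its only submodules are `0` and `X`. -/
def IsIrreducible (X : PreMod N) (τ ħ : ℂ) : Prop :=
  Nonempty X.B ∧ ∀ Y : PreMod N, Y.IsRep τ ħ → ∀ φ : Hom ħ Y X, Function.Injective φ.map →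
    Nonempty Y.B → Function.Surjective φ.map

/-- `HasFactors τ ħ S X n`: there is a finite chain of submodules `0 ⊆ X_1 ⊆ ⋯ ⊆ X_m = X`, at
least `n` successive quotients of which are isomorphic to `S`. -/
inductive HasFactors (τ ħ : ℂ) (S : PreMod N) : PreMod N → ℕ → Prop
  | zero (X : PreMod N) : HasFactors τ ħ S X 0
  | skip {X Y : PreMod N} {n : ℕ} (hY : Y.IsRep τ ħ) (φ : Hom ħ Y X)
      (hφ : Function.Injective φ.map) : HasFactors τ ħ S Y n → HasFactors τ ħ S X n
  | step {X Y : PreMod N} {n : ℕ} (hY : Y.IsRep τ ħ) (φ : Hom ħ Y X)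
      (hφ : Function.Injective φ.map) (π : Hom ħ X S) (hπ : Function.Surjective π.map)
      (hex : LinearMap.range φ.map = LinearMap.ker π.map) :
      HasFactors τ ħ S Y n → HasFactors τ ħ S X (n + 1)

/-- The multiplicity of the irreducible module `S` in `X`: the largest number of factors
isomorphic to `S` in a finite chain of submodules of `X`. -/
def mult (τ ħ : ℂ) (S X : PreMod N) : ℕ := sSup {n | HasFactors τ ħ S X n}

end PreMod

/-! ### e-weights and the target ring of q-characters -/

/-- The constant tuples `(c_1, …, c_N)` with `c_1 ⋯ c_N = 1`. -/
def constTuples (N : ℕ) : Subgroup (Fin N → MCˣ) where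
  carrier := {c | ∃ k : Fin N → ℂˣ, ∏ i, k i = 1 ∧
    ∀ i, c i = Units.map (algebraMap ℂ MC : ℂ →* MC) (k i)}
  mul_mem' := by
    rintro a b ⟨k, hk, ha⟩ ⟨l, hl, hb⟩
    refine ⟨k * l, ?_, fun i => ?_⟩
    · simp [Finset.prod_mul_distrib, hk, hl]
    · simp [ha i, hb i]
  one_mem' := ⟨1, by simp, fun i => by simp⟩
  inv_mem' := by
    rintro a ⟨k, hk, ha⟩
    refine ⟨k⁻¹, ?_, fun i => ?_⟩
    · simp [Finset.prod_inv_distrib, hk]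
    · simp [ha i]

/-- `N`-tuples of non-zero meromorphic functions of `z`, modulo constant tuples of product one. -/
def MGrp (N : ℕ) : Type := (Fin N → MCˣ) ⧸ constTuples N

instance (N : ℕ) : CommGroup (MGrp N) := inferInstanceAs (CommGroup ((Fin N → MCˣ) ⧸ constTuples N))

/-- The class of a tuple. -/
def MGrp.mk {N : ℕ} (f : Fin N → MCˣ) : MGrp N := QuotientGroup.mk f

/-- The group of e-weights `(f; μ)`, written additively. -/
abbrev EWt (N : ℕ) : Type := Additive (MGrp N) × H N

/-- The e-weight `(f; μ)`. -/
def EWt.mk {N : ℕ} (f : Fin N → MCˣ) (μ : H N) : EWt N :=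
  (Additive.ofMul (MGrp.mk f), μ)

/-- Formal sums of e-weights with integer coefficients, finitely many over each weight `μ`, the
weights being in a finite union of cones. -/
@[ext]
structure QRing (N : ℕ) where
  coeff : EWt N → ℤ
  finite : ∀ μ : H N, {f : EWt N | f.2 = μ ∧ coeff f ≠ 0}.Finite
  cones : InCones {μ | ∃ f : EWt N, f.2 = μ ∧ coeff f ≠ 0}


/-! The product of two such formal sums is well-defined. To see this and the ring axioms, formal
sums are embedded in a ring of Hahn series, for the order reverse to the dominance order. -/

theorem QPlus_eq_zero_or {N : ℕ} {x : H N} (hx : x ∈ QPlus N) :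
    x = 0 ∨ 1 ≤ (-∑ i : Fin N, (i : ℂ) * x.1 i).re := by
  induction hx using AddSubmonoid.closure_induction with
  | mem x hx =>
    right
    obtain ⟨i, j, hij, rfl⟩ := hx
    have hj : ((j : ℕ) : ℂ) = (i : ℕ) + 1 := by rw [← hij]; push_cast; ring
    have : ∀ t : Fin N, (ε i - ε j).1 t = (if t = i then (1 : ℂ) else 0)
        - (if t = j then (1 : ℂ) else 0) := by
      intro t
      change ((if t = i then (1 : ℂ) else 0) - 1 / N) - ((if t = j then (1 : ℂ) else 0) - 1 / N) = _
      ring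
    simp only [this, mul_sub, Finset.sum_sub_distrib]
    simp [hj]
  | zero => exact Or.inl rfl
  | add x y _ _ hx hy =>
    rcases hx with rfl | hx
    · rcases hy with rfl | hy
      · left; simp
      · right; simpa using hy
    · rcases hy with rfl | hy
      · right; simpa using hx
      · right
        have : (-∑ i : Fin N, (i : ℂ) * (x + y).1 i) =
            (-∑ i : Fin N, (i : ℂ) * x.1 i) + (-∑ i : Fin N, (i : ℂ) * y.1 i) := by
          change (-∑ i : Fin N, (i : ℂ) * (x.1 i + y.1 i)) = _
          simp only [mul_add, Finset.sum_add_distrib]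
          ring
        rw [this, Complex.add_re]
        linarith

theorem QPlus_antisymm {N : ℕ} {x : H N} (hx : x ∈ QPlus N) (hx' : -x ∈ QPlus N) : x = 0 := by
  rcases QPlus_eq_zero_or hx with h | h
  · exact h
  rcases QPlus_eq_zero_or hx' with h' | h'
  · exact neg_eq_zero.mp h'
  exfalso
  have : (-∑ i : Fin N, (i : ℂ) * (-x).1 i) = -(-∑ i : Fin N, (i : ℂ) * x.1 i) := by
    change (-∑ i : Fin N, (i : ℂ) * (-(x.1 i))) = _
    simp
  rw [this, Complex.neg_re] at h'
  linarith

/-- Weights with the dominance order. -/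
def DomH (N : ℕ) : Type := H N

instance (N : ℕ) : AddCommGroup (DomH N) := inferInstanceAs (AddCommGroup (H N))

/-- The underlying weight. -/
def DomH.toH {N : ℕ} : DomH N →+ H N := AddMonoidHom.id (H N)

theorem DomH.toH_injective {N : ℕ} : Function.Injective (DomH.toH (N := N)) := fun _ _ h => h

instance (N : ℕ) : PartialOrder (DomH N) where
  le x y := y.toH - x.toH ∈ QPlus N
  le_refl x := by rw [sub_self]; exact zero_mem _
  le_trans x y z hxy hyz := by
    have := add_mem hyz hxy
    rwa [sub_add_sub_cancel] at this
  le_antisymm x y hxy hyx := by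
    have h := QPlus_antisymm hyx (by rwa [neg_sub])
    exact DomH.toH_injective (sub_eq_zero.mp h)

theorem DomH.le_iff {N : ℕ} {x y : DomH N} : x ≤ y ↔ y.toH - x.toH ∈ QPlus N := Iff.rfl

instance (N : ℕ) : IsOrderedCancelAddMonoid (DomH N) where
  add_le_add_left x y hxy z := by
    rw [DomH.le_iff] at hxy ⊢
    rwa [map_add, map_add, add_sub_add_right_eq_sub]
  le_of_add_le_add_left x y z h := by
    rw [DomH.le_iff] at h ⊢
    rwa [map_add, map_add, add_sub_add_left_eq_sub] at h

theorem isPWO_QPlus (N : ℕ) : Set.IsPWO {x : DomH N | x.toH ∈ QPlus N} := by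
  have hfin : (simpleRoots N).Finite := by
    refine (Set.finite_range (fun p : Fin N × Fin N => ε p.1 - ε p.2)).subset ?_
    rintro x ⟨i, j, -, rfl⟩
    exact ⟨(i, j), rfl⟩
  have hfin' : {x : DomH N | x.toH ∈ simpleRoots N}.Finite :=
    hfin.preimage DomH.toH_injective.injOn
  have h := Set.IsPWO.addSubmonoid_closure (s := {x : DomH N | x.toH ∈ simpleRoots N}) ?_
    hfin'.isPWO
  · exact h
  · intro x hx
    rw [DomH.le_iff, map_zero, sub_zero]
    exact AddSubmonoid.subset_closure hx

/-- The e-weights, partially ordered by the reverse of the dominance order on weights. -/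
def EOrd (N : ℕ) : Type := EWt N

instance (N : ℕ) : AddCommGroup (EOrd N) := inferInstanceAs (AddCommGroup (EWt N))

/-- The underlying e-weight. -/
def EOrd.toE {N : ℕ} : EOrd N ≃+ EWt N := AddEquiv.refl (EWt N)

/-- The weight of an e-weight. -/
def EOrd.wt {N : ℕ} (a : EOrd N) : DomH N := a.toE.2

theorem EOrd.wt_add {N : ℕ} (a b : EOrd N) : (a + b).wt = a.wt + b.wt := rfl

instance (N : ℕ) : PartialOrder (EOrd N) where
  le a b := a = b ∨ b.wt < a.wt
  le_refl a := Or.inl rfl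
  le_trans a b c hab hbc := by
    rcases hab with rfl | hab
    · exact hbc
    · rcases hbc with rfl | hbc
      · exact Or.inr hab
      · exact Or.inr (hbc.trans hab)
  le_antisymm a b hab hba := by
    rcases hab with h | hab
    · exact h
    · rcases hba with h | hba
      · exact h.symm
      · exact absurd hab hba.asymm

theorem EOrd.le_iff {N : ℕ} {a b : EOrd N} : a ≤ b ↔ a = b ∨ b.wt < a.wt := Iff.rfl

instance (N : ℕ) : IsOrderedCancelAddMonoid (EOrd N) where
  add_le_add_left a b hab c := by
    rcases hab with rfl | hab
    · exact le_refl _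
    · right
      rw [EOrd.wt_add, EOrd.wt_add]
      exact add_lt_add_left hab _
  le_of_add_le_add_left a b c h := by
    rcases h with h | h
    · exact Or.inl (add_left_cancel h)
    · right
      rw [EOrd.wt_add, EOrd.wt_add] at h
      exact lt_of_add_lt_add_left h

namespace QRing

variable {N : ℕ}

theorem isPWO_support (x : QRing N) :
    Set.IsPWO (Function.support (fun a : EOrd N => x.coeff a.toE)) := by
  obtain ⟨T, hT⟩ := x.cones
  have hsub : Function.support (fun a : EOrd N => x.coeff a.toE) ⊆
      ⋃ ν ∈ T, {a : EOrd N | x.coeff a.toE ≠ 0 ∧ ν - a.wt.toH ∈ QPlus N} := by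
    intro a ha
    obtain ⟨ν, hν, h⟩ := hT a.toE.2 ⟨a.toE, rfl, ha⟩
    exact Set.mem_biUnion hν ⟨ha, h⟩
  refine Set.IsPWO.mono ?_ hsub
  refine (Finset.isPWO_bUnion T).mpr fun ν _ => ?_
  refine Set.partiallyWellOrderedOn_iff_exists_lt.mpr fun f hf => ?_
  obtain ⟨g, hg⟩ := (isPWO_QPlus N).exists_monotone_subseq
    (f := fun n => (show DomH N from ν) - (f n).wt) (fun n => (hf n).2)
  by_cases hc : ∃ n, (f (g n)).wt ≠ (f (g 0)).wt
  · obtain ⟨n, hn⟩ := hc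
    have h0n : 0 < n := Nat.pos_of_ne_zero fun h => hn (by rw [h])
    refine ⟨g 0, g n, g.strictMono h0n, Or.inr (lt_of_le_of_ne ?_ hn)⟩
    exact (sub_le_sub_iff_left _).mp (hg (Nat.zero_le n))
  · push Not at hc
    have hfin := x.finite (f (g 0)).wt.toH
    have hmem : ∀ n, (f (g n)).toE ∈
        {a : EWt N | a.2 = (f (g 0)).wt.toH ∧ x.coeff a ≠ 0} := fun n => ⟨hc n, (hf (g n)).1⟩
    have := hfin.to_subtype
    obtain ⟨m, n, hmn, h⟩ := Finite.exists_ne_map_eq_of_infinite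
      (fun n : ℕ => (⟨(f (g n)).toE, hmem n⟩ :
        {a : EWt N | a.2 = (f (g 0)).wt.toH ∧ x.coeff a ≠ 0}))
    have h : f (g m) = f (g n) := EOrd.toE.injective (congrArg Subtype.val h)
    rcases lt_or_gt_of_ne hmn with hlt | hlt
    · exact ⟨g m, g n, g.strictMono hlt, Or.inl h⟩
    · exact ⟨g n, g m, g.strictMono hlt, Or.inl h.symm⟩

theorem fiber_finite {s : Set (EOrd N)} (hs : s.IsPWO) (μ : H N) :
    {a : EOrd N | a ∈ s ∧ a.wt.toH = μ}.Finite := by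
  by_contra hinf
  have hinf : {a : EOrd N | a ∈ s ∧ a.wt.toH = μ}.Infinite := hinf
  let f := hinf.natEmbedding
  obtain ⟨m, n, hmn, h⟩ := Set.partiallyWellOrderedOn_iff_exists_lt.mp hs
    (fun n => (f n : EOrd N)) (fun n => (f n).2.1)
  have hwt : (f m : EOrd N).wt = (f n : EOrd N).wt :=
    DomH.toH_injective ((f m).2.2.trans (f n).2.2.symm)
  rcases h with h | h
  · exact hmn.ne (f.injective (Subtype.ext h))
  · exact absurd h (by rw [hwt]; exact lt_irrefl _)

/-- The Hahn series of a formal sum. -/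
def toHahn (x : QRing N) : HahnSeries (EOrd N) ℤ where
  coeff a := x.coeff a.toE
  isPWO_support' := x.isPWO_support

theorem toHahn_injective : Function.Injective (toHahn (N := N)) := by
  intro x y h
  ext a
  exact congrFun (congrArg HahnSeries.coeff h) (EOrd.toE.symm a)

theorem toHahn_mul_coeff (x y : QRing N) (a : EWt N) :
    (x.toHahn * y.toHahn).coeff (EOrd.toE.symm a) = ∑ᶠ b : EWt N, x.coeff b * y.coeff (a - b) := by
  classical
  rw [HahnSeries.coeff_mul]
  set A := Finset.antidiagonal x.toHahn.isPWO_support y.toHahn.isPWO_support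
    (EOrd.toE.symm a) with hA
  have hmem : ∀ p, p ∈ A ↔ x.coeff p.1.toE ≠ 0 ∧ y.coeff p.2.toE ≠ 0 ∧ p.1.toE + p.2.toE = a := by
    intro p
    rw [hA, Finset.mem_antidiagonal]
    rfl
  rw [finsum_eq_sum_of_support_subset (s := A.image fun p => p.1.toE)]
  · rw [Finset.sum_image]
    · refine Finset.sum_congr rfl fun p hp => ?_
      have h := ((hmem p).mp hp).2.2
      rw [← h, add_sub_cancel_left]
      rfl
    · intro p hp q hq hpq
      have hp' := ((hmem p).mp hp).2.2
      have hq' := ((hmem q).mp hq).2.2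
      have h1 : p.1.toE = q.1.toE := hpq
      rw [← hq', h1] at hp'
      exact Prod.ext (EOrd.toE.injective h1) (EOrd.toE.injective (add_left_cancel hp'))
  · intro b hb
    rw [Finset.mem_coe, Finset.mem_image]
    refine ⟨(EOrd.toE.symm b, EOrd.toE.symm (a - b)), (hmem _).mpr ⟨?_, ?_, ?_⟩, rfl⟩
    · exact left_ne_zero_of_mul hb
    · exact right_ne_zero_of_mul hb
    · exact add_sub_cancel b a

theorem exists_ne_zero_of_finsum_ne_zero' {α : Type} {c : α → ℤ} (h : ∑ᶠ a, c a ≠ 0) :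
    ∃ a, c a ≠ 0 := by
  by_contra hc
  push Not at hc
  exact h (by simp [hc])

/-- Formal sums over the e-weights whose support is partially well-ordered satisfy the finiteness
condition. -/
theorem finite_of_isPWO {c : EWt N → ℤ}
    (hs : Set.IsPWO (Function.support (fun a : EOrd N => c a.toE))) (μ : H N) :
    {f : EWt N | f.2 = μ ∧ c f ≠ 0}.Finite :=
  ((fiber_finite hs μ).image EOrd.toE).subset fun f hf => ⟨EOrd.toE.symm f, ⟨hf.2, hf.1⟩, rfl⟩

instance : Zero (QRing N) :=
  ⟨⟨fun _ => 0, fun μ => by simp, ∅, fun μ hμ => by simp at hμ⟩⟩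

open Classical in
instance : One (QRing N) :=
  ⟨⟨fun f => if f = 0 then 1 else 0,
    fun μ => (Set.finite_singleton (0 : EWt N)).subset fun f hf => by
      by_contra h
      exact hf.2 (if_neg h),
    {0}, by
      rintro μ ⟨f, rfl, hf⟩
      have : f = 0 := by
        by_contra h
        exact hf (if_neg h)
      subst this
      exact ⟨0, by simp, by simp⟩⟩⟩

instance : Add (QRing N) :=
  ⟨fun x y => ⟨fun f => x.coeff f + y.coeff f,
    fun μ => ((x.finite μ).union (y.finite μ)).subset fun f hf => by
      by_contra h
      simp only [Set.mem_union, Set.mem_ofPred_eq, hf.1, true_and, not_or, not_not] at h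
      exact hf.2 (by rw [h.1, h.2, add_zero]),
    by
      classical
      obtain ⟨S, hS⟩ := x.cones
      obtain ⟨T, hT⟩ := y.cones
      refine ⟨S ∪ T, ?_⟩
      rintro μ ⟨f, rfl, hf⟩
      by_cases hx : x.coeff f = 0
      · obtain ⟨ν, hν, h⟩ := hT f.2 ⟨f, rfl, fun hy => hf (by rw [hx, hy, add_zero])⟩
        exact ⟨ν, Finset.mem_union_right _ hν, h⟩
      · obtain ⟨ν, hν, h⟩ := hS f.2 ⟨f, rfl, hx⟩
        exact ⟨ν, Finset.mem_union_left _ hν, h⟩⟩⟩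

instance : Neg (QRing N) :=
  ⟨fun x => ⟨fun f => -x.coeff f, by simpa using x.finite, by simpa using x.cones⟩⟩

/-- The product is induced from the group law of e-weights: the coefficient of `f` in `x y` is the
(finite) sum of the products of the coefficient of `g` in `x` and that of `f g⁻¹` in `y`. -/
instance : Mul (QRing N) :=
  ⟨fun x y => ⟨fun f => ∑ᶠ g : EWt N, x.coeff g * y.coeff (f - g),
    finite_of_isPWO (by
      have h := (x.toHahn * y.toHahn).isPWO_support
      convert h using 2
      ext a
      exact not_congr ⟨fun h => (toHahn_mul_coeff x y a.toE).trans h,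
        fun h => (toHahn_mul_coeff x y a.toE).symm.trans h⟩),
    by
      classical
      obtain ⟨S, hS⟩ := x.cones
      obtain ⟨T, hT⟩ := y.cones
      refine ⟨Finset.image₂ (· + ·) S T, ?_⟩
      rintro μ ⟨f, rfl, hf⟩
      obtain ⟨g, hg⟩ := exists_ne_zero_of_finsum_ne_zero' hf
      obtain ⟨ν, hν, h⟩ := hS g.2 ⟨g, rfl, left_ne_zero_of_mul hg⟩
      obtain ⟨ν', hν', h'⟩ := hT (f - g).2 ⟨f - g, rfl, right_ne_zero_of_mul hg⟩
      refine ⟨ν + ν', Finset.mem_image₂_of_mem hν hν', ?_⟩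
      have := add_mem h h'
      rw [Prod.snd_sub] at this
      convert this using 1
      abel⟩⟩

theorem mul_coeff (x y : QRing N) (f : EWt N) :
    (x * y).coeff f = ∑ᶠ g : EWt N, x.coeff g * y.coeff (f - g) := rfl

theorem toHahn_zero : (0 : QRing N).toHahn = 0 := rfl

theorem toHahn_one : (1 : QRing N).toHahn = 1 := by
  classical
  ext a
  rw [HahnSeries.coeff_one]
  change (if a.toE = 0 then (1 : ℤ) else 0) = _
  simp only [EmbeddingLike.map_eq_zero_iff]

theorem toHahn_add (x y : QRing N) : (x + y).toHahn = x.toHahn + y.toHahn := rfl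

theorem toHahn_neg (x : QRing N) : (-x).toHahn = -x.toHahn := rfl

theorem toHahn_mul (x y : QRing N) : (x * y).toHahn = x.toHahn * y.toHahn := by
  ext a
  exact (toHahn_mul_coeff x y a.toE).symm

instance : CommRing (QRing N) where
  add_assoc x y z := toHahn_injective (by simp only [toHahn_add, add_assoc])
  zero_add x := toHahn_injective (by simp only [toHahn_add, toHahn_zero, zero_add])
  add_zero x := toHahn_injective (by simp only [toHahn_add, toHahn_zero, add_zero])
  add_comm x y := toHahn_injective (by simp only [toHahn_add, add_comm])
  left_distrib x y z := toHahn_injective (by simp only [toHahn_add, toHahn_mul, mul_add])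
  right_distrib x y z := toHahn_injective (by simp only [toHahn_add, toHahn_mul, add_mul])
  zero_mul x := toHahn_injective (by simp only [toHahn_mul, toHahn_zero, zero_mul])
  mul_zero x := toHahn_injective (by simp only [toHahn_mul, toHahn_zero, mul_zero])
  mul_assoc x y z := toHahn_injective (by simp only [toHahn_mul, mul_assoc])
  one_mul x := toHahn_injective (by simp only [toHahn_mul, toHahn_one, one_mul])
  mul_one x := toHahn_injective (by simp only [toHahn_mul, toHahn_one, mul_one])
  neg_add_cancel x := toHahn_injective
    (by simp only [toHahn_add, toHahn_neg, toHahn_zero, neg_add_cancel])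
  mul_comm x y := toHahn_injective (by simp only [toHahn_mul, mul_comm])
  nsmul := nsmulRec
  zsmul := zsmulRec

end QRing

/-! ### q-characters -/

/-- `χ` is the q-character of `X`: for each weight `μ` there is an ordered basis of `X[μ]` making
the elliptic quantum minors upper triangular, such that the coefficient of `(g; μ)` in `χ` is the
number of basis vectors whose tuple `(f_1, …, f_N)` has class `g`. -/
def IsQChar {N : ℕ} (τ ħ : ℂ) (X : PreMod N) (χ : QRing N) : Prop :=
  ∀ μ : H N, ∃ (n : ℕ) (v : Module.Basis (Fin n) (MH N) (X.wtSpace μ))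
    (f : Fin n → Fin N → MCˣ), X.IsTri τ ħ μ v f ∧
      ∀ g : MGrp N, χ.coeff (Additive.ofMul g, μ) =
        Nat.card {s : Fin n // MGrp.mk (f s) = g}

open Classical in
/-- The q-character of `X`. -/
def qc {N : ℕ} (τ ħ : ℂ) (X : PreMod N) : QRing N :=
  if h : ∃ χ, IsQChar τ ħ X χ then h.choose else 0

/-! ### Highest weights and the completed Grothendieck group -/

/-- The scalar `∏_{j>k} θ(λ_{kj}) / θ(λ_{kj} + ħ α_{kj})`. -/
def hatFactor {N : ℕ} (τ ħ : ℂ) (k : Fin N) (α : H N) : MH N :=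
  ∏ j : Fin N, if k < j then thH τ k j 0 / thH τ k j (ħ * ldiff k j α) else 1

/-- `X` contains a highest weight vector `v` of highest weight `d`: a non-zero vector of weight
`α`, annihilated by the `L_{ij}(z)` for `i > j`, such that
`L_{kk}(z) (∏_{j>k} θ(λ_{kj})/θ(λ_{kj} + ħα_{kj}) v) = f_k(z) v` for all `k`, with `f_k(z)`
non-zero meromorphic functions of `z`, and `d = ((f_1, …, f_N); α)`. -/
def HasHighestWeight {N : ℕ} (τ ħ : ℂ) (X : PreMod N) (d : EWt N) : Prop :=
  ∃ (v : X.V) (f : Fin N → MCˣ), v ≠ 0 ∧ v ∈ X.wtSpace d.2 ∧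
    (∀ i j : Fin N, j < i → X.actL ħ i j 0 (X.ext v) = 0) ∧
    (∀ k : Fin N, X.actL ħ k k 0 (X.ext (hatFactor τ ħ k d.2 • v)) = ofC N (f k) • X.ext v) ∧
    d = EWt.mk f d.2

/-- The set of highest weights of irreducible modules in category `O`. -/
def HighestWeights (N : ℕ) (τ ħ : ℂ) : Set (EWt N) :=
  {d | ∃ X : PreMod N, X.InO τ ħ ∧ X.IsIrreducible τ ħ ∧ HasHighestWeight τ ħ X d}

/-- A fixed irreducible module `S(d)` in category `O` of highest weight `d`. -/
def simpleMod {N : ℕ} {τ ħ : ℂ} (d : HighestWeights N τ ħ) : PreMod N := d.2.choose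

/-- The completed Grothendieck group: formal sums `∑ c_d [S(d)]` with integer coefficients such
that the direct sum of the modules `S(d)^{⊕|c_d|}` is in category `O`. -/
@[ext]
structure KO (N : ℕ) (τ ħ : ℂ) where
  coeff : HighestWeights N τ ħ → ℤ
  inO : (PreMod.dsum fun p : Σ d : HighestWeights N τ ħ, Fin (coeff d).natAbs =>
    simpleMod p.1).InO τ ħ

/-- The objects of category `O`. -/
abbrev ObjO (N : ℕ) (τ ħ : ℂ) : Type 1 := {X : PreMod N // X.InO τ ħ}

/-- The ring `R` has as addition the usual one of formal sums, and its multiplication satisfies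
`[X][Y] = [X ⊗ Y]` for the dynamical tensor product of objects of category `O`. -/
def IsGrothendieckRing {N : ℕ} {τ ħ : ℂ}
    (hten : ∀ X Y : ObjO N τ ħ, (PreMod.tensor ħ X.1 Y.1).InO τ ħ)
    (cls : ObjO N τ ħ → KO N τ ħ) (R : Ring (KO N τ ħ)) : Prop :=
  (∀ (x y : KO N τ ħ) (d : HighestWeights N τ ħ), (x + y).coeff d = x.coeff d + y.coeff d) ∧
    ∀ X Y : ObjO N τ ħ, cls X * cls Y = cls ⟨PreMod.tensor ħ X.1 Y.1, hten X Y⟩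

end EllipticO

end

noncomputable section
namespace EllipticO

/-! ### The zeros of the theta function -/

section ThetaZeros

open Complex

/-- The terms of the theta series. -/
def thetaTerm (τ z : ℂ) (j : ℤ) : ℂ :=
  Complex.exp (Complex.I * Real.pi * ((j : ℂ) + 1 / 2) ^ 2 * τ
    + 2 * Complex.I * Real.pi * ((j : ℂ) + 1 / 2) * (z + 1 / 2))

theorem theta_eq_tsum (τ z : ℂ) : theta τ z = -∑' j : ℤ, thetaTerm τ z j := rfl

theorem summable_thetaTerm {τ : ℂ} (hτ : 0 < τ.im) (z : ℂ) : Summable (thetaTerm τ z) := by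
  have h := ((summable_jacobiTheta₂_term_iff (z + 1 / 2 + τ / 2) τ).mpr hτ).mul_left
    (Complex.exp (Complex.I * Real.pi * τ / 4 + Complex.I * Real.pi * (z + 1 / 2)))
  refine h.congr fun j => ?_
  rw [thetaTerm, jacobiTheta₂_term, ← Complex.exp_add]
  congr 1
  ring

theorem exp_pi_mul_I_odd (n : ℤ) : Complex.exp ((2 * n + 1) * (Real.pi * Complex.I)) = -1 := by
  rw [add_mul, Complex.exp_add, one_mul, Complex.exp_pi_mul_I]
  have : (2 * (n : ℂ)) * (Real.pi * Complex.I) = n * (2 * Real.pi * Complex.I) := by ring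
  rw [this, Complex.exp_int_mul_two_pi_mul_I, one_mul]

theorem theta_neg (τ z : ℂ) : theta τ (-z) = -theta τ z := by
  rw [theta_eq_tsum, theta_eq_tsum, neg_inj]
  let e : ℤ ≃ ℤ := ⟨fun j => -1 - j, fun j => -1 - j, fun j => by ring, fun j => by ring⟩
  rw [← e.tsum_eq (thetaTerm τ (-z)), ← tsum_neg]
  refine tsum_congr fun j => ?_
  have : thetaTerm τ (-z) (e j) =
      Complex.exp ((2 * ((-1 - j : ℤ) : ℂ) + 1) * (Real.pi * Complex.I)) * thetaTerm τ z j := by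
    rw [thetaTerm, thetaTerm, ← Complex.exp_add]
    congr 1
    simp only [e, Equiv.coe_fn_mk]
    push_cast
    ring
  rw [this, exp_pi_mul_I_odd, neg_one_mul]

theorem theta_zero (τ : ℂ) : theta τ 0 = 0 := by
  have h := theta_neg τ 0
  rw [neg_zero] at h
  have h2 : (2 : ℂ) * theta τ 0 = 0 := by linear_combination h
  simpa using h2

theorem integral_jacobiTheta₂ {τ : ℂ} (hτ : 0 < τ.im) :
    ∫ x in (0 : ℝ)..1, jacobiTheta₂ x τ = 1 := by
  let f : ℤ → C(ℝ, ℂ) := fun n =>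
    ⟨fun x => jacobiTheta₂_term n x τ, by unfold jacobiTheta₂_term; fun_prop⟩
  have hnorm : ∀ (n : ℤ) (x : ℝ), ‖f n x‖ = ‖jacobiTheta₂_term n 0 τ‖ := by
    intro n x
    change ‖jacobiTheta₂_term n x τ‖ = _
    rw [norm_jacobiTheta₂_term, norm_jacobiTheta₂_term]
    simp
  have hsum : Summable fun n : ℤ =>
      ‖(f n).restrict (⟨Set.uIcc 0 1, isCompact_uIcc⟩ : TopologicalSpace.Compacts ℝ)‖ := by
    refine Summable.of_nonneg_of_le (fun _ => norm_nonneg _) (fun n => ?_)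
      ((summable_jacobiTheta₂_term_iff 0 τ).mpr hτ).norm
    rw [ContinuousMap.norm_le _ (norm_nonneg _)]
    intro x
    exact (hnorm n x).le
  have h := intervalIntegral.hasSum_intervalIntegral_of_summable_norm (a := 0) (b := 1) hsum
  have hint : ∀ n : ℤ, ∫ x in (0 : ℝ)..1, f n x = if n = 0 then 1 else 0 := by
    intro n
    have hfn : ∀ x : ℝ, f n x = Complex.exp (Real.pi * Complex.I * n ^ 2 * τ) *
        Complex.exp ((2 * Real.pi * Complex.I * n) * x) := by
      intro x
      change jacobiTheta₂_term n x τ = _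
      rw [jacobiTheta₂_term, ← Complex.exp_add, add_comm]
    simp only [hfn]
    split_ifs with h0
    · subst h0; simp
    · have hc : (2 * Real.pi * Complex.I * n : ℂ) ≠ 0 := by
        simp [Real.pi_ne_zero, h0]
      rw [intervalIntegral.integral_const_mul, integral_exp_mul_complex hc]
      have : Complex.exp (2 * Real.pi * Complex.I * n * (1 : ℝ)) = 1 := by
        rw [← Complex.exp_int_mul_two_pi_mul_I n]
        congr 1
        push_cast
        ring
      rw [this]
      simp
  simp only [hint] at h
  have h' := h.unique (hasSum_ite_eq 0 1)
  exact h'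

theorem exists_theta_ne_zero {τ : ℂ} (hτ : 0 < τ.im) : ∃ z, theta τ z ≠ 0 := by
  by_contra hcon
  push Not at hcon
  have h0 : ∀ w, jacobiTheta₂ w τ = 0 := by
    intro w
    have h := hcon (w - 1 / 2 - τ / 2)
    rw [theta_eq, neg_eq_zero, mul_eq_zero] at h
    rcases h with h | h
    · exact absurd h (Complex.exp_ne_zero _)
    · convert h using 2
      ring
  have h1 := integral_jacobiTheta₂ hτ
  simp [h0] at h1

theorem theta_add_int_add_int_mul {τ z : ℂ} (k l : ℤ) (h : theta τ z = 0) :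
    theta τ (z + k + l * τ) = 0 := by
  have h1 : ∀ {w : ℂ}, theta τ w = 0 → theta τ (w + 1) = 0 := by
    intro w hw
    rw [theta_eq, neg_eq_zero, mul_eq_zero] at hw ⊢
    right
    have h2 := hw.resolve_left (Complex.exp_ne_zero _)
    rw [show w + 1 + 1 / 2 + τ / 2 = w + 1 / 2 + τ / 2 + 1 by ring, jacobiTheta₂_add_left, h2]
  have h2 : ∀ {w : ℂ}, theta τ w = 0 → theta τ (w + τ) = 0 := by
    intro w hw
    rw [theta_eq, neg_eq_zero, mul_eq_zero] at hw ⊢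
    right
    have h2 := hw.resolve_left (Complex.exp_ne_zero _)
    rw [show w + τ + 1 / 2 + τ / 2 = w + 1 / 2 + τ / 2 + τ by ring, jacobiTheta₂_add_left', h2,
      mul_zero]
  have hn : ∀ {w : ℂ}, theta τ w = 0 → theta τ (-w) = 0 := by
    intro w hw
    rw [theta_neg, hw, neg_zero]
  have h1' : ∀ {w : ℂ}, theta τ w = 0 → theta τ (w - 1) = 0 := by
    intro w hw
    have := hn (h1 (hn hw))
    rwa [neg_add, neg_neg, ← sub_eq_add_neg] at this
  have h2' : ∀ {w : ℂ}, theta τ w = 0 → theta τ (w - τ) = 0 := by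
    intro w hw
    have := hn (h2 (hn hw))
    rwa [neg_add, neg_neg, ← sub_eq_add_neg] at this
  have hk : theta τ (z + k) = 0 := by
    induction k using Int.induction_on with
    | zero => simpa using h
    | succ k ih => have := h1 ih; push_cast at this ⊢; rwa [← add_assoc]
    | pred k ih => have := h1' ih; push_cast at this ⊢; rwa [← add_sub_assoc]
  induction l using Int.induction_on with
  | zero => simpa using hk
  | succ l ih =>
    have := h2 ih
    push_cast at this ⊢
    rwa [add_mul, one_mul, ← add_assoc]
  | pred l ih =>
    have := h2' ih
    push_cast at this ⊢
    rwa [sub_mul, one_mul, ← add_sub_assoc]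

/-- The terms of the theta functions of degree two. -/
def thetaTwo (τ x : ℂ) (p : ℤ) : ℂ :=
  Complex.exp (Complex.I * Real.pi * τ * p ^ 2 / 2 + 2 * Complex.I * Real.pi * p * x)

def thetaEven (τ x : ℂ) : ℂ := ∑' m : ℤ, thetaTwo τ x (2 * m)

def thetaOdd (τ x : ℂ) : ℂ := ∑' m : ℤ, thetaTwo τ x (2 * m + 1)

theorem summable_thetaTwo_even {τ : ℂ} (hτ : 0 < τ.im) (x : ℂ) :
    Summable fun m : ℤ => thetaTwo τ x (2 * m) := by
  have h := (summable_jacobiTheta₂_term_iff (2 * x) (2 * τ)).mpr (by simpa using hτ)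
  refine h.congr fun j => ?_
  rw [thetaTwo, jacobiTheta₂_term]
  congr 1
  push_cast
  ring

theorem summable_thetaTwo_odd {τ : ℂ} (hτ : 0 < τ.im) (x : ℂ) :
    Summable fun m : ℤ => thetaTwo τ x (2 * m + 1) := by
  have h := ((summable_jacobiTheta₂_term_iff (2 * x + τ) (2 * τ)).mpr (by simpa using hτ)).mul_left
    (Complex.exp (Complex.I * Real.pi * τ / 2 + 2 * Complex.I * Real.pi * x))
  refine h.congr fun j => ?_
  rw [thetaTwo, jacobiTheta₂_term, ← Complex.exp_add]
  congr 1
  push_cast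
  ring

theorem theta_mul_theta {τ : ℂ} (hτ : 0 < τ.im) (x y : ℂ) :
    theta τ (x + y) * theta τ (x - y) =
      thetaEven τ x * thetaOdd τ y - thetaOdd τ x * thetaEven τ y := by
  have hmul : ∀ {f g : ℤ → ℂ}, Summable f → Summable g →
      HasSum (fun p : ℤ × ℤ => f p.1 * g p.2) ((∑' j, f j) * ∑' k, g k) := by
    intro f g hf hg
    rw [tsum_mul_tsum_of_summable_norm hf.norm hg.norm]
    exact (summable_mul_of_summable_norm hf.norm hg.norm).hasSum
  have hT := hmul (summable_thetaTerm hτ (x + y)) (summable_thetaTerm hτ (x - y))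
  have h1 := hmul (summable_thetaTwo_even hτ x) (summable_thetaTwo_odd hτ y)
  have h2 := (hmul (summable_thetaTwo_odd hτ x) (summable_thetaTwo_even hτ y)).neg
  let e : (ℤ × ℤ) ⊕ (ℤ × ℤ) → ℤ × ℤ :=
    Sum.elim (fun p => (p.1 + p.2, p.1 - p.2 - 1)) (fun p => (p.1 + p.2, p.1 - p.2))
  have he : Function.Bijective e := by
    constructor
    · rintro (⟨a, b⟩ | ⟨a, b⟩) (⟨c, d⟩ | ⟨c, d⟩) h <;> simp [e] at h ⊢ <;> omega
    · rintro ⟨j, k⟩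
      rcases Int.even_or_odd' (j + k) with ⟨m, hm | hm⟩
      · exact ⟨Sum.inr (m, j - m), by simp [e]; omega⟩
      · exact ⟨Sum.inl (m + 1, j - m - 1), by simp [e]; omega⟩
  rw [theta_eq_tsum, theta_eq_tsum, neg_mul_neg]
  refine hT.unique ?_
  rw [← (Equiv.ofBijective e he).hasSum_iff, sub_eq_add_neg (thetaEven τ x * _)]
  refine HasSum.sum (M := ℂ) (α := ℤ × ℤ) (β := ℤ × ℤ) ?_ ?_
  · refine Eq.mpr (congrArg (HasSum · _) (funext ?_)) h1
    rintro ⟨m, n⟩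
    simp only [Function.comp_apply, Equiv.ofBijective_apply, e, Sum.elim_inl, thetaTerm, thetaTwo,
      ← Complex.exp_add]
    rw [Complex.exp_eq_exp_iff_exists_int]
    refine ⟨m, ?_⟩
    push_cast
    ring
  · refine Eq.mpr (congrArg (HasSum · _) (funext ?_)) h2
    rintro ⟨m, n⟩
    simp only [Function.comp_apply, Equiv.ofBijective_apply, e, Sum.elim_inr, thetaTerm, thetaTwo,
      ← Complex.exp_add]
    rw [← neg_one_mul, ← exp_pi_mul_I_odd m, ← Complex.exp_add]
    congr 1
    push_cast
    ring

theorem theta_nsmul_eq_zero {τ : ℂ} (hτ : 0 < τ.im) {a : ℂ} (ha : theta τ a = 0) (n : ℕ) :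
    theta τ (n * a) = 0 := by
  obtain ⟨z, hz⟩ := exists_theta_ne_zero hτ
  have hdet : ∀ (x : ℂ) (m : ℕ), theta τ (m * a) = 0 →
      thetaEven τ x * thetaOdd τ (x + m * a) = thetaOdd τ x * thetaEven τ (x + m * a) := by
    intro x m hm
    rw [← sub_eq_zero, ← theta_mul_theta hτ, sub_add_cancel_left, theta_neg, hm]
    simp
  induction n with
  | zero => simp [theta_zero]
  | succ n ih =>
    by_contra hne
    set x : ℂ := (z - (n + 1 : ℕ) * a) / 2 with hx
    have h1 := hdet x 1 (by simpa using ha)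
    have h2 := hdet (x + a) n ih
    rw [Nat.cast_one, one_mul] at h1
    rw [show x + a + n * a = x + (n + 1 : ℕ) * a by push_cast; ring] at h2
    have h3 := theta_mul_theta hτ x (x + (n + 1 : ℕ) * a)
    rw [show x + (x + (n + 1 : ℕ) * a) = z by rw [hx]; ring, sub_add_cancel_left, theta_neg] at h3
    have h4 : theta τ z * -theta τ ((n + 1 : ℕ) * a) ≠ 0 := mul_ne_zero hz (neg_ne_zero.mpr hne)
    rw [h3] at h4
    have hE : thetaEven τ (x + a) = 0 := by
      refine (mul_eq_zero.mp ?_).resolve_left h4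
      linear_combination thetaEven τ x * h2 + thetaEven τ (x + (n + 1 : ℕ) * a) * h1
    have hO : thetaOdd τ (x + a) = 0 := by
      refine (mul_eq_zero.mp ?_).resolve_left h4
      linear_combination thetaOdd τ x * h2 + thetaOdd τ (x + (n + 1 : ℕ) * a) * h1
    have hprod : ∀ y, theta τ (x + a + y) * theta τ (x + a - y) = 0 := by
      intro y
      rw [theta_mul_theta hτ, hE, hO]
      ring
    let f : Ent ℂ := ⟨fun y => theta τ (x + a + y),
      (differentiable_theta τ).comp (by fun_prop : Differentiable ℂ fun y : ℂ => x + a + y)⟩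
    let g : Ent ℂ := ⟨fun y => theta τ (x + a - y),
      (differentiable_theta τ).comp (by fun_prop : Differentiable ℂ fun y : ℂ => x + a - y)⟩
    have hfg : f * g = 0 := Subtype.ext (funext hprod)
    rcases mul_eq_zero.mp hfg with h | h
    · have := congrFun (congrArg Subtype.val h) (z - (x + a))
      exact hz (by simpa [f] using this)
    · have := congrFun (congrArg Subtype.val h) (x + a - z)
      exact hz (by simpa [g] using this)

/-- The theta function does not vanish outside the rational span of `1` and `τ`. -/
theorem theta_ne_zero {τ : ℂ} (hτ : 0 < τ.im) {a : ℂ} (ha : ∀ p q : ℚ, a ≠ p + q * τ) :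
    theta τ a ≠ 0 := by
  intro h0
  have hzero := theta_nsmul_eq_zero hτ h0
  have hτ0 : τ.im ≠ 0 := hτ.ne'
  let s : ℕ → ℝ := fun n => (n * a).im / τ.im
  let r : ℕ → ℝ := fun n => (n * a).re - s n * τ.re
  let p : ℕ → ℂ := fun n => n * a + (-⌊r n⌋ : ℤ) + (-⌊s n⌋ : ℤ) * τ
  have hp0 : ∀ n, theta τ (p n) = 0 := fun n => theta_add_int_add_int_mul _ _ (hzero n)
  have hna : ∀ n : ℕ, (n * a : ℂ) = r n + s n * τ := by
    intro n
    apply Complex.ext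
    · simp [r]
    · simp [s, hτ0]
  have hp : ∀ n, p n = Int.fract (r n) + Int.fract (s n) * τ := by
    intro n
    simp only [p]
    rw [hna, ← Int.self_sub_floor, ← Int.self_sub_floor]
    push_cast
    ring
  let K : Set ℂ := (fun q : ℝ × ℝ => (q.1 + q.2 * τ : ℂ)) '' (Set.Icc 0 1 ×ˢ Set.Icc 0 1)
  have hK : IsCompact K :=
    (isCompact_Icc.prod isCompact_Icc).image (by fun_prop)
  have hpK : Set.range p ⊆ K := by
    rintro _ ⟨n, rfl⟩
    exact ⟨(Int.fract (r n), Int.fract (s n)),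
      ⟨⟨Int.fract_nonneg _, (Int.fract_lt_one _).le⟩,
        ⟨Int.fract_nonneg _, (Int.fract_lt_one _).le⟩⟩, (hp n).symm⟩
  have hinj : Function.Injective p := by
    intro m n hmn
    by_contra hne
    have hne' : ((m : ℂ) - n) ≠ 0 := sub_ne_zero.mpr (by exact_mod_cast hne)
    refine ha ((⌊r m⌋ - ⌊r n⌋ : ℤ) / (m - n : ℤ)) ((⌊s m⌋ - ⌊s n⌋ : ℤ) / (m - n : ℤ)) ?_
    simp only [p] at hmn
    push_cast at hmn ⊢
    field_simp
    linear_combination hmn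
  obtain ⟨x, -, hx⟩ := (Set.infinite_range_of_injective hinj).exists_accPt_of_subset_isCompact hK hpK
  have hana : AnalyticOnNhd ℂ (theta τ) Set.univ :=
    fun z _ => (differentiable_theta τ).analyticAt z
  have hfreq : ∃ᶠ z in nhdsWithin x {x}ᶜ, theta τ z = 0 := by
    rw [accPt_iff_frequently_nhdsNE] at hx
    refine hx.mono ?_
    rintro _ ⟨n, rfl⟩
    exact hp0 n
  have h := hana.eqOn_zero_of_preconnected_of_frequently_eq_zero isPreconnected_univ
    (Set.mem_univ x) hfreq
  obtain ⟨z, hz⟩ := exists_theta_ne_zero hτ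
  exact hz (h (Set.mem_univ z))

end ThetaZeros

end EllipticO
end

noncomputable section
namespace EllipticO

/-! ### Substitutions in meromorphic functions -/

section Substitution

variable {E F G : Type} [NormedAddCommGroup E] [NormedSpace ℂ E]
  [NormedAddCommGroup F] [NormedSpace ℂ F] [NormedAddCommGroup G] [NormedSpace ℂ G]

instance instFieldMer : Field (Mer E) := FractionRing.field (Ent E)
instance instDivisionRingMer : DivisionRing (Mer E) := instFieldMer.toDivisionRing
instance instCommRingMer : CommRing (Mer E) := instFieldMer.toCommRing
instance instRingMer : Ring (Mer E) := instDivisionRingMer.toRing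
instance instCommSemiringMer : CommSemiring (Mer E) := instCommRingMer.toCommSemiring
instance instSemiringMer : Semiring (Mer E) := instDivisionRingMer.toDivisionSemiring.toSemiring
instance instNonAssocSemiringMer : NonAssocSemiring (Mer E) := instSemiringMer.toNonAssocSemiring
instance instAddCommGroupMer : AddCommGroup (Mer E) := instRingMer.toAddCommGroup
instance instAddCommMonoidMer : AddCommMonoid (Mer E) :=
  instNonAssocSemiringMer.toNonUnitalNonAssocSemiring.toAddCommMonoid
instance instAddMonoidMer : AddMonoid (Mer E) := instAddCommMonoidMer.toAddMonoid
instance instMulZeroClassMer : MulZeroClass (Mer E) :=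
  instNonAssocSemiringMer.toNonUnitalNonAssocSemiring.toMulZeroClass
instance instZeroMer : Zero (Mer E) := instMulZeroClassMer.toZero
instance instMonoidWithZeroMer : MonoidWithZero (Mer E) := instSemiringMer.toMonoidWithZero
instance instMonoidMer : Monoid (Mer E) := instMonoidWithZeroMer.toMonoid
instance instCommMonoidMer : CommMonoid (Mer E) := instCommRingMer.toCommMonoid
instance instGroupWithZeroMer : GroupWithZero (Mer E) := instDivisionRingMer.toDivisionSemiring.toGroupWithZero
instance instModuleMer : Module (Mer E) (Mer E) := Semiring.toModule
instance instDistribMulActionMer : DistribMulAction (Mer E) (Mer E) :=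
  instModuleMer.toDistribMulAction
instance instSMulZeroClassMer : SMulZeroClass (Mer E) (Mer E) :=
  instDistribMulActionMer.toDistribSMul.toSMulZeroClass
instance instNoZeroDivisorsMer : NoZeroDivisors (Mer E) := inferInstance
instance instIsDomainMer : IsDomain (Mer E) := inferInstance
instance instNontrivialMer : Nontrivial (Mer E) := inferInstance
instance instAlgebraEntMer : Algebra (Ent E) (Mer E) := inferInstance
instance instAlgebraComplexMer : Algebra ℂ (Mer E) := inferInstance
instance instIsFractionRingMer : IsFractionRing (Ent E) (Mer E) := inferInstance
instance instCharZeroMer : CharZero (Mer E) :=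
  charZero_of_injective_algebraMap (algebraMap ℂ (Mer E)).injective
instance instNeZeroMer : NeZero (1 : Mer E) := inferInstance
instance instCommRingEnt : CommRing (Ent E) := inferInstance
instance instSemiringEnt : Semiring (Ent E) := inferInstance
instance instNoZeroDivisorsEnt : NoZeroDivisors (Ent E) := inferInstance
instance instDistribMulActionEnt : DistribMulAction (Ent E) (Ent E) := inferInstance
instance instSubMer : Sub (Mer E) := instRingMer.toSub
instance instNegMer : Neg (Mer E) := instRingMer.toNeg
instance instIsCancelMulZeroMer : IsCancelMulZero (Mer E) := inferInstance

theorem algebraMap_ent_injective : Function.Injective (algebraMap (Ent E) (Mer E)) :=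
  IsFractionRing.injective (Ent E) (Mer E)

theorem mer_hom_ext {R : Type} [CommSemiring R] {f g : Mer E →+* R}
    (h : ∀ a : Ent E, f (algebraMap (Ent E) (Mer E) a) = g (algebraMap (Ent E) (Mer E) a)) :
    f = g :=
  IsLocalization.ringHom_ext (R := Ent E) (S := Mer E) (nonZeroDivisors (Ent E)) (RingHom.ext h)

theorem pull_algebraMap (φ : E → F) (hφ : Differentiable ℂ φ) (hs : Function.Surjective φ)
    (a : Ent F) :
    pull φ hφ hs (algebraMap (Ent F) (Mer F) a) = algebraMap (Ent E) (Mer E) (entComp φ hφ a) :=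
  IsLocalization.map_eq (M := nonZeroDivisors (Ent F)) (T := nonZeroDivisors (Ent E))
    (S := Mer F) (Q := Mer E)
    (nonZeroDivisors_le_comap_nonZeroDivisors_of_injective _ (entComp_injective φ hφ hs)) a

theorem pull_pull (φ : E → F) (hφ : Differentiable ℂ φ) (hs : Function.Surjective φ)
    (ψ : F → G) (hψ : Differentiable ℂ ψ) (hs' : Function.Surjective ψ) (f : Mer G) :
    pull φ hφ hs (pull ψ hψ hs' f) = pull (ψ ∘ φ) (hψ.comp hφ) (hs'.comp hs) f := by
  have h : (pull φ hφ hs).comp (pull ψ hψ hs') = pull (ψ ∘ φ) (hψ.comp hφ) (hs'.comp hs) := by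
    refine mer_hom_ext fun a => ?_
    rw [RingHom.comp_apply, pull_algebraMap, pull_algebraMap, pull_algebraMap]
    rfl
  exact congrArg (fun g => g f) h

theorem pull_congr {φ ψ : E → F} (h : φ = ψ) (hφ : Differentiable ℂ φ)
    (hs : Function.Surjective φ) (f : Mer F) :
    pull φ hφ hs f = pull ψ (h ▸ hφ) (h ▸ hs) f := by
  subst h; rfl

theorem pull_id (f : Mer E) : pull (fun x : E => x) differentiable_id Function.surjective_id f = f := by
  have h : pull (fun x : E => x) differentiable_id Function.surjective_id = RingHom.id (Mer E) := by
    refine mer_hom_ext fun a => ?_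
    rw [pull_algebraMap]
    rfl
  exact congrArg (fun g => g f) h

theorem pull_ofEnt (φ : E → F) (hφ : Differentiable ℂ φ) (hs : Function.Surjective φ)
    (f : F → ℂ) (hf : Differentiable ℂ f) :
    pull φ hφ hs (ofEnt f hf) = ofEnt (fun x => f (φ x)) (hf.comp hφ) :=
  pull_algebraMap φ hφ hs _

theorem ofEnt_congr {f g : E → ℂ} (h : ∀ x, f x = g x) (hf : Differentiable ℂ f)
    (hg : Differentiable ℂ g) : ofEnt f hf = ofEnt g hg := by
  obtain rfl : f = g := funext h
  rfl

theorem ofEnt_ne_zero {f : E → ℂ} {hf : Differentiable ℂ f} {x : E} (hx : f x ≠ 0) :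
    ofEnt f hf ≠ 0 := by
  intro h
  have h0 : (⟨f, hf⟩ : Ent E) = 0 := by
    apply algebraMap_ent_injective
    rw [map_zero]
    exact h
  exact hx (congrFun (congrArg Subtype.val h0) x)

theorem algebraMap_complex (c : ℂ) :
    algebraMap ℂ (Mer E) c = algebraMap (Ent E) (Mer E) (algebraMap ℂ (Ent E) c) :=
  IsScalarTower.algebraMap_apply ℂ (Ent E) (Mer E) c

theorem pull_const (φ : E → F) (hφ : Differentiable ℂ φ) (hs : Function.Surjective φ) (c : ℂ) :
    pull φ hφ hs (algebraMap ℂ (Mer F) c) = algebraMap ℂ (Mer E) c := by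
  rw [algebraMap_complex, algebraMap_complex, pull_algebraMap]
  rfl

theorem shift_const (u : E) (c : ℂ) : shift u (algebraMap ℂ (Mer E) c) = algebraMap ℂ (Mer E) c :=
  pull_const _ _ _ c

theorem shift_def (u : E) (h : Function.Surjective fun x : E => x + u) :
    shift u = pull (fun x => x + u) (by fun_prop) h := rfl

theorem surjective_add_vec {A : Type} [AddGroup A] (u : A) :
    Function.Surjective fun x : A => x + u :=
  fun y => ⟨y - u, sub_add_cancel y u⟩

theorem shift_pull (u : E) (φ : E → F) (hφ : Differentiable ℂ φ) (hs : Function.Surjective φ)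
    (v : F) (h : ∀ x, φ (x + u) = φ x + v) (f : Mer F) :
    shift u (pull φ hφ hs f) = pull φ hφ hs (shift v f) := by
  rw [shift_def u (surjective_add_vec u), shift_def v (surjective_add_vec v), pull_pull, pull_pull]
  exact pull_congr (funext fun x => h x) _ _ _

theorem shift_shift (u v : E) (f : Mer E) : shift u (shift v f) = shift (u + v) f := by
  rw [shift_def u (surjective_add_vec u), shift_def v (surjective_add_vec v), pull_pull,
    shift_def (u + v) (surjective_add_vec (u + v))]
  exact pull_congr (funext fun x => add_assoc x u v) _ _ _

theorem shift_zero (f : Mer E) : shift (0 : E) f = f := by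
  rw [shift_def 0 (surjective_add_vec 0), pull_congr (show (fun x : E => x + 0) = fun x => x from funext fun x => add_zero x), pull_id]

theorem shift_comm (u v : E) (f : Mer E) : shift u (shift v f) = shift v (shift u f) := by
  rw [shift_shift, shift_shift, add_comm]

theorem shift_shift_neg (u : E) (f : Mer E) : shift u (shift (-u) f) = f := by
  rw [shift_shift, add_neg_cancel, shift_zero]

theorem shift_injective (u : E) : Function.Injective (shift u) := (shift u).injective

theorem exists_ent_div (f : Mer E) : ∃ a b : Ent E, b ≠ 0 ∧
    f * algebraMap (Ent E) (Mer E) b = algebraMap (Ent E) (Mer E) a := by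
  obtain ⟨⟨a, b⟩, h⟩ := IsLocalization.surj (nonZeroDivisors (Ent E)) f
  exact ⟨a, b, nonZeroDivisors.ne_zero b.2, h⟩

/-- `f` is regular along the entire map `ι`, with restriction `g`. -/
def Restricts (ι : E → F) (hι : Differentiable ℂ ι) (f : Mer F) (g : Mer E) : Prop :=
  ∃ a b : Ent F, entComp ι hι b ≠ 0 ∧
    f * algebraMap (Ent F) (Mer F) b = algebraMap (Ent F) (Mer F) a ∧
    g * algebraMap (Ent E) (Mer E) (entComp ι hι b) = algebraMap (Ent E) (Mer E) (entComp ι hι a)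

namespace Restricts

variable {ι : E → F} {hι : Differentiable ℂ ι}

theorem of_ent (a : Ent F) :
    Restricts ι hι (algebraMap _ (Mer F) a) (algebraMap _ (Mer E) (entComp ι hι a)) :=
  ⟨a, 1, by simp, by simp, by simp⟩

theorem zero : Restricts ι hι 0 0 := ⟨0, 1, by simp, by simp, by simp⟩

theorem mul {f f' : Mer F} {g g' : Mer E} (h : Restricts ι hι f g) (h' : Restricts ι hι f' g') :
    Restricts ι hι (f * f') (g * g') := by
  obtain ⟨a, b, hb, h1, h2⟩ := h
  obtain ⟨a', b', hb', h1', h2'⟩ := h'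
  refine ⟨a * a', b * b', ?_, ?_, ?_⟩
  · rw [map_mul]; exact mul_ne_zero hb hb'
  · rw [map_mul, map_mul, ← h1, ← h1']; ring
  · rw [map_mul, map_mul, map_mul, map_mul, ← h2, ← h2']; ring

theorem add {f f' : Mer F} {g g' : Mer E} (h : Restricts ι hι f g) (h' : Restricts ι hι f' g') :
    Restricts ι hι (f + f') (g + g') := by
  obtain ⟨a, b, hb, h1, h2⟩ := h
  obtain ⟨a', b', hb', h1', h2'⟩ := h'
  refine ⟨a * b' + a' * b, b * b', ?_, ?_, ?_⟩
  · rw [map_mul]; exact mul_ne_zero hb hb'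
  · rw [map_mul, map_add, map_mul, map_mul, ← h1, ← h1']; ring
  · simp only [map_mul, map_add]; rw [← h2, ← h2']; ring

theorem sum {α : Type} (s : Finset α) {f : α → Mer F} {g : α → Mer E}
    (h : ∀ i ∈ s, Restricts ι hι (f i) (g i)) : Restricts ι hι (∑ i ∈ s, f i) (∑ i ∈ s, g i) := by
  classical
  induction s using Finset.induction_on with
  | empty => simpa using zero
  | insert i s hi ih =>
    rw [Finset.sum_insert hi, Finset.sum_insert hi]
    exact (h i (Finset.mem_insert_self _ _)).add
      (ih fun k hk => h k (Finset.mem_insert_of_mem hk))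

theorem unique {f : Mer F} {g g' : Mer E} (h : Restricts ι hι f g) (h' : Restricts ι hι f g') :
    g = g' := by
  obtain ⟨a, b, hb, h1, h2⟩ := h
  obtain ⟨a', b', hb', h1', h2'⟩ := h'
  have hab : a * b' = a' * b := by
    apply algebraMap_ent_injective
    rw [map_mul, map_mul, ← h1, ← h1']; ring
  have hab' := congrArg (fun t => algebraMap (Ent E) (Mer E) (entComp ι hι t)) hab
  simp only [map_mul] at hab'
  rw [← h2, ← h2'] at hab'
  have hne : ∀ t : Ent F, entComp ι hι t ≠ 0 → algebraMap (Ent E) (Mer E) (entComp ι hι t) ≠ 0 :=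
    fun t ht h0 => ht (algebraMap_ent_injective (by rw [h0, map_zero]))
  refine mul_right_cancel₀ (mul_ne_zero (hne b hb) (hne b' hb')) ?_
  linear_combination hab'

theorem inv {f : Mer F} {g : Mer E} (h : Restricts ι hι f g) (hg : g ≠ 0) :
    Restricts ι hι f⁻¹ g⁻¹ := by
  obtain ⟨a, b, hb, h1, h2⟩ := h
  have hne : ∀ t : Ent F, entComp ι hι t ≠ 0 → algebraMap (Ent E) (Mer E) (entComp ι hι t) ≠ 0 :=
    fun t ht h0 => ht (algebraMap_ent_injective (by rw [h0, map_zero]))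
  have ha : entComp ι hι a ≠ 0 := by
    intro h0
    rw [h0, map_zero] at h2
    exact (mul_ne_zero hg (hne b hb)) h2
  have hf : f ≠ 0 := by
    rintro rfl
    rw [zero_mul] at h1
    have : a = 0 := algebraMap_ent_injective (by rw [← h1, map_zero])
    exact ha (by rw [this, map_zero])
  exact ⟨b, a, ha, by rw [← h1, inv_mul_cancel_left₀ hf], by rw [← h2, inv_mul_cancel_left₀ hg]⟩

/-- Functions pulled back along `π` restrict to their pull-back along `π ∘ ι`. -/
theorem pull (π : F → G) (hπ : Differentiable ℂ π) (hs : Function.Surjective π)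
    (ψ : E → G) (hψ : Differentiable ℂ ψ) (hs' : Function.Surjective ψ)
    (h : ∀ x, π (ι x) = ψ x) (f : Mer G) :
    Restricts ι hι (EllipticO.pull π hπ hs f) (EllipticO.pull ψ hψ hs' f) := by
  obtain ⟨a, b, hb, hab⟩ := exists_ent_div f
  have hcomp : ∀ t : Ent G, entComp ι hι (entComp π hπ t) = entComp ψ hψ t := by
    intro t
    refine Subtype.ext (funext fun x => ?_)
    change t.1 (π (ι x)) = t.1 (ψ x)
    rw [h]
  refine ⟨entComp π hπ a, entComp π hπ b, ?_, ?_, ?_⟩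
  · rw [hcomp]
    intro h0
    exact hb (entComp_injective ψ hψ hs' (by rw [h0, map_zero]))
  · rw [← pull_algebraMap _ _ hs, ← pull_algebraMap _ _ hs, ← map_mul, hab]
  · rw [hcomp, hcomp, ← pull_algebraMap _ _ hs', ← pull_algebraMap _ _ hs', ← map_mul, hab]

end Restricts

end Substitution

/-! ### Functions of `z`, of `w` and of `λ` -/

section Variables

variable {N : ℕ}

theorem ofH_shift (v : H N) (f : MH N) : ofH N (shift v f) = shift ((0, v) : ℂ × H N) (ofH N f) :=
  (shift_pull _ _ _ _ v (fun _ => rfl) f).symm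

theorem ofH_shift_fst (u : ℂ) (f : MH N) : shift ((u, 0) : ℂ × H N) (ofH N f) = ofH N f := by
  have h := (shift_pull ((u, 0) : ℂ × H N) (fun x : ℂ × H N => x.2) (by fun_prop)
    (fun l => ⟨(0, l), rfl⟩) 0 (fun _ => rfl) f)
  rw [shift_zero] at h
  exact h

theorem ofC_shift (u : ℂ) (v : H N) (f : MC) :
    shift ((u, v) : ℂ × H N) (ofC N f) = ofC N (shift u f) :=
  shift_pull _ _ _ _ u (fun _ => rfl) f

theorem atZ_shift (v : H N) (f : MZ N) :
    atZ N (shift ((0, v) : ℂ × H N) f) = shift ((0, 0, v) : ℂ × ℂ × H N) (atZ N f) :=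
  (shift_pull _ _ _ _ ((0, v) : ℂ × H N) (fun _ => rfl) f).symm

theorem atW_shift (v : H N) (f : MZ N) :
    atW N (shift ((0, v) : ℂ × H N) f) = shift ((0, 0, v) : ℂ × ℂ × H N) (atW N f) :=
  (shift_pull _ _ _ _ ((0, v) : ℂ × H N) (fun _ => rfl) f).symm

theorem atZsubW_shift (v : H N) (f : MZ N) :
    atZsubW N (shift ((0, v) : ℂ × H N) f) = shift ((0, 0, v) : ℂ × ℂ × H N) (atZsubW N f) :=
  (shift_pull _ _ _ _ ((0, v) : ℂ × H N)
    (fun x => by ext <;> simp) f).symm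

theorem atW_ofH (f : MH N) : atW N (ofH N f) = atZ N (ofH N f) := by
  have h := (pull_pull (fun x : ℂ × ℂ × H N => (x.2.1, x.2.2)) (by fun_prop)
    (fun y => ⟨(0, y.1, y.2), rfl⟩) (fun x : ℂ × H N => x.2) (by fun_prop)
    (fun l => ⟨(0, l), rfl⟩) f)
  have h' := (pull_pull (fun x : ℂ × ℂ × H N => (x.1, x.2.2)) (by fun_prop)
    (fun y => ⟨(y.1, 0, y.2), rfl⟩) (fun x : ℂ × H N => x.2) (by fun_prop)
    (fun l => ⟨(0, l), rfl⟩) f)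
  exact h.trans h'.symm

theorem ofC_algebraMap (a : Ent ℂ) : ofC N (algebraMap _ _ a) =
    algebraMap _ _ (entComp (fun x : ℂ × H N => x.1) (by fun_prop) a) :=
  pull_algebraMap _ _ _ _

theorem ofH_algebraMap (a : Ent (H N)) : ofH N (algebraMap _ _ a) =
    algebraMap _ _ (entComp (fun x : ℂ × H N => x.2) (by fun_prop) a) :=
  pull_algebraMap _ _ _ _

/-- A function of `z` which is also a function of `λ` is constant. -/
theorem exists_const_of_ofC_eq_ofH {q : MC} {p : MH N} (h : ofC N q = ofH N p) :
    ∃ c : ℂ, q = algebraMap ℂ MC c := by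
  obtain ⟨a, b, hb, hab⟩ := exists_ent_div q
  obtain ⟨a', b', hb', hab'⟩ := exists_ent_div p
  have hb0 : ∃ l, b'.1 l ≠ 0 := by
    by_contra hcon
    push Not at hcon
    exact hb' (Subtype.ext (funext hcon))
  obtain ⟨l, hl⟩ := hb0
  have h1 := congrArg (ofC N) hab
  have h2 := congrArg (ofH N) hab'
  rw [map_mul] at h1 h2
  rw [ofC_algebraMap, ofC_algebraMap] at h1
  rw [ofH_algebraMap, ofH_algebraMap] at h2
  have h3 : entComp (fun x : ℂ × H N => x.1) (by fun_prop) a *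
      entComp (fun x : ℂ × H N => x.2) (by fun_prop) b' =
      entComp (fun x : ℂ × H N => x.2) (by fun_prop) a' *
      entComp (fun x : ℂ × H N => x.1) (by fun_prop) b := by
    apply algebraMap_ent_injective
    rw [map_mul, map_mul, ← h1, ← h2, h]
    ring
  have h4 : ∀ z, a.1 z * b'.1 l = a'.1 l * b.1 z := fun z =>
    congrFun (congrArg Subtype.val h3) (z, l)
  refine ⟨a'.1 l / b'.1 l, ?_⟩
  have hbne : algebraMap (Ent ℂ) MC b ≠ 0 := fun h0 =>
    hb (algebraMap_ent_injective (by rw [h0, map_zero]))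
  refine mul_right_cancel₀ hbne ?_
  rw [hab, algebraMap_complex, ← map_mul]
  congr 1
  refine Subtype.ext (funext fun z => ?_)
  change a.1 z = a'.1 l / b'.1 l * b.1 z
  field_simp
  linear_combination h4 z

theorem exists_common_denominator {E : Type} [NormedAddCommGroup E] [NormedSpace ℂ E] {α : Type}
    (s : Finset α) (f : α → Mer E) : ∃ (b : Ent E) (a : α → Ent E), b ≠ 0 ∧
      ∀ i ∈ s, f i * algebraMap (Ent E) (Mer E) b = algebraMap (Ent E) (Mer E) (a i) := by
  obtain ⟨b, hb⟩ := IsLocalization.exist_integer_multiples (nonZeroDivisors (Ent E)) s f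
  choose! a ha using hb
  refine ⟨b, a, nonZeroDivisors.ne_zero b.2, fun i hi => ?_⟩
  rw [ha i hi, Algebra.smul_def, mul_comm]

/-- Functions of `(z, λ)` and of `(w, λ)` are linearly disjoint over the functions of `λ`. -/
theorem linear_disjoint {α : Type} (s : Finset α) (κ h : α → MZ N)
    (hκ : ∀ g : α → MH N, ∑ t ∈ s, ofH N (g t) * κ t = 0 → ∀ t ∈ s, g t = 0)
    (h0 : ∑ t ∈ s, atZ N (κ t) * atW N (h t) = 0) : ∀ t ∈ s, h t = 0 := by
  obtain ⟨d, a, hd, ha⟩ := exists_common_denominator s κ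
  obtain ⟨d', g, hd', hg⟩ := exists_common_denominator s h
  have hdne : ∀ {E : Type} [NormedAddCommGroup E] [NormedSpace ℂ E] {b : Ent E}, b ≠ 0 →
      algebraMap (Ent E) (Mer E) b ≠ 0 := fun hb h0 =>
    hb (algebraMap_ent_injective (by rw [h0, map_zero]))
  let πz : ℂ × ℂ × H N → ℂ × H N := fun x => (x.1, x.2.2)
  let πw : ℂ × ℂ × H N → ℂ × H N := fun x => (x.2.1, x.2.2)
  have hπz : Differentiable ℂ πz := by fun_prop
  have hπw : Differentiable ℂ πw := by fun_prop
  have hent : ∑ t ∈ s, entComp πz hπz (a t) * entComp πw hπw (g t) = 0 := by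
    apply algebraMap_ent_injective
    rw [map_zero, map_sum]
    have : ∀ t ∈ s, algebraMap _ (MZW N) (entComp πz hπz (a t) * entComp πw hπw (g t)) =
        atZ N (κ t) * atW N (h t) *
          (atZ N (algebraMap _ _ d) * atW N (algebraMap _ _ d')) := by
      intro t ht
      have h1 := congrArg (atZ N) (ha t ht)
      have h2 := congrArg (atW N) (hg t ht)
      rw [map_mul] at h1 h2
      have h3 : atZ N (algebraMap _ _ (a t)) = algebraMap _ (MZW N) (entComp πz hπz (a t)) :=
        pull_algebraMap _ _ _ _
      have h4 : atW N (algebraMap _ _ (g t)) = algebraMap _ (MZW N) (entComp πw hπw (g t)) :=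
        pull_algebraMap _ _ _ _
      rw [map_mul, ← h3, ← h4, ← h1, ← h2]
      ring
    rw [Finset.sum_congr rfl this, ← Finset.sum_mul, h0, zero_mul]
  have hzero : ∀ w : ℂ, ∀ t ∈ s, ∀ l, (g t).1 (w, l) = 0 := by
    intro w t ht l
    let gw : α → Ent (H N) := fun t => ⟨fun l => (g t).1 (w, l),
      Differentiable.comp (g t).2 (by fun_prop : Differentiable ℂ fun l : H N => (w, l))⟩
    have hsum : ∑ t ∈ s, entComp (fun x : ℂ × H N => x.2) (by fun_prop) (gw t) * a t = 0 := by
      refine Subtype.ext (funext fun x => ?_)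
      have h1 := congrFun (congrArg Subtype.val hent) ((x.1, w, x.2) : ℂ × ℂ × H N)
      simp only [AddSubmonoidClass.coe_finsetSum, Finset.sum_apply, Subalgebra.coe_zero,
        Pi.zero_apply] at h1 ⊢
      rw [← h1]
      refine Finset.sum_congr rfl fun t _ => ?_
      exact mul_comm _ _
    have h2 := hκ (fun t => algebraMap _ (MH N) (gw t)) ?_ t ht
    · have h3 : gw t = 0 := algebraMap_ent_injective (by rw [h2, map_zero])
      exact congrFun (congrArg Subtype.val h3) l
    · refine (mul_eq_zero.mp ?_).resolve_right (hdne hd)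
      rw [Finset.sum_mul]
      have h3 := congrArg (algebraMap _ (MZ N)) hsum
      rw [map_sum, map_zero] at h3
      rw [← h3]
      refine Finset.sum_congr rfl fun t ht => ?_
      rw [map_mul, mul_assoc, ha t ht]
      congr 1
      exact pull_algebraMap _ _ _ _
  intro t ht
  have h1 := hg t ht
  have h2 : g t = 0 := Subtype.ext (funext fun x => hzero x.1 t ht x.2)
  rw [h2, map_zero] at h1
  exact (mul_eq_zero.mp h1).resolve_right (hdne hd')

end Variables

end EllipticO
end

noncomputable section
namespace EllipticO

/-! ### Extension of scalars for spaces with a basis -/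

section BaseExtension

variable {k K : Type} [Field k] [Field K] {B C : Type}

/-- Vectors with coordinates in `k`, viewed as vectors with coordinates in `K`. -/
def bext (j : k →+* K) (x : B →₀ k) : B →₀ K := x.mapRange j (map_zero j)

theorem bext_apply (j : k →+* K) (x : B →₀ k) (b : B) : bext j x b = j (x b) := rfl

theorem bext_zero (j : k →+* K) : bext j (0 : B →₀ k) = 0 := by
  ext b; simp [bext_apply]

theorem bext_add (j : k →+* K) (x y : B →₀ k) : bext j (x + y) = bext j x + bext j y := by
  ext b; simp [bext_apply]

theorem bext_sub (j : k →+* K) (x y : B →₀ k) : bext j (x - y) = bext j x - bext j y := by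
  ext b; simp [bext_apply]

theorem bext_smul (j : k →+* K) (a : k) (x : B →₀ k) : bext j (a • x) = j a • bext j x := by
  ext b; simp [bext_apply]

theorem bext_single (j : k →+* K) (b : B) (a : k) :
    bext j (Finsupp.single b a) = Finsupp.single b (j a) :=
  Finsupp.mapRange_single

theorem bext_sum (j : k →+* K) {α : Type} (s : Finset α) (x : α → B →₀ k) :
    bext j (∑ i ∈ s, x i) = ∑ i ∈ s, bext j (x i) := by
  ext b; simp [bext_apply, Finsupp.finsetSum_apply, map_sum]

theorem bext_injective (j : k →+* K) : Function.Injective (bext j : (B →₀ k) → (B →₀ K)) := by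
  intro x y h
  ext b
  exact j.injective (DFunLike.congr_fun h b)

/-- The `k`-linear forms on `K`. -/
def IsCoef (j : k →+* K) (φ : K →+ k) : Prop := ∀ a y, φ (j a * y) = a * φ y

theorem IsCoef.mul_right {j : k →+* K} {φ : K →+ k} (h : IsCoef j φ) (c : K) :
    IsCoef j (φ.comp (AddMonoidHom.mulRight c)) := by
  intro a y
  simp only [AddMonoidHom.comp_apply, AddMonoidHom.coe_mulRight, mul_assoc, h a]

/-- Apply a linear form to all the coordinates of a vector. -/
def cvec (φ : K →+ k) (y : B →₀ K) : B →₀ k := y.mapRange φ φ.map_zero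

theorem cvec_apply (φ : K →+ k) (y : B →₀ K) (b : B) : cvec φ y b = φ (y b) := rfl

theorem cvec_zero (φ : K →+ k) : cvec φ (0 : B →₀ K) = 0 := by ext; simp [cvec_apply]

theorem cvec_add (φ : K →+ k) (y z : B →₀ K) : cvec φ (y + z) = cvec φ y + cvec φ z := by
  ext b; simp [cvec_apply]

theorem cvec_smul_bext {j : k →+* K} {φ : K →+ k} (h : IsCoef j φ) (c : K) (x : B →₀ k) :
    cvec φ (c • bext j x) = φ c • x := by
  ext b
  simp only [cvec_apply, Finsupp.smul_apply, bext_apply, smul_eq_mul]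
  rw [mul_comm, h, mul_comm]

theorem cvec_bext {j : k →+* K} {φ : K →+ k} (h : IsCoef j φ) (x : B →₀ k) :
    cvec φ (bext j x) = φ 1 • x := by
  rw [← cvec_smul_bext h, one_smul]

theorem cvec_smul (φ : K →+ k) (c : K) (y : B →₀ K) :
    cvec φ (c • y) = cvec (φ.comp (AddMonoidHom.mulRight c)) y := by
  ext b
  simp [cvec_apply, mul_comm]

/-- Every element of `K` is a combination of linearly independent elements, with coefficients given
by linear forms. -/
theorem exists_coef_basis (j : k →+* K) : ∃ (I : Type) (κ : I → K) (φ : I → K →+ k),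
    (∀ i, IsCoef j (φ i)) ∧ (∀ y : K, (Function.support fun i => φ i y).Finite) ∧
    (∀ y : K, y = ∑ᶠ i, j (φ i y) * κ i) ∧
    (∀ (s : Finset I) (g : I → k), ∑ i ∈ s, j (g i) * κ i = 0 → ∀ i ∈ s, g i = 0) := by
  let := j.toAlgebra
  let b := Module.Basis.ofVectorSpace k K
  refine ⟨_, b, fun i => (b.coord i).toAddMonoidHom, ?_, ?_, ?_, ?_⟩
  · intro i a y
    change b.coord i (j a * y) = a * b.coord i y
    rw [show j a * y = a • y from (Algebra.smul_def a y).symm, map_smul, smul_eq_mul]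
  · intro y
    exact (b.repr y).hasFiniteSupport
  · intro y
    conv_lhs => rw [← b.linearCombination_repr y, Finsupp.linearCombination_apply, Finsupp.sum]
    rw [finsum_eq_sum_of_support_subset (s := (b.repr y).support)]
    · refine Finset.sum_congr rfl fun i _ => ?_
      rw [Algebra.smul_def]
      rfl
    · intro i hi
      rw [Finset.mem_coe, Finsupp.mem_support_iff]
      intro h0
      refine hi ?_
      change j (b.repr y i) * _ = 0
      rw [h0, map_zero, zero_mul]
  · intro s g h
    refine linearIndependent_iff'.mp b.linearIndependent s g ?_
    rw [← h]
    refine Finset.sum_congr rfl fun i _ => ?_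
    rw [Algebra.smul_def]
    rfl

theorem eq_zero_of_coef {j : k →+* K} {y : K} (h : ∀ φ : K →+ k, IsCoef j φ → φ y = 0) : y = 0 := by
  obtain ⟨I, κ, φ, hφ, -, hy, -⟩ := exists_coef_basis j
  rw [hy y]
  simp [fun i => h (φ i) (hφ i)]

theorem exists_coef_one (j : k →+* K) : ∃ φ : K →+ k, IsCoef j φ ∧ φ 1 = 1 := by
  by_contra hcon
  push Not at hcon
  refine one_ne_zero (eq_zero_of_coef (j := j) fun φ hφ => ?_)
  by_contra h0
  refine hcon ((AddMonoidHom.mulLeft (φ 1)⁻¹).comp φ) ?_ ?_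
  · intro a y
    simp only [AddMonoidHom.comp_apply, AddMonoidHom.coe_mulLeft, hφ a y]
    ring
  · simp [h0]

theorem vec_eq_zero_of_coef {j : k →+* K} {y : B →₀ K}
    (h : ∀ φ : K →+ k, IsCoef j φ → cvec φ y = 0) : y = 0 := by
  ext b
  exact eq_zero_of_coef (j := j) fun φ hφ => DFunLike.congr_fun (h φ hφ) b

/-- The extension of scalars of a subspace. -/
def spanK (j : k →+* K) (p : Submodule k (B →₀ k)) : Submodule K (B →₀ K) :=
  Submodule.span K (bext j '' p)

theorem exists_decomposition (j : k →+* K) (y : B →₀ K) : ∃ (I : Type) (κ : I → K) (s : Finset I)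
    (φ : I → K →+ k), (∀ i, IsCoef j (φ i)) ∧ y = ∑ i ∈ s, κ i • bext j (cvec (φ i) y) ∧
    ∀ g : I → k, ∑ i ∈ s, j (g i) * κ i = 0 → ∀ i ∈ s, g i = 0 := by
  classical
  obtain ⟨I, κ, φ, hφ, hfin, hy, hind⟩ := exists_coef_basis j
  refine ⟨I, κ, y.support.biUnion fun b => (hfin (y b)).toFinset, φ, hφ, ?_, fun g => hind _ g⟩
  ext b
  rw [Finsupp.finsetSum_apply]
  by_cases hb : y b = 0
  · simp [bext_apply, cvec_apply, hb]
  · conv_lhs => rw [hy (y b)]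
    rw [finsum_eq_sum_of_support_subset]
    · refine Finset.sum_congr rfl fun i _ => ?_
      rw [Finsupp.smul_apply, bext_apply, cvec_apply, smul_eq_mul, mul_comm]
    · intro i hi
      rw [Finset.mem_coe, Finset.mem_biUnion]
      refine ⟨b, Finsupp.mem_support_iff.mpr hb, ?_⟩
      rw [Set.Finite.mem_toFinset]
      intro h0
      refine hi ?_
      have h1 : φ i (y b) = 0 := h0
      change j (φ i (y b)) * _ = 0
      rw [h1, map_zero, zero_mul]

theorem mem_spanK_iff {j : k →+* K} {p : Submodule k (B →₀ k)} {y : B →₀ K} :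
    y ∈ spanK j p ↔ ∀ φ : K →+ k, IsCoef j φ → cvec φ y ∈ p := by
  constructor
  · intro hy
    induction hy using Submodule.span_induction with
    | mem y hy =>
      obtain ⟨x, hx, rfl⟩ := hy
      intro φ hφ
      rw [cvec_bext hφ]
      exact p.smul_mem _ hx
    | zero => intro φ _; rw [cvec_zero]; exact p.zero_mem
    | add y z _ _ hy hz =>
      intro φ hφ
      rw [cvec_add]
      exact p.add_mem (hy φ hφ) (hz φ hφ)
    | smul c y _ hy =>
      intro φ hφ
      rw [cvec_smul]
      exact hy _ (hφ.mul_right c)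
  · intro h
    obtain ⟨I, κ, s, φ, hφ, hy, -⟩ := exists_decomposition j y
    rw [hy]
    exact Submodule.sum_mem _ fun i _ => Submodule.smul_mem _ _
      (Submodule.subset_span ⟨_, h _ (hφ i), rfl⟩)

theorem bext_mem_spanK {j : k →+* K} {p : Submodule k (B →₀ k)} {x : B →₀ k} :
    bext j x ∈ spanK j p ↔ x ∈ p := by
  constructor
  · intro h
    obtain ⟨φ, hφ, h1⟩ := exists_coef_one j
    have := mem_spanK_iff.mp h φ hφ
    rwa [cvec_bext hφ, h1, one_smul] at this
  · intro h
    exact Submodule.subset_span ⟨x, h, rfl⟩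

theorem spanK_span (j : k →+* K) (s : Set (B →₀ k)) :
    spanK j (Submodule.span k s) = Submodule.span K (bext j '' s) := by
  refine le_antisymm (Submodule.span_le.mpr ?_)
    (Submodule.span_mono (Set.image_mono Submodule.subset_span))
  rintro _ ⟨x, hx, rfl⟩
  induction hx using Submodule.span_induction with
  | mem x hx => exact Submodule.subset_span ⟨x, hx, rfl⟩
  | zero => rw [bext_zero]; exact Submodule.zero_mem _
  | add x y _ _ hx hy => rw [bext_add]; exact Submodule.add_mem _ hx hy
  | smul a x _ hx => rw [bext_smul]; exact Submodule.smul_mem _ _ hx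

theorem spanK_mono (j : k →+* K) {p q : Submodule k (B →₀ k)} (h : p ≤ q) :
    spanK j p ≤ spanK j q :=
  Submodule.span_mono (Set.image_mono h)

theorem spanK_bot (j : k →+* K) : spanK j (⊥ : Submodule k (B →₀ k)) = ⊥ := by
  rw [eq_bot_iff]
  intro y hy
  exact vec_eq_zero_of_coef (j := j) fun φ hφ => mem_spanK_iff.mp hy φ hφ

theorem spanK_top (j : k →+* K) : spanK j (⊤ : Submodule k (B →₀ k)) = ⊤ := by
  rw [eq_top_iff]
  intro y _
  exact mem_spanK_iff.mpr fun _ _ => Submodule.mem_top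

theorem linearIndependent_bext (j : k →+* K) {S : Type} {v : S → B →₀ k}
    (hv : LinearIndependent k v) : LinearIndependent K (fun s => bext j (v s)) := by
  rw [linearIndependent_iff'] at hv ⊢
  intro t c hc s hs
  refine eq_zero_of_coef (j := j) fun φ hφ => ?_
  refine hv t (fun s => φ (c s)) ?_ s hs
  have h := congrArg (cvec φ) hc
  have hsum : cvec φ (∑ i ∈ t, c i • bext j (v i)) = ∑ i ∈ t, cvec φ (c i • bext j (v i)) :=
    map_sum (⟨⟨cvec φ, cvec_zero φ⟩, cvec_add φ⟩ : (B →₀ K) →+ (B →₀ k)) _ _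
  rw [hsum, cvec_zero] at h
  rw [← h]
  exact Finset.sum_congr rfl fun i _ => (cvec_smul_bext hφ _ _).symm

/-- The extension of scalars of a linear map. -/
def extMap (j : k →+* K) (T : (B →₀ k) →ₗ[k] (C →₀ k)) : (B →₀ K) →ₗ[K] (C →₀ K) :=
  Finsupp.linearCombination K fun b => bext j (T (Finsupp.single b 1))

theorem extMap_single (j : k →+* K) (T : (B →₀ k) →ₗ[k] (C →₀ k)) (b : B) (c : K) :
    extMap j T (Finsupp.single b c) = c • bext j (T (Finsupp.single b 1)) :=
  Finsupp.linearCombination_single K c b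

theorem cvec_extMap {j : k →+* K} {φ : K →+ k} (hφ : IsCoef j φ)
    (T : (B →₀ k) →ₗ[k] (C →₀ k)) (y : B →₀ K) : cvec φ (extMap j T y) = T (cvec φ y) := by
  induction y using Finsupp.induction_linear with
  | zero => simp [cvec_zero]
  | add y z hy hz => rw [map_add, cvec_add, cvec_add, map_add, hy, hz]
  | single b c =>
    rw [extMap_single, cvec_smul_bext hφ, ← map_smul, Finsupp.smul_single, smul_eq_mul, mul_one]
    congr 1
    exact (Finsupp.mapRange_single (hf := φ.map_zero)).symm

theorem extMap_bext (j : k →+* K) (T : (B →₀ k) →ₗ[k] (C →₀ k)) (x : B →₀ k) :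
    extMap j T (bext j x) = bext j (T x) := by
  induction x using Finsupp.induction_linear with
  | zero => simp [bext_zero]
  | add y z hy hz => rw [bext_add, map_add, map_add, bext_add, hy, hz]
  | single b c =>
    rw [bext_single, extMap_single, ← bext_smul, ← map_smul, Finsupp.smul_single, smul_eq_mul,
      mul_one]

theorem extMap_injective (j : k →+* K) {T : (B →₀ k) →ₗ[k] (C →₀ k)}
    (hT : Function.Injective T) : Function.Injective (extMap j T) := by
  rw [← LinearMap.ker_eq_bot, LinearMap.ker_eq_bot']
  intro y hy
  refine vec_eq_zero_of_coef (j := j) fun φ hφ => hT ?_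
  rw [← cvec_extMap hφ, hy, cvec_zero, map_zero]

theorem extMap_mem_spanK {j : k →+* K} {T : (B →₀ k) →ₗ[k] (C →₀ k)} {p : Submodule k (C →₀ k)}
    {y : B →₀ K} : extMap j T y ∈ spanK j p ↔ y ∈ spanK j (p.comap T) := by
  rw [mem_spanK_iff, mem_spanK_iff]
  refine forall₂_congr fun φ hφ => ?_
  rw [cvec_extMap hφ, Submodule.mem_comap]

theorem extMap_mem_map {j : k →+* K} {T : (B →₀ k) →ₗ[k] (C →₀ k)} {p : Submodule k (B →₀ k)}
    {y : B →₀ K} (hy : y ∈ spanK j p) : extMap j T y ∈ spanK j (p.map T) :=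
  extMap_mem_spanK.mpr (spanK_mono j (Submodule.le_comap_map T p) hy)

theorem extMap_surjective (j : k →+* K) {T : (B →₀ k) →ₗ[k] (C →₀ k)}
    (hT : Function.Surjective T) : Function.Surjective (extMap j T) := by
  rw [← LinearMap.range_eq_top, eq_top_iff, ← spanK_top j, spanK, Submodule.span_le]
  rintro _ ⟨x, -, rfl⟩
  obtain ⟨y, rfl⟩ := hT x
  exact ⟨bext j y, extMap_bext j T y⟩

end BaseExtension

/-! ### Triangular families for difference operators -/

section Triangular

variable {k K : Type} [Field k] [Field K] {B : Type} {j : k →+* K} {ι : Type}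

/-- Two triangular bases for the same semilinear operators have the same diagonal entries, up to
the order of the basis vectors and rescaling. -/
theorem exists_equiv_of_triangular {S S' : Type} [Fintype S] [LinearOrder S] [Fintype S']
    [LinearOrder S'] {v : S → B →₀ k} {v' : S' → B →₀ k} (hv : LinearIndependent k v)
    (hv' : LinearIndependent k v')
    (hspan : Submodule.span k (Set.range v) = Submodule.span k (Set.range v'))
    (τ : ι → k →+* K) (D : ι → (B →₀ k) → (B →₀ K))
    (hadd : ∀ l x y, D l (x + y) = D l x + D l y) (hsmul : ∀ l a x, D l (a • x) = τ l a • D l x)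
    (F : S → ι → K) (F' : S' → ι → K)
    (hF : ∀ l s, D l (v s) - F s l • bext j (v s) ∈ spanK j (Submodule.span k (v '' Set.Iio s)))
    (hF' : ∀ l s, D l (v' s) - F' s l • bext j (v' s) ∈
      spanK j (Submodule.span k (v' '' Set.Iio s))) :
    ∃ π : S ≃ S', ∀ s, ∃ a a' : k, a ≠ 0 ∧ a' ≠ 0 ∧
      ∀ l, τ l a * F s l * j a' = τ l a' * F' (π s) l * j a := by
  classical
  have hzero : ∀ l, D l 0 = 0 := fun l => by
    have := hsmul l 0 0; rwa [smul_zero, map_zero, zero_smul] at this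
  -- generalities on one triangular family
  have key : ∀ {S : Type} [LinearOrder S] {v : S → B →₀ k} {F : S → ι → K},
      LinearIndependent k v → (∀ l s, D l (v s) - F s l • bext j (v s) ∈
        spanK j (Submodule.span k (v '' Set.Iio s))) →
      (∀ s x, x ∈ Submodule.span k (v '' Set.Iic s) →
        ∃ a : k, x - a • v s ∈ Submodule.span k (v '' Set.Iio s)) ∧
      (∀ s x (a : k), x - a • v s ∈ Submodule.span k (v '' Set.Iio s) →
        ∀ l, D l x - (τ l a * F s l) • bext j (v s) ∈
          spanK j (Submodule.span k (v '' Set.Iio s))) := by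
    intro S _ v F hv hF
    refine ⟨?_, ?_⟩
    · intro s x hx
      rw [← Set.Iio_insert, Set.image_insert_eq, Submodule.mem_span_insert] at hx
      obtain ⟨a, z, hz, rfl⟩ := hx
      exact ⟨a, by simpa using hz⟩
    · intro s x a hx l
      have hlow : ∀ y ∈ Submodule.span k (v '' Set.Iio s),
          D l y ∈ spanK j (Submodule.span k (v '' Set.Iio s)) := by
        intro y hy
        induction hy using Submodule.span_induction with
        | mem y hy =>
          obtain ⟨r, hr, rfl⟩ := hy
          have h1 := spanK_mono j (Submodule.span_mono (R := k)
            (Set.image_mono (f := v) (Set.Iio_subset_Iio (le_of_lt hr)))) (hF l r)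
          have h2 : bext j (v r) ∈ spanK j (Submodule.span k (v '' Set.Iio s)) :=
            bext_mem_spanK.mpr (Submodule.subset_span ⟨r, hr, rfl⟩)
          simpa using Submodule.add_mem _ h1 (Submodule.smul_mem _ (F r l) h2)
        | zero => rw [hzero]; exact Submodule.zero_mem _
        | add y z _ _ hy hz => rw [hadd]; exact Submodule.add_mem _ hy hz
        | smul c y _ hy => rw [hsmul]; exact Submodule.smul_mem _ _ hy
      have h1 := hlow _ hx
      have h2 : D l x = D l (x - a • v s) + τ l a • D l (v s) := by
        rw [← hsmul, ← hadd, sub_add_cancel]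
      have h3 := Submodule.smul_mem _ (τ l a) (hF l s)
      rw [h2]
      convert Submodule.add_mem _ h1 h3 using 1
      rw [smul_sub, smul_smul]
      abel
  obtain ⟨hA, hD⟩ := key hv hF
  obtain ⟨hA', hD'⟩ := key hv' hF'
  set Vl : S → Submodule k (B →₀ k) := fun s => Submodule.span k (v '' Set.Iio s) with hVl
  set Ve : S → Submodule k (B →₀ k) := fun s => Submodule.span k (v '' Set.Iic s) with hVe
  set Vl' : S' → Submodule k (B →₀ k) := fun s => Submodule.span k (v' '' Set.Iio s) with hVl'
  set Ve' : S' → Submodule k (B →₀ k) := fun s => Submodule.span k (v' '' Set.Iic s) with hVe'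
  have hnot : ∀ s, v s ∉ Vl s := fun s => hv.notMem_span_image (by simp)
  have hlt' : ∀ s' x, x ∈ Vl' s' → x = 0 ∨ ∃ t' < s', x ∈ Ve' t' := by
    intro s' x hx
    by_cases hne : (Finset.univ.filter fun t' => t' < s').Nonempty
    · right
      refine ⟨_, (Finset.mem_filter.mp (Finset.max'_mem _ hne)).2, ?_⟩
      refine Submodule.span_mono (Set.image_mono ?_) hx
      intro r hr
      exact Finset.le_max' _ _ (Finset.mem_filter.mpr ⟨Finset.mem_univ _, hr⟩)
    · left
      have : Set.Iio s' = ∅ := by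
        ext r
        simp only [Set.mem_Iio, Set.mem_empty_iff_false, iff_false]
        intro hr
        exact hne ⟨r, Finset.mem_filter.mpr ⟨Finset.mem_univ _, hr⟩⟩
      simp only [hVl', this, Set.image_empty, Submodule.span_empty] at hx
      exact hx
  -- the relative position
  have hpos : ∀ s, ∃ s', (∃ x ∈ Ve s, x ∈ Ve' s' ∧ x ∉ Vl s) ∧
      ∀ t' < s', ∀ x ∈ Ve s, x ∈ Ve' t' → x ∈ Vl s := by
    intro s
    have hvs : v s ∈ Submodule.span k (Set.range v') :=
      hspan ▸ Submodule.subset_span ⟨s, rfl⟩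
    have hne : Nonempty S' := by
      by_contra h
      rw [not_nonempty_iff] at h
      rw [Set.range_eq_empty, Submodule.span_empty, Submodule.mem_bot] at hvs
      exact hv.ne_zero s hvs
    have hex : (Finset.univ.filter fun s' => ∃ x ∈ Ve s, x ∈ Ve' s' ∧ x ∉ Vl s).Nonempty := by
      refine ⟨Finset.univ.max' Finset.univ_nonempty, Finset.mem_filter.mpr ⟨Finset.mem_univ _,
        v s, Submodule.subset_span ⟨s, Set.self_mem_Iic, rfl⟩, ?_, hnot s⟩⟩
      refine Submodule.span_mono ?_ hvs
      rintro _ ⟨r, rfl⟩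
      exact ⟨r, Finset.le_max' _ _ (Finset.mem_univ r), rfl⟩
    refine ⟨_, (Finset.mem_filter.mp (Finset.min'_mem _ hex)).2, ?_⟩
    intro t' ht' x hx hx'
    by_contra hcon
    exact absurd (Finset.min'_le _ t' (Finset.mem_filter.mpr
      ⟨Finset.mem_univ _, x, hx, hx', hcon⟩)) (not_le.mpr ht')
  choose π hex hmin using hpos
  choose x hxe hxe' hxl using hex
  have hmin' : ∀ s y, y ∈ Ve s → y ∈ Vl' (π s) → y ∈ Vl s := by
    intro s y hy hy'
    rcases hlt' _ _ hy' with rfl | ⟨t', ht', h⟩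
    · exact Submodule.zero_mem _
    · exact hmin s t' ht' y hy h
  have hle : ∀ s, Vl s ≤ Ve s := fun s =>
    Submodule.span_mono (Set.image_mono Set.Iio_subset_Iic_self)
  have hle' : ∀ s, Vl' s ≤ Ve' s := fun s =>
    Submodule.span_mono (Set.image_mono Set.Iio_subset_Iic_self)
  have hinj : Function.Injective π := by
    have hlt : ∀ s t, s < t → π s ≠ π t := by
      intro s t hst heq
      obtain ⟨a, ha⟩ := hA' _ _ (hxe' s)
      obtain ⟨c, hc⟩ := hA' _ _ (hxe' t)
      rw [heq] at ha
      have ha0 : a ≠ 0 := by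
        rintro rfl
        rw [zero_smul, sub_zero] at ha
        refine hxl s (hmin' s _ (hxe s) ?_)
        rwa [heq]
      have hs : x s ∈ Vl t := Submodule.span_mono (Set.image_mono
        (fun r (hr : r ≤ s) => lt_of_le_of_lt hr hst)) (hxe s)
      have h1 : x t - (c / a) • x s ∈ Vl t := by
        refine hmin' t _ (Submodule.sub_mem _ (hxe t) (Submodule.smul_mem _ _ (hle t hs))) ?_
        have := Submodule.sub_mem _ hc (Submodule.smul_mem _ (c / a) ha)
        convert this using 1
        rw [smul_sub, smul_smul, div_mul_cancel₀ _ ha0]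
        abel
      have h2 := Submodule.add_mem _ h1 (Submodule.smul_mem _ (c / a) hs)
      rw [sub_add_cancel] at h2
      exact hxl t h2
    intro s t h
    rcases lt_trichotomy s t with hst | hst | hst
    · exact absurd h (hlt s t hst)
    · exact hst
    · exact absurd h.symm (hlt t s hst)
  have hcard : Fintype.card S = Fintype.card S' := by
    rw [← finrank_span_eq_card hv, ← finrank_span_eq_card hv', hspan]
  have hbij : Function.Bijective π := (Fintype.bijective_iff_injective_and_card π).mpr ⟨hinj, hcard⟩
  refine ⟨Equiv.ofBijective π hbij, fun s => ?_⟩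
  obtain ⟨a, ha⟩ := hA _ _ (hxe s)
  obtain ⟨a', ha'⟩ := hA' _ _ (hxe' s)
  have ha0 : a ≠ 0 := by
    rintro rfl
    rw [zero_smul, sub_zero] at ha
    exact hxl s ha
  have ha0' : a' ≠ 0 := by
    rintro rfl
    rw [zero_smul, sub_zero] at ha'
    exact hxl s (hmin' s _ (hxe s) ha')
  refine ⟨a, a', ha0, ha0', fun l => ?_⟩
  have hnotx : x s ∉ Vl s ⊔ Vl' (π s) := by
    intro hmem
    obtain ⟨y, hy, y', hy', hsum⟩ := Submodule.mem_sup.mp hmem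
    refine hxl s ?_
    have : y' ∈ Vl s := by
      refine hmin' s y' ?_ hy'
      have h1 : y' = x s - y := by rw [← hsum]; abel
      rw [h1]
      exact Submodule.sub_mem _ (hxe s) (hle s hy)
    rw [← hsum]
    exact Submodule.add_mem _ hy this
  have hja : j a ≠ 0 := (map_ne_zero j).mpr ha0
  have hja' : j a' ≠ 0 := (map_ne_zero j).mpr ha0'
  have e1 : D l (x s) - (τ l a * F s l / j a) • bext j (x s) ∈ spanK j (Vl s) := by
    have h1 := hD s (x s) a ha l
    have h2 := Submodule.smul_mem _ (τ l a * F s l / j a) (bext_mem_spanK (j := j).mpr ha)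
    convert Submodule.sub_mem _ h1 h2 using 1
    rw [bext_sub, bext_smul, smul_sub, smul_smul, div_mul_cancel₀ _ hja]
    abel
  have e2 : D l (x s) - (τ l a' * F' (π s) l / j a') • bext j (x s) ∈ spanK j (Vl' (π s)) := by
    have h1 := hD' (π s) (x s) a' ha' l
    have h2 := Submodule.smul_mem _ (τ l a' * F' (π s) l / j a') (bext_mem_spanK (j := j).mpr ha')
    convert Submodule.sub_mem _ h1 h2 using 1
    rw [bext_sub, bext_smul, smul_sub, smul_smul, div_mul_cancel₀ _ hja']
    abel
  have e3 : (τ l a * F s l / j a - τ l a' * F' (π s) l / j a') • bext j (x s) ∈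
      spanK j (Vl s ⊔ Vl' (π s)) := by
    have := Submodule.sub_mem _ (spanK_mono j le_sup_right e2) (spanK_mono j le_sup_left e1)
    convert this using 1
    rw [sub_smul]
    abel
  have e4 : τ l a * F s l / j a - τ l a' * F' (π s) l / j a' = 0 := by
    by_contra hne
    refine hnotx (bext_mem_spanK (j := j).mp ?_)
    have := Submodule.smul_mem _ (τ l a * F s l / j a - τ l a' * F' (π s) l / j a')⁻¹ e3
    rwa [smul_smul, inv_mul_cancel₀ hne, one_smul] at this
  rw [sub_eq_zero, div_eq_div_iff hja hja'] at e4
  exact e4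

end Triangular

end EllipticO
end

noncomputable section
namespace EllipticO

/-! ### Difference operators over a field with translations -/

/-- A field of functions of `λ` and of parameters, with the translations in `λ`. -/
structure Frame (N : ℕ) (K : Type) [Field K] where
  T : H N → K →+* K
  T_zero : ∀ f, T 0 f = f
  T_add : ∀ u v f, T (u + v) f = T u (T v f)
  j : MH N →+* K

/-- A substitution `z ↦ φ(z)` compatible with the translations in `λ`. -/
structure Frame.IsPoint {N : ℕ} {K : Type} [Field K] (F : Frame N K) (φ : MZ N →+* K) : Prop where
  ofH : ∀ f, φ (ofH N f) = F.j f
  shift : ∀ v f, φ (shift ((0, v) : ℂ × H N) f) = F.T v (φ f)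

/-- Functions of `(z, λ)`. -/
def frameZ (N : ℕ) : Frame N (MZ N) where
  T v := shift ((0, v) : ℂ × H N)
  T_zero f := shift_zero f
  T_add u v f := by
    rw [shift_shift]
    congr 2
    simp
  j := ofH N

/-- Functions of `(z, w, λ)`. -/
def frameZW (N : ℕ) : Frame N (MZW N) where
  T v := shift ((0, 0, v) : ℂ × ℂ × H N)
  T_zero f := shift_zero f
  T_add u v f := by
    rw [shift_shift]
    congr 2
    simp
  j := (atZ N).comp (ofH N)

theorem isPoint_id (N : ℕ) : (frameZ N).IsPoint (RingHom.id (MZ N)) :=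
  ⟨fun _ => rfl, fun _ _ => rfl⟩

theorem isPoint_shift (N : ℕ) (u : ℂ) : (frameZ N).IsPoint (shift ((u, 0) : ℂ × H N)) :=
  ⟨fun f => ofH_shift_fst u f, fun _ f => shift_comm _ _ f⟩

theorem isPoint_atZ (N : ℕ) : (frameZW N).IsPoint (atZ N) := ⟨fun _ => rfl, atZ_shift⟩

theorem isPoint_atW (N : ℕ) : (frameZW N).IsPoint (atW N) := ⟨fun f => atW_ofH f, atW_shift⟩

section SemilinearAction

variable {K : Type} [Field K] {B C : Type}

/-- The semilinear map with prescribed values on basis vectors. -/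
def sact (σ : K →+* K) (Φ : B → C →₀ K) (x : B →₀ K) : C →₀ K := x.sum fun b g => σ g • Φ b

variable (σ : K →+* K) (Φ : B → C →₀ K)

theorem sact_zero : sact σ Φ 0 = 0 := Finsupp.sum_zero_index

theorem sact_add (x y : B →₀ K) : sact σ Φ (x + y) = sact σ Φ x + sact σ Φ y :=
  Finsupp.sum_add_index' (fun b => by rw [map_zero, zero_smul])
    (fun b g h => by rw [map_add, add_smul])

theorem sact_single (b : B) (g : K) : sact σ Φ (Finsupp.single b g) = σ g • Φ b :=
  Finsupp.sum_single_index (by rw [map_zero, zero_smul])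

theorem sact_smul (a : K) (x : B →₀ K) : sact σ Φ (a • x) = σ a • sact σ Φ x := by
  induction x using Finsupp.induction_linear with
  | zero => rw [smul_zero, sact_zero, smul_zero]
  | add x y hx hy => rw [smul_add, sact_add, sact_add, hx, hy, smul_add]
  | single b g =>
    rw [Finsupp.smul_single, sact_single, sact_single, smul_eq_mul, map_mul, smul_smul]

end SemilinearAction

namespace PreMod

variable {N : ℕ} {K : Type} [Field K] (F : Frame N K) (ħ : ℂ) (X Y : PreMod N)

/-- The operator `L_{ij}(φ(z))` on vectors with coordinates in `K`. -/
def op (φ : MZ N →+* K) (i j : Fin N) (y : X.B →₀ K) : X.B →₀ K :=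
  sact (F.T (ħ • ε j)) (fun b => bext φ (X.L i j b)) y

variable {φ : MZ N →+* K} {i j : Fin N}

theorem op_zero : X.op F ħ φ i j 0 = 0 := sact_zero _ _

theorem op_add (x y : X.B →₀ K) : X.op F ħ φ i j (x + y) = X.op F ħ φ i j x + X.op F ħ φ i j y :=
  sact_add _ _ x y

theorem op_smul (a : K) (x : X.B →₀ K) :
    X.op F ħ φ i j (a • x) = F.T (ħ • ε j) a • X.op F ħ φ i j x :=
  sact_smul _ _ a x

theorem op_single (b : X.B) (a : K) :
    X.op F ħ φ i j (Finsupp.single b a) = F.T (ħ • ε j) a • bext φ (X.L i j b) :=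
  sact_single _ _ b a

theorem op_sum {α : Type} (s : Finset α) (x : α → X.B →₀ K) :
    X.op F ħ φ i j (∑ a ∈ s, x a) = ∑ a ∈ s, X.op F ħ φ i j (x a) :=
  map_sum (⟨⟨X.op F ħ φ i j, X.op_zero F ħ⟩, X.op_add F ħ⟩ : (X.B →₀ K) →+ (X.B →₀ K)) _ _

theorem actL_eq (u : ℂ) (x : X.B →₀ MZ N) :
    X.actL ħ i j u x = X.op (frameZ N) ħ (shift ((u, 0) : ℂ × H N)) i j x := rfl

theorem actL_zero_eq (x : X.B →₀ MZ N) :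
    X.actL ħ i j 0 x = X.op (frameZ N) ħ (RingHom.id (MZ N)) i j x := by
  have h : shift ((0, 0) : ℂ × H N) = RingHom.id (MZ N) :=
    RingHom.ext fun f => shift_zero (E := ℂ × H N) f
  rw [actL_eq, h]

/-- Substituting `φ` in `L_{ij}(z) y`. -/
theorem bext_op {F : Frame N K} (hφ : F.IsPoint φ) (y : X.B →₀ MZ N) :
    bext φ (X.op (frameZ N) ħ (RingHom.id (MZ N)) i j y) = X.op F ħ φ i j (bext φ y) := by
  induction y using Finsupp.induction_linear with
  | zero => simp only [op_zero, bext_zero]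
  | add x y hx hy => rw [op_add, bext_add, hx, hy, bext_add, op_add]
  | single b g =>
    rw [op_single, bext_smul, bext_single, op_single]
    rw [show bext (RingHom.id (MZ N)) (X.L i j b) = X.L i j b from Finsupp.ext fun _ => rfl]
    congr 1
    exact hφ.shift _ _

/-- The vector `y` is homogeneous of weight `μ`. -/
def HasWt {L : Type} [Zero L] (X : PreMod N) (y : X.B →₀ L) (μ : H N) : Prop :=
  ∀ b, y b ≠ 0 → X.wt b = μ

theorem mem_wtSpace_iff {x : X.V} {μ : H N} : x ∈ X.wtSpace μ ↔ X.HasWt x μ := by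
  rw [wtSpace, Finsupp.mem_supported']
  refine forall_congr' fun b => ?_
  rw [Set.mem_ofPred_eq]
  exact not_imp_comm

variable {X} in
theorem HasWt.smul {y : X.B →₀ K} {μ : H N} (h : X.HasWt y μ) (a : K) : X.HasWt (a • y) μ := by
  intro b hb
  refine h b fun h0 => hb ?_
  rw [Finsupp.smul_apply, h0, smul_zero]

variable {X} in
theorem HasWt.add {y z : X.B →₀ K} {μ : H N} (hy : X.HasWt y μ) (hz : X.HasWt z μ) :
    X.HasWt (y + z) μ := by
  intro b hb
  by_cases h : y b = 0
  · refine hz b fun h0 => hb ?_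
    rw [Finsupp.add_apply, h, h0, add_zero]
  · exact hy b h

theorem HasWt.zero {μ : H N} : X.HasWt (0 : X.B →₀ K) μ := fun _ h => absurd rfl h

variable {X} in
theorem HasWt.sum {α : Type} {s : Finset α} {y : α → X.B →₀ K} {μ : H N}
    (hy : ∀ a ∈ s, X.HasWt (y a) μ) : X.HasWt (∑ a ∈ s, y a) μ := by
  classical
  induction s using Finset.induction_on with
  | empty => rw [Finset.sum_empty]; exact HasWt.zero X
  | insert a s ha ih =>
    rw [Finset.sum_insert ha]
    exact (hy a (Finset.mem_insert_self _ _)).add (ih fun c hc => hy c (Finset.mem_insert_of_mem hc))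

variable {X} in
theorem HasWt.bext {k : Type} [Field k] (j : k →+* K) {x : X.B →₀ k} {μ : H N} (h : X.HasWt x μ) :
    X.HasWt (bext j x) μ := by
  intro b hb
  refine h b fun h0 => hb ?_
  rw [bext_apply, h0, map_zero]

theorem hasWt_single (b : X.B) (a : K) : X.HasWt (Finsupp.single b a) (X.wt b) := by
  classical
  intro c hc
  by_contra h
  exact hc (Finsupp.single_eq_of_ne fun hcb => h (by rw [hcb]))

theorem hasWt_sum_single {x : X.B →₀ K} {μ : H N} (h : X.HasWt x μ) (P : (X.B →₀ K) → Prop)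
    (hzero : P 0) (hadd : ∀ x y, P x → P y → P (x + y))
    (hsingle : ∀ (b : X.B) (a : K), X.wt b = μ → P (Finsupp.single b a)) : P x := by
  rw [← Finsupp.sum_single x, Finsupp.sum]
  refine Finset.sum_induction _ P hadd hzero fun b hb => hsingle b _ (h b ?_)
  exact Finsupp.mem_support_iff.mp hb

variable {X} in
theorem HasWt.op {y : X.B →₀ K} {μ : H N} (h : X.HasWt y μ) :
    X.HasWt (X.op F ħ φ i j y) (μ + ε j - ε i) := by
  refine X.hasWt_sum_single h (fun y => X.HasWt (X.op F ħ φ i j y) (μ + ε j - ε i)) ?_ ?_ ?_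
  · rw [op_zero]; exact HasWt.zero X
  · intro x y hx hy; rw [op_add]; exact hx.add hy
  · intro b a hb
    rw [op_single]
    refine HasWt.smul ?_ _
    intro c hc
    rw [← hb]
    refine X.L_wt i j b c fun h0 => hc ?_
    rw [bext_apply, h0, map_zero]

/-- The operator `μ_l(g)` for the weights `ω` of the basis vectors. -/
def muL {B : Type} (ω : B → H N) (g : K) (y : B →₀ K) : B →₀ K :=
  Finsupp.onFinset y.support (fun b => F.T (ħ • ω b) g * y b)
    (fun _ hb => Finsupp.mem_support_iff.mpr (right_ne_zero_of_mul hb))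

section MuL

variable {B : Type} (ω : B → H N)

theorem muL_apply (g : K) (y : B →₀ K) (b : B) : muL F ħ ω g y b = F.T (ħ • ω b) g * y b := rfl

theorem muL_add (g : K) (x y : B →₀ K) : muL F ħ ω g (x + y) = muL F ħ ω g x + muL F ħ ω g y := by
  ext b; simp only [muL_apply, Finsupp.add_apply, mul_add]

theorem muL_zero (g : K) : muL F ħ ω g (0 : B →₀ K) = 0 := by
  ext b; simp only [muL_apply, Finsupp.zero_apply, mul_zero]

theorem muL_zero_left (y : B →₀ K) : muL F ħ ω 0 y = 0 := by
  ext b; simp only [muL_apply, Finsupp.zero_apply, map_zero, zero_mul]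

theorem muL_smul (g a : K) (x : B →₀ K) : muL F ħ ω g (a • x) = a • muL F ħ ω g x := by
  ext b; simp only [muL_apply, Finsupp.smul_apply, smul_eq_mul]; ring

theorem muL_sum {α : Type} (g : K) (s : Finset α) (x : α → B →₀ K) :
    muL F ħ ω g (∑ a ∈ s, x a) = ∑ a ∈ s, muL F ħ ω g (x a) := by
  ext b; simp only [muL_apply, Finsupp.finsetSum_apply, Finset.mul_sum]

end MuL

variable {X} in
theorem HasWt.muL_eq {y : X.B →₀ K} {μ : H N} (h : X.HasWt y μ) (g : K) :
    muL F ħ X.wt g y = F.T (ħ • μ) g • y := by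
  ext b
  rw [muL_apply, Finsupp.smul_apply, smul_eq_mul]
  by_cases hb : y b = 0
  · rw [hb, mul_zero, mul_zero]
  · rw [h b hb]

/-- The RLL relation for the coefficients `R` and the parameters `φ₁`, `φ₂`, on all vectors. -/
def RLLAt (φ₁ φ₂ : MZ N →+* K) (R : Fin N → Fin N → Fin N → Fin N → K) (y : X.B →₀ K) : Prop :=
  ∀ i j m n : Fin N,
    ∑ p, ∑ q, muL F ħ X.wt (R m n p q) (X.op F ħ φ₁ p i (X.op F ħ φ₂ q j y)) =
      ∑ p, ∑ q, R p q i j • X.op F ħ φ₂ n q (X.op F ħ φ₁ m p y)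

/-- The matrix `R` preserves weights. -/
def IsWtZero {K : Type} [Zero K] (R : Fin N → Fin N → Fin N → Fin N → K) : Prop :=
  ∀ p q i j, R p q i j ≠ 0 → (p = i ∧ q = j) ∨ (p = j ∧ q = i)

variable {φ₁ φ₂ : MZ N →+* K} {R : Fin N → Fin N → Fin N → Fin N → K}

theorem RLLAt.add {x y : X.B →₀ K} (hx : X.RLLAt F ħ φ₁ φ₂ R x) (hy : X.RLLAt F ħ φ₁ φ₂ R y) :
    X.RLLAt F ħ φ₁ φ₂ R (x + y) := by
  intro i j m n
  simp only [op_add, muL_add, smul_add, Finset.sum_add_distrib]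
  rw [hx, hy]

theorem RLLAt.smul (hR : IsWtZero R) {x : X.B →₀ K} (hx : X.RLLAt F ħ φ₁ φ₂ R x) (a : K) :
    X.RLLAt F ħ φ₁ φ₂ R (a • x) := by
  intro i j m n
  have hcomm : ∀ u v : H N, F.T u (F.T v a) = F.T v (F.T u a) := fun u v => by
    rw [← F.T_add, ← F.T_add, add_comm]
  simp only [op_smul, muL_smul]
  simp only [← Finset.smul_sum]
  rw [hx i j m n, Finset.smul_sum]
  refine Finset.sum_congr rfl fun p _ => ?_
  rw [Finset.smul_sum]
  refine Finset.sum_congr rfl fun q _ => ?_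
  by_cases h : R p q i j = 0
  · rw [h, zero_smul, zero_smul, smul_zero]
  · rw [smul_comm]
    rcases hR p q i j h with ⟨rfl, rfl⟩ | ⟨rfl, rfl⟩
    · rw [hcomm]
    · rfl

theorem rllAt_of_basis (hR : IsWtZero R)
    (h : ∀ b, X.RLLAt F ħ φ₁ φ₂ R (Finsupp.single b 1)) (y : X.B →₀ K) :
    X.RLLAt F ħ φ₁ φ₂ R y := by
  induction y using Finsupp.induction_linear with
  | zero =>
    intro i j m n
    simp only [op_zero, muL_zero, smul_zero, Finset.sum_const_zero]
  | add x y hx hy => exact RLLAt.add F ħ X hx hy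
  | single b a =>
    have := RLLAt.smul F ħ X hR (h b) a
    rwa [Finsupp.smul_single, smul_eq_mul, mul_one] at this

/-! The R-matrix of the elliptic quantum group as a function of `(z, w, λ)`. -/

/-- `R_{pq}^{ij}(z - w; λ)`. -/
def RZW (N : ℕ) (τ ħ : ℂ) (p q i j : Fin N) : MZW N := atZsubW N (Rcoef τ ħ p q i j)

theorem isWtZero_RZW (τ ħ : ℂ) : IsWtZero (RZW N τ ħ) := by
  intro p q i j h
  by_contra hcon
  rw [not_or] at hcon
  refine h ?_
  unfold RZW Rcoef
  have h1 : ¬(p = i ∧ q = j) := hcon.1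
  have h2 : ¬(p = j ∧ q = i) := hcon.2
  split_ifs with h0
  · subst h0; exact absurd ‹_› h1
  · exact map_zero _
  · exact map_zero _

theorem rll_iff (τ : ℂ) : X.RLL τ ħ ↔
    ∀ y, X.RLLAt (frameZW N) ħ (atZ N) (atW N) (RZW N τ ħ) y := by
  have key : ∀ (i j m n : Fin N) (b c : X.B),
      ((∑ p, ∑ q, shift ((0, 0, ħ • X.wt c) : ℂ × ℂ × H N) (atZsubW N (Rcoef τ ħ m n p q)) *
        act ((0, 0, ħ • ε i) : ℂ × ℂ × H N) (fun a => mapVec (atZ N) (X.L p i a))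
          (mapVec (atW N) (X.L q j b)) c) =
      (∑ p, ∑ q, muL (frameZW N) ħ X.wt (RZW N τ ħ m n p q) (X.op (frameZW N) ħ (atZ N) p i
        (X.op (frameZW N) ħ (atW N) q j (Finsupp.single b 1)))) c) ∧
      ((∑ p, ∑ q, atZsubW N (Rcoef τ ħ p q i j) *
        act ((0, 0, ħ • ε q) : ℂ × ℂ × H N) (fun a => mapVec (atW N) (X.L n q a))
          (mapVec (atZ N) (X.L m p b)) c) =
      (∑ p, ∑ q, RZW N τ ħ p q i j • X.op (frameZW N) ħ (atW N) n q
        (X.op (frameZW N) ħ (atZ N) m p (Finsupp.single b 1))) c) := by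
    intro i j m n b c
    constructor
    · rw [Finsupp.finsetSum_apply]
      refine Finset.sum_congr rfl fun p _ => ?_
      rw [Finsupp.finsetSum_apply]
      refine Finset.sum_congr rfl fun q _ => ?_
      rw [muL_apply, op_single, map_one, one_smul]
      rfl
    · rw [Finsupp.finsetSum_apply]
      refine Finset.sum_congr rfl fun p _ => ?_
      rw [Finsupp.finsetSum_apply]
      refine Finset.sum_congr rfl fun q _ => ?_
      rw [Finsupp.smul_apply, op_single, map_one, one_smul]
      rfl
  constructor
  · intro h
    refine rllAt_of_basis _ ħ X (isWtZero_RZW τ ħ) fun b i j m n => ?_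
    ext c
    rw [← (key i j m n b c).1, ← (key i j m n b c).2]
    exact h i j m n b c
  · intro h i j m n b c
    rw [(key i j m n b c).1, (key i j m n b c).2, h _ i j m n]

/-! ### The dynamical tensor product of vectors -/

section Tens

variable {B C : Type} (ω : C → H N)

/-- The dynamical tensor product of two vectors. -/
def tens (x : B →₀ K) (y : C →₀ K) : B × C →₀ K :=
  x.sum fun b g => y.sum fun c h => Finsupp.single (b, c) (F.T (ħ • ω c) g * h)

theorem tens_apply (x : B →₀ K) (y : C →₀ K) (p : B × C) :
    tens F ħ ω x y p = F.T (ħ • ω p.2) (x p.1) * y p.2 := by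
  classical
  obtain ⟨b, c⟩ := p
  unfold tens
  rw [Finsupp.sum_apply, Finsupp.sum]
  by_cases hb : x b = 0
  · rw [hb, map_zero, zero_mul]
    refine Finset.sum_eq_zero fun b' hb' => ?_
    rw [Finsupp.sum_apply]
    refine Finset.sum_eq_zero fun c' _ => ?_
    beta_reduce
    rw [Finsupp.single_eq_of_ne]
    rintro h
    obtain ⟨rfl, rfl⟩ := Prod.mk.inj h
    exact (Finsupp.mem_support_iff.mp hb') hb
  rw [Finset.sum_eq_single b]
  · rw [Finsupp.sum_apply, Finsupp.sum]
    by_cases hc : y c = 0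
    · rw [hc, mul_zero]
      refine Finset.sum_eq_zero fun c' hc' => ?_
      rw [Finsupp.single_eq_of_ne]
      rintro h
      obtain ⟨-, rfl⟩ := Prod.mk.inj h
      exact (Finsupp.mem_support_iff.mp hc') hc
    rw [Finset.sum_eq_single c]
    · rw [Finsupp.single_eq_same]
    · intro c' _ hne
      rw [Finsupp.single_eq_of_ne]
      rintro h
      exact hne (Prod.mk.inj h).2.symm
    · intro h
      exact absurd (Finsupp.mem_support_iff.mpr hc) h
  · intro b' _ hne
    rw [Finsupp.sum_apply]
    refine Finset.sum_eq_zero fun c' _ => ?_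
    beta_reduce
    rw [Finsupp.single_eq_of_ne]
    rintro h
    exact hne (Prod.mk.inj h).1.symm
  · intro h
    exact absurd (Finsupp.mem_support_iff.mpr hb) h

theorem tens_add_left (x x' : B →₀ K) (y : C →₀ K) :
    tens F ħ ω (x + x') y = tens F ħ ω x y + tens F ħ ω x' y := by
  ext p; simp only [tens_apply, Finsupp.add_apply, map_add, add_mul]

theorem tens_add_right (x : B →₀ K) (y y' : C →₀ K) :
    tens F ħ ω x (y + y') = tens F ħ ω x y + tens F ħ ω x y' := by
  ext p; simp only [tens_apply, Finsupp.add_apply, mul_add]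

theorem tens_zero_left (y : C →₀ K) : tens F ħ ω (0 : B →₀ K) y = 0 := by
  ext p; simp only [tens_apply, Finsupp.zero_apply, map_zero, zero_mul]

theorem tens_zero_right (x : B →₀ K) : tens F ħ ω x (0 : C →₀ K) = 0 := by
  ext p; simp only [tens_apply, Finsupp.zero_apply, mul_zero]

theorem tens_sum_left {α : Type} (s : Finset α) (x : α → B →₀ K) (y : C →₀ K) :
    tens F ħ ω (∑ a ∈ s, x a) y = ∑ a ∈ s, tens F ħ ω (x a) y := by
  ext p; simp only [tens_apply, Finsupp.finsetSum_apply, map_sum, Finset.sum_mul]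

theorem tens_sum_right {α : Type} (s : Finset α) (x : B →₀ K) (y : α → C →₀ K) :
    tens F ħ ω x (∑ a ∈ s, y a) = ∑ a ∈ s, tens F ħ ω x (y a) := by
  ext p; simp only [tens_apply, Finsupp.finsetSum_apply, Finset.mul_sum]

theorem tens_smul_right (a : K) (x : B →₀ K) (y : C →₀ K) :
    tens F ħ ω x (a • y) = a • tens F ħ ω x y := by
  ext p; simp only [tens_apply, Finsupp.smul_apply, smul_eq_mul]; ring

theorem tens_smul_left (a : K) (x : B →₀ K) (y : C →₀ K) :
    tens F ħ ω (a • x) y = tens F ħ ω x (muL F ħ ω a y) := by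
  ext p; simp only [tens_apply, Finsupp.smul_apply, smul_eq_mul, muL_apply, map_mul]; ring

theorem tens_single (b : B) (c : C) (g h : K) :
    tens F ħ ω (Finsupp.single b g) (Finsupp.single c h) =
      Finsupp.single (b, c) (F.T (ħ • ω c) g * h) := by
  unfold tens
  rw [Finsupp.sum_single_index, Finsupp.sum_single_index]
  · rw [mul_zero, Finsupp.single_zero]
  · simp

theorem bext_tens {F : Frame N K} {φ : MZ N →+* K} (hφ : F.IsPoint φ) (x : B →₀ MZ N)
    (y : C →₀ MZ N) :
    bext φ (tens (frameZ N) ħ ω x y) = tens F ħ ω (bext φ x) (bext φ y) := by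
  ext p
  rw [bext_apply, tens_apply, tens_apply, map_mul]
  congr 1
  exact hφ.shift _ _

end Tens

/-- The dynamical tensor product of vectors of `X` and `Y`. -/
def tensv (x : X.B →₀ K) (y : Y.B →₀ K) : (tensor ħ X Y).B →₀ K := tens F ħ Y.wt x y

/-- The basis vector `b ⊗ c`. -/
def tpair {X Y : PreMod N} (b : X.B) (c : Y.B) : (tensor ħ X Y).B := (b, c)

theorem tpair_cases {X Y : PreMod N} (p : (tensor ħ X Y).B) : ∃ b c, p = tpair ħ b c :=
  ⟨p.1, p.2, rfl⟩

theorem wt_tpair (b : X.B) (c : Y.B) : (tensor ħ X Y).wt (tpair ħ b c) = X.wt b + Y.wt c := rfl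

section TensV

variable (x x' : X.B →₀ K) (y y' : Y.B →₀ K)

theorem tensv_apply (b : X.B) (c : Y.B) :
    tensv F ħ X Y x y (tpair ħ b c) = F.T (ħ • Y.wt c) (x b) * y c :=
  tens_apply F ħ Y.wt x y (b, c)

theorem tensv_add_left : tensv F ħ X Y (x + x') y = tensv F ħ X Y x y + tensv F ħ X Y x' y :=
  tens_add_left F ħ Y.wt x x' y

theorem tensv_add_right : tensv F ħ X Y x (y + y') = tensv F ħ X Y x y + tensv F ħ X Y x y' :=
  tens_add_right F ħ Y.wt x y y'

theorem tensv_zero_left : tensv F ħ X Y 0 y = 0 := tens_zero_left F ħ Y.wt y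

theorem tensv_zero_right : tensv F ħ X Y x 0 = 0 := tens_zero_right F ħ Y.wt x

theorem tensv_sum_left {α : Type} (s : Finset α) (x : α → X.B →₀ K) :
    tensv F ħ X Y (∑ a ∈ s, x a) y = ∑ a ∈ s, tensv F ħ X Y (x a) y :=
  tens_sum_left F ħ Y.wt s x y

theorem tensv_sum_right {α : Type} (s : Finset α) (y : α → Y.B →₀ K) :
    tensv F ħ X Y x (∑ a ∈ s, y a) = ∑ a ∈ s, tensv F ħ X Y x (y a) :=
  tens_sum_right F ħ Y.wt s x y

theorem tensv_smul_right (a : K) : tensv F ħ X Y x (a • y) = a • tensv F ħ X Y x y :=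
  tens_smul_right F ħ Y.wt a x y

theorem tensv_smul_left (a : K) :
    tensv F ħ X Y (a • x) y = tensv F ħ X Y x (muL F ħ Y.wt a y) :=
  tens_smul_left F ħ Y.wt a x y

theorem tensv_single (b : X.B) (c : Y.B) (g h : K) :
    tensv F ħ X Y (Finsupp.single b g) (Finsupp.single c h) =
      Finsupp.single (tpair ħ b c) (F.T (ħ • Y.wt c) g * h) :=
  tens_single F ħ Y.wt b c g h

theorem bext_tensv {F : Frame N K} {φ : MZ N →+* K} (hφ : F.IsPoint φ) (x : X.B →₀ MZ N)
    (y : Y.B →₀ MZ N) :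
    bext φ (tensv (frameZ N) ħ X Y x y) = tensv F ħ X Y (bext φ x) (bext φ y) :=
  bext_tens ħ Y.wt hφ x y

end TensV

theorem tensor_L (b : X.B) (c : Y.B) :
    (tensor ħ X Y).L i j (tpair ħ b c) =
      ∑ k, tensv (frameZ N) ħ X Y (X.L i k b) (Y.L k j c) := rfl

theorem op_tens {F : Frame N K} (hφ : F.IsPoint φ) (x : X.B →₀ K) (y : Y.B →₀ K) :
    (tensor ħ X Y).op F ħ φ i j (tensv F ħ X Y x y) =
      ∑ k, tensv F ħ X Y (X.op F ħ φ i k x) (Y.op F ħ φ k j y) := by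
  induction x using Finsupp.induction_linear with
  | zero =>
    rw [tensv_zero_left, op_zero]
    simp only [op_zero, tensv_zero_left, Finset.sum_const_zero]
  | add x x' hx hx' =>
    rw [tensv_add_left, op_add, hx, hx', ← Finset.sum_add_distrib]
    simp only [op_add, tensv_add_left]
  | single b g =>
    induction y using Finsupp.induction_linear with
    | zero =>
      rw [tensv_zero_right, op_zero]
      simp only [op_zero, tensv_zero_right, Finset.sum_const_zero]
    | add y y' hy hy' =>
      rw [tensv_add_right, op_add, hy, hy', ← Finset.sum_add_distrib]
      simp only [op_add, tensv_add_right]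
    | single c h =>
      rw [tensv_single, op_single, tensor_L, bext_sum, Finset.smul_sum]
      refine Finset.sum_congr rfl fun k _ => ?_
      rw [bext_tensv ħ X Y hφ, op_single, op_single]
      refine Finsupp.ext fun p => ?_
      obtain ⟨b', c', rfl⟩ := tpair_cases ħ p
      rw [Finsupp.smul_apply, tensv_apply, tensv_apply]
      simp only [Finsupp.smul_apply, smul_eq_mul, bext_apply]
      by_cases hc : Y.L k j c c' = 0
      · simp only [hc, map_zero, mul_zero]
      · have hw := Y.L_wt k j c c' hc
        rw [map_mul, map_mul, ← F.T_add, ← F.T_add, hw]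
        have : ħ • (Y.wt c + ε j - ε k) + ħ • ε k = ħ • ε j + ħ • Y.wt c := by module
        rw [this]
        ring

theorem muL_tens (g : K) (x : X.B →₀ K) (y : Y.B →₀ K) :
    muL F ħ (tensor ħ X Y).wt g (tensv F ħ X Y x y) = tensv F ħ X Y (muL F ħ X.wt g x) y := by
  refine Finsupp.ext fun p => ?_
  obtain ⟨b, c, rfl⟩ := tpair_cases ħ p
  rw [muL_apply, tensv_apply, tensv_apply, muL_apply, map_mul, ← F.T_add]
  have : ħ • (tensor ħ X Y).wt (tpair ħ b c) = ħ • Y.wt c + ħ • X.wt b := by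
    rw [wt_tpair, smul_add, add_comm]
  rw [this]
  ring

theorem sum_comm_two {M : Type} [AddCommMonoid M] (f : Fin N → Fin N → Fin N → Fin N → M) :
    ∑ p, ∑ q, ∑ k, ∑ l, f p q k l = ∑ k, ∑ l, ∑ p, ∑ q, f p q k l := by
  calc _ = ∑ p, ∑ k, ∑ l, ∑ q, f p q k l := by
        refine Finset.sum_congr rfl fun p _ => ?_
        rw [Finset.sum_comm]
        exact Finset.sum_congr rfl fun k _ => Finset.sum_comm
    _ = _ := by
        rw [Finset.sum_comm]
        exact Finset.sum_congr rfl fun k _ => Finset.sum_comm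

theorem rllAt_tens {F : Frame N K} (h₁ : F.IsPoint φ₁) (h₂ : F.IsPoint φ₂)
    {x : X.B →₀ K} {y : Y.B →₀ K} (hx : X.RLLAt F ħ φ₁ φ₂ R x) (hy : Y.RLLAt F ħ φ₁ φ₂ R y) :
    (tensor ħ X Y).RLLAt F ħ φ₁ φ₂ R (tensv F ħ X Y x y) := by
  intro i j m n
  have hL : ∀ p q, muL F ħ (tensor ħ X Y).wt (R m n p q) ((tensor ħ X Y).op F ħ φ₁ p i
      ((tensor ħ X Y).op F ħ φ₂ q j (tensv F ħ X Y x y))) =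
      ∑ k, ∑ l, tensv F ħ X Y (muL F ħ X.wt (R m n p q) (X.op F ħ φ₁ p k (X.op F ħ φ₂ q l x)))
        (Y.op F ħ φ₁ k i (Y.op F ħ φ₂ l j y)) := by
    intro p q
    rw [op_tens ħ X Y h₂, op_sum, muL_sum, Finset.sum_comm]
    refine Finset.sum_congr rfl fun l _ => ?_
    rw [op_tens ħ X Y h₁, muL_sum]
    exact Finset.sum_congr rfl fun k _ => muL_tens F ħ X Y _ _ _
  have hRr : ∀ k l, (tensor ħ X Y).op F ħ φ₂ n l ((tensor ħ X Y).op F ħ φ₁ m k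
      (tensv F ħ X Y x y)) = ∑ p, ∑ q, tensv F ħ X Y (X.op F ħ φ₂ n q (X.op F ħ φ₁ m p x))
        (Y.op F ħ φ₂ q l (Y.op F ħ φ₁ p k y)) := by
    intro k l
    rw [op_tens ħ X Y h₁, op_sum]
    refine Finset.sum_congr rfl fun p _ => ?_
    rw [op_tens ħ X Y h₂]
  calc _ = ∑ p, ∑ q, ∑ k, ∑ l, tensv F ħ X Y
        (muL F ħ X.wt (R m n p q) (X.op F ħ φ₁ p k (X.op F ħ φ₂ q l x)))
        (Y.op F ħ φ₁ k i (Y.op F ħ φ₂ l j y)) := by simp only [hL]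
    _ = ∑ k, ∑ l, tensv F ħ X Y (∑ p, ∑ q, R p q k l • X.op F ħ φ₂ n q (X.op F ħ φ₁ m p x))
        (Y.op F ħ φ₁ k i (Y.op F ħ φ₂ l j y)) := by
      simp only [← hx _ _ m n, tensv_sum_left]
      exact sum_comm_two _
    _ = ∑ p, ∑ q, tensv F ħ X Y (X.op F ħ φ₂ n q (X.op F ħ φ₁ m p x))
        (∑ k, ∑ l, muL F ħ Y.wt (R p q k l) (Y.op F ħ φ₁ k i (Y.op F ħ φ₂ l j y))) := by
      simp only [tensv_sum_left, tensv_sum_right, tensv_smul_left]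
      exact sum_comm_two _
    _ = _ := by
      simp only [hy i j, hRr, tensv_sum_right, tensv_smul_right, Finset.smul_sum]
      exact sum_comm_two _

theorem rll_tensor (τ : ℂ) (hX : X.RLL τ ħ) (hY : Y.RLL τ ħ) : (tensor ħ X Y).RLL τ ħ := by
  rw [rll_iff] at hX hY ⊢
  refine rllAt_of_basis _ ħ _ (isWtZero_RZW τ ħ) ?_
  intro p
  obtain ⟨b, c, rfl⟩ := tpair_cases ħ p
  have h := rllAt_tens ħ X Y (isPoint_atZ N) (isPoint_atW N) (hX (Finsupp.single b 1))
    (hY (Finsupp.single c 1))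
  rwa [tensv_single, map_one, one_mul] at h

end PreMod

end EllipticO
end

noncomputable section
namespace EllipticO

/-! ### The exchange relation -/

section Exchange

variable {N : ℕ}

theorem ε_apply (i t : Fin N) : (ε i : H N).1 t = (if t = i then 1 else 0) - 1 / N := rfl

theorem ldiff_ε {m n : Fin N} (h : m ≠ n) (c : ℂ) : ldiff m n (c • ε m) = c := by
  have : ∀ t, (c • (ε m : H N)).1 t = c * ((if t = m then 1 else 0) - 1 / N) := fun t => rfl
  rw [ldiff, this, this, if_pos rfl, if_neg h.symm]
  ring

theorem thL_ne_zero {τ : ℂ} (hτ : 0 < τ.im) {m n : Fin N} (h : m ≠ n) (c : ℂ) :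
    thL τ m n c ≠ 0 := by
  obtain ⟨z, hz⟩ := exists_theta_ne_zero hτ
  refine ofEnt_ne_zero (x := ((0, (z - c) • ε m) : ℂ × H N)) ?_
  beta_reduce
  rw [ldiff_ε h, sub_add_cancel]
  exact hz

theorem thConst_eq (τ c : ℂ) : thConst N τ c = ofEnt (fun _ : ℂ × H N => theta τ c)
    (differentiable_const _) := algebraMap_complex _

section RestrictsShift

variable {E F : Type} [NormedAddCommGroup E] [NormedSpace ℂ E]
  [NormedAddCommGroup F] [NormedSpace ℂ F]

theorem Restricts.shift {ι : E → F} {hι : Differentiable ℂ ι} {f : Mer F} {g : Mer E}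
    (h : Restricts ι hι f g) {u : E} {v : F} (huv : ∀ x, ι (x + u) = ι x + v) :
    Restricts ι hι (EllipticO.shift v f) (EllipticO.shift u g) := by
  obtain ⟨a, b, hb, hf, hg⟩ := h
  have hcomp : ∀ t : Ent F, entComp ι hι (entComp (fun x => x + v) (by fun_prop) t) =
      entComp (fun x => x + u) (by fun_prop) (entComp ι hι t) := by
    intro t
    refine Subtype.ext (funext fun x => ?_)
    exact congrArg t.1 (huv x).symm
  have hsE : ∀ t : Ent E, EllipticO.shift u (algebraMap (Ent E) (Mer E) t) =
      algebraMap (Ent E) (Mer E) (entComp (fun x => x + u) (by fun_prop) t) :=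
    fun t => pull_algebraMap _ _ _ t
  have hsF : ∀ t : Ent F, EllipticO.shift v (algebraMap (Ent F) (Mer F) t) =
      algebraMap (Ent F) (Mer F) (entComp (fun x => x + v) (by fun_prop) t) :=
    fun t => pull_algebraMap _ _ _ t
  refine ⟨entComp (fun x => x + v) (by fun_prop) a, entComp (fun x => x + v) (by fun_prop) b,
    ?_, ?_, ?_⟩
  · rw [hcomp]
    intro h0
    exact hb (entComp_injective (fun x => x + u) (by fun_prop) (surjective_add_vec u)
      (h0.trans (map_zero _).symm))
  · rw [← hsF, ← hsF, ← map_mul, hf]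
  · rw [hcomp, hcomp, ← hsE, ← hsE, ← map_mul, hg]

theorem Restricts.of_eq {ι : E → F} {hι : Differentiable ℂ ι} {f : F → ℂ}
    {hf : Differentiable ℂ f} {g : E → ℂ} {hg : Differentiable ℂ g} (h : ∀ x, f (ι x) = g x) :
    Restricts ι hι (ofEnt f hf) (ofEnt g hg) := by
  obtain rfl : (fun x => f (ι x)) = g := funext h
  exact Restricts.of_ent _

end RestrictsShift

/-- The map `(z, λ) ↦ (z, z + ħ, λ)`. -/
def diagShift (N : ℕ) (ħ : ℂ) (x : ℂ × H N) : ℂ × ℂ × H N := (x.1, x.1 + ħ, x.2)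

theorem differentiable_diagShift (ħ : ℂ) : Differentiable ℂ (diagShift N ħ) := by
  unfold diagShift; fun_prop

/-- Restriction to `w = z + ħ`. -/
def RestrD (N : ℕ) (ħ : ℂ) : MZW N → MZ N → Prop :=
  Restricts (diagShift N ħ) (differentiable_diagShift ħ)

theorem restrD_atZ (ħ : ℂ) (f : MZ N) : RestrD N ħ (atZ N f) f := by
  have h := Restricts.pull (ι := diagShift N ħ) (hι := differentiable_diagShift ħ)
    (fun x : ℂ × ℂ × H N => (x.1, x.2.2)) (by fun_prop)
    (fun y => ⟨(y.1, 0, y.2), rfl⟩) (fun x => x) differentiable_id Function.surjective_id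
    (fun _ => rfl) f
  rwa [pull_id] at h

theorem restrD_atW (ħ : ℂ) (f : MZ N) : RestrD N ħ (atW N f) (shift ((ħ, 0) : ℂ × H N) f) :=
  Restricts.pull (ι := diagShift N ħ) (hι := differentiable_diagShift ħ)
    (fun x : ℂ × ℂ × H N => (x.2.1, x.2.2)) (by fun_prop)
    (fun y => ⟨(0, y.1, y.2), rfl⟩) (fun x => x + ((ħ, 0) : ℂ × H N)) (by fun_prop)
    (surjective_add_vec _) (fun x => by ext1 <;> simp [diagShift]) f

/-- The function `θ(ħ)θ(λ_{mn} - ħ)/θ(λ_{mn})`. -/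
def exCoef (τ ħ : ℂ) (m n : Fin N) : MZ N := thConst N τ ħ * thL τ m n (-ħ) * (thL τ m n 0)⁻¹

/-- The residue of the R-matrix at `z = -ħ`, up to a factor. -/
def exRes (τ ħ : ℂ) (p q i j : Fin N) : MZ N :=
  (if p = j ∧ q = i then exCoef τ ħ j i else 0) - (if p = i ∧ q = j then exCoef τ ħ i j else 0)

theorem exCoef_ne_zero {τ ħ : ℂ} (hτ : 0 < τ.im) (hħ : theta τ ħ ≠ 0) {m n : Fin N} (h : m ≠ n) :
    exCoef τ ħ m n ≠ 0 := by
  refine mul_ne_zero (mul_ne_zero ?_ (thL_ne_zero hτ h _)) (inv_ne_zero (thL_ne_zero hτ h _))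
  rw [thConst_eq]
  exact ofEnt_ne_zero (x := 0) hħ

theorem atZsubW_ofEnt (f : ℂ × H N → ℂ) (hf : Differentiable ℂ f) : atZsubW N (ofEnt f hf) =
    ofEnt (fun x : ℂ × ℂ × H N => f (x.1 - x.2.1, x.2.2)) (hf.comp (by fun_prop)) :=
  pull_ofEnt _ _ _ _ _

theorem restrD_atZsubW (ħ : ℂ) {f : ℂ × H N → ℂ} {hf : Differentiable ℂ f} {g : ℂ × H N → ℂ}
    {hg : Differentiable ℂ g} (h : ∀ x, f (-ħ, x.2) = g x) :
    RestrD N ħ (atZsubW N (ofEnt f hf)) (ofEnt g hg) := by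
  rw [atZsubW_ofEnt]
  refine Restricts.of_eq fun x => ?_
  rw [← h]
  simp [diagShift]

theorem restrD_thL (τ ħ : ℂ) (m n : Fin N) (c : ℂ) :
    RestrD N ħ (atZsubW N (thL τ m n c)) (thL τ m n c) := restrD_atZsubW ħ fun _ => rfl

theorem restrD_thConst (τ ħ c : ℂ) : RestrD N ħ (atZsubW N (thConst N τ c)) (thConst N τ c) := by
  rw [thConst_eq]
  exact restrD_atZsubW ħ fun _ => rfl

theorem restrD_thZ_zero (τ ħ : ℂ) : RestrD N ħ (atZsubW N (thZ N τ 0)) (-thConst N τ ħ) := by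
  have h : -thConst N τ ħ = ofEnt (fun _ : ℂ × H N => theta τ (-ħ)) (differentiable_const _) := by
    rw [theta_neg, thConst_eq, ofEnt, ofEnt, ← map_neg]
    rfl
  rw [h]
  exact restrD_atZsubW ħ fun x => by simp

theorem restrD_thZ (τ ħ : ℂ) : RestrD N ħ (atZsubW N (thZ N τ ħ)) 0 := by
  have h : (0 : MZ N) = ofEnt (fun _ : ℂ × H N => 0) (differentiable_const _) :=
    (map_zero (algebraMap (Ent (ℂ × H N)) (MZ N))).symm
  rw [h]
  exact restrD_atZsubW ħ fun x => by simp [theta_zero]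

theorem restrD_thZL (τ ħ : ℂ) (i j : Fin N) :
    RestrD N ħ (atZsubW N (thZL τ i j)) (thL τ i j (-ħ)) :=
  restrD_atZsubW ħ fun x => by simp [add_comm]

theorem thZ_ne_zero {τ : ℂ} (hτ : 0 < τ.im) (c : ℂ) : thZ N τ c ≠ 0 := by
  obtain ⟨z, hz⟩ := exists_theta_ne_zero hτ
  refine ofEnt_ne_zero (x := ((z - c, 0) : ℂ × H N)) ?_
  simpa using hz

theorem restrD_R {τ : ℂ} (hτ : 0 < τ.im) (ħ : ℂ) (p q i j : Fin N) :
    RestrD N ħ (atZsubW N (thZ N τ ħ) * PreMod.RZW N τ ħ p q i j) (exRes τ ħ p q i j) := by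
  have hD : atZsubW N (thZ N τ ħ) ≠ 0 := fun h =>
    thZ_ne_zero (N := N) hτ ħ ((atZsubW N).injective (h.trans (map_zero _).symm))
  unfold PreMod.RZW Rcoef
  by_cases hij : i = j
  · subst hij
    have : exRes τ ħ p q i i = 0 := sub_self _
    rw [if_pos rfl, this]
    split_ifs
    · rw [map_one, mul_one]; exact restrD_thZ τ ħ
    · rw [map_zero, mul_zero]; exact Restricts.zero
  rw [if_neg hij]
  by_cases h1 : p = i ∧ q = j
  · obtain ⟨rfl, rfl⟩ := h1
    have h2 : ¬(p = q ∧ q = p) := fun h => hij h.1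
    rw [if_pos ⟨rfl, rfl⟩, exRes, if_neg h2, if_pos ⟨rfl, rfl⟩]
    have e : atZsubW N (thZ N τ ħ) * atZsubW N (thZ N τ 0 * thL τ p q (-ħ) /
        (thZ N τ ħ * thL τ p q 0)) = atZsubW N (thZ N τ 0) * atZsubW N (thL τ p q (-ħ)) *
          (atZsubW N (thL τ p q 0))⁻¹ := by
      rw [map_div₀, map_mul, map_mul]
      field_simp
    have e' : 0 - exCoef τ ħ p q = -thConst N τ ħ * thL τ p q (-ħ) * (thL τ p q 0)⁻¹ := by
      rw [exCoef]; ring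
    rw [e, e']
    exact ((restrD_thZ_zero τ ħ).mul (restrD_thL τ ħ _ _ _)).mul
      ((restrD_thL τ ħ _ _ _).inv (thL_ne_zero hτ hij _))
  · rw [if_neg h1]
    by_cases h2 : p = j ∧ q = i
    · obtain ⟨rfl, rfl⟩ := h2
      rw [if_pos ⟨rfl, rfl⟩, exRes, if_neg h1, if_pos ⟨rfl, rfl⟩]
      have e : atZsubW N (thZ N τ ħ) * atZsubW N (thZL τ p q * thConst N τ ħ /
          (thZ N τ ħ * thL τ p q 0)) = atZsubW N (thConst N τ ħ) * atZsubW N (thZL τ p q) *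
            (atZsubW N (thL τ p q 0))⁻¹ := by
        rw [map_div₀, map_mul, map_mul]
        field_simp
      rw [e, sub_zero]
      exact ((restrD_thConst τ ħ ħ).mul (restrD_thZL τ ħ _ _)).mul
        ((restrD_thL τ ħ _ _ _).inv (thL_ne_zero hτ (Ne.symm hij) _))
    · rw [if_neg h2, exRes, if_neg h1, if_neg h2, map_zero, mul_zero, sub_zero]
      exact Restricts.zero

end Exchange

namespace PreMod

variable {N : ℕ} {K : Type} [Field K] (F : Frame N K) (ħ : ℂ) (X Y : PreMod N)

theorem bext_op_comp {F : Frame N K} {φ : MZ N →+* K} (hφ : F.IsPoint φ) (ψ : MZ N →+* MZ N)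
    {i j : Fin N} (y : X.B →₀ MZ N) :
    bext φ (X.op (frameZ N) ħ ψ i j y) = X.op F ħ (φ.comp ψ) i j (bext φ y) := by
  induction y using Finsupp.induction_linear with
  | zero => simp only [op_zero, bext_zero]
  | add x y hx hy => rw [op_add, bext_add, hx, hy, bext_add, op_add]
  | single b g =>
    rw [op_single, bext_smul, bext_single, op_single]
    rw [show bext φ (bext ψ (X.L i j b)) = bext (φ.comp ψ) (X.L i j b) from Finsupp.ext fun _ => rfl]
    congr 1
    exact hφ.shift _ _

theorem op_bext_apply {F : Frame N K} {φ ψ : MZ N →+* K} (hψ : F.IsPoint ψ) {i j : Fin N}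
    (x : X.B →₀ MZ N) (c : X.B) : X.op F ħ φ i j (bext ψ x) c =
      ∑ b ∈ x.support, ψ (shift ((0, ħ • ε j) : ℂ × H N) (x b)) * φ (X.L i j b c) := by
  conv_lhs => rw [← Finsupp.sum_single x, Finsupp.sum, bext_sum, op_sum, Finsupp.finsetSum_apply]
  refine Finset.sum_congr rfl fun b _ => ?_
  rw [bext_single, op_single, Finsupp.smul_apply, bext_apply, smul_eq_mul, hψ.shift]

/-- The operator `L_{mi}(z) L_{nj}(z + ħ)`. -/
def pairOp (m i n j : Fin N) (y : X.B →₀ MZ N) : X.B →₀ MZ N :=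
  X.op (frameZ N) ħ (RingHom.id (MZ N)) m i (X.op (frameZ N) ħ (shift ((ħ, 0) : ℂ × H N)) n j y)

theorem exchange_basis {τ : ℂ} (hτ : 0 < τ.im) (hħ : theta τ ħ ≠ 0) (hX : X.RLL τ ħ)
    (m n i j : Fin N) (b : X.B) :
    X.pairOp ħ m i n j (Finsupp.single b 1) - X.pairOp ħ n i m j (Finsupp.single b 1) =
      -(X.pairOp ħ m j n i (Finsupp.single b 1) - X.pairOp ħ n j m i (Finsupp.single b 1)) := by
  by_cases hmn : m = n
  · subst hmn; simp
  have hop : ∀ (φ : MZ N →+* MZW N) i j, X.op (frameZW N) ħ φ i j (Finsupp.single b 1) =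
      bext φ (X.L i j b) := fun φ i j => by rw [op_single, map_one, one_smul]
  have hop' : ∀ (φ : MZ N →+* MZ N) i j, X.op (frameZ N) ħ φ i j (Finsupp.single b 1) =
      bext φ (X.L i j b) := fun φ i j => by rw [op_single, map_one, one_smul]
  refine Finsupp.ext fun c => ?_
  set P : Fin N → Fin N → Fin N → Fin N → MZ N := fun m i n j =>
    X.pairOp ħ m i n j (Finsupp.single b 1) c with hP
  set P' : Fin N → Fin N → Fin N → Fin N → MZ N := fun n q m p =>
    X.op (frameZ N) ħ (shift ((ħ, 0) : ℂ × H N)) n q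
      (X.op (frameZ N) ħ (RingHom.id (MZ N)) m p (Finsupp.single b 1)) c with hP'
  have hr : ∀ p i q j, RestrD N ħ (X.op (frameZW N) ħ (atZ N) p i
      (X.op (frameZW N) ħ (atW N) q j (Finsupp.single b 1)) c) (P p i q j) := by
    intro p i q j
    simp only [hP, pairOp]
    rw [hop, hop', op_bext_apply _ _ (isPoint_atW N), op_bext_apply _ _ (isPoint_shift N ħ)]
    exact Restricts.sum _ fun b' _ => (restrD_atW ħ _).mul (restrD_atZ ħ _)
  have hr' : ∀ p i q j, RestrD N ħ (X.op (frameZW N) ħ (atW N) p i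
      (X.op (frameZW N) ħ (atZ N) q j (Finsupp.single b 1)) c) (P' p i q j) := by
    intro p i q j
    simp only [hP']
    rw [hop, hop', op_bext_apply _ _ (isPoint_atZ N), op_bext_apply _ _ (isPoint_id N)]
    exact Restricts.sum _ fun b' _ => (restrD_atZ ħ _).mul (restrD_atW ħ _)
  have hDinv : ∀ v : H N, shift ((0, 0, v) : ℂ × ℂ × H N) (atZsubW N (thZ N τ ħ)) =
      atZsubW N (thZ N τ ħ) := by
    intro v
    rw [← atZsubW_shift]
    congr 1
    exact (pull_ofEnt _ _ _ _ _).trans (ofEnt_congr (fun x => by simp) _ _)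
  have key : ∀ i j, ∑ p, ∑ q, shift ((0, ħ • X.wt c) : ℂ × H N) (exRes τ ħ m n p q) * P p i q j =
      ∑ p, ∑ q, exRes τ ħ p q i j * P' n q m p := by
    intro i j
    have h := DFunLike.congr_fun ((rll_iff ħ X τ).mp hX (Finsupp.single b 1) i j m n) c
    simp only [Finsupp.finsetSum_apply, muL_apply, Finsupp.smul_apply, smul_eq_mul] at h
    have h2 := congrArg (fun t => atZsubW N (thZ N τ ħ) * t) h
    simp only [Finset.mul_sum, ← mul_assoc] at h2
    refine Restricts.unique (ι := diagShift N ħ) (hι := differentiable_diagShift ħ) ?_ ?_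
      (f := ∑ p, ∑ q, atZsubW N (thZ N τ ħ) * (frameZW N).T (ħ • X.wt c) (RZW N τ ħ m n p q) *
        X.op (frameZW N) ħ (atZ N) p i (X.op (frameZW N) ħ (atW N) q j (Finsupp.single b 1)) c)
    · refine Restricts.sum _ fun p _ => Restricts.sum _ fun q _ => Restricts.mul ?_ (hr p i q j)
      have e : atZsubW N (thZ N τ ħ) * (frameZW N).T (ħ • X.wt c) (RZW N τ ħ m n p q) =
          shift ((0, 0, ħ • X.wt c) : ℂ × ℂ × H N)
            (atZsubW N (thZ N τ ħ) * RZW N τ ħ m n p q) := by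
        rw [map_mul, hDinv]
        rfl
      rw [e]
      refine (restrD_R hτ ħ m n p q).shift fun x => ?_
      ext1 <;> simp [diagShift]
    · rw [h2]
      exact Restricts.sum _ fun p _ => Restricts.sum _ fun q _ =>
        (restrD_R hτ ħ p q i j).mul (hr' n q m p)
  have hR : ∀ i j, ∑ p, ∑ q, exRes τ ħ p q i j * P' n q m p =
      exCoef τ ħ j i * P' n i m j - exCoef τ ħ i j * P' n j m i := by
    intro i j
    simp only [exRes, sub_mul, Finset.sum_sub_distrib, ite_and, ite_mul, zero_mul]
    simp only [Finset.sum_ite_eq', Finset.mem_univ, if_true, Finset.sum_ite_irrel,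
      Finset.sum_const_zero]
  have hLs : ∀ i j, ∑ p, ∑ q, shift ((0, ħ • X.wt c) : ℂ × H N) (exRes τ ħ m n p q) * P p i q j =
      shift ((0, ħ • X.wt c) : ℂ × H N) (exCoef τ ħ m n) * (P n i m j - P m i n j) := by
    intro i j
    have e : ∀ p q, shift ((0, ħ • X.wt c) : ℂ × H N) (exRes τ ħ m n p q) =
        (if p = n then if q = m then shift ((0, ħ • X.wt c) : ℂ × H N) (exCoef τ ħ m n) else 0
          else 0) -
        (if p = m then if q = n then shift ((0, ħ • X.wt c) : ℂ × H N) (exCoef τ ħ m n) else 0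
          else 0) := by
      intro p q
      rw [exRes, map_sub]
      congr 1
      · by_cases h : m = q ∧ n = p
        · obtain ⟨rfl, rfl⟩ := h; simp
        · rw [if_neg h, map_zero]
          split_ifs with h1 h2
          · exact absurd ⟨h2.symm, h1.symm⟩ h
          · rfl
          · rfl
      · by_cases h : m = p ∧ n = q
        · obtain ⟨rfl, rfl⟩ := h; simp
        · rw [if_neg h, map_zero]
          split_ifs with h1 h2
          · exact absurd ⟨h1.symm, h2.symm⟩ h
          · rfl
          · rfl
    simp only [e, sub_mul, Finset.sum_sub_distrib, ite_mul, zero_mul]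
    simp only [Finset.sum_ite_eq', Finset.mem_univ, if_true, Finset.sum_ite_irrel,
      Finset.sum_const_zero]
    ring
  have h1 := key i j
  have h2 := key j i
  rw [hLs, hR] at h1 h2
  have hne : shift ((0, ħ • X.wt c) : ℂ × H N) (exCoef τ ħ m n) ≠ 0 :=
    fun h => exCoef_ne_zero hτ hħ hmn (shift_injective _ (h.trans (map_zero _).symm))
  have h3 : shift ((0, ħ • X.wt c) : ℂ × H N) (exCoef τ ħ m n) *
      ((P n i m j - P m i n j) + (P n j m i - P m j n i)) = 0 := by
    rw [mul_add, h1, h2]; ring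
  have h4 := (mul_eq_zero.mp h3).resolve_left hne
  change P m i n j - P n i m j = -(P m j n i - P n j m i)
  linear_combination -h4

/-- The exchange relation for the operators `L_{mi}(z + a) L_{nj}(z + a + ħ)`. -/
theorem exchange {τ : ℂ} (hτ : 0 < τ.im) (hħ : theta τ ħ ≠ 0) (hX : X.RLL τ ħ) (a : ℂ)
    (m n i j : Fin N) (y : X.B →₀ MZ N) :
    X.actL ħ m i a (X.actL ħ n j (a + ħ) y) - X.actL ħ n i a (X.actL ħ m j (a + ħ) y) =
      -(X.actL ħ m j a (X.actL ħ n i (a + ħ) y) - X.actL ħ n j a (X.actL ħ m i (a + ħ) y)) := by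
  induction y using Finsupp.induction_linear with
  | zero => simp only [actL_eq, op_zero, sub_self, neg_zero]
  | add x y hx hy =>
    simp only [actL_eq, op_add] at hx hy ⊢
    rw [add_sub_add_comm, hx, hy, add_sub_add_comm, neg_add]
  | single b g =>
    have hg : Finsupp.single b g = g • Finsupp.single b (1 : MZ N) := by
      rw [Finsupp.smul_single, smul_eq_mul, mul_one]
    have hcomp : (shift ((a, 0) : ℂ × H N)).comp (shift ((ħ, 0) : ℂ × H N)) =
        shift ((a + ħ, 0) : ℂ × H N) := by
      refine RingHom.ext fun f => ?_
      rw [RingHom.comp_apply, shift_shift, Prod.mk_add_mk, add_zero]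
    have hpair : ∀ m i n j, X.actL ħ m i a (X.actL ħ n j (a + ħ) (Finsupp.single b 1)) =
        bext (k := MZ N) (K := MZ N) (shift ((a, 0) : ℂ × H N)) (X.pairOp ħ m i n j (Finsupp.single b 1)) := by
      intro m i n j
      rw [actL_eq, actL_eq, pairOp, bext_op ħ X (isPoint_shift N a),
        bext_op_comp ħ X (isPoint_shift N a), bext_single, map_one, hcomp]
    have hs : ∀ m i n j, X.actL ħ m i a (X.actL ħ n j (a + ħ) (Finsupp.single b g)) =
        (frameZ N).T (ħ • ε i + ħ • ε j) g •
          bext (k := MZ N) (K := MZ N) (shift ((a, 0) : ℂ × H N)) (X.pairOp ħ m i n j (Finsupp.single b 1)) := by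
      intro m i n j
      rw [hg, ← hpair, actL_eq, actL_eq, op_smul, op_smul, (frameZ N).T_add]
      rfl
    rw [hs, hs, hs, hs, ← smul_sub, ← bext_sub, exchange_basis ħ X hτ hħ hX, add_comm (ħ • ε j),
      ← smul_sub, ← bext_sub, ← smul_neg]
    congr 1
    ext c
    simp [bext_apply]

end PreMod

end EllipticO
end

noncomputable section
namespace EllipticO

/-! ### Quantum minors for operators satisfying the exchange relation -/

section Words

variable {N : ℕ} {V W U : Type} [AddCommGroup V] [AddCommGroup W] [AddCommGroup U]
  (A : Fin N → Fin N → ℂ → V →+ V) (A' : Fin N → Fin N → ℂ → W →+ W)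
  (A'' : Fin N → Fin N → ℂ → U →+ U) (ħ : ℂ)

/-- The product of the operators `A_{r(s) c(s)}(a + sħ)`. -/
def word (a : ℂ) {k : ℕ} (r c : Fin k → Fin N) (x : V) : V :=
  (List.finRange k).foldr (fun s y => A (r s) (c s) (a + (s : ℕ) * ħ) y) x

theorem word_zero (a : ℂ) (r c : Fin 0 → Fin N) (x : V) : word A ħ a r c x = x := rfl

theorem word_succ (a : ℂ) {k : ℕ} (r c : Fin (k + 1) → Fin N) (x : V) :
    word A ħ a r c x = A (r 0) (c 0) a
      (word A ħ (a + ħ) (fun s => r s.succ) (fun s => c s.succ) x) := by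
  unfold word
  rw [List.finRange_succ, List.foldr_cons, List.foldr_map]
  have h1 : a + (((0 : Fin (k + 1)) : ℕ) : ℂ) * ħ = a := by simp
  have h2 : ∀ s : Fin k, a + ((s.succ : ℕ) : ℂ) * ħ = a + ħ + (s : ℕ) * ħ := by
    intro s
    rw [Fin.val_succ]
    push_cast
    ring
  simp only [h1, h2]

/-- The alternating sum of words. -/
def altWord {k : ℕ} (r c : Fin k → Fin N) (x : V) : V :=
  ∑ π : Equiv.Perm (Fin k), (Equiv.Perm.sign π : ℤ) • word A ħ 0 (r ∘ π) c x

theorem foldr_sub {α : Type} (l : List α) (f : α → V →+ V) (x y : V) :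
    l.foldr (fun s y => f s y) x - l.foldr (fun s y => f s y) y =
      l.foldr (fun s y => f s y) (x - y) := by
  induction l with
  | nil => rfl
  | cons a l ih => rw [List.foldr_cons, List.foldr_cons, List.foldr_cons, ← map_sub, ih]

theorem foldr_neg {α : Type} (l : List α) (f : α → V →+ V) (x : V) :
    l.foldr (fun s y => f s y) (-x) = -l.foldr (fun s y => f s y) x := by
  induction l with
  | nil => rfl
  | cons a l ih => rw [List.foldr_cons, List.foldr_cons, ih, map_neg]

/-- The exchange relation. -/
def Exchange : Prop := ∀ (a : ℂ) (m n i j : Fin N) (y : V),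
  A m i a (A n j (a + ħ) y) - A n i a (A m j (a + ħ) y) =
    -(A m j a (A n i (a + ħ) y) - A n j a (A m i (a + ħ) y))

theorem finRange_split {n : ℕ} (s : Fin n) : ∃ l l' : List (Fin (n + 1)),
    List.finRange (n + 1) = l ++ s.castSucc :: s.succ :: l' ∧
      (∀ t ∈ l, t ≠ s.castSucc ∧ t ≠ s.succ) ∧ ∀ t ∈ l', t ≠ s.castSucc ∧ t ≠ s.succ := by
  have hs : (s : ℕ) < (List.finRange (n + 1)).length := by
    rw [List.length_finRange]; omega
  have hs' : (s : ℕ) + 1 < (List.finRange (n + 1)).length := by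
    rw [List.length_finRange]; omega
  have h : List.finRange (n + 1) = (List.finRange (n + 1)).take s ++ s.castSucc :: s.succ ::
      (List.finRange (n + 1)).drop (s + 1 + 1) := by
    conv_lhs => rw [← List.take_append_drop s (List.finRange (n + 1)),
      List.drop_eq_getElem_cons hs, List.drop_eq_getElem_cons hs', List.getElem_finRange,
      List.getElem_finRange]
    rfl
  refine ⟨_, _, h, ?_⟩
  have hnd := List.nodup_finRange (n + 1)
  rw [h, List.nodup_append] at hnd
  obtain ⟨-, h2, h3⟩ := hnd
  rw [List.nodup_cons, List.nodup_cons] at h2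
  refine ⟨fun t ht => ⟨h3 t ht _ (by simp), h3 t ht _ (by simp)⟩, fun t ht => ⟨?_, ?_⟩⟩
  · rintro rfl; exact h2.1 (List.mem_cons_of_mem _ ht)
  · rintro rfl; exact h2.2.1 ht

variable {A ħ}

theorem word_swap (hA : Exchange A ħ) {n : ℕ} (s : Fin n) (r c : Fin (n + 1) → Fin N) (x : V) :
    word A ħ 0 r c x - word A ħ 0 (r ∘ Equiv.swap s.castSucc s.succ) c x =
      -(word A ħ 0 r (c ∘ Equiv.swap s.castSucc s.succ) x -
        word A ħ 0 (r ∘ Equiv.swap s.castSucc s.succ) (c ∘ Equiv.swap s.castSucc s.succ) x) := by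
  obtain ⟨l, l', hl, h1, h2⟩ := finRange_split s
  have key : ∀ r' c' : Fin (n + 1) → Fin N,
      (∀ t, t ≠ s.castSucc ∧ t ≠ s.succ → r' t = r t) →
      (∀ t, t ≠ s.castSucc ∧ t ≠ s.succ → c' t = c t) →
      word A ħ 0 r' c' x = l.foldr (fun t y => A (r t) (c t) (0 + (t : ℕ) * ħ) y)
        (A (r' s.castSucc) (c' s.castSucc) ((s : ℕ) * ħ)
          (A (r' s.succ) (c' s.succ) ((s : ℕ) * ħ + ħ)
            (l'.foldr (fun t y => A (r t) (c t) (0 + (t : ℕ) * ħ) y) x))) := by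
    intro r' c' hr hc
    unfold word
    rw [hl, List.foldr_append, List.foldr_cons, List.foldr_cons]
    have e1 : (0 : ℂ) + ((s.castSucc : ℕ) : ℂ) * ħ = (s : ℕ) * ħ := by simp
    have e2 : (0 : ℂ) + ((s.succ : ℕ) : ℂ) * ħ = (s : ℕ) * ħ + ħ := by
      rw [Fin.val_succ]; push_cast; ring
    rw [e1, e2]
    have hfold : ∀ (m : List (Fin (n + 1))) (y : V),
        (∀ t ∈ m, t ≠ s.castSucc ∧ t ≠ s.succ) →
        m.foldr (fun t y => A (r' t) (c' t) (0 + (t : ℕ) * ħ) y) y =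
          m.foldr (fun t y => A (r t) (c t) (0 + (t : ℕ) * ħ) y) y := by
      intro m y hm
      refine List.foldr_ext _ _ _ fun t ht z => ?_
      rw [hr t (hm t ht), hc t (hm t ht)]
    rw [hfold l' x h2, hfold l _ h1]
  have hsw : ∀ (g : Fin (n + 1) → Fin N) t, t ≠ s.castSucc ∧ t ≠ s.succ →
      (g ∘ Equiv.swap s.castSucc s.succ) t = g t := by
    intro g t ht
    rw [Function.comp_apply, Equiv.swap_apply_of_ne_of_ne ht.1 ht.2]
  rw [key r c (fun _ _ => rfl) fun _ _ => rfl, key _ c (hsw r) fun _ _ => rfl,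
    key r _ (fun _ _ => rfl) (hsw c), key _ _ (hsw r) (hsw c)]
  simp only [Function.comp_apply, Equiv.swap_apply_left, Equiv.swap_apply_right]
  rw [foldr_sub, foldr_sub, hA, foldr_neg]

theorem altWord_swap [IsAddTorsionFree V] (hA : Exchange A ħ) {n : ℕ} (s : Fin n)
    (r c : Fin (n + 1) → Fin N) (x : V) :
    altWord A ħ r (c ∘ Equiv.swap s.castSucc s.succ) x = -altWord A ħ r c x := by
  set σ := Equiv.swap s.castSucc s.succ with hσ
  have hsign : (Equiv.Perm.sign σ : ℤ) = -1 := by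
    rw [hσ, Equiv.Perm.sign_swap (Fin.castSucc_lt_succ).ne]; rfl
  have hre : ∀ c', ∑ π : Equiv.Perm (Fin (n + 1)), (Equiv.Perm.sign π : ℤ) •
      word A ħ 0 ((r ∘ π) ∘ σ) c' x = -altWord A ħ r c' x := by
    intro c'
    rw [altWord, ← Finset.sum_neg_distrib]
    refine Fintype.sum_equiv (Equiv.mulRight σ) _ _ fun π => ?_
    rw [Equiv.coe_mulRight, Equiv.Perm.sign_mul]
    push_cast
    rw [hsign, mul_neg_one, neg_smul, neg_neg]
    rfl
  have h : altWord A ħ r c x - -altWord A ħ r c x =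
      -(altWord A ħ r (c ∘ σ) x - -altWord A ħ r (c ∘ σ) x) := by
    rw [← hre c, ← hre (c ∘ σ), altWord, altWord, ← Finset.sum_sub_distrib,
      ← Finset.sum_sub_distrib, ← Finset.sum_neg_distrib]
    refine Finset.sum_congr rfl fun π _ => ?_
    rw [← smul_sub, ← smul_sub, word_swap hA s (r ∘ π) c x, smul_neg]
  have h2 : (2 : ℕ) • altWord A ħ r (c ∘ σ) x = (2 : ℕ) • -altWord A ħ r c x := by
    rw [two_nsmul, two_nsmul]
    rw [sub_neg_eq_add, sub_neg_eq_add, neg_add] at h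
    rw [← neg_add, h, neg_add, neg_neg]
  exact nsmul_right_injective two_ne_zero h2

theorem altWord_perm [IsAddTorsionFree V] (hA : Exchange A ħ) {k : ℕ} (r c : Fin k → Fin N)
    (π : Equiv.Perm (Fin k)) (x : V) :
    altWord A ħ r (c ∘ π) x = (Equiv.Perm.sign π : ℤ) • altWord A ħ r c x := by
  cases k with
  | zero =>
    rw [Subsingleton.elim π 1]
    simp
  | succ n =>
    have hπ : π ∈ Submonoid.closure (Set.range fun s : Fin n => Equiv.swap s.castSucc s.succ) := by
      rw [Equiv.Perm.mclosure_swap_castSucc_succ]; trivial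
    induction hπ using Submonoid.closure_induction generalizing c with
    | mem σ hσ =>
      obtain ⟨s, rfl⟩ := hσ
      beta_reduce
      rw [altWord_swap hA, Equiv.Perm.sign_swap (Fin.castSucc_lt_succ).ne]
      simp
    | one => simp
    | mul σ σ' _ _ h h' =>
      rw [Equiv.Perm.coe_mul, ← Function.comp_assoc, h', h, smul_smul, Equiv.Perm.sign_mul,
        Units.val_mul, mul_comm]

theorem altWord_eq_zero [IsAddTorsionFree V] (hA : Exchange A ħ) {k : ℕ} (r : Fin k → Fin N)
    {c : Fin k → Fin N} (hc : ¬Function.Injective c) (x : V) : altWord A ħ r c x = 0 := by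
  rw [Function.Injective] at hc
  push Not at hc
  obtain ⟨s, t, hst, hne⟩ := hc
  have h := altWord_perm hA r c (Equiv.swap s t) x
  have hcs : c ∘ Equiv.swap s t = c := by
    funext u
    rw [Function.comp_apply, Equiv.swap_apply_def]
    split_ifs with h1 h2
    · rw [h1, hst]
    · rw [h2, hst]
    · rfl
  rw [hcs, Equiv.Perm.sign_swap hne] at h
  have h2 : (2 : ℕ) • altWord A ħ r c x = (2 : ℕ) • (0 : V) := by
    rw [two_nsmul, smul_zero]
    conv_lhs => arg 1; rw [h]
    simp
  exact nsmul_right_injective two_ne_zero h2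

variable {A' A''}

theorem word_coproduct (t : V →+ W →+ U)
    (ht : ∀ i j a x y, A'' i j a (t x y) = ∑ k, t (A i k a x) (A' k j a y)) {k : ℕ} (a : ℂ)
    (r c : Fin k → Fin N) (x : V) (y : W) :
    word A'' ħ a r c (t x y) =
      ∑ κ : Fin k → Fin N, t (word A ħ a r κ x) (word A' ħ a κ c y) := by
  induction k generalizing a with
  | zero =>
    rw [Fintype.sum_subsingleton _ r, word_zero, word_zero, word_zero]
  | succ n ih =>
    rw [word_succ, ih, map_sum, ← (Fin.consEquiv fun _ => Fin N).sum_comp, Fintype.sum_prod_type_right]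
    refine Finset.sum_congr rfl fun κ _ => ?_
    rw [ht]
    refine Finset.sum_congr rfl fun k _ => ?_
    rw [word_succ, word_succ]
    rfl

open Classical in
theorem altWord_coproduct [IsAddTorsionFree V] (hA : Exchange A ħ) (t : V →+ W →+ U)
    (ht : ∀ i j a x y, A'' i j a (t x y) = ∑ k, t (A i k a x) (A' k j a y)) {k : ℕ}
    {e : Fin k → Fin N} (he : Function.Injective e) (x : V) (y : W) :
    altWord A'' ħ e e (t x y) = t (altWord A ħ e e x) (altWord A' ħ e e y) +
      ∑ κ : Fin k → Fin N, if Function.Injective κ ∧ ¬ Set.range κ ⊆ Set.range e then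
        t (altWord A ħ e κ x) (word A' ħ 0 κ e y) else 0 := by
  have h1 : altWord A'' ħ e e (t x y) =
      ∑ κ : Fin k → Fin N, t (altWord A ħ e κ x) (word A' ħ 0 κ e y) := by
    simp only [altWord, word_coproduct t ht, Finset.smul_sum]
    rw [Finset.sum_comm]
    refine Finset.sum_congr rfl fun κ _ => ?_
    rw [map_sum, AddMonoidHom.finsetSum_apply]
    refine Finset.sum_congr rfl fun π _ => ?_
    rw [map_zsmul, AddMonoidHom.zsmul_apply]
  have h2 : t (altWord A ħ e e x) (altWord A' ħ e e y) =
      ∑ κ : Fin k → Fin N, if Function.Injective κ ∧ Set.range κ ⊆ Set.range e then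
        t (altWord A ħ e κ x) (word A' ħ 0 κ e y) else 0 := by
    have hd : altWord A' ħ e e y = ∑ π : Equiv.Perm (Fin k),
        (Equiv.Perm.sign π : ℤ) • word A' ħ 0 (e ∘ π) e y := rfl
    rw [← Finset.sum_filter, hd, map_sum]
    refine Finset.sum_bij (fun π _ => e ∘ π) ?_ ?_ ?_ ?_
    · intro π _
      rw [Finset.mem_filter]
      refine ⟨Finset.mem_univ _, he.comp π.injective, ?_⟩
      rintro _ ⟨s, rfl⟩
      exact ⟨π s, rfl⟩
    · intro π _ π' _ h
      exact Equiv.ext fun s => he (congrFun h s)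
    · intro κ hκ
      rw [Finset.mem_filter] at hκ
      obtain ⟨-, hinj, hsub⟩ := hκ
      choose f hf using fun s => hsub ⟨s, rfl⟩
      have hfi : Function.Injective f := fun s s' h => hinj (by rw [← hf s, ← hf s', h])
      refine ⟨Equiv.ofBijective f (Finite.injective_iff_bijective.mp hfi), Finset.mem_univ _, ?_⟩
      exact funext hf
    · intro π _
      rw [altWord_perm hA, map_zsmul, map_zsmul, AddMonoidHom.zsmul_apply]
  rw [h1, h2, ← Finset.sum_add_distrib]
  refine Finset.sum_congr rfl fun κ _ => ?_
  by_cases hi : Function.Injective κ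
  · by_cases hs : Set.range κ ⊆ Set.range e
    · rw [if_pos ⟨hi, hs⟩, if_neg (fun h => h.2 hs), add_zero]
    · rw [if_neg (fun h => hs h.2), if_pos ⟨hi, hs⟩, zero_add]
  · rw [if_neg (fun h => hi h.1), if_neg (fun h => hi h.1), altWord_eq_zero hA e hi, map_zero,
      add_zero]
    rfl

end Words

section TopIndices

variable {N : ℕ}

/-- The last `k` indices, in decreasing order. -/
def topIdx {k : ℕ} (hk : k ≤ N) (s : Fin k) : Fin N := Fin.rev (Fin.castLE hk s)

theorem topIdx_injective {k : ℕ} (hk : k ≤ N) : Function.Injective (topIdx hk) :=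
  Fin.rev_injective.comp (Fin.castLE_injective hk)

theorem mem_range_topIdx {k : ℕ} (hk : k ≤ N) {i : Fin N} :
    i ∈ Set.range (topIdx hk) ↔ N - k ≤ (i : ℕ) := by
  constructor
  · rintro ⟨s, rfl⟩
    rw [topIdx, Fin.val_rev, Fin.val_castLE]
    omega
  · intro h
    refine ⟨⟨N - (i + 1), by omega⟩, ?_⟩
    ext
    rw [topIdx, Fin.val_rev, Fin.val_castLE]
    dsimp only
    omega

/-- The last `k` indices have the largest sum. -/
theorem sum_lt_sum_topIdx {k : ℕ} (hk : k ≤ N) {κ : Fin k → Fin N} (hκ : Function.Injective κ)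
    (h : ¬ Set.range κ ⊆ Set.range (topIdx hk)) :
    ∑ s, (κ s : ℕ) < ∑ s, (topIdx hk s : ℕ) := by
  classical
  set S := Finset.univ.image κ with hS
  set T := Finset.univ.image (topIdx hk) with hT
  have hSs : ∑ s, (κ s : ℕ) = ∑ i ∈ S, (i : ℕ) := by
    rw [hS, Finset.sum_image fun a _ b _ h => hκ h]
  have hTs : ∑ s, (topIdx hk s : ℕ) = ∑ i ∈ T, (i : ℕ) := by
    rw [hT, Finset.sum_image fun a _ b _ h => topIdx_injective hk h]
  have hcard : S.card = T.card := by
    rw [hS, hT, Finset.card_image_of_injective _ hκ,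
      Finset.card_image_of_injective _ (topIdx_injective hk)]
  have hdc : (S \ T).card = (T \ S).card := Finset.card_sdiff_comm hcard
  have hmemT : ∀ i, i ∈ T ↔ N - k ≤ (i : ℕ) := by
    intro i
    rw [hT, ← mem_range_topIdx hk]
    simp
  have hne : (S \ T).Nonempty := by
    rw [Set.not_subset] at h
    obtain ⟨i, ⟨s, rfl⟩, hi⟩ := h
    refine ⟨κ s, Finset.mem_sdiff.mpr ⟨Finset.mem_image_of_mem _ (Finset.mem_univ _), ?_⟩⟩
    rw [hmemT, ← mem_range_topIdx hk]
    exact hi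
  rw [hSs, hTs, ← Finset.sum_inter_add_sum_sdiff S T, ← Finset.sum_inter_add_sum_sdiff T S,
    Finset.inter_comm T S]
  refine Nat.add_lt_add_left ?_ _
  calc ∑ i ∈ S \ T, (i : ℕ) < ∑ i ∈ S \ T, (N - k) := by
        refine Finset.sum_lt_sum_of_nonempty hne fun i hi => ?_
        have := (Finset.mem_sdiff.mp hi).2
        rw [hmemT] at this
        omega
    _ = (T \ S).card • (N - k) := by rw [Finset.sum_const, hdc]
    _ ≤ ∑ i ∈ T \ S, (i : ℕ) := by
        refine Finset.card_nsmul_le_sum _ _ _ fun i hi => ?_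
        exact (hmemT i).mp (Finset.mem_sdiff.mp hi).1

end TopIndices

end EllipticO
end

noncomputable section
namespace EllipticO

section Height

variable {N : ℕ}

/-- The height of a weight. -/
def ht (x : H N) : ℝ := (-∑ i : Fin N, (i : ℂ) * x.1 i).re

theorem ht_add (x y : H N) : ht (x + y) = ht x + ht y := by
  have : (-∑ i : Fin N, (i : ℂ) * (x + y).1 i) =
      (-∑ i : Fin N, (i : ℂ) * x.1 i) + (-∑ i : Fin N, (i : ℂ) * y.1 i) := by
    change (-∑ i : Fin N, (i : ℂ) * (x.1 i + y.1 i)) = _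
    simp only [mul_add, Finset.sum_add_distrib]
    ring
  rw [ht, this, Complex.add_re]
  rfl

theorem ht_zero : ht (0 : H N) = 0 := by
  have := ht_add (0 : H N) 0
  rw [add_zero] at this
  linarith

theorem ht_neg (x : H N) : ht (-x) = -ht x := by
  have := ht_add x (-x)
  rw [add_neg_cancel, ht_zero] at this
  linarith

theorem ht_sub (x y : H N) : ht (x - y) = ht x - ht y := by
  rw [sub_eq_add_neg, ht_add, ht_neg, sub_eq_add_neg]

theorem ht_sum {α : Type} (s : Finset α) (x : α → H N) : ht (∑ a ∈ s, x a) = ∑ a ∈ s, ht (x a) :=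
  map_sum (⟨⟨ht, ht_zero⟩, ht_add⟩ : H N →+ ℝ) _ _

theorem ht_ε (i : Fin N) : ht (ε i) = (∑ t : Fin N, (t : ℝ)) / N - i := by
  have : (-∑ t : Fin N, (t : ℂ) * (ε i : H N).1 t) = ((∑ t : Fin N, (t : ℝ)) / N - i : ℝ) := by
    simp only [ε_apply, mul_sub, Finset.sum_sub_distrib, mul_ite, mul_one, mul_zero,
      Finset.sum_ite_eq', Finset.mem_univ, if_true]
    push_cast
    rw [← Finset.sum_mul]
    ring
  rw [ht, this, Complex.ofReal_re]

theorem ht_nonneg_of_QPlus {x : H N} (hx : x ∈ QPlus N) : x = 0 ∨ 1 ≤ ht x := QPlus_eq_zero_or hx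

end Height

theorem PreMod.theta_shift {N : ℕ} (τ : ℂ) (k : ℕ) (v w : H N) :
    shift ((0, v) : ℂ × H N) (Theta τ k w) = Theta τ k (v + w) := by
  unfold Theta
  rw [map_prod]
  refine Finset.prod_congr rfl fun i _ => ?_
  rw [map_prod]
  refine Finset.prod_congr rfl fun j _ => ?_
  split_ifs
  · refine (pull_ofEnt _ _ _ _ _).trans (ofEnt_congr (fun x => ?_) _ _)
    congr 1
    change ldiff i j (x.2 + v) + _ = ldiff i j x.2 + ldiff i j (v + w)
    change (x.2.1 i + v.1 i - (x.2.1 j + v.1 j)) + (w.1 i - w.1 j) =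
      (x.2.1 i - x.2.1 j) + (v.1 i + w.1 i - (v.1 j + w.1 j))
    ring
  · exact map_one _

theorem PreMod.Theta_ne_zero {N : ℕ} {τ : ℂ} (hτ : 0 < τ.im) (k : ℕ) (w : H N) : Theta τ k w ≠ 0 := by
  refine Finset.prod_ne_zero_iff.mpr fun i _ => Finset.prod_ne_zero_iff.mpr fun j _ => ?_
  split_ifs with h
  · exact thL_ne_zero hτ h.2.ne _
  · exact one_ne_zero

namespace PreMod

section GenericWords

variable {N : ℕ} {K : Type} [Field K] (F : Frame N K) (ħ : ℂ) (X Y : PreMod N)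
  (pt : ℂ → MZ N →+* K)

theorem isAddTorsionFree_vec [CharZero K] {B : Type} : IsAddTorsionFree (B →₀ K) := by
  refine ⟨fun n hn x y h => ?_⟩
  ext b
  have h1 : n • x b = n • y b := DFunLike.congr_fun h b
  rw [nsmul_eq_mul, nsmul_eq_mul] at h1
  exact mul_left_cancel₀ (Nat.cast_ne_zero.mpr hn) h1

/-- The operators `L_{ij}(z + a)` as additive maps, `pt a` being the substitution of `z + a`. -/
def opHom (i j : Fin N) (a : ℂ) : (X.B →₀ K) →+ (X.B →₀ K) :=
  ⟨⟨X.op F ħ (pt a) i j, X.op_zero F ħ⟩, X.op_add F ħ⟩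

theorem opHom_apply (i j : Fin N) (a : ℂ) (x : X.B →₀ K) :
    X.opHom F ħ pt i j a x = X.op F ħ (pt a) i j x := rfl

theorem word_smul {k : ℕ} (a : ℂ) (r c : Fin k → Fin N) (g : K) (x : X.B →₀ K) :
    word (X.opHom F ħ pt) ħ a r c (g • x) =
      F.T (ħ • ∑ s, ε (c s)) g • word (X.opHom F ħ pt) ħ a r c x := by
  induction k generalizing a with
  | zero => rw [word_zero, word_zero, Fin.sum_univ_zero, smul_zero, F.T_zero]
  | succ n ih =>
    rw [word_succ, ih, opHom_apply, op_smul, word_succ, ← F.T_add, Fin.sum_univ_succ, smul_add]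
    rfl

theorem word_add {k : ℕ} (a : ℂ) (r c : Fin k → Fin N) (x y : X.B →₀ K) :
    word (X.opHom F ħ pt) ħ a r c (x + y) =
      word (X.opHom F ħ pt) ħ a r c x + word (X.opHom F ħ pt) ħ a r c y := by
  induction k generalizing a with
  | zero => rfl
  | succ n ih => rw [word_succ, ih, map_add, word_succ, word_succ]

variable {X} in
theorem HasWt.word {k : ℕ} (a : ℂ) (r c : Fin k → Fin N) {x : X.B →₀ K} {μ : H N}
    (h : X.HasWt x μ) :
    X.HasWt (word (X.opHom F ħ pt) ħ a r c x) (μ + ∑ s, ε (c s) - ∑ s, ε (r s)) := by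
  induction k generalizing a with
  | zero => rw [Fin.sum_univ_zero, Fin.sum_univ_zero, add_zero, sub_zero]; exact h
  | succ n ih =>
    rw [word_succ, Fin.sum_univ_succ, Fin.sum_univ_succ]
    have := (ih (a + ħ) (fun s => r s.succ) (fun s => c s.succ)).op F ħ (φ := pt a) (i := r 0)
      (j := c 0)
    rw [show μ + ∑ s : Fin n, ε (c s.succ) - ∑ s : Fin n, ε (r s.succ) + ε (c 0) - ε (r 0) =
      μ + (ε (c 0) + ∑ s : Fin n, ε (c s.succ)) - (ε (r 0) + ∑ s : Fin n, ε (r s.succ)) by abel]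
      at this
    exact this

theorem altWord_smul {k : ℕ} (r c : Fin k → Fin N) (g : K) (x : X.B →₀ K) :
    altWord (X.opHom F ħ pt) ħ r c (g • x) =
      F.T (ħ • ∑ s, ε (c s)) g • altWord (X.opHom F ħ pt) ħ r c x := by
  rw [altWord, altWord, Finset.smul_sum]
  refine Finset.sum_congr rfl fun π _ => ?_
  rw [word_smul, smul_comm]

theorem altWord_add {k : ℕ} (r c : Fin k → Fin N) (x y : X.B →₀ K) :
    altWord (X.opHom F ħ pt) ħ r c (x + y) =
      altWord (X.opHom F ħ pt) ħ r c x + altWord (X.opHom F ħ pt) ħ r c y := by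
  rw [altWord, altWord, altWord, ← Finset.sum_add_distrib]
  refine Finset.sum_congr rfl fun π _ => ?_
  rw [word_add, smul_add]

variable {X} in
theorem HasWt.zsmul {x : X.B →₀ K} {μ : H N} (h : X.HasWt x μ) (n : ℤ) : X.HasWt (n • x) μ := by
  rw [← Int.cast_smul_eq_zsmul K]
  exact h.smul _

variable {X} in
theorem HasWt.altWord {k : ℕ} (r c : Fin k → Fin N) {x : X.B →₀ K} {μ : H N}
    (h : X.HasWt x μ) :
    X.HasWt (altWord (X.opHom F ħ pt) ħ r c x) (μ + ∑ s, ε (c s) - ∑ s, ε (r s)) := by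
  refine HasWt.sum fun π _ => HasWt.zsmul ?_ _
  have := h.word F ħ pt 0 (r ∘ π) c
  rwa [show ∑ s, (ε ((r ∘ π) s) : H N) = ∑ s, ε (r s) from
    Equiv.sum_comp π fun s => (ε (r s) : H N)] at this

variable {X} in
theorem HasWt.altWord_self {k : ℕ} (r : Fin k → Fin N) {x : X.B →₀ K} {μ : H N}
    (h : X.HasWt x μ) : X.HasWt (EllipticO.altWord (X.opHom F ħ pt) ħ r r x) μ := by
  have := h.altWord F ħ pt r r
  rwa [add_sub_cancel_right] at this

/-- The dynamical tensor product of vectors as a biadditive map. -/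
def tensHom : (X.B →₀ K) →+ (Y.B →₀ K) →+ ((tensor ħ X Y).B →₀ K) :=
  AddMonoidHom.mk' (fun x => AddMonoidHom.mk' (fun y => tensv F ħ X Y x y)
    fun _ _ => tensv_add_right F ħ X Y _ _ _)
    fun _ _ => AddMonoidHom.ext fun _ => tensv_add_left F ħ X Y _ _ _

theorem tensHom_apply (x : X.B →₀ K) (y : Y.B →₀ K) :
    tensHom F ħ X Y x y = tensv F ħ X Y x y := rfl

/-- On a tensor product, an alternating word is the tensor product of the alternating words up to
terms whose second factor has a smaller weight. -/
theorem altWord_tens [CharZero K] {F : Frame N K} {pt : ℂ → MZ N →+* K}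
    (hpt : ∀ a, F.IsPoint (pt a)) (hX : Exchange (X.opHom F ħ pt) ħ) {k : ℕ} (hk : k ≤ N)
    {μ ν : H N} {x : X.B →₀ K} {y : Y.B →₀ K} (hx : X.HasWt x μ) (hy : Y.HasWt y ν)
    (P : Submodule K ((tensor ħ X Y).B →₀ K))
    (hP : ∀ (μ' ν' : H N) (x' : X.B →₀ K) (y' : Y.B →₀ K), X.HasWt x' μ' → Y.HasWt y' ν' →
      μ' + ν' = μ + ν → ht ν' < ht ν → tensv F ħ X Y x' y' ∈ P) :
    altWord ((tensor ħ X Y).opHom F ħ pt) ħ (topIdx hk) (topIdx hk) (tensv F ħ X Y x y) -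
      tensv F ħ X Y (altWord (X.opHom F ħ pt) ħ (topIdx hk) (topIdx hk) x)
        (altWord (Y.opHom F ħ pt) ħ (topIdx hk) (topIdx hk) y) ∈ P := by
  classical
  have := isAddTorsionFree_vec (K := K) (B := X.B)
  have ht : ∀ i j a x y, (tensor ħ X Y).opHom F ħ pt i j a (tensHom F ħ X Y x y) =
      ∑ k, tensHom F ħ X Y (X.opHom F ħ pt i k a x) (Y.opHom F ħ pt k j a y) :=
    fun i j a x y => op_tens ħ X Y (hpt a) x y
  have hc := altWord_coproduct hX (tensHom F ħ X Y) ht (topIdx_injective hk) x y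
  rw [tensHom_apply, tensHom_apply] at hc
  rw [hc, add_sub_cancel_left]
  refine P.sum_mem fun κ _ => ?_
  split_ifs with h
  · rw [tensHom_apply]
    refine hP _ _ _ _ (hx.altWord F ħ pt (topIdx hk) κ) (hy.word F ħ pt 0 κ (topIdx hk)) (by abel) ?_
    have hlt := sum_lt_sum_topIdx hk h.1 h.2
    have hlt' : (∑ s, ((κ s : ℕ) : ℝ)) < ∑ s, ((topIdx hk s : ℕ) : ℝ) := by exact_mod_cast hlt
    rw [ht_sub, ht_add, ht_sum, ht_sum]
    simp only [ht_ε, Finset.sum_sub_distrib]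
    linarith
  · exact P.zero_mem

end GenericWords

variable {N : ℕ} (τ ħ : ℂ) (X Y : PreMod N)

/-- The substitution of `z + a` for `z`. -/
def ptZ (N : ℕ) (a : ℂ) : MZ N →+* MZ N := shift ((a, 0) : ℂ × H N)

theorem isPoint_ptZ (a : ℂ) : (frameZ N).IsPoint (ptZ N a) := isPoint_shift N a

theorem actL_ptZ (i j : Fin N) (a : ℂ) (x : X.B →₀ MZ N) :
    X.actL ħ i j a x = X.opHom (frameZ N) ħ (ptZ N) i j a x := rfl

theorem exchange_opHom {τ : ℂ} (hτ : 0 < τ.im) (hħ : theta τ ħ ≠ 0) (hX : X.RLL τ ħ) :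
    Exchange (X.opHom (frameZ N) ħ (ptZ N)) ħ := fun a m n i j y => X.exchange ħ hτ hħ hX a m n i j y

/-- The alternating sum in the `k`-th quantum minor. -/
def alt {k : ℕ} (hk : k ≤ N) (x : X.B →₀ MZ N) : X.B →₀ MZ N :=
  altWord (X.opHom (frameZ N) ħ (ptZ N)) ħ (topIdx hk) (topIdx hk) x

theorem take_finRange {k : ℕ} (hk : k ≤ N) :
    (List.finRange N).take k = (List.finRange k).map (Fin.castLE hk) := by
  refine List.ext_getElem ?_ fun n h1 h2 => ?_
  · simp [hk]
  · simp only [List.getElem_take, List.getElem_finRange, List.getElem_map]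
    rfl

open Classical in
theorem minor_eq {k : ℕ} (hk : k ≤ N) (μ : H N) (x : X.B →₀ MZ N) :
    X.minor τ ħ k μ x = (Theta τ k (0 : H N) / Theta τ k (ħ • μ)) • X.alt ħ hk x := by
  rw [minor]
  congr 1
  rw [← Finset.sum_filter, alt, altWord]
  symm
  let f := Equiv.ofInjective (topIdx hk) (topIdx_injective hk)
  have hf : ∀ s, (f s : Fin N) = topIdx hk s := fun s => rfl
  have happ : ∀ (π : Equiv.Perm (Fin k)) s, π.extendDomain f (topIdx hk s) = topIdx hk (π s) := by
    intro π s
    rw [← hf, Equiv.Perm.extendDomain_apply_image, hf]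
  refine Finset.sum_bij (fun π _ => π.extendDomain f) ?_ ?_ ?_ ?_
  · intro π _
    rw [Finset.mem_filter]
    refine ⟨Finset.mem_univ _, fun i hi => ?_⟩
    refine Equiv.Perm.extendDomain_apply_not_subtype _ _ ?_
    intro h
    have := (mem_range_topIdx hk).mp h
    omega
  · intro π _ π' _ h
    refine Equiv.ext fun s => topIdx_injective hk ?_
    rw [← happ, ← happ, h]
  · intro σ hσ
    rw [Finset.mem_filter] at hσ
    obtain ⟨-, hσ⟩ := hσ
    have hmem : ∀ s, σ (topIdx hk s) ∈ Set.range (topIdx hk) := by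
      intro s
      by_contra h
      have h' := h
      rw [mem_range_topIdx, not_le] at h'
      have h2 := σ.injective (hσ _ h')
      exact h (by rw [h2]; exact ⟨s, rfl⟩)
    choose g hg using hmem
    have hgi : Function.Injective g := fun s s' h =>
      topIdx_injective hk (σ.injective (by rw [← hg s, ← hg s', h]))
    refine ⟨Equiv.ofBijective g (Finite.injective_iff_bijective.mp hgi), Finset.mem_univ _, ?_⟩
    refine Equiv.ext fun i => ?_
    by_cases hi : i ∈ Set.range (topIdx hk)
    · obtain ⟨s, rfl⟩ := hi
      rw [happ, ← hg]
      rfl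
    · rw [Equiv.Perm.extendDomain_apply_not_subtype _ _ hi]
      rw [mem_range_topIdx, not_le] at hi
      exact (hσ _ hi).symm
  · intro π _
    rw [Equiv.Perm.sign_extendDomain, Int.cast_smul_eq_zsmul]
    congr 1
    rw [minorTerm, take_finRange hk, List.foldr_map, word]
    have h1 : ∀ s : Fin k, (0 : ℂ) + (s : ℕ) * ħ = ((Fin.castLE hk s : Fin N) : ℕ) * ħ := by
      intro s
      rw [zero_add]
      rfl
    refine List.foldr_ext _ _ _ fun s _ y => ?_
    rw [h1, ← actL_ptZ]
    congr 1
    exact (happ π s).symm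

/-- The weight by which the `k`-th quantum minor shifts. -/
def minorWt (N : ℕ) (k : ℕ) : H N := ∑ i : Fin N, if N - k ≤ (i : ℕ) then ε i else 0

theorem sum_topIdx {k : ℕ} (hk : k ≤ N) : ∑ s, (ε (topIdx hk s) : H N) = minorWt N k := by
  classical
  rw [minorWt, ← Finset.sum_filter]
  refine Finset.sum_bij (fun s _ => topIdx hk s) ?_ ?_ ?_ ?_
  · intro s _
    exact Finset.mem_filter.mpr ⟨Finset.mem_univ _, (mem_range_topIdx hk).mp ⟨s, rfl⟩⟩
  · intro s _ t _ h
    exact topIdx_injective hk h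
  · intro i hi
    obtain ⟨s, hs⟩ := (mem_range_topIdx hk).mpr (Finset.mem_filter.mp hi).2
    exact ⟨s, Finset.mem_univ _, hs⟩
  · intro s _
    rfl

/-- On a tensor product, a quantum minor is the tensor product of the quantum minors up to terms
whose second factor has a smaller weight. -/
theorem minor_tens (hτ : 0 < τ.im) (hħ : theta τ ħ ≠ 0) (hX : X.RLL τ ħ) {k : ℕ} (hk : k ≤ N)
    {μ ν : H N} {x : X.B →₀ MZ N} {y : Y.B →₀ MZ N} (hx : X.HasWt x μ) (hy : Y.HasWt y ν)
    (P : Submodule (MZ N) ((tensor ħ X Y).B →₀ MZ N))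
    (hP : ∀ (μ' ν' : H N) (x' : X.B →₀ MZ N) (y' : Y.B →₀ MZ N), X.HasWt x' μ' → Y.HasWt y' ν' →
      μ' + ν' = μ + ν → ht ν' < ht ν → tensv (frameZ N) ħ X Y x' y' ∈ P) :
    (tensor ħ X Y).minor τ ħ k (μ + ν) (tensv (frameZ N) ħ X Y x y) -
      tensv (frameZ N) ħ X Y (X.minor τ ħ k μ x) (Y.minor τ ħ k ν y) ∈ P := by
  have hc := altWord_tens ħ X Y (isPoint_ptZ (N := N)) (X.exchange_opHom ħ hτ hħ hX) hk hx hy P hP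
  have hyw := hy.altWord_self (frameZ N) ħ (ptZ N) (topIdx hk)
  have hscal : (frameZ N).T (ħ • ν) (Theta τ k (0 : H N) / Theta τ k (ħ • μ)) *
      (Theta τ k (0 : H N) / Theta τ k (ħ • ν)) = Theta τ k (0 : H N) / Theta τ k (ħ • (μ + ν)) := by
    have h1 : (frameZ N).T (ħ • ν) (Theta τ k (0 : H N) / Theta τ k (ħ • μ)) =
        Theta τ k (ħ • ν) / Theta τ k (ħ • (μ + ν)) := by
      change shift _ _ = _
      rw [map_div₀, theta_shift, theta_shift, add_zero, smul_add, add_comm (ħ • ν)]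
    rw [h1]
    have := Theta_ne_zero hτ k (ħ • ν)
    have := Theta_ne_zero hτ k (ħ • (μ + ν))
    field_simp
  have hmain : tensv (frameZ N) ħ X Y (X.minor τ ħ k μ x) (Y.minor τ ħ k ν y) =
      (Theta τ k (0 : H N) / Theta τ k (ħ • (μ + ν))) •
        tensv (frameZ N) ħ X Y (X.alt ħ hk x) (Y.alt ħ hk y) := by
    rw [minor_eq τ ħ X hk, minor_eq τ ħ Y hk, tensv_smul_left]
    have hyw' : Y.HasWt (Y.alt ħ hk y) ν := hyw
    rw [(hyw'.smul _).muL_eq, smul_smul, hscal, tensv_smul_right]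
  rw [hmain, minor_eq τ ħ (tensor ħ X Y) hk, ← smul_sub]
  exact P.smul_mem _ hc

end PreMod

end EllipticO
end

noncomputable section
namespace EllipticO

/-! ### Triangular bases of graded spaces -/

section Graded

variable {k : Type} [Field k] {G B : Type} (wt : B → G)

open Classical in
/-- The projection onto a weight space. -/
def wproj (μ : G) : (B →₀ k) →ₗ[k] (B →₀ k) where
  toFun x := x.filter fun b => wt b = μ
  map_add' _ _ := Finsupp.filter_add
  map_smul' _ _ := Finsupp.filter_smul

theorem wproj_apply_of_eq {μ : G} {b : B} (h : wt b = μ) (x : B →₀ k) : wproj wt μ x b = x b := by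
  classical
  exact Finsupp.filter_apply_pos (fun b => wt b = μ) x h

theorem wproj_apply_of_ne {μ : G} {b : B} (h : wt b ≠ μ) (x : B →₀ k) : wproj wt μ x b = 0 := by
  classical
  exact Finsupp.filter_apply_neg (fun b => wt b = μ) x h

/-- Homogeneous vectors. -/
def Homog {L : Type} [Zero L] (x : B →₀ L) (μ : G) : Prop := ∀ b, x b ≠ 0 → wt b = μ

variable {wt}

theorem Homog.wproj_eq {x : B →₀ k} {μ : G} (h : Homog wt x μ) : wproj wt μ x = x := by
  ext b
  by_cases hb : wt b = μ
  · exact wproj_apply_of_eq wt hb x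
  · rw [wproj_apply_of_ne wt hb]
    by_contra h0
    exact hb (h b (Ne.symm h0))

theorem Homog.wproj_eq_zero {x : B →₀ k} {μ ν : G} (h : Homog wt x μ) (hne : μ ≠ ν) :
    wproj wt ν x = 0 := by
  ext b
  by_cases hb : wt b = ν
  · rw [wproj_apply_of_eq wt hb]
    by_contra h0
    exact hne ((h b h0).symm.trans hb)
  · rw [wproj_apply_of_ne wt hb]; rfl

theorem homog_wproj (x : B →₀ k) (μ : G) : Homog wt (wproj wt μ x) μ := by
  intro b hb
  by_contra h
  exact hb (wproj_apply_of_ne wt h x)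

theorem exists_sum_wproj (x : B →₀ k) : ∃ t : Finset G, x = ∑ μ ∈ t, wproj wt μ x := by
  classical
  refine ⟨x.support.image wt, ?_⟩
  ext b
  rw [Finsupp.finsetSum_apply]
  by_cases hb : x b = 0
  · rw [hb, Finset.sum_eq_zero]
    intro μ _
    by_cases h : wt b = μ
    · rw [wproj_apply_of_eq wt h, hb]
    · exact wproj_apply_of_ne wt h x
  · rw [Finset.sum_eq_single (wt b), wproj_apply_of_eq wt rfl]
    · intro μ _ h
      exact wproj_apply_of_ne wt h.symm x
    · intro h
      exact absurd (Finset.mem_image_of_mem _ (Finsupp.mem_support_iff.mpr hb)) h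

theorem wproj_map {B' : Type} {wt' : B' → G} (φ : (B →₀ k) →ₗ[k] (B' →₀ k))
    (hwt : ∀ x μ, Homog wt x μ → Homog wt' (φ x) μ) (x : B →₀ k) (μ : G) :
    wproj wt' μ (φ x) = φ (wproj wt μ x) := by
  obtain ⟨t, ht⟩ := exists_sum_wproj (wt := wt) x
  have hone : ∀ ν, wproj wt' μ (φ (wproj wt ν x)) = φ (wproj wt μ (wproj wt ν x)) := by
    intro ν
    by_cases hν : ν = μ
    · subst hν
      rw [(hwt _ _ (homog_wproj x ν)).wproj_eq, (homog_wproj x ν).wproj_eq]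
    · rw [(hwt _ _ (homog_wproj x ν)).wproj_eq_zero hν, (homog_wproj x ν).wproj_eq_zero hν,
        map_zero]
  calc wproj wt' μ (φ x) = wproj wt' μ (φ (∑ ν ∈ t, wproj wt ν x)) := by rw [← ht]
    _ = ∑ ν ∈ t, wproj wt' μ (φ (wproj wt ν x)) := by simp only [map_sum]
    _ = ∑ ν ∈ t, φ (wproj wt μ (wproj wt ν x)) := Finset.sum_congr rfl fun ν _ => hone ν
    _ = φ (wproj wt μ (∑ ν ∈ t, wproj wt ν x)) := by simp only [map_sum]
    _ = _ := by rw [← ht]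

end Graded

section TriangularBases

variable {k K : Type} [Field k] [Field K] {j : k →+* K} {ι G B B' S : Type}

/-- The homogeneous basis `v` makes the operators `D` triangular, with diagonal entries `F`. -/
structure IsTriang (j : k →+* K) (wt : B → G) (D : ι → (B →₀ k) → (B →₀ K)) (v : S → B →₀ k)
    (ω : S → G) (F : S → ι → K) (h : S → ℕ) : Prop where
  li : LinearIndependent k v
  homog : ∀ s, Homog wt (v s) (ω s)
  span : Submodule.span k (Set.range v) = ⊤
  fin : ∀ μ, {s | ω s = μ}.Finite
  inj : ∀ s s', ω s = ω s' → h s = h s' → s = s'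
  tri : ∀ l s, D l (v s) - F s l • bext j (v s) ∈
    spanK j (Submodule.span k (v '' {s' | ω s' = ω s ∧ h s' < h s}))

variable {wt : B → G} {D : ι → (B →₀ k) → (B →₀ K)} {v : S → B →₀ k} {ω : S → G}
  {F : S → ι → K} {h : S → ℕ}

/-- A homogeneous vector is a combination of basis vectors of the same weight. -/
theorem mem_span_fiber (hv : ∀ s, Homog wt (v s) (ω s))
    (hspan : Submodule.span k (Set.range v) = ⊤) {x : B →₀ k} {μ : G} (hx : Homog wt x μ) :
    x ∈ Submodule.span k (v '' {s | ω s = μ}) := by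
  have h1 : ∀ y ∈ Submodule.span k (Set.range v),
      wproj wt μ y ∈ Submodule.span k (v '' {s | ω s = μ}) := by
    intro y hy
    induction hy using Submodule.span_induction with
    | mem y hy =>
      obtain ⟨s, rfl⟩ := hy
      by_cases hs : ω s = μ
      · rw [← hs, (hv s).wproj_eq]
        exact Submodule.subset_span ⟨s, rfl, rfl⟩
      · rw [(hv s).wproj_eq_zero hs]
        exact zero_mem _
    | zero => rw [map_zero]; exact zero_mem _
    | add y z _ _ hy hz => rw [map_add]; exact add_mem hy hz
    | smul c y _ hy => rw [map_smul]; exact Submodule.smul_mem _ c hy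
  have := h1 x (by rw [hspan]; trivial)
  rwa [hx.wproj_eq] at this

theorem homog_of_mem_span {A : Set S} (hv : ∀ s, Homog wt (v s) (ω s)) {μ : G}
    (hA : ∀ s ∈ A, ω s = μ) {x : B →₀ k} (hx : x ∈ Submodule.span k (v '' A)) :
    Homog wt x μ := by
  have : wproj wt μ x = x := by
    induction hx using Submodule.span_induction with
    | mem y hy =>
      obtain ⟨s, hs, rfl⟩ := hy
      rw [← hA s hs, (hv s).wproj_eq]
    | zero => rw [map_zero]
    | add y z _ _ hy hz => rw [map_add, hy, hz]
    | smul c y _ hy => rw [map_smul, hy]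
  rw [← this]
  exact homog_wproj x μ

/-- The fibres of a triangular basis can be numbered compatibly with the rank. -/
theorem exists_fin_fiber {Λ : Type} [LinearOrder Λ] {μ : G} (hfin : {s | ω s = μ}.Finite)
    (h : S → Λ) : ∃ (n : ℕ) (e : Fin n ≃ {s // ω s = μ}), ∀ a b, h (e a) < h (e b) → a < b := by
  have : Finite {s // ω s = μ} := hfin
  let n := Nat.card {s // ω s = μ}
  let e₀ : Fin n ≃ {s // ω s = μ} := (Finite.equivFin _).symm
  let σ := Tuple.sort fun a => h (e₀ a)
  refine ⟨n, σ.trans e₀, fun a b hab => ?_⟩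
  by_contra hle
  have := Tuple.monotone_sort (fun a => h (e₀ a)) (not_lt.mp hle)
  exact absurd hab (not_lt.mpr this)

/-- A rank function with values in any linear order can be replaced by an injective one. -/
theorem IsTriang.of_rank {Λ : Type} [LinearOrder Λ] (h : S → Λ) (li : LinearIndependent k v)
    (homog : ∀ s, Homog wt (v s) (ω s)) (span : Submodule.span k (Set.range v) = ⊤)
    (fin : ∀ μ, {s | ω s = μ}.Finite)
    (tri : ∀ l s, D l (v s) - F s l • bext j (v s) ∈
      spanK j (Submodule.span k (v '' {s' | ω s' = ω s ∧ h s' < h s}))) :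
    ∃ h' : S → ℕ, IsTriang j wt D v ω F h' := by
  choose n e he using fun μ => exists_fin_fiber (fin μ) h
  refine ⟨fun s => (e (ω s)).symm ⟨s, rfl⟩, li, homog, span, fin, ?_, ?_⟩
  · intro s s' hω hs
    have key : ∀ μ (hs : ω s = μ) (hs' : ω s' = μ),
        (((e μ).symm ⟨s, hs⟩ : Fin _) : ℕ) = (e μ).symm ⟨s', hs'⟩ → s = s' := by
      intro μ hs hs' heq
      exact congrArg Subtype.val ((e μ).symm.injective (Fin.ext heq))
    refine key (ω s) rfl hω.symm (hs.trans ?_)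
    have : ∀ μ (hs' : ω s' = μ), (((e (ω s')).symm ⟨s', rfl⟩ : Fin _) : ℕ) =
        (e μ).symm ⟨s', hs'⟩ := by
      intro μ hs'
      subst hs'
      rfl
    exact this _ _
  · intro l s
    refine spanK_mono j (Submodule.span_mono (Set.image_mono ?_)) (tri l s)
    rintro s' ⟨hω, hlt⟩
    refine ⟨hω, ?_⟩
    have key : ∀ μ (hs : ω s = μ) (hs' : ω s' = μ),
        (((e μ).symm ⟨s', hs'⟩ : Fin _) : ℕ) < (e μ).symm ⟨s, hs⟩ := by
      intro μ hs hs'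
      refine he μ _ _ ?_
      rw [Equiv.apply_symm_apply, Equiv.apply_symm_apply]
      exact hlt
    have hk := key (ω s) rfl hω
    have : ∀ μ (hs' : ω s' = μ), (((e (ω s')).symm ⟨s', rfl⟩ : Fin _) : ℕ) =
        (e μ).symm ⟨s', hs'⟩ := by
      intro μ hs'
      subst hs'
      rfl
    rw [this _ hω]
    exact hk

/-- Two triangular bases for the same semilinear operators have the same diagonal entries, up to
the order of the basis vectors and rescaling. -/
theorem IsTriang.exists_equiv {S' : Type} {v' : S' → B →₀ k} {ω' : S' → G} {F' : S' → ι → K}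
    {h' : S' → ℕ} (T : IsTriang j wt D v ω F h) (T' : IsTriang j wt D v' ω' F' h')
    (τ : ι → k →+* K) (hadd : ∀ l x y, D l (x + y) = D l x + D l y)
    (hsmul : ∀ l a x, D l (a • x) = τ l a • D l x) (μ : G) :
    ∃ π : {s // ω s = μ} ≃ {s // ω' s = μ}, ∀ s : {s // ω s = μ}, ∃ a a' : k, a ≠ 0 ∧ a' ≠ 0 ∧
      ∀ l, τ l a * F s.1 l * j a' = τ l a' * F' (π s).1 l * j a := by
  obtain ⟨n, e, he⟩ := exists_fin_fiber (T.fin μ) h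
  obtain ⟨n', e', he'⟩ := exists_fin_fiber (T'.fin μ) h'
  have hrange : ∀ {S : Type} {v : S → B →₀ k} {ω : S → G} {n : ℕ} (e : Fin n ≃ {s // ω s = μ}),
      Set.range (fun a => v (e a)) = v '' {s | ω s = μ} := by
    intro S v ω n e
    ext x
    constructor
    · rintro ⟨a, rfl⟩
      exact ⟨e a, (e a).2, rfl⟩
    · rintro ⟨s, hs, rfl⟩
      exact ⟨e.symm ⟨s, hs⟩, by simp⟩
  have htri : ∀ {S : Type} {v : S → B →₀ k} {ω : S → G} {F : S → ι → K} {h : S → ℕ} {n : ℕ}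
      (_ : IsTriang j wt D v ω F h)
      (e : Fin n ≃ {s // ω s = μ}), (∀ a b, h (e a) < h (e b) → a < b) → ∀ l a,
      D l (v (e a)) - F (e a) l • bext j (v (e a)) ∈
        spanK j (Submodule.span k ((fun a => v (e a)) '' Set.Iio a)) := by
    intro S v ω F h n T e he l a
    refine spanK_mono j (Submodule.span_mono ?_) (T.tri l (e a))
    rintro _ ⟨s', ⟨hω, hlt⟩, rfl⟩
    refine ⟨e.symm ⟨s', hω.trans (e a).2⟩, he _ _ ?_, ?_⟩
    · rw [Equiv.apply_symm_apply]; exact hlt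
    · beta_reduce; rw [Equiv.apply_symm_apply]
  have hsp : ∀ {S : Type} {v : S → B →₀ k} {ω : S → G} {F : S → ι → K} {h : S → ℕ}
      (_ : IsTriang j wt D v ω F h) (x : B →₀ k),
      x ∈ Submodule.span k (v '' {s | ω s = μ}) ↔ Homog wt x μ := fun T x =>
    ⟨fun hx => homog_of_mem_span T.homog (fun _ hs => hs) hx,
      fun hx => mem_span_fiber T.homog T.span hx⟩
  obtain ⟨π, hπ⟩ := exists_equiv_of_triangular (j := j) (v := fun a => v (e a))
    (v' := fun a => v' (e' a))
    (T.li.comp (fun a => (e a : S)) (Subtype.val_injective.comp e.injective))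
    (T'.li.comp (fun a => (e' a : S')) (Subtype.val_injective.comp e'.injective))
    (by rw [hrange e, hrange e']; ext x; rw [hsp T, hsp T']) τ D hadd hsmul
    (fun a => F (e a)) (fun a => F' (e' a)) (htri T e he) (htri T' e' he')
  refine ⟨e.symm.trans (π.trans e'), fun s => ?_⟩
  have := hπ (e.symm s)
  rw [Equiv.apply_symm_apply] at this
  exact this

/-! #### Subspaces and quotients -/

/-- The span of the basis vectors of weight `μ` and rank less than `n`. -/
def flag (v : S → B →₀ k) (ω : S → G) (h : S → ℕ) (μ : G) (n : ℕ) : Submodule k (B →₀ k) :=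
  Submodule.span k (v '' {s | ω s = μ ∧ h s < n})

theorem flag_mono {μ : G} {m n : ℕ} (hmn : m ≤ n) : flag v ω h μ m ≤ flag v ω h μ n :=
  Submodule.span_mono (Set.image_mono fun _ hs => ⟨hs.1, hs.2.trans_le hmn⟩)

theorem mem_flag {s : S} {n : ℕ} (hs : h s < n) : v s ∈ flag v ω h (ω s) n :=
  Submodule.subset_span ⟨s, ⟨rfl, hs⟩, rfl⟩

/-- The leading indices of a subspace. -/
def leading (v : S → B →₀ k) (ω : S → G) (h : S → ℕ) (W : Submodule k (B →₀ k)) : Set S :=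
  {s | ∃ w ∈ W, w - v s ∈ flag v ω h (ω s) (h s)}

namespace IsTriang

theorem homog_flag (T : IsTriang j wt D v ω F h) {μ : G} {n : ℕ} {x : B →₀ k}
    (hx : x ∈ flag v ω h μ n) : Homog wt x μ :=
  homog_of_mem_span T.homog (fun _ hs => hs.1) hx

theorem notMem_flag (T : IsTriang j wt D v ω F h) (s : S) : v s ∉ flag v ω h (ω s) (h s) := by
  intro hs
  exact T.li.notMem_span_image (fun hmem => lt_irrefl _ hmem.2) hs

theorem exists_mem_flag (T : IsTriang j wt D v ω F h) {μ : G} {x : B →₀ k} (hx : Homog wt x μ) :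
    ∃ n, x ∈ flag v ω h μ n := by
  obtain ⟨n, hn⟩ := (T.fin μ).image h |>.bddAbove
  refine ⟨n + 1, Submodule.span_mono (Set.image_mono ?_) (mem_span_fiber T.homog T.span hx)⟩
  intro s hs
  exact ⟨hs, Nat.lt_succ_of_le (hn ⟨s, hs, rfl⟩)⟩

theorem homog_of_leading (T : IsTriang j wt D v ω F h) {s : S} {w : B →₀ k}
    (hw : w - v s ∈ flag v ω h (ω s) (h s)) : Homog wt w (ω s) := by
  have hmem : w ∈ flag v ω h (ω s) (h s + 1) := by
    have := add_mem (flag_mono (Nat.le_succ _) hw) (mem_flag (ω := ω) (v := v) (Nat.lt_succ_self (h s)))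
    rwa [sub_add_cancel] at this
  exact T.homog_flag hmem

/-- Vectors with leading indices outside those of `W` are independent modulo `W`. -/
theorem independent_mod (T : IsTriang j wt D v ω F h) {W : Submodule k (B →₀ k)}
    (hW : ∀ x ∈ W, ∀ μ, wproj wt μ x ∈ W) {R : Type} {ρ : R → S} (hρ : Function.Injective ρ)
    {u : R → B →₀ k} (hR : ∀ r, ρ r ∉ leading v ω h W)
    (hu : ∀ r, u r - v (ρ r) ∈ flag v ω h (ω (ρ r)) (h (ρ r)))
    (t : Finset R) (c : R → k) (hc : ∑ r ∈ t, c r • u r ∈ W) : ∀ r ∈ t, c r = 0 := by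
  classical
  by_contra hcon
  push Not at hcon
  obtain ⟨r₀, hr₀, hc₀⟩ := hcon
  obtain ⟨r₁, hr₁, hmax⟩ := Finset.exists_max_image
    (t.filter fun r => c r ≠ 0 ∧ ω (ρ r) = ω (ρ r₀)) (fun r => h (ρ r))
    ⟨r₀, Finset.mem_filter.mpr ⟨hr₀, hc₀, rfl⟩⟩
  obtain ⟨hr₁t, hc₁, hω₁⟩ := Finset.mem_filter.mp hr₁
  refine hR r₁ ⟨(c r₁)⁻¹ • wproj wt (ω (ρ r₁)) (∑ r ∈ t, c r • u r),
    W.smul_mem _ (hW _ hc _), ?_⟩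
  have hsum : wproj wt (ω (ρ r₁)) (∑ r ∈ t, c r • u r) - c r₁ • v (ρ r₁) ∈
      flag v ω h (ω (ρ r₁)) (h (ρ r₁)) := by
    rw [← Finset.add_sum_erase t _ hr₁t, map_add, map_smul,
      (T.homog_of_leading (hu r₁)).wproj_eq, add_sub_right_comm, ← smul_sub, map_sum]
    refine add_mem (Submodule.smul_mem _ _ (hu r₁)) (sum_mem fun r hr => ?_)
    obtain ⟨hne, hrt⟩ := Finset.mem_erase.mp hr
    rw [map_smul]
    by_cases hcr : c r = 0
    · rw [hcr, zero_smul]; exact zero_mem _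
    refine Submodule.smul_mem _ _ ?_
    by_cases hω : ω (ρ r) = ω (ρ r₁)
    · have hle := hmax r (Finset.mem_filter.mpr ⟨hrt, hcr, hω.trans hω₁⟩)
      have hlt : h (ρ r) < h (ρ r₁) := lt_of_le_of_ne hle fun heq =>
        hne (hρ (T.inj _ _ hω heq))
      rw [← hω, (T.homog_of_leading (hu r)).wproj_eq]
      have := add_mem (flag_mono hlt.le (hu r)) (mem_flag (ω := ω) (v := v) hlt)
      rwa [sub_add_cancel] at this
    · rw [(T.homog_of_leading (hu r)).wproj_eq_zero hω]
      exact zero_mem _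
  have := Submodule.smul_mem _ (c r₁)⁻¹ hsum
  rwa [smul_sub, smul_smul, inv_mul_cancel₀ hc₁, one_smul] at this

theorem mem_span_leading (T : IsTriang j wt D v ω F h) {W : Submodule k (B →₀ k)} {w : S → B →₀ k}
    (hwW : ∀ s ∈ leading v ω h W, w s ∈ W)
    (hw : ∀ s ∈ leading v ω h W, w s - v s ∈ flag v ω h (ω s) (h s)) (μ : G) (n : ℕ)
    {x : B →₀ k} (hx : x ∈ W) (hxn : x ∈ flag v ω h μ n) :
    x ∈ Submodule.span k (w '' {s | s ∈ leading v ω h W ∧ ω s = μ ∧ h s < n}) := by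
  induction n generalizing x with
  | zero =>
    have : x = 0 := by
      rw [flag] at hxn
      simpa using hxn
    rw [this]
    exact zero_mem _
  | succ n ih =>
    have hmono : Submodule.span k (w '' {s | s ∈ leading v ω h W ∧ ω s = μ ∧ h s < n}) ≤
        Submodule.span k (w '' {s | s ∈ leading v ω h W ∧ ω s = μ ∧ h s < n + 1}) :=
      Submodule.span_mono (Set.image_mono fun s hs => ⟨hs.1, hs.2.1, hs.2.2.trans (Nat.lt_succ_self n)⟩)
    by_cases hs : ∃ s, ω s = μ ∧ h s = n
    · obtain ⟨s, rfl, rfl⟩ := hs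
      have hset : v '' {s' | ω s' = ω s ∧ h s' < h s + 1} =
          insert (v s) (v '' {s' | ω s' = ω s ∧ h s' < h s}) := by
        rw [← Set.image_insert_eq]
        congr 1
        ext s'
        constructor
        · rintro ⟨h1, h2⟩
          rcases Nat.lt_succ_iff_lt_or_eq.mp h2 with h3 | h3
          · exact Or.inr ⟨h1, h3⟩
          · exact Or.inl (T.inj _ _ h1 h3)
        · rintro (rfl | h1)
          · exact ⟨rfl, Nat.lt_succ_self _⟩
          · exact ⟨h1.1, h1.2.trans (Nat.lt_succ_self _)⟩
      rw [flag, hset, Submodule.mem_span_insert] at hxn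
      obtain ⟨c, y, hy, rfl⟩ := hxn
      by_cases hc : c = 0
      · subst hc
        rw [zero_smul, zero_add] at hx ⊢
        exact hmono (ih hx hy)
      · have hsl : s ∈ leading v ω h W := by
          refine ⟨c⁻¹ • (c • v s + y), W.smul_mem _ hx, ?_⟩
          rw [smul_add, smul_smul, inv_mul_cancel₀ hc, one_smul, add_sub_cancel_left]
          exact Submodule.smul_mem _ _ hy
        have h1 := ih (x := (c • v s + y) - c • w s) (sub_mem hx (W.smul_mem _ (hwW s hsl))) (by
          rw [add_sub_right_comm, ← smul_sub]
          refine add_mem (Submodule.smul_mem _ _ ?_) hy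
          rw [← neg_sub]
          exact neg_mem (hw s hsl))
        have h2 : c • w s ∈ Submodule.span k
            (w '' {s' | s' ∈ leading v ω h W ∧ ω s' = ω s ∧ h s' < h s + 1}) :=
          Submodule.smul_mem _ _ (Submodule.subset_span ⟨s, ⟨hsl, rfl, Nat.lt_succ_self _⟩, rfl⟩)
        have := add_mem (hmono h1) h2
        rwa [sub_add_cancel] at this
    · refine hmono (ih hx ?_)
      refine Submodule.span_mono (Set.image_mono ?_) hxn
      rintro s ⟨h1, h2⟩
      refine ⟨h1, lt_of_le_of_ne (Nat.le_of_lt_succ h2) fun h3 => hs ⟨s, h1, h3⟩⟩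

theorem map_flag (hadd : ∀ l x y, D l (x + y) = D l x + D l y) {τ : ι → k →+* K}
    (hsmul : ∀ l a x, D l (a • x) = τ l a • D l x) (T : IsTriang j wt D v ω F h) {μ : G} {n : ℕ}
    (l : ι) {x : B →₀ k} (hx : x ∈ flag v ω h μ n) : D l x ∈ spanK j (flag v ω h μ n) := by
  induction hx using Submodule.span_induction with
  | mem x hx =>
    obtain ⟨s, ⟨rfl, hs⟩, rfl⟩ := hx
    have h1 := spanK_mono j (flag_mono hs.le) (T.tri l s)
    have h2 := Submodule.smul_mem _ (F s l) (bext_mem_spanK (j := j).mpr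
      (mem_flag (ω := ω) (v := v) hs))
    have := add_mem h1 h2
    rwa [sub_add_cancel] at this
  | zero =>
    have : D l 0 = 0 := by
      have := hsmul l 0 0
      rwa [smul_zero, map_zero, zero_smul] at this
    rw [this]
    exact zero_mem _
  | add x y _ _ hx hy => rw [hadd]; exact add_mem hx hy
  | smul c x _ hx => rw [hsmul]; exact Submodule.smul_mem _ _ hx

variable {wt' : B' → G} {D' : ι → (B' →₀ k) → (B' →₀ K)}

/-- A subspace stable under the operators has a triangular basis indexed by its leading indices. -/
theorem sub (T : IsTriang j wt D v ω F h) {τ : ι → k →+* K}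
    (hadd : ∀ l x y, D l (x + y) = D l x + D l y) (hsmul : ∀ l a x, D l (a • x) = τ l a • D l x)
    (φ : (B' →₀ k) →ₗ[k] (B →₀ k)) (hφ : Function.Injective φ)
    (hwt : ∀ x μ, Homog wt' x μ → Homog wt (φ x) μ)
    (hD : ∀ l x, extMap j φ (D' l x) = D l (φ x)) :
    ∃ u : leading v ω h (LinearMap.range φ) → B' →₀ k,
      IsTriang j wt' D' u (fun s => ω s) (fun s => F s) (fun s => h s) := by
  classical
  set W := LinearMap.range φ with hW
  have hproj := wproj_map (wt := wt') (wt' := wt) φ hwt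
  have hWg : ∀ x ∈ W, ∀ μ, wproj wt μ x ∈ W := by
    rintro _ ⟨x, rfl⟩ μ
    exact ⟨_, (hproj x μ).symm⟩
  choose u hu using fun s : leading v ω h W =>
    show ∃ u, φ u - v s ∈ flag v ω h (ω s) (h s) by
      obtain ⟨_, ⟨u, rfl⟩, hu⟩ := s.2
      exact ⟨u, hu⟩
  let w : S → B →₀ k := fun s => if hs : s ∈ leading v ω h W then φ (u ⟨s, hs⟩) else 0
  have hws : ∀ s : leading v ω h W, w s = φ (u s) := fun s => dif_pos s.2
  have hwW : ∀ s ∈ leading v ω h W, w s ∈ W := fun s hs => by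
    rw [hws ⟨s, hs⟩]; exact ⟨_, rfl⟩
  have hw : ∀ s ∈ leading v ω h W, w s - v s ∈ flag v ω h (ω s) (h s) := fun s hs => by
    rw [hws ⟨s, hs⟩]; exact hu ⟨s, hs⟩
  have hker : ∀ x μ n, φ x ∈ flag v ω h μ n →
      x ∈ Submodule.span k (u '' {s | ω s = μ ∧ h s < n}) := by
    intro x μ n hx
    have h1 := T.mem_span_leading hwW hw μ n ⟨x, rfl⟩ hx
    have hset : w '' {s | s ∈ leading v ω h W ∧ ω s = μ ∧ h s < n} =
        φ '' (u '' {s | ω s = μ ∧ h s < n}) := by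
      rw [Set.image_image]
      ext y
      constructor
      · rintro ⟨s, ⟨hs, h1⟩, rfl⟩
        exact ⟨⟨s, hs⟩, h1, (hws ⟨s, hs⟩).symm⟩
      · rintro ⟨s, h1, rfl⟩
        exact ⟨s, ⟨s.2, h1⟩, hws s⟩
    rw [hset, ← Submodule.map_span] at h1
    obtain ⟨y, hy, hyx⟩ := h1
    rwa [← hφ hyx]
  refine ⟨u, ?_, ?_, ?_, ?_, ?_, ?_⟩
  · rw [linearIndependent_iff']
    intro t c hc
    refine T.independent_mod (W := ⊥) ?_ (ρ := fun s : leading v ω h W => (s : S))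
      Subtype.val_injective (u := fun s => φ (u s)) ?_ hu t c ?_
    · intro x hx μ
      rw [(Submodule.mem_bot k).mp hx, map_zero]
      exact zero_mem _
    · rintro s ⟨y, hy, hys⟩
      rw [(Submodule.mem_bot k).mp hy, zero_sub] at hys
      exact T.notMem_flag s (neg_mem_iff.mp hys)
    · rw [Submodule.mem_bot]
      have := congrArg φ hc
      rw [map_sum, map_zero] at this
      rw [← this]
      exact Finset.sum_congr rfl fun s _ => (map_smul φ _ _).symm
  · intro s
    have h1 := T.homog_of_leading (hu s)
    have h2 := hproj (u s) (ω s)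
    rw [h1.wproj_eq] at h2
    rw [hφ h2]
    exact homog_wproj _ _
  · rw [eq_top_iff]
    intro x _
    obtain ⟨t, ht⟩ := exists_sum_wproj (wt := wt') x
    rw [ht]
    refine sum_mem fun μ _ => ?_
    obtain ⟨n, hn⟩ := T.exists_mem_flag (hwt _ _ (homog_wproj x μ))
    exact Submodule.span_mono (Set.image_subset_range _ _) (hker _ _ _ hn)
  · intro μ
    exact (T.fin μ).preimage Subtype.val_injective.injOn
  · intro s s' h1 h2
    exact Subtype.ext (T.inj _ _ h1 h2)
  · intro l s
    have hle : (flag v ω h (ω s) (h s)).comap φ ≤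
        Submodule.span k (u '' {s' | ω s' = ω s ∧ h s' < h s}) := fun x hx => hker _ _ _ hx
    refine spanK_mono j hle (extMap_mem_spanK.mp ?_)
    rw [map_sub, map_smul, hD, extMap_bext]
    have hsplit : φ (u s) = v s + (φ (u s) - v s) := by abel
    rw [hsplit, hadd, bext_add, smul_add]
    have h1 := T.tri l s
    have h2 := T.map_flag hadd hsmul l (hu s)
    have h3 := Submodule.smul_mem _ (F s l) (bext_mem_spanK (j := j).mpr (hu s))
    rw [add_sub_add_comm]
    exact add_mem h1 (sub_mem h2 h3)

/-- A quotient has a triangular basis indexed by the non-leading indices of the kernel. -/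
theorem quot (T : IsTriang j wt D v ω F h) (π : (B →₀ k) →ₗ[k] (B' →₀ k))
    (hπ : Function.Surjective π)
    (hwt : ∀ x μ, Homog wt x μ → Homog wt' (π x) μ)
    (hD : ∀ l x, extMap j π (D l x) = D' l (π x)) :
    IsTriang j wt' D' (fun s : {s // s ∉ leading v ω h (LinearMap.ker π)} => π (v s))
      (fun s => ω s) (fun s => F s) (fun s => h s) := by
  classical
  set W := LinearMap.ker π with hW
  have hproj := wproj_map (wt := wt) (wt' := wt') π hwt
  have hWg : ∀ x ∈ W, ∀ μ, wproj wt μ x ∈ W := by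
    intro x hx μ
    rw [hW, LinearMap.mem_ker] at hx ⊢
    rw [← hproj, hx, map_zero]
  have hspan : ∀ n μ x, x ∈ flag v ω h μ n → π x ∈ Submodule.span k
      ((fun s : {s // s ∉ leading v ω h W} => π (v s)) '' {s | ω s = μ ∧ h s < n}) := by
    intro n
    induction n using Nat.strong_induction_on with
    | _ n ih =>
      intro μ x hx
      induction hx using Submodule.span_induction with
      | mem x hx =>
        obtain ⟨s, ⟨rfl, hs⟩, rfl⟩ := hx
        by_cases hl : s ∈ leading v ω h W
        · obtain ⟨w, hw, hws⟩ := hl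
          have h1 := ih _ hs _ _ hws
          rw [map_sub, LinearMap.mem_ker.mp hw, zero_sub, neg_mem_iff] at h1
          refine Submodule.span_mono (Set.image_mono ?_) h1
          intro s' hs'
          exact ⟨hs'.1, hs'.2.trans hs⟩
        · exact Submodule.subset_span ⟨⟨s, hl⟩, ⟨rfl, hs⟩, rfl⟩
      | zero => rw [map_zero]; exact zero_mem _
      | add x y _ _ hx hy => rw [map_add]; exact add_mem hx hy
      | smul c x _ hx => rw [map_smul]; exact Submodule.smul_mem _ _ hx
  refine ⟨?_, ?_, ?_, ?_, ?_, ?_⟩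
  · rw [linearIndependent_iff']
    intro t c hc
    refine T.independent_mod hWg (ρ := fun s : {s // s ∉ leading v ω h W} => (s : S))
      Subtype.val_injective (u := fun s => v s) (fun s => s.2) ?_ t c ?_
    · intro s
      rw [sub_self]
      exact zero_mem _
    · refine LinearMap.mem_ker.mpr ?_
      rw [map_sum, ← hc]
      exact Finset.sum_congr rfl fun s _ => map_smul π _ _
  · intro s
    exact hwt _ _ (T.homog s)
  · rw [eq_top_iff]
    intro y _
    obtain ⟨x, rfl⟩ := hπ y
    obtain ⟨t, ht⟩ := exists_sum_wproj (wt := wt) x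
    rw [ht, map_sum]
    refine sum_mem fun μ _ => ?_
    obtain ⟨n, hn⟩ := T.exists_mem_flag (homog_wproj (wt := wt) x μ)
    exact Submodule.span_mono (Set.image_subset_range _ _) (hspan _ _ _ hn)
  · intro μ
    exact (T.fin μ).preimage Subtype.val_injective.injOn
  · intro s s' h1 h2
    exact Subtype.ext (T.inj _ _ h1 h2)
  · intro l s
    rw [← hD, ← extMap_bext, ← map_smul, ← map_sub]
    refine spanK_mono j ?_ (extMap_mem_map (T.tri l s))
    rintro _ ⟨x, hx, rfl⟩
    exact hspan _ _ _ hx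

end IsTriang

end TriangularBases

end EllipticO
end

noncomputable section
namespace EllipticO

section Fibers

variable {k K : Type} [Field k] [Field K] {j : k →+* K} {ι G B : Type}

theorem coe_basis_linearIndependent {k M I : Type} [Field k] [AddCommGroup M] [Module k M]
    {p : Submodule k M} (b : Module.Basis I k p) : LinearIndependent k fun a => (b a : M) :=
  b.linearIndependent.map' p.subtype (Submodule.ker_subtype _)

theorem coe_basis_span {k M I : Type} [Field k] [AddCommGroup M] [Module k M]
    {p : Submodule k M} (b : Module.Basis I k p) {x : M} (hx : x ∈ p) :
    x ∈ Submodule.span k (Set.range fun a => (b a : M)) := by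
  have h2 := Submodule.mem_map_of_mem (f := p.subtype) (b.mem_span ⟨x, hx⟩)
  rw [Submodule.map_span, ← Set.range_comp] at h2
  exact h2

/-- Linearly independent families of different degrees are jointly linearly independent. -/
theorem linearIndependent_sigma {wt : B → G} {n : G → Type} {u : ∀ μ, n μ → B →₀ k}
    (hli : ∀ μ, LinearIndependent k (u μ)) (hw : ∀ μ a, Homog wt (u μ a) μ) :
    LinearIndependent k fun s : Σ μ, n μ => u s.1 s.2 := by
  classical
  rw [linearIndependent_iff']
  intro t c hc ⟨μ, a⟩ ha
  have h1 := congrArg (wproj wt μ) hc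
  rw [map_zero, map_sum] at h1
  have h2 := hli μ
  rw [linearIndependent_iff'] at h2
  refine h2 (t.preimage (Sigma.mk μ) sigma_mk_injective.injOn) (fun a => c ⟨μ, a⟩) ?_ a
    (Finset.mem_preimage.mpr ha)
  rw [← h1, ← Finset.sum_preimage (Sigma.mk μ) t sigma_mk_injective.injOn
    fun s => wproj wt μ (c s • u s.1 s.2)]
  · refine Finset.sum_congr rfl fun a _ => ?_
    rw [map_smul, (hw μ a).wproj_eq]
  · rintro ⟨ν, a⟩ _ hs
    have hne : ν ≠ μ := fun h => hs (by subst h; exact Set.mem_range_self _)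
    rw [map_smul, (hw ν a).wproj_eq_zero hne, smul_zero]

/-- Triangular bases of the weight spaces give a triangular basis. -/
theorem isTriang_sigma {wt : B → G} {D : ι → (B →₀ k) → (B →₀ K)} {n : G → ℕ}
    (u : ∀ μ, Fin (n μ) → B →₀ k) {F : (Σ μ, Fin (n μ)) → ι → K}
    (hli : ∀ μ, LinearIndependent k (u μ)) (hw : ∀ μ a, Homog wt (u μ a) μ)
    (hsp : ∀ μ x, Homog wt x μ → x ∈ Submodule.span k (Set.range (u μ)))
    (htri : ∀ μ l s, ∃ c : Fin (n μ) → K, (∀ r, s < r → c r = 0) ∧ c s = F ⟨μ, s⟩ l ∧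
      D l (u μ s) = ∑ r, c r • bext j (u μ r)) :
    IsTriang j wt D (fun s : Σ μ, Fin (n μ) => u s.1 s.2) (fun s => s.1) F (fun s => s.2) := by
  refine ⟨linearIndependent_sigma hli hw, fun s => hw s.1 s.2, ?_, ?_, ?_, ?_⟩
  · rw [eq_top_iff]
    intro x _
    obtain ⟨t, ht⟩ := exists_sum_wproj (wt := wt) x
    rw [ht]
    refine sum_mem fun μ _ => ?_
    refine Submodule.span_mono ?_ (hsp μ _ (homog_wproj x μ))
    rintro _ ⟨a, rfl⟩
    exact ⟨⟨μ, a⟩, rfl⟩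
  · intro μ
    refine (Set.finite_range fun a : Fin (n μ) => (⟨μ, a⟩ : Σ μ, Fin (n μ))).subset ?_
    rintro ⟨ν, a⟩ rfl
    exact ⟨a, rfl⟩
  · rintro ⟨μ, a⟩ ⟨ν, a'⟩ rfl h
    exact congrArg _ (Fin.ext h)
  · rintro l ⟨μ, s⟩
    obtain ⟨c, hc, hcs, hD⟩ := htri μ l s
    rw [hD, ← Finset.add_sum_erase _ _ (Finset.mem_univ s), hcs, add_sub_cancel_left]
    refine sum_mem fun r hr => ?_
    rcases lt_or_gt_of_ne (Finset.ne_of_mem_erase hr) with hlt | hlt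
    · refine Submodule.smul_mem _ _ (bext_mem_spanK.mpr (Submodule.subset_span ?_))
      exact ⟨⟨μ, r⟩, ⟨rfl, hlt⟩, rfl⟩
    · rw [hc r hlt, zero_smul]
      exact zero_mem _

end Fibers

namespace PreMod

variable {N : ℕ} (τ ħ : ℂ) (X : PreMod N)

/-- The quantum minors as semilinear operators. -/
def qminor (l : Fin N) (x : X.V) : X.B →₀ MZ N :=
  Theta τ (l + 1) (0 : H N) • muL (frameZ N) ħ X.wt (Theta τ (l + 1) (0 : H N))⁻¹
    (X.alt ħ l.2 (bext (ofH N) x))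

theorem ext_eq (x : X.V) : X.ext x = bext (ofH N) x := rfl

variable {X} in
theorem HasWt.alt {k : ℕ} (hk : k ≤ N) {x : X.B →₀ MZ N} {μ : H N} (h : X.HasWt x μ) :
    X.HasWt (X.alt ħ hk x) μ := h.altWord_self (frameZ N) ħ (ptZ N) (topIdx hk)

theorem minor_ext (l : Fin N) {x : X.V} {μ : H N} (h : X.HasWt x μ) :
    X.minor τ ħ (l + 1) μ (X.ext x) = X.qminor τ ħ l x := by
  have hw : X.HasWt (X.alt ħ l.2 (bext (ofH N) x)) μ := (h.bext (ofH N)).alt ħ l.2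
  rw [minor_eq τ ħ X l.2, qminor, hw.muL_eq, smul_smul, ext_eq]
  congr 1
  rw [div_eq_mul_inv]
  congr 1
  rw [map_inv₀]
  congr 1
  have := theta_shift τ (l + 1) (ħ • μ) 0
  rw [add_zero] at this
  exact this.symm

/-- The twist of scalars by the quantum minors. -/
def minorTwist (N : ℕ) (ħ : ℂ) (l : Fin N) : MH N →+* MZ N :=
  ((frameZ N).T (ħ • minorWt N (l + 1))).comp (ofH N)

theorem qminor_add (l : Fin N) (x y : X.V) :
    X.qminor τ ħ l (x + y) = X.qminor τ ħ l x + X.qminor τ ħ l y := by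
  rw [qminor, bext_add, alt, altWord_add, muL_add, smul_add]
  rfl

theorem qminor_smul (l : Fin N) (a : MH N) (x : X.V) :
    X.qminor τ ħ l (a • x) = minorTwist N ħ l a • X.qminor τ ħ l x := by
  rw [qminor, bext_smul, alt, altWord_smul, sum_topIdx, muL_smul, smul_comm]
  rfl

/-- The product `f_N(z) f_{N-1}(z+ħ) ⋯`. -/
def diagProd (ħ : ℂ) (l : Fin N) (f : Fin N → MCˣ) : MC :=
  ∏ t : Fin N, if t ≤ l then shift (((t : ℕ) : ℂ) * ħ) (f (Fin.rev t) : MC) else 1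

/-- The homogeneous basis `v` makes the quantum minors triangular. -/
abbrev Tri {S : Type} (v : S → X.V) (ω : S → H N) (f : S → Fin N → MCˣ) (h : S → ℕ) : Prop :=
  IsTriang (ofH N) X.wt (X.qminor τ ħ) v ω (fun s l => ofC N (diagProd ħ l (f s))) h

theorem exists_combination {k K B : Type} [Field k] [Field K] {j : k →+* K} {n : ℕ}
    (v : Fin n → B →₀ k) (A : Set (Fin n)) {y : B →₀ K}
    (hy : y ∈ spanK j (Submodule.span k (v '' A))) :
    ∃ c : Fin n → K, (∀ r, r ∉ A → c r = 0) ∧ y = ∑ r, c r • bext j (v r) := by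
  rw [spanK_span, Set.image_image, Finsupp.mem_span_image_iff_linearCombination] at hy
  obtain ⟨c, hc, rfl⟩ := hy
  refine ⟨c, fun r hr => ?_, ?_⟩
  · exact (Finsupp.mem_supported' K c).mp hc r hr
  · rw [Finsupp.linearCombination_apply, Finsupp.sum_fintype]
    intro r
    rw [zero_smul]

variable {X τ ħ}

theorem Tri.exists_isTri {S : Type} {v : S → X.V} {ω : S → H N} {f : S → Fin N → MCˣ} {h : S → ℕ}
    (T : X.Tri τ ħ v ω f h) (μ : H N) : ∃ (n : ℕ) (e : Fin n ≃ {s // ω s = μ})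
      (b : Module.Basis (Fin n) (MH N) (X.wtSpace μ)), X.IsTri τ ħ μ b (fun a => f (e a)) := by
  obtain ⟨n, e, he⟩ := exists_fin_fiber (T.fin μ) h
  have hmem : ∀ a, v (e a) ∈ X.wtSpace μ := by
    intro a
    rw [mem_wtSpace_iff]
    have := T.homog (e a)
    rwa [(e a).2] at this
  have hli : LinearIndependent (MH N) fun a => (⟨v (e a), hmem a⟩ : X.wtSpace μ) := by
    refine LinearIndependent.of_comp (X.wtSpace μ).subtype ?_
    exact T.li.comp (fun a => (e a : S)) (Subtype.val_injective.comp e.injective)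
  have hsp : ⊤ ≤ Submodule.span (MH N)
      (Set.range fun a => (⟨v (e a), hmem a⟩ : X.wtSpace μ)) := by
    rintro ⟨x, hx⟩ -
    have h1 := mem_span_fiber T.homog T.span ((X.mem_wtSpace_iff).mp hx)
    have hset : v '' {s | ω s = μ} = (X.wtSpace μ).subtype ''
        (Set.range fun a => (⟨v (e a), hmem a⟩ : X.wtSpace μ)) := by
      rw [← Set.range_comp]
      ext y
      constructor
      · rintro ⟨s, hs, rfl⟩
        exact ⟨e.symm ⟨s, hs⟩, by simp⟩
      · rintro ⟨a, rfl⟩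
        exact ⟨e a, (e a).2, rfl⟩
    rw [hset, ← Submodule.map_span] at h1
    obtain ⟨y, hy, hyx⟩ := h1
    have : y = ⟨x, hx⟩ := Subtype.ext hyx
    rwa [← this]
  let b := Module.Basis.mk hli hsp
  have hb : ∀ a, ((b a : X.wtSpace μ) : X.V) = v (e a) := fun a => by
    rw [Module.Basis.mk_apply]
  refine ⟨n, e, b, fun l => ?_⟩
  have htri : ∀ a, X.qminor τ ħ l (v (e a)) - ofC N (diagProd ħ l (f (e a))) • bext (ofH N) (v (e a)) ∈
      spanK (ofH N) (Submodule.span (MH N) ((fun a => v (e a)) '' Set.Iio a)) := by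
    intro a
    refine spanK_mono _ (Submodule.span_mono ?_) (T.tri l (e a))
    rintro _ ⟨s', ⟨hω, hlt⟩, rfl⟩
    refine ⟨e.symm ⟨s', hω.trans (e a).2⟩, he _ _ ?_, ?_⟩
    · rw [Equiv.apply_symm_apply]; exact hlt
    · beta_reduce; rw [Equiv.apply_symm_apply]
  choose c hc hcs using fun a => exists_combination (fun a => v (e a)) _ (htri a)
  refine ⟨fun r s => (if r = s then ofC N (diagProd ħ l (f (e s))) else 0) + c s r, ?_, ?_, ?_⟩
  · intro r s hrs
    beta_reduce
    rw [if_neg hrs.ne', hc s r (by rw [Set.mem_Iio]; exact hrs.not_gt), add_zero]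
  · intro s
    beta_reduce
    rw [if_pos rfl, hc s s (by rw [Set.mem_Iio]; exact lt_irrefl s), add_zero]
    rfl
  · intro s
    have hw : X.HasWt (b s : X.V) μ := X.mem_wtSpace_iff.mp (b s).2
    rw [minor_ext τ ħ X l hw]
    simp only [add_smul, Finset.sum_add_distrib, ite_smul, zero_smul, Finset.sum_ite_eq',
      Finset.mem_univ, if_true, hb, ext_eq]
    rw [← hcs s]
    abel

/-- Triangular bases of the weight spaces give a triangular basis. -/
theorem tri_of_isTri {n : H N → ℕ} {b : ∀ μ, Module.Basis (Fin (n μ)) (MH N) (X.wtSpace μ)}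
    {f : ∀ μ, Fin (n μ) → Fin N → MCˣ} (hb : ∀ μ, X.IsTri τ ħ μ (b μ) (f μ)) :
    X.Tri τ ħ (fun s : Σ μ, Fin (n μ) => (b s.1 s.2 : X.V)) (fun s => s.1)
      (fun s => f s.1 s.2) (fun s => s.2) := by
  refine isTriang_sigma (fun μ a => (b μ a : X.V)) (fun μ => coe_basis_linearIndependent (b μ))
    (fun μ a => X.mem_wtSpace_iff.mp (b μ a).2)
    (fun μ x hx => coe_basis_span (b μ) (X.mem_wtSpace_iff.mpr hx)) ?_
  intro μ l s
  obtain ⟨U, hU, hUd, hUs⟩ := hb μ l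
  have hw : X.HasWt (b μ s : X.V) μ := X.mem_wtSpace_iff.mp (b μ s).2
  refine ⟨fun r => U r s, fun r hr => hU r s hr, hUd s, ?_⟩
  rw [← minor_ext τ ħ X l hw]
  exact hUs s

theorem inO_iff : X.InO τ ħ ↔ X.IsRep τ ħ ∧ InCones X.wts ∧
    ∃ (S : Type) (v : S → X.V) (ω : S → H N) (f : S → Fin N → MCˣ) (h : S → ℕ),
      X.Tri τ ħ v ω f h := by
  constructor
  · rintro ⟨h1, h2, h3⟩
    choose n b f hb using h3
    exact ⟨h1, h2, _, _, _, _, _, tri_of_isTri hb⟩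
  · rintro ⟨h1, h2, S, v, ω, f, h, T⟩
    refine ⟨h1, h2, fun μ => ?_⟩
    obtain ⟨n, e, b, hb⟩ := T.exists_isTri μ
    exact ⟨n, b, _, hb⟩

end PreMod

/-! ### Uniqueness of the q-character -/

section Constants

variable {N : ℕ} {ħ : ℂ}

theorem PreMod.diagProd_ne_zero (l : Fin N) (f : Fin N → MCˣ) : PreMod.diagProd ħ l f ≠ 0 := by
  refine Finset.prod_ne_zero_iff.mpr fun t _ => ?_
  split_ifs
  · exact (map_ne_zero _).mpr (Units.ne_zero _)
  · exact one_ne_zero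

theorem PreMod.diagProd_eq (l : Fin N) (f : Fin N → MCˣ) : PreMod.diagProd ħ l f =
    ∏ t ∈ Finset.Iic l, shift (((t : ℕ) : ℂ) * ħ) (f (Fin.rev t) : MC) := by
  rw [PreMod.diagProd, ← Finset.prod_filter]
  refine Finset.prod_congr ?_ fun _ _ => rfl
  ext t
  simp

theorem PreMod.minorWt_self : PreMod.minorWt N N = 0 := by
  refine Subtype.ext (funext fun t => ?_)
  have h1 : ∀ i : Fin N, (if N - N ≤ (i : ℕ) then (ε i : H N) else 0) = ε i := fun i =>
    if_pos (by omega)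
  rw [PreMod.minorWt, Finset.sum_congr rfl fun i _ => h1 i, AddSubmonoidClass.coe_finsetSum,
    Finset.sum_apply]
  simp only [ε_apply]
  have hN : (N : ℂ) ≠ 0 := by
    have : NeZero N := ⟨fun h => by subst h; exact t.elim0⟩
    exact NeZero.ne _
  rw [Finset.sum_sub_distrib]
  simp [hN]

/-- Two tuples with the same eigenvalues of the quantum minors up to rescaling of eigenvectors
have the same class. -/
theorem mk_eq_of_rescale {f f' : Fin N → MCˣ} {a a' : MH N} (ha : a ≠ 0) (ha' : a' ≠ 0)
    (h : ∀ l, PreMod.minorTwist N ħ l a * ofC N (PreMod.diagProd ħ l f) * ofH N a' =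
      PreMod.minorTwist N ħ l a' * ofC N (PreMod.diagProd ħ l f') * ofH N a) :
    MGrp.mk f = MGrp.mk f' := by
  rcases N.eq_zero_or_pos with rfl | hN
  · rw [Subsingleton.elim f f']
  let q : Fin N → MC := fun t => (f' (Fin.rev t) : MC) / (f (Fin.rev t) : MC)
  have hq0 : ∀ t, q t ≠ 0 := fun t => div_ne_zero (Units.ne_zero _) (Units.ne_zero _)
  have hG : ∀ l : Fin N, PreMod.diagProd ħ l f' / PreMod.diagProd ħ l f =
      ∏ t ∈ (Finset.Iic l : Finset (Fin N)), shift (((t : ℕ) : ℂ) * ħ) (q t) := by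
    intro l
    rw [PreMod.diagProd_eq, PreMod.diagProd_eq, ← Finset.prod_div_distrib]
    exact Finset.prod_congr rfl fun t _ => (map_div₀ _ _ _).symm
  have htw : ∀ (l : Fin N) (g : MH N), PreMod.minorTwist N ħ l g =
      ofH N (shift (ħ • PreMod.minorWt N (l + 1)) g) := fun l g => (ofH_shift _ _).symm
  have hconst : ∀ l : Fin N, ∃ c : ℂ, ∏ t ∈ (Finset.Iic l : Finset (Fin N)), shift (((t : ℕ) : ℂ) * ħ) (q t) =
      algebraMap ℂ MC c := by
    intro l
    rw [← hG]
    refine exists_const_of_ofC_eq_ofH (N := N)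
      (p := shift (ħ • PreMod.minorWt N (l + 1)) a * a' /
        (shift (ħ • PreMod.minorWt N (l + 1)) a' * a)) ?_
    have h1 := h l
    rw [htw, htw] at h1
    rw [map_div₀, map_div₀, map_mul, map_mul, div_eq_div_iff]
    · linear_combination -h1
    · exact (map_ne_zero _).mpr (PreMod.diagProd_ne_zero l f)
    · exact mul_ne_zero ((map_ne_zero _).mpr ((map_ne_zero _).mpr ha')) ((map_ne_zero _).mpr ha)
  have hqc : ∀ (n : ℕ) (t : Fin N), (t : ℕ) = n → ∃ c : ℂ, q t = algebraMap ℂ MC c := by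
    intro n
    induction n using Nat.strong_induction_on with
    | _ n ih =>
      intro t ht
      have hlow : ∃ c : ℂ, ∏ s ∈ (Finset.Iio t : Finset (Fin N)), shift (((s : ℕ) : ℂ) * ħ) (q s) =
          algebraMap ℂ MC c := by
        choose! d hd using fun (s : Fin N) (hs : s ∈ Finset.Iio t) =>
          ih s (by rw [← ht]; exact Fin.lt_def.mp (Finset.mem_Iio.mp hs)) s rfl
        refine ⟨∏ s ∈ Finset.Iio t, d s, ?_⟩
        rw [map_prod]
        refine Finset.prod_congr rfl fun s hs => ?_
        rw [hd s hs, shift_const]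
      obtain ⟨c, hc⟩ := hconst t
      obtain ⟨c', hc'⟩ := hlow
      rw [← Finset.Iio_insert, Finset.prod_insert (by simp), hc'] at hc
      have hc0 : algebraMap ℂ MC c' ≠ 0 := by
        rw [← hc']
        exact Finset.prod_ne_zero_iff.mpr fun s _ => (map_ne_zero _).mpr (hq0 s)
      refine ⟨c / c', ?_⟩
      refine shift_injective (((t : ℕ) : ℂ) * ħ) ?_
      rw [shift_const, map_div₀ (algebraMap ℂ MC), eq_div_iff hc0]
      exact hc
  choose c hc using fun t => hqc (t : Fin N) t rfl
  have hc0 : ∀ t, c t ≠ 0 := fun t h0 => hq0 t (by rw [hc, h0, map_zero])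
  have hprod : ∏ t, c t = 1 := by
    let l : Fin N := ⟨N - 1, by omega⟩
    have h1 := h l
    have hl : ((l : ℕ) + 1) = N := by change N - 1 + 1 = N; omega
    rw [htw, htw, hl, PreMod.minorWt_self, smul_zero, shift_zero, shift_zero] at h1
    have h2 : PreMod.diagProd ħ l f = PreMod.diagProd ħ l f' := by
      refine (ofC N).injective ?_
      refine mul_left_cancel₀ (mul_ne_zero ((map_ne_zero (ofH N)).mpr ha)
        ((map_ne_zero (ofH N)).mpr ha')) ?_
      linear_combination h1
    have h3 := hG l
    rw [h2, div_self (PreMod.diagProd_ne_zero l f')] at h3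
    have h4 : Finset.Iic l = Finset.univ := by
      ext t
      simp only [Finset.mem_Iic, Finset.mem_univ, iff_true]
      exact Fin.mk_le_mk.mpr (by omega)
    refine (algebraMap ℂ MC).injective ?_
    rw [map_prod, map_one, h3, h4]
    refine Finset.prod_congr rfl fun t _ => ?_
    rw [hc, shift_const]
  refine QuotientGroup.eq.mpr ⟨fun i => Units.mk0 (c (Fin.rev i)) (hc0 _), ?_, fun i => ?_⟩
  · refine Units.ext ?_
    rw [Units.coe_prod, Units.val_one, ← hprod]
    exact Equiv.prod_comp Fin.revPerm c
  · refine Units.ext ?_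
    have h1 := hc (Fin.rev i)
    simp only [q, Fin.rev_rev] at h1
    change ((f i)⁻¹ : MCˣ) * (f' i : MC) = algebraMap ℂ MC (c (Fin.rev i))
    rw [← h1, div_eq_mul_inv, mul_comm, Units.val_inv_eq_inv_val]

end Constants

section QChar

variable {N : ℕ} {τ ħ : ℂ} {X : PreMod N}

theorem EWt.mk_eq_iff {f : Fin N → MCˣ} {μ ν : H N} {g : MGrp N} :
    EWt.mk f μ = (Additive.ofMul g, ν) ↔ MGrp.mk f = g ∧ μ = ν := by
  rw [EWt.mk, Prod.mk.injEq]
  rfl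

/-- The number of vectors with a given e-weight does not depend on the triangular basis. -/
theorem PreMod.Tri.card_eq {S S' : Type} {v : S → X.V} {ω : S → H N} {f : S → Fin N → MCˣ}
    {h : S → ℕ} (T : X.Tri τ ħ v ω f h) {v' : S' → X.V} {ω' : S' → H N} {f' : S' → Fin N → MCˣ}
    {h' : S' → ℕ} (T' : X.Tri τ ħ v' ω' f' h') (a : EWt N) :
    Nat.card {s // EWt.mk (f s) (ω s) = a} = Nat.card {s // EWt.mk (f' s) (ω' s) = a} := by
  obtain ⟨g, μ⟩ := a
  obtain ⟨π, hπ⟩ := T.exists_equiv T' (PreMod.minorTwist N ħ) (X.qminor_add τ ħ)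
    (X.qminor_smul τ ħ) μ
  have hmk : ∀ s : {s // ω s = μ}, MGrp.mk (f s) = MGrp.mk (f' (π s)) := by
    intro s
    obtain ⟨a, a', ha, ha', hl⟩ := hπ s
    exact mk_eq_of_rescale ha ha' hl
  have e : ∀ {S : Type} {ω : S → H N} {f : S → Fin N → MCˣ},
      Nat.card {s // EWt.mk (f s) (ω s) = (g, μ)} =
        Nat.card {s : {s // ω s = μ} // MGrp.mk (f s) = Additive.toMul g} := by
    intro S ω f
    refine Nat.card_congr ⟨fun s => ⟨⟨s, (EWt.mk_eq_iff.mp s.2).2⟩, (EWt.mk_eq_iff.mp s.2).1⟩,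
      fun s => ⟨s, EWt.mk_eq_iff.mpr ⟨s.2, s.1.2⟩⟩, fun _ => rfl, fun _ => rfl⟩
  rw [e, e]
  refine Nat.card_congr (π.subtypeEquiv fun s => ?_)
  rw [hmk]

theorem isQChar_iff {S : Type} {v : S → X.V} {ω : S → H N} {f : S → Fin N → MCˣ}
    {h : S → ℕ} (T : X.Tri τ ħ v ω f h) (χ : QRing N) :
    IsQChar τ ħ X χ ↔ ∀ a, χ.coeff a = Nat.card {s // EWt.mk (f s) (ω s) = a} := by
  constructor
  · intro hχ
    choose n b f' hb hc using hχ
    rintro ⟨g, μ⟩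
    have h1 := hc μ (Additive.toMul g)
    rw [ofMul_toMul] at h1
    rw [h1, T.card_eq (PreMod.tri_of_isTri hb) (g, μ), Nat.cast_inj]
    refine Nat.card_congr (Equiv.ofBijective (fun s : {s // MGrp.mk (f' μ s) = Additive.toMul g} =>
      (⟨⟨μ, s.1⟩, EWt.mk_eq_iff.mpr ⟨s.2, rfl⟩⟩ :
        {s : Σ μ, Fin (n μ) // EWt.mk (f' s.1 s.2) s.1 = (g, μ)})) ⟨?_, ?_⟩)
    · intro s s' h
      exact Subtype.ext (eq_of_heq (Sigma.mk.inj (Subtype.mk.inj h)).2)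
    · rintro ⟨⟨ν, s⟩, hs⟩
      obtain ⟨hm, hw⟩ := EWt.mk_eq_iff.mp hs
      dsimp only at hm hw
      subst hw
      exact ⟨⟨s, hm⟩, rfl⟩
  · intro hχ μ
    obtain ⟨n, e, b, hb⟩ := T.exists_isTri μ
    refine ⟨n, b, _, hb, fun g => ?_⟩
    rw [hχ, Nat.cast_inj]
    refine Nat.card_congr ⟨fun s => ⟨e.symm ⟨s, (EWt.mk_eq_iff.mp s.2).2⟩, ?_⟩,
      fun s => ⟨e s, EWt.mk_eq_iff.mpr ⟨s.2, (e s).2⟩⟩, fun s => ?_, fun s => ?_⟩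
    · rw [Equiv.apply_symm_apply]
      exact (EWt.mk_eq_iff.mp s.2).1
    · exact Subtype.ext (by simp)
    · exact Subtype.ext (by simp)

theorem exists_isQChar {S : Type} {v : S → X.V} {ω : S → H N} {f : S → Fin N → MCˣ}
    {h : S → ℕ} (T : X.Tri τ ħ v ω f h) (hX : InCones X.wts) : ∃ χ, IsQChar τ ħ X χ := by
  have hpos : ∀ a : EWt N, (Nat.card {s // EWt.mk (f s) (ω s) = a} : ℤ) ≠ 0 →
      ∃ s, EWt.mk (f s) (ω s) = a := by
    intro a ha
    rw [Nat.cast_ne_zero, Nat.card_ne_zero] at ha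
    obtain ⟨⟨s, hs⟩⟩ := ha.1
    exact ⟨s, hs⟩
  have hωwt : ∀ s, ω s ∈ X.wts := by
    intro s
    obtain ⟨b, hb⟩ := Finsupp.ne_iff.mp (T.li.ne_zero s)
    exact ⟨b, T.homog s b hb⟩
  refine ⟨⟨fun a => Nat.card {s // EWt.mk (f s) (ω s) = a}, fun μ => ?_, ?_⟩, ?_⟩
  · refine ((T.fin μ).image fun s => EWt.mk (f s) (ω s)).subset ?_
    rintro a ⟨rfl, ha⟩
    obtain ⟨s, rfl⟩ := hpos a ha
    exact ⟨s, rfl, rfl⟩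
  · obtain ⟨C, hC⟩ := hX
    refine ⟨C, ?_⟩
    rintro _ ⟨a, rfl, ha⟩
    obtain ⟨s, rfl⟩ := hpos a ha
    exact hC _ (hωwt s)
  · exact (isQChar_iff T _).mpr fun a => rfl

theorem existsUnique_isQChar (hX : X.InO τ ħ) : ∃! χ, IsQChar τ ħ X χ := by
  obtain ⟨-, hc, S, v, ω, f, h, T⟩ := PreMod.inO_iff.mp hX
  obtain ⟨χ, hχ⟩ := exists_isQChar T hc
  refine ⟨χ, hχ, fun χ' hχ' => ?_⟩
  ext a
  rw [(isQChar_iff T χ).mp hχ a, (isQChar_iff T χ').mp hχ' a]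

theorem isQChar_qc (hX : X.InO τ ħ) : IsQChar τ ħ X (qc τ ħ X) := by
  have h := (existsUnique_isQChar hX).exists
  rw [qc, dif_pos h]
  exact h.choose_spec

theorem qc_coeff (hX : X.InO τ ħ) {S : Type} {v : S → X.V} {ω : S → H N} {f : S → Fin N → MCˣ}
    {h : S → ℕ} (T : X.Tri τ ħ v ω f h) (a : EWt N) :
    (qc τ ħ X).coeff a = Nat.card {s // EWt.mk (f s) (ω s) = a} :=
  (isQChar_iff T _).mp (isQChar_qc hX) a

end QChar

end EllipticO
end

noncomputable section
namespace EllipticO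

section WeightFibers

variable {N : ℕ} {S S' : Type} {ω : S → H N} {ω' : S' → H N}

theorem finite_pairs_of_inCones (hc : InCones (Set.range ω)) (hc' : InCones (Set.range ω'))
    (hf : ∀ μ, {s | ω s = μ}.Finite) (hf' : ∀ μ, {s | ω' s = μ}.Finite) (μ : H N) :
    {p : S × S' | ω p.1 + ω' p.2 = μ}.Finite := by
  obtain ⟨C, hC⟩ := hc
  obtain ⟨C', hC'⟩ := hc'
  have hfin : (⋃ ν ∈ C, ⋃ ν' ∈ C', ⋃ q ∈ Set.antidiagonal {x : DomH N | x.toH ∈ QPlus N}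
      {x : DomH N | x.toH ∈ QPlus N} (show DomH N from (ν + ν' - μ)),
      {s | ω s = ν - q.1.toH} ×ˢ {s | ω' s = ν' - q.2.toH}).Finite := by
    refine C.finite_toSet.biUnion fun ν _ => C'.finite_toSet.biUnion fun ν' _ => ?_
    refine Set.Finite.biUnion ?_ fun q _ => (hf _).prod (hf' _)
    exact Set.AddAntidiagonal.finite_of_isPWO (isPWO_QPlus N) (isPWO_QPlus N) _
  refine hfin.subset ?_
  rintro ⟨s, s'⟩ hp
  change ω s + ω' s' = μ at hp
  obtain ⟨ν, hν, h⟩ := hC (ω s) ⟨s, rfl⟩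
  obtain ⟨ν', hν', h'⟩ := hC' (ω' s') ⟨s', rfl⟩
  simp only [Set.mem_iUnion]
  refine ⟨ν, hν, ν', hν', ((ν - ω s : H N), (ν' - ω' s' : H N)), ⟨h, h', ?_⟩, ?_, ?_⟩
  · change (ν - ω s) + (ν' - ω' s') = ν + ν' - μ
    rw [← hp]
    abel
  · exact (sub_sub_cancel ν (ω s)).symm
  · exact (sub_sub_cancel ν' (ω' s')).symm

theorem inCones_add (hc : InCones (Set.range ω)) (hc' : InCones (Set.range ω')) :
    InCones (Set.range fun p : S × S' => ω p.1 + ω' p.2) := by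
  classical
  obtain ⟨C, hC⟩ := hc
  obtain ⟨C', hC'⟩ := hc'
  refine ⟨Finset.image₂ (· + ·) C C', ?_⟩
  rintro _ ⟨⟨s, s'⟩, rfl⟩
  obtain ⟨ν, hν, h⟩ := hC (ω s) ⟨s, rfl⟩
  obtain ⟨ν', hν', h'⟩ := hC' (ω' s') ⟨s', rfl⟩
  refine ⟨ν + ν', Finset.mem_image₂_of_mem hν hν', ?_⟩
  rw [add_sub_add_comm]
  exact add_mem h h'

theorem card_pairs {G : Type} [AddCommGroup G] {e : S → G} {e' : S' → G} (a : G)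
    (hfin : {p : S × S' | e p.1 + e' p.2 = a}.Finite) :
    (Nat.card {p : S × S' // e p.1 + e' p.2 = a} : ℤ) =
      ∑ᶠ g, (Nat.card {s // e s = g} : ℤ) * Nat.card {s // e' s = a - g} := by
  classical
  have hcard : ∀ g, Nat.card {s // e s = g} * Nat.card {s // e' s = a - g} =
      (hfin.toFinset.filter fun p => e p.1 = g).card := by
    intro g
    rw [← Nat.card_prod, ← Nat.card_eq_finsetCard]
    refine Nat.card_congr ⟨fun q => ⟨(q.1, q.2), ?_⟩, fun p => ⟨⟨p.1.1, ?_⟩, ⟨p.1.2, ?_⟩⟩,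
      fun _ => rfl, fun _ => rfl⟩
    · rw [Finset.mem_filter, Set.Finite.mem_toFinset]
      refine ⟨?_, q.1.2⟩
      change e q.1 + e' q.2 = a
      rw [q.1.2, q.2.2, add_sub_cancel]
    · exact (Finset.mem_filter.mp p.2).2
    · obtain ⟨h1, h2⟩ := Finset.mem_filter.mp p.2
      rw [Set.Finite.mem_toFinset] at h1
      refine eq_sub_of_add_eq' (Eq.trans ?_ h1)
      rw [h2]
  have hall : Nat.card {p : S × S' // e p.1 + e' p.2 = a} = hfin.toFinset.card := by
    rw [← Nat.card_eq_finsetCard]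
    exact Nat.card_congr (Equiv.subtypeEquivRight fun p => (hfin.mem_toFinset).symm)
  rw [finsum_eq_sum_of_support_subset (s := hfin.toFinset.image fun p => e p.1)]
  · simp only [← Nat.cast_mul, hcard]
    rw [← Nat.cast_sum, ← Finset.card_eq_sum_card_image, hall]
  · intro g hg
    rw [Function.mem_support, ← Nat.cast_mul, hcard, Nat.cast_ne_zero, Finset.card_ne_zero] at hg
    obtain ⟨p, hp⟩ := hg
    obtain ⟨h1, h2⟩ := Finset.mem_filter.mp hp
    exact Finset.mem_coe.mpr (Finset.mem_image.mpr ⟨p, h1, h2⟩)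

end WeightFibers

section TensorBases

variable {N : ℕ} {K : Type} [Field K] (F : Frame N K) (ħ : ℂ) {B C S S' : Type} {ω : C → H N}

open PreMod

theorem tens_mem_of_span {v : S → B →₀ K} {v' : S' → C →₀ K} {ω' : S' → H N}
    (hv' : ∀ t, Homog ω (v' t) (ω' t)) {A : Set S} {A' : Set S'} (P : Submodule K (B × C →₀ K))
    (hP : ∀ s ∈ A, ∀ t ∈ A', tens F ħ ω (v s) (v' t) ∈ P) {x : B →₀ K} {y : C →₀ K}
    (hx : x ∈ Submodule.span K (v '' A)) (hy : y ∈ Submodule.span K (v' '' A')) :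
    tens F ħ ω x y ∈ P := by
  induction hy using Submodule.span_induction with
  | zero => rw [tens_zero_right]; exact zero_mem _
  | add y y' _ _ h h' => rw [tens_add_right]; exact add_mem h h'
  | smul c y _ h => rw [tens_smul_right]; exact P.smul_mem _ h
  | mem y hy =>
    obtain ⟨t, ht, rfl⟩ := hy
    induction hx using Submodule.span_induction with
    | zero => rw [tens_zero_left]; exact zero_mem _
    | add y y' _ _ h h' => rw [tens_add_left]; exact add_mem h h'
    | mem x hx =>
      obtain ⟨s, hs, rfl⟩ := hx
      exact hP s hs t ht
    | smul c x _ h =>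
      have : muL F ħ ω c (v' t) = F.T (ħ • ω' t) c • v' t := by
        ext b
        rw [muL_apply, Finsupp.smul_apply, smul_eq_mul]
        by_cases hb : v' t b = 0
        · rw [hb, mul_zero, mul_zero]
        · rw [hv' t b hb]
      rw [tens_smul_left, this, tens_smul_right]
      exact P.smul_mem _ h

theorem span_tens {v : S → B →₀ K} {v' : S' → C →₀ K} {ω' : S' → H N}
    (hv' : ∀ t, Homog ω (v' t) (ω' t)) (hs : Submodule.span K (Set.range v) = ⊤)
    (hs' : Submodule.span K (Set.range v') = ⊤) :
    Submodule.span K (Set.range fun p : S × S' => tens F ħ ω (v p.1) (v' p.2)) = ⊤ := by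
  rw [eq_top_iff]
  intro x _
  induction x using Finsupp.induction_linear with
  | zero => exact zero_mem _
  | add x y hx hy => exact add_mem (hx trivial) (hy trivial)
  | single p a =>
    have h1 : Finsupp.single p a = tens F ħ ω (Finsupp.single p.1 1) (Finsupp.single p.2 a) := by
      rw [tens_single, map_one, one_mul]
    rw [h1]
    refine tens_mem_of_span F ħ hv' _ (A := Set.univ) (A' := Set.univ) ?_ (v := v) ?_ ?_
    · intro s _ t _
      exact Submodule.subset_span ⟨(s, t), rfl⟩
    · rw [Set.image_univ, hs]; trivial
    · rw [Set.image_univ, hs']; trivial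

theorem linearIndependent_tens {v : S → B →₀ K} {v' : S' → C →₀ K} {ω' : S' → H N}
    (hv' : ∀ t, Homog ω (v' t) (ω' t)) (hl : LinearIndependent K v)
    (hl' : LinearIndependent K v') :
    LinearIndependent K fun p : S × S' => tens F ħ ω (v p.1) (v' p.2) := by
  classical
  rw [linearIndependent_iff'']
  intro t c hct hc
  set A := t.image Prod.fst with hA
  set A' := t.image Prod.snd with hA'
  have hsub : t ⊆ A ×ˢ A' := fun p hp => Finset.mem_product.mpr
    ⟨Finset.mem_image_of_mem _ hp, Finset.mem_image_of_mem _ hp⟩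
  rw [Finset.sum_subset hsub fun p _ hp => by rw [hct p hp, zero_smul], Finset.sum_product] at hc
  have hcoord : ∀ b c', ∑ s ∈ A, ∑ s' ∈ A', c (s, s') * (F.T (ħ • ω' s') (v s b) * v' s' c') = 0 := by
    intro b c'
    have h1 := DFunLike.congr_fun hc (b, c')
    rw [Finsupp.finsetSum_apply] at h1
    rw [← Finsupp.zero_apply (a := (b, c')) (M := K), ← h1]
    refine Finset.sum_congr rfl fun s _ => ?_
    rw [Finsupp.finsetSum_apply]
    refine Finset.sum_congr rfl fun s' _ => ?_
    rw [Finsupp.smul_apply, smul_eq_mul, tens_apply]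
    by_cases h0 : v' s' c' = 0
    · simp only [h0, mul_zero]
    · rw [hv' s' c' h0]
  have hd : ∀ b, ∀ s' ∈ A', ∑ s ∈ A, c (s, s') * F.T (ħ • ω' s') (v s b) = 0 := by
    intro b
    rw [linearIndependent_iff'] at hl'
    refine hl' A' (fun s' => ∑ s ∈ A, c (s, s') * F.T (ħ • ω' s') (v s b)) ?_
    ext c'
    rw [Finsupp.finsetSum_apply, Finsupp.zero_apply, ← hcoord b c', Finset.sum_comm]
    refine Finset.sum_congr rfl fun s' _ => ?_
    rw [Finsupp.smul_apply, smul_eq_mul, Finset.sum_mul]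
    exact Finset.sum_congr rfl fun s _ => by ring
  rintro ⟨s, s'⟩
  by_cases hs : (s, s') ∈ t
  · have h1 := linearIndependent_bext (F.T (ħ • ω' s')) hl
    rw [linearIndependent_iff'] at h1
    refine h1 A (fun s => c (s, s')) ?_ s (Finset.mem_image_of_mem _ hs)
    ext b
    rw [Finsupp.finsetSum_apply, Finsupp.zero_apply, ← hd b s' (Finset.mem_image_of_mem _ hs)]
    rfl
  · exact hct _ hs

end TensorBases

/-- Functions of `λ`. -/
def frameH (N : ℕ) : Frame N (MH N) where
  T v := shift v
  T_zero f := shift_zero f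
  T_add u v f := by rw [shift_shift]
  j := RingHom.id _

namespace PreMod

variable {N : ℕ} {τ ħ : ℂ} {X Y : PreMod N}

theorem bext_tensv_frameH (x : X.V) (y : Y.V) :
    bext (ofH N) (tensv (frameH N) ħ X Y x y) =
      tensv (frameZ N) ħ X Y (bext (ofH N) x) (bext (ofH N) y) := by
  refine Finsupp.ext fun p => ?_
  obtain ⟨b, c, rfl⟩ := tpair_cases ħ p
  rw [bext_apply, tensv_apply, tensv_apply, map_mul]
  congr 1
  exact ofH_shift _ _

theorem HasWt.tensv {K : Type} [Field K] (F : Frame N K) {x : X.B →₀ K} {y : Y.B →₀ K} {μ ν : H N}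
    (hx : X.HasWt x μ) (hy : Y.HasWt y ν) :
    (tensor ħ X Y).HasWt (tensv F ħ X Y x y) (μ + ν) := by
  intro p hp
  obtain ⟨b, c, rfl⟩ := tpair_cases ħ p
  rw [tensv_apply] at hp
  rw [wt_tpair, hy c (right_ne_zero_of_mul hp), hx b]
  intro h0
  rw [h0, map_zero, zero_mul] at hp
  exact hp rfl

theorem diagProd_mul (l : Fin N) (f g : Fin N → MCˣ) :
    diagProd ħ l (f * g) = diagProd ħ l f * diagProd ħ l g := by
  rw [diagProd_eq, diagProd_eq, diagProd_eq, ← Finset.prod_mul_distrib]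
  refine Finset.prod_congr rfl fun t _ => ?_
  rw [Pi.mul_apply, Units.val_mul, map_mul]

section Triangular

variable {S S' : Type} {v : S → X.V} {ω : S → H N} {f : S → Fin N → MCˣ} {h : S → ℕ}
  {v' : S' → Y.V} {ω' : S' → H N} {f' : S' → Fin N → MCˣ} {h' : S' → ℕ}

theorem Tri.inCones (T : X.Tri τ ħ v ω f h) (hX : InCones X.wts) : InCones (Set.range ω) := by
  obtain ⟨C, hC⟩ := hX
  refine ⟨C, ?_⟩
  rintro _ ⟨s, rfl⟩
  obtain ⟨b, hb⟩ := Finsupp.ne_iff.mp (T.li.ne_zero s)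
  exact hC _ ⟨b, T.homog s b hb⟩

theorem Tri.mem_span_bext (T : X.Tri τ ħ v ω f h) {x : X.B →₀ MZ N} {μ : H N} (hx : X.HasWt x μ) :
    x ∈ Submodule.span (MZ N) ((fun s => bext (ofH N) (v s)) '' {s | ω s = μ}) := by
  refine mem_span_fiber (k := MZ N) (wt := X.wt) (fun s => HasWt.bext _ (X := X) (T.homog s)) ?_ hx
  have := spanK_span (ofH N) (Set.range v)
  rw [T.span, spanK_top, ← Set.range_comp] at this
  exact this.symm

/-- Triangular bases of `X` and `Y` give one of the tensor product. -/
theorem Tri.tensor (hτ : 0 < τ.im) (hħ : theta τ ħ ≠ 0) (hX : X.RLL τ ħ)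
    (T : X.Tri τ ħ v ω f h) (T' : Y.Tri τ ħ v' ω' f' h') (hcX : InCones X.wts)
    (hcY : InCones Y.wts) :
    ∃ h'' : S × S' → ℕ, (tensor ħ X Y).Tri τ ħ
      (fun p : S × S' => tensv (frameH N) ħ X Y (v p.1) (v' p.2)) (fun p => ω p.1 + ω' p.2)
      (fun p => f p.1 * f' p.2) h'' := by
  refine IsTriang.of_rank (Λ := ℝ ×ₗ ℕ) (fun p : S × S' => toLex (ht (ω' p.2), h p.1 + h' p.2))
    (linearIndependent_tens (frameH N) ħ T'.homog T.li T'.li) ?_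
    (span_tens (frameH N) ħ T'.homog T.span T'.span)
    (finite_pairs_of_inCones (T.inCones hcX) (T'.inCones hcY) T.fin T'.fin) ?_
  · rintro ⟨s, t⟩
    exact HasWt.tensv (frameH N) (T.homog s) (T'.homog t)
  rintro l ⟨s, t⟩
  have hs : X.HasWt (v s) (ω s) := T.homog s
  have ht : Y.HasWt (v' t) (ω' t) := T'.homog t
  set P := spanK (ofH N) (Submodule.span (MH N)
    ((fun p : S × S' => tensv (frameH N) ħ X Y (v p.1) (v' p.2)) ''
      {p | ω p.1 + ω' p.2 = ω s + ω' t ∧ toLex (EllipticO.ht (ω' p.2), h p.1 + h' p.2) <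
        toLex (EllipticO.ht (ω' t), h s + h' t)})) with hP
  have hmem : ∀ (A : Set S) (A' : Set S'), (∀ a ∈ A, ∀ a' ∈ A', ω a + ω' a' = ω s + ω' t ∧
      toLex (EllipticO.ht (ω' a'), h a + h' a') < toLex (EllipticO.ht (ω' t), h s + h' t)) →
      ∀ (x : X.B →₀ MZ N) (y : Y.B →₀ MZ N),
      x ∈ Submodule.span (MZ N) ((fun s => bext (ofH N) (v s)) '' A) →
      y ∈ Submodule.span (MZ N) ((fun s => bext (ofH N) (v' s)) '' A') →
      tensv (frameZ N) ħ X Y x y ∈ P := by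
    intro A A' hA x y hx hy
    refine tens_mem_of_span (frameZ N) ħ (ω := Y.wt) (v := fun s => bext (ofH N) (v s))
      (v' := fun s => bext (ofH N) (v' s)) (ω' := ω')
      (fun t => HasWt.bext _ (X := Y) (T'.homog t)) P ?_ hx hy
    intro a ha a' ha'
    have := bext_tensv_frameH (ħ := ħ) (v a) (v' a')
    change tensv (frameZ N) ħ X Y _ _ ∈ P
    rw [← this]
    exact bext_mem_spanK.mpr (Submodule.subset_span ⟨(a, a'), hA a ha a' ha', rfl⟩)
  have hten := HasWt.tensv (ħ := ħ) (frameH N) hs ht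
  have hmin := minor_tens τ ħ X Y hτ hħ hX l.2 (hs.bext (ofH N)) (ht.bext (ofH N)) P ?_
  · beta_reduce
    rw [← minor_ext τ ħ _ l hten, ext_eq, bext_tensv_frameH]
    rw [← ext_eq X, ← ext_eq Y, minor_ext τ ħ X l hs, minor_ext τ ħ Y l ht] at hmin
    have hsplit : tensv (frameZ N) ħ X Y (X.qminor τ ħ l (v s)) (Y.qminor τ ħ l (v' t)) -
        ofC N (diagProd ħ l (f s * f' t)) •
          tensv (frameZ N) ħ X Y (bext (ofH N) (v s)) (bext (ofH N) (v' t)) ∈ P := by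
      have hd := T.tri l s
      have hd' := T'.tri l t
      rw [spanK_span, Set.image_image] at hd hd'
      obtain ⟨d, hdef⟩ : ∃ d, d = X.qminor τ ħ l (v s) - ofC N (diagProd ħ l (f s)) •
        bext (ofH N) (v s) := ⟨_, rfl⟩
      obtain ⟨d', hdef'⟩ : ∃ d', d' = Y.qminor τ ħ l (v' t) - ofC N (diagProd ħ l (f' t)) •
        bext (ofH N) (v' t) := ⟨_, rfl⟩
      rw [← hdef] at hd
      rw [← hdef'] at hd'
      rw [eq_sub_iff_add_eq] at hdef hdef'
      have hF : muL (frameZ N) ħ Y.wt (ofC N (diagProd ħ l (f s))) (bext (ofH N) (v' t)) =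
          ofC N (diagProd ħ l (f s)) • bext (ofH N) (v' t) := by
        rw [(ht.bext (ofH N)).muL_eq]
        congr 1
        exact (ofC_shift 0 _ _).trans (congrArg _ (shift_zero _))
      have hbs : bext (ofH N) (v s) ∈ Submodule.span (MZ N)
          ((fun s => bext (ofH N) (v s)) '' {s}) := Submodule.subset_span ⟨s, rfl, rfl⟩
      have hbt : bext (ofH N) (v' t) ∈ Submodule.span (MZ N)
          ((fun s => bext (ofH N) (v' s)) '' {t}) := Submodule.subset_span ⟨t, rfl, rfl⟩
      have hm : ofC N (diagProd ħ l (f s)) • tensv (frameZ N) ħ X Y (bext (ofH N) (v s))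
          (ofC N (diagProd ħ l (f' t)) • bext (ofH N) (v' t)) = tensv (frameZ N) ħ X Y
            (ofC N (diagProd ħ l (f s)) • bext (ofH N) (v s))
            (ofC N (diagProd ħ l (f' t)) • bext (ofH N) (v' t)) := by
        rw [tensv_smul_left, muL_smul, hF]
        simp only [tensv_smul_right]
        rw [smul_comm]
      have hm' : tensv (frameZ N) ħ X Y (ofC N (diagProd ħ l (f s)) • bext (ofH N) (v s))
          (ofC N (diagProd ħ l (f' t)) • bext (ofH N) (v' t)) = ofC N (diagProd ħ l (f s * f' t)) •
          tensv (frameZ N) ħ X Y (bext (ofH N) (v s)) (bext (ofH N) (v' t)) := by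
        rw [← hm, tensv_smul_right, smul_smul, diagProd_mul, map_mul]
      rw [← hdef, ← hdef', tensv_add_left, tensv_add_right, tensv_add_right, hm', ← add_assoc,
        add_sub_cancel_right]
      refine add_mem (add_mem ?_ ?_) ?_
      · refine hmem _ _ ?_ _ _ hd hd'
        rintro a ⟨ha, hla⟩ a' ⟨ha', hla'⟩
        rw [ha, ha']
        exact ⟨rfl, Prod.Lex.toLex_lt_toLex.mpr (Or.inr ⟨rfl, add_lt_add hla hla'⟩)⟩
      · refine hmem _ _ ?_ _ _ hd (Submodule.smul_mem _ _ hbt)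
        rintro a ⟨ha, hla⟩ a' rfl
        rw [ha]
        exact ⟨rfl, Prod.Lex.toLex_lt_toLex.mpr (Or.inr ⟨rfl, Nat.add_lt_add_right hla _⟩)⟩
      · refine hmem _ _ ?_ _ _ (Submodule.smul_mem _ _ hbs) hd'
        rintro a rfl a' ⟨ha', hla'⟩
        rw [ha']
        exact ⟨rfl, Prod.Lex.toLex_lt_toLex.mpr (Or.inr ⟨rfl, Nat.add_lt_add_left hla' _⟩)⟩
    have := add_mem hmin hsplit
    rwa [sub_add_sub_cancel] at this
  · intro μ' ν' x' y' hx' hy' hsum hlt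
    refine hmem _ _ ?_ _ _ (T.mem_span_bext hx') (T'.mem_span_bext hy')
    rintro a rfl a' rfl
    exact ⟨hsum, Prod.Lex.toLex_lt_toLex.mpr (Or.inl hlt)⟩

end Triangular

theorem inO_tensor (hτ : 0 < τ.im) (hħ : theta τ ħ ≠ 0) (hX : X.InO τ ħ) (hY : Y.InO τ ħ) :
    (tensor ħ X Y).InO τ ħ := by
  rw [inO_iff] at hX hY ⊢
  obtain ⟨h1, h2, S, v, ω, f, h, T⟩ := hX
  obtain ⟨h1', h2', S', v', ω', f', h', T'⟩ := hY
  obtain ⟨h'', T''⟩ := T.tensor hτ hħ h1.rll T' h2 h2'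
  exact ⟨⟨finite_pairs_of_inCones h2 h2' h1.finite h1'.finite, rll_tensor ħ X Y τ h1.rll h1'.rll⟩,
    inCones_add h2 h2', _, _, _, _, _, T''⟩

end PreMod

theorem qc_tensor {N : ℕ} {τ ħ : ℂ} {X Y : PreMod N} (hτ : 0 < τ.im) (hħ : theta τ ħ ≠ 0)
    (hX : X.InO τ ħ) (hY : Y.InO τ ħ) :
    qc τ ħ (PreMod.tensor ħ X Y) = qc τ ħ X * qc τ ħ Y := by
  have hXY := PreMod.inO_tensor hτ hħ hX hY
  obtain ⟨h1, h2, S, v, ω, f, h, T⟩ := PreMod.inO_iff.mp hX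
  obtain ⟨h1', h2', S', v', ω', f', h', T'⟩ := PreMod.inO_iff.mp hY
  obtain ⟨h'', T''⟩ := T.tensor hτ hħ h1.rll T' h2 h2'
  have hfin : ∀ a : EWt N,
      {p : S × S' | EWt.mk (f p.1) (ω p.1) + EWt.mk (f' p.2) (ω' p.2) = a}.Finite := by
    intro a
    refine (finite_pairs_of_inCones (T.inCones h2) (T'.inCones h2') T.fin T'.fin a.2).subset ?_
    rintro p rfl
    rfl
  refine QRing.ext (funext fun a => ?_)
  rw [qc_coeff hXY T'' a, QRing.mul_coeff]
  refine (card_pairs (e := fun s => EWt.mk (f s) (ω s)) (e' := fun s => EWt.mk (f' s) (ω' s)) a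
    (hfin a)).trans ?_
  refine finsum_congr fun g => ?_
  rw [qc_coeff hX T, qc_coeff hY T']

end EllipticO
end

noncomputable section
namespace EllipticO

theorem bext_bext {k K L B : Type} [Field k] [Field K] [Field L] (j : k →+* K) (ψ : K →+* L)
    (x : B →₀ k) : bext ψ (bext j x) = bext (ψ.comp j) x :=
  Finsupp.ext fun _ => rfl

theorem bext_id {k B : Type} [Field k] (x : B →₀ k) : bext (RingHom.id k) x = x :=
  Finsupp.ext fun _ => rfl

theorem homog_extMap {k K B C G : Type} [Field k] [Field K] (j : k →+* K)
    {T : (B →₀ k) →ₗ[k] (C →₀ k)} {wt : B → G} {wt' : C → G}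
    (hT : ∀ b, Homog wt' (T (Finsupp.single b 1)) (wt b)) {y : B →₀ K} {μ : G}
    (hy : Homog wt y μ) : Homog wt' (extMap j T y) μ := by
  intro c hc
  rw [extMap, Finsupp.linearCombination_apply, Finsupp.sum_apply] at hc
  obtain ⟨b, hb, hc⟩ := Finset.exists_ne_zero_of_sum_ne_zero hc
  rw [← hy b (Finsupp.mem_support_iff.mp hb)]
  refine hT b c fun h0 => hc ?_
  beta_reduce
  rw [Finsupp.smul_apply, bext_apply, h0, map_zero, smul_zero]

theorem extMap_eq_zero {k K B C : Type} [Field k] [Field K] {j : k →+* K}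
    {T : (B →₀ k) →ₗ[k] (C →₀ k)} {y : B →₀ K} :
    extMap j T y = 0 ↔ y ∈ spanK j (LinearMap.ker T) := by
  rw [← Submodule.mem_bot K, ← spanK_bot j, extMap_mem_spanK, Submodule.comap_bot]

theorem bext_extMap {k K L B C : Type} [Field k] [Field K] [Field L] (j : k →+* K) (ψ : K →+* L)
    (T : (B →₀ k) →ₗ[k] (C →₀ k)) (y : B →₀ K) :
    bext ψ (extMap j T y) = extMap (ψ.comp j) T (bext ψ y) := by
  induction y using Finsupp.induction_linear with
  | zero => simp [bext_zero]
  | add y z hy hz => rw [map_add, bext_add, hy, hz, bext_add, map_add]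
  | single b c =>
    rw [extMap_single, bext_smul, bext_single, extMap_single, bext_bext]

section MapWord

variable {N : ℕ} {V W : Type} [AddCommGroup V] [AddCommGroup W]
  {A : Fin N → Fin N → ℂ → V →+ V} {A' : Fin N → Fin N → ℂ → W →+ W} {f : V → W}

theorem map_word (hf : ∀ i j a x, f (A i j a x) = A' i j a (f x)) (ħ a : ℂ) {k : ℕ}
    (r c : Fin k → Fin N) (x : V) : f (word A ħ a r c x) = word A' ħ a r c (f x) := by
  induction k generalizing a with
  | zero => rfl
  | succ n ih => rw [word_succ, word_succ, hf, ih]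

theorem map_altWord (hadd : ∀ x y, f (x + y) = f x + f y)
    (hf : ∀ i j a x, f (A i j a x) = A' i j a (f x)) (ħ : ℂ) {k : ℕ} (r c : Fin k → Fin N) (x : V) :
    f (altWord A ħ r c x) = altWord A' ħ r c (f x) := by
  change AddMonoidHom.mk' f hadd _ = _
  rw [altWord, altWord, map_sum]
  refine Finset.sum_congr rfl fun π _ => ?_
  rw [map_zsmul]
  exact congrArg _ (map_word hf ħ 0 _ c x)

end MapWord

namespace PreMod

variable {N : ℕ} {τ ħ : ℂ} {X Y Z : PreMod N}

namespace Hom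

section Operators

variable {K : Type} [Field K] {F : Frame N K} {ψ φ₁ φ₂ : MZ N →+* K} {i j : Fin N}

theorem extMap_L (φ : Hom ħ X Y) (b : X.B) : extMap (ofH N) φ.map (X.L i j b) =
    Y.op (frameZ N) ħ (RingHom.id (MZ N)) i j (bext (ofH N) (φ.map (Finsupp.single b 1))) :=
  (φ.comm i j b).trans (actL_zero_eq ħ Y _)

theorem homog (φ : Hom ħ X Y) (x : X.V) (μ : H N) (h : X.HasWt x μ) : Y.HasWt (φ.map x) μ :=
  Y.mem_wtSpace_iff.mp (φ.map_wt μ x (X.mem_wtSpace_iff.mpr h))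

theorem extMap_op (φ : Hom ħ X Y) (hψ : F.IsPoint ψ) (y : X.B →₀ K) :
    extMap F.j φ.map (X.op F ħ ψ i j y) = Y.op F ħ ψ i j (extMap F.j φ.map y) := by
  have hj : ψ.comp (ofH N) = F.j := RingHom.ext hψ.ofH
  induction y using Finsupp.induction_linear with
  | zero => rw [op_zero, map_zero, op_zero]
  | add y z hy hz => rw [op_add, map_add, hy, hz, map_add, op_add]
  | single b a =>
    rw [op_single, map_smul, extMap_single, op_smul]
    congr 1
    rw [← hj, ← bext_extMap, φ.extMap_L, bext_op ħ Y hψ, bext_bext]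

theorem extMap_muL (φ : Hom ħ X Y) (g : K) (y : X.B →₀ K) :
    extMap F.j φ.map (muL F ħ X.wt g y) = muL F ħ Y.wt g (extMap F.j φ.map y) := by
  induction y using Finsupp.induction_linear with
  | zero => rw [muL_zero, map_zero, muL_zero]
  | add y z hy hz => rw [muL_add, map_add, hy, hz, map_add, muL_add]
  | single b a =>
    have h1 : X.HasWt (Finsupp.single b a) (X.wt b) := X.hasWt_single b a
    have h2 : Y.HasWt (bext F.j (φ.map (Finsupp.single b 1))) (X.wt b) :=
      (φ.homog _ _ (X.hasWt_single b 1)).bext _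
    rw [h1.muL_eq, map_smul, extMap_single, muL_smul, h2.muL_eq, smul_comm]

theorem rllAt_map (φ : Hom ħ X Y) (h₁ : F.IsPoint φ₁) (h₂ : F.IsPoint φ₂)
    {R : Fin N → Fin N → Fin N → Fin N → K} {y : X.B →₀ K} (h : X.RLLAt F ħ φ₁ φ₂ R y) :
    Y.RLLAt F ħ φ₁ φ₂ R (extMap F.j φ.map y) := by
  intro i j m n
  have := congrArg (extMap F.j φ.map) (h i j m n)
  simpa only [map_sum, map_smul, φ.extMap_muL, φ.extMap_op h₁, φ.extMap_op h₂] using this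

theorem rllAt_of_map (φ : Hom ħ X Y) (hφ : Function.Injective φ.map) (h₁ : F.IsPoint φ₁)
    (h₂ : F.IsPoint φ₂) {R : Fin N → Fin N → Fin N → Fin N → K} {y : X.B →₀ K}
    (h : Y.RLLAt F ħ φ₁ φ₂ R (extMap F.j φ.map y)) : X.RLLAt F ħ φ₁ φ₂ R y := by
  intro i j m n
  refine extMap_injective F.j hφ ?_
  have := h i j m n
  simpa only [map_sum, map_smul, φ.extMap_muL, φ.extMap_op h₁, φ.extMap_op h₂] using this

theorem rll_of_injective (φ : Hom ħ X Y) (hφ : Function.Injective φ.map) (h : Y.RLL τ ħ) :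
    X.RLL τ ħ := by
  rw [rll_iff] at h ⊢
  exact fun y => φ.rllAt_of_map hφ (isPoint_atZ N) (isPoint_atW N) (h _)

theorem rll_of_surjective (φ : Hom ħ X Y) (hφ : Function.Surjective φ.map) (h : X.RLL τ ħ) :
    Y.RLL τ ħ := by
  rw [rll_iff] at h ⊢
  intro y
  obtain ⟨x, rfl⟩ := extMap_surjective (frameZW N).j hφ y
  exact φ.rllAt_map (isPoint_atZ N) (isPoint_atW N) (h _)

theorem extMap_op_bext (φ : Hom ħ X Y) (x : X.V) :
    extMap (ofH N) φ.map (X.op (frameZ N) ħ (RingHom.id (MZ N)) i j (bext (ofH N) x)) =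
      Y.op (frameZ N) ħ (RingHom.id (MZ N)) i j (bext (ofH N) (φ.map x)) := by
  rw [← extMap_bext]
  exact φ.extMap_op (F := frameZ N) (isPoint_id N) _

theorem extMap_altWord (φ : Hom ħ X Y) {pt : ℂ → MZ N →+* K} (hpt : ∀ a, F.IsPoint (pt a))
    {k : ℕ} (r c : Fin k → Fin N) (x : X.B →₀ K) :
    extMap F.j φ.map (altWord (X.opHom F ħ pt) ħ r c x) =
      altWord (Y.opHom F ħ pt) ħ r c (extMap F.j φ.map x) :=
by
  refine map_altWord (f := fun y => extMap F.j φ.map y) (A := X.opHom F ħ pt)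
    (A' := Y.opHom F ħ pt) ?_ ?_ ħ r c x
  · intro x y
    exact map_add _ x y
  · intro i j a x
    exact φ.extMap_op (hpt a) x

theorem extMap_alt (φ : Hom ħ X Y) {k : ℕ} (hk : k ≤ N) (x : X.B →₀ MZ N) :
    extMap (ofH N) φ.map (X.alt ħ hk x) = Y.alt ħ hk (extMap (ofH N) φ.map x) :=
  φ.extMap_altWord (F := frameZ N) isPoint_ptZ (topIdx hk) (topIdx hk) x

theorem extMap_qminor (φ : Hom ħ X Y) (l : Fin N) (x : X.V) :
    extMap (ofH N) φ.map (X.qminor τ ħ l x) = Y.qminor τ ħ l (φ.map x) := by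
  rw [qminor, map_smul, qminor, ← extMap_bext, ← φ.extMap_alt l.2]
  congr 1
  exact φ.extMap_muL (F := frameZ N) _ _

end Operators

/-- Linear maps compatible with the operators on a spanning set of vectors are morphisms. -/
def ofBasis (f : X.V →ₗ[MH N] Y.V) (hwt : ∀ b, Y.HasWt (f (Finsupp.single b 1)) (X.wt b))
    (hL : ∀ i j b, extMap (ofH N) f (X.L i j b) = Y.op (frameZ N) ħ (RingHom.id (MZ N)) i j
      (bext (ofH N) (f (Finsupp.single b 1)))) : Hom ħ X Y where
  map := f
  map_wt := by
    intro μ x hx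
    rw [mem_wtSpace_iff] at hx ⊢
    refine X.hasWt_sum_single hx (fun x => Y.HasWt (f x) μ) ?_ ?_ ?_
    · rw [map_zero]; exact HasWt.zero Y
    · intro x y h h'; rw [map_add]; exact h.add h'
    · intro b a hb
      have : (Finsupp.single b a : X.V) = a • Finsupp.single b 1 := by
        rw [Finsupp.smul_single, smul_eq_mul, mul_one]
      rw [this, map_smul, ← hb]
      exact (hwt b).smul a
  comm i j b := (hL i j b).trans (actL_zero_eq ħ Y _).symm

theorem extMap_comp {k K B C D : Type} [Field k] [Field K] (j : k →+* K)
    (T : (B →₀ k) →ₗ[k] (C →₀ k)) (T' : (C →₀ k) →ₗ[k] (D →₀ k)) (y : B →₀ K) :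
    extMap j (T'.comp T) y = extMap j T' (extMap j T y) := by
  induction y using Finsupp.induction_linear with
  | zero => simp only [map_zero]
  | add y z hy hz => simp only [map_add, hy, hz]
  | single b c => rw [extMap_single, extMap_single, map_smul, extMap_bext, LinearMap.comp_apply]

/-- The composition of morphisms. -/
def comp (ψ : Hom ħ Y Z) (φ : Hom ħ X Y) : Hom ħ X Z :=
  ofBasis (ψ.map.comp φ.map) (fun b => ψ.homog _ _ (φ.homog _ _ (X.hasWt_single b 1))) (by
    intro i j b
    rw [extMap_comp, φ.extMap_L]
    exact ψ.extMap_op_bext _)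

theorem comp_map (ψ : Hom ħ Y Z) (φ : Hom ħ X Y) : (ψ.comp φ).map = ψ.map.comp φ.map := rfl

/-- A morphism through which an injective morphism factors. -/
theorem exists_lift (φ : Hom ħ X Z) (ι : Hom ħ Y Z) (hι : Function.Injective ι.map)
    (h : LinearMap.range φ.map ≤ LinearMap.range ι.map) :
    ∃ ψ : Hom ħ X Y, ∀ x, ι.map (ψ.map x) = φ.map x := by
  let e := LinearEquiv.ofInjective ι.map hι
  let f : X.V →ₗ[MH N] Y.V := e.symm.toLinearMap.comp
    (φ.map.codRestrict (LinearMap.range ι.map) fun x => h ⟨x, rfl⟩)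
  have hf : ∀ x, ι.map (f x) = φ.map x := by
    intro x
    have := congrArg Subtype.val (e.apply_symm_apply
      (φ.map.codRestrict (LinearMap.range ι.map) (fun x => h ⟨x, rfl⟩) x))
    exact this
  have hwt : ∀ b, Y.HasWt (f (Finsupp.single b 1)) (X.wt b) := by
    intro b
    have h1 : Z.HasWt (ι.map (f (Finsupp.single b 1))) (X.wt b) := by
      rw [hf]; exact φ.homog _ _ (X.hasWt_single b 1)
    have h2 : f (Finsupp.single b 1) = wproj Y.wt (X.wt b) (f (Finsupp.single b 1)) := by
      refine hι ?_
      rw [← wproj_map ι.map ι.homog]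
      exact (Homog.wproj_eq h1).symm
    rw [h2]
    exact homog_wproj _ _
  refine ⟨ofBasis f hwt ?_, hf⟩
  intro i j b
  refine extMap_injective (ofH N) hι ?_
  rw [← extMap_comp, show ι.map.comp f = φ.map from LinearMap.ext hf, φ.extMap_L]
  rw [ι.extMap_op_bext, hf]

end Hom

/-! ### Submodules -/

/-- The submodules of `X`. -/
structure IsSub (ħ : ℂ) (X : PreMod N) (W : Submodule (MH N) X.V) : Prop where
  wproj : ∀ x ∈ W, ∀ μ, wproj X.wt μ x ∈ W
  op : ∀ x ∈ W, ∀ (i j : Fin N) (φ : MZ N →+ MH N), IsCoef (ofH N) φ →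
    cvec φ (X.op (frameZ N) ħ (RingHom.id (MZ N)) i j (bext (ofH N) x)) ∈ W

theorem IsSub.op_mem {W : Submodule (MH N) X.V} (h : IsSub ħ X W) {x : X.V} (hx : x ∈ W)
    (i j : Fin N) :
    X.op (frameZ N) ħ (RingHom.id (MZ N)) i j (bext (ofH N) x) ∈ spanK (ofH N) W :=
  mem_spanK_iff.mpr (h.op x hx i j)

theorem IsSub.of_op {W : Submodule (MH N) X.V} (h : ∀ x ∈ W, ∀ μ, EllipticO.wproj X.wt μ x ∈ W)
    (h' : ∀ x ∈ W, ∀ i j : Fin N,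
      X.op (frameZ N) ħ (RingHom.id (MZ N)) i j (bext (ofH N) x) ∈ spanK (ofH N) W) :
    IsSub ħ X W :=
  ⟨h, fun x hx i j => mem_spanK_iff.mp (h' x hx i j)⟩

theorem Hom.isSub_map (φ : Hom ħ X Y) {W : Submodule (MH N) X.V} (hW : IsSub ħ X W) :
    IsSub ħ Y (W.map φ.map) := by
  refine IsSub.of_op ?_ ?_
  · rintro _ ⟨x, hx, rfl⟩ μ
    exact ⟨_, hW.wproj x hx μ, (wproj_map φ.map φ.homog x μ).symm⟩
  · rintro _ ⟨x, hx, rfl⟩ i j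
    rw [← φ.extMap_op_bext]
    exact extMap_mem_map (hW.op_mem hx i j)

theorem Hom.isSub_comap (φ : Hom ħ X Y) {W : Submodule (MH N) Y.V} (hW : IsSub ħ Y W) :
    IsSub ħ X (W.comap φ.map) := by
  refine IsSub.of_op ?_ ?_
  · intro x hx μ
    rw [Submodule.mem_comap, ← wproj_map φ.map φ.homog]
    exact hW.wproj _ hx μ
  · intro x hx i j
    rw [← extMap_mem_spanK, φ.extMap_op_bext]
    exact hW.op_mem hx i j

theorem isSub_top : IsSub ħ X ⊤ := ⟨fun _ _ _ => trivial, fun _ _ _ _ _ _ => trivial⟩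

theorem isSub_bot : IsSub ħ X ⊥ := by
  refine IsSub.of_op ?_ ?_
  · rintro x hx μ
    rw [Submodule.mem_bot] at hx ⊢
    rw [hx, map_zero]
  · rintro x hx i j
    rw [Submodule.mem_bot] at hx
    rw [hx, bext_zero, op_zero]
    exact zero_mem _

theorem Hom.isSub_range (φ : Hom ħ X Y) : IsSub ħ Y (LinearMap.range φ.map) := by
  rw [← Submodule.map_top]
  exact φ.isSub_map isSub_top

theorem Hom.isSub_ker (φ : Hom ħ X Y) : IsSub ħ X (LinearMap.ker φ.map) := by
  rw [← Submodule.comap_bot]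
  exact φ.isSub_comap isSub_bot

theorem IsSub.sInf {s : Set (Submodule (MH N) X.V)} (hs : ∀ W ∈ s, IsSub ħ X W) :
    IsSub ħ X (sInf s) := by
  refine ⟨fun x hx μ => ?_, fun x hx i j φ hφ => ?_⟩
  · rw [Submodule.mem_sInf] at hx ⊢
    exact fun W hW => (hs W hW).wproj x (hx W hW) μ
  · rw [Submodule.mem_sInf] at hx ⊢
    exact fun W hW => (hs W hW).op x (hx W hW) i j φ hφ

theorem IsSub.sSup_of_directed {s : Set (Submodule (MH N) X.V)} (hne : s.Nonempty)
    (hdir : DirectedOn (· ≤ ·) s) (hs : ∀ W ∈ s, IsSub ħ X W) : IsSub ħ X (sSup s) := by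
  refine ⟨fun x hx μ => ?_, fun x hx i j φ hφ => ?_⟩
  · obtain ⟨W, hW, hx⟩ := (Submodule.mem_sSup_of_directed hne hdir).mp hx
    exact (le_sSup hW : W ≤ _) ((hs W hW).wproj x hx μ)
  · obtain ⟨W, hW, hx⟩ := (Submodule.mem_sSup_of_directed hne hdir).mp hx
    exact (le_sSup hW : W ≤ _) ((hs W hW).op x hx i j φ hφ)

/-- The quotient of a module by a submodule. -/
theorem IsSub.exists_quotient {W : Submodule (MH N) X.V} (hW : IsSub ħ X W) :
    ∃ (Q : PreMod N) (π : Hom ħ X Q), Function.Surjective π.map ∧ LinearMap.ker π.map = W := by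
  classical
  have hspan : Submodule.span (MH N) (Set.range fun b : X.B => W.mkQ (Finsupp.single b 1)) = ⊤ := by
    rw [eq_top_iff]
    intro y _
    obtain ⟨x, rfl⟩ := W.mkQ_surjective y
    induction x using Finsupp.induction_linear with
    | zero => rw [map_zero]; exact zero_mem _
    | add x y hx hy => rw [map_add]; exact add_mem (hx trivial) (hy trivial)
    | single b a =>
      rw [show (Finsupp.single b a : X.V) = a • Finsupp.single b 1 by
        rw [Finsupp.smul_single, smul_eq_mul, mul_one], map_smul]
      exact Submodule.smul_mem _ _ (Submodule.subset_span ⟨b, rfl⟩)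
  obtain ⟨S, ι, hι, hS, hli⟩ := exists_linearIndependent' (MH N)
    fun b : X.B => W.mkQ (Finsupp.single b 1)
  rw [hspan] at hS
  let e := Module.Basis.mk hli hS.ge
  let π : X.V →ₗ[MH N] (S →₀ MH N) := e.repr.toLinearMap.comp W.mkQ
  have hπs : ∀ s, π (Finsupp.single (ι s) 1) = Finsupp.single s 1 := by
    intro s
    have : W.mkQ (Finsupp.single (ι s) 1) = e s := by rw [Module.Basis.mk_apply]; rfl
    change e.repr _ = _
    rw [this, e.repr_self]
  have hsurj : Function.Surjective π := e.repr.surjective.comp W.mkQ_surjective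
  have hker : LinearMap.ker π = W := by
    rw [LinearEquiv.ker_comp, Submodule.ker_mkQ]
  let incl : (S →₀ MH N) →ₗ[MH N] X.V := Finsupp.lmapDomain (MH N) (MH N) ι
  have hincl : ∀ s a, incl (Finsupp.single s a) = Finsupp.single (ι s) a := fun s a =>
    Finsupp.mapDomain_single
  have hπi : ∀ c, π (incl c) = c := by
    intro c
    have : π.comp incl = LinearMap.id := by
      refine Finsupp.lhom_ext' fun s => LinearMap.ext_ring ?_
      change π (incl (Finsupp.single s 1)) = Finsupp.single s 1
      rw [hincl, hπs]
    exact LinearMap.congr_fun this c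
  let wt : S → H N := fun s => X.wt (ι s)
  have hiw : ∀ c μ, Homog wt c μ → Homog X.wt (incl c) μ := by
    intro c μ hc b hb
    have := Finsupp.mapDomain_support (Finsupp.mem_support_iff.mpr hb)
    obtain ⟨s, hs, rfl⟩ := Finset.mem_image.mp this
    exact hc s (Finsupp.mem_support_iff.mp hs)
  have hsub : ∀ x, x - incl (π x) ∈ W := by
    intro x
    rw [← hker, LinearMap.mem_ker, map_sub, hπi, sub_self]
  have hwt : ∀ x μ, X.HasWt x μ → Homog wt (π x) μ := by
    intro x μ hx
    have h1 := hW.wproj _ (hsub x) μ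
    rw [map_sub, Homog.wproj_eq hx, wproj_map incl hiw, ← hker, LinearMap.mem_ker, map_sub, hπi,
      sub_eq_zero] at h1
    rw [h1]
    exact homog_wproj _ _
  have hπh : ∀ b, Homog wt (π (Finsupp.single b 1)) (X.wt b) := fun b =>
    hwt _ _ (X.hasWt_single b 1)
  let Q : PreMod N :=
    { B := S
      wt := wt
      L := fun i j s => extMap (ofH N) π (X.L i j (ι s))
      L_wt := fun i j s s' h => homog_extMap (ofH N) hπh (X.L_wt i j (ι s)) s' h }
  have hL : ∀ i j x, extMap (ofH N) π (X.op (frameZ N) ħ (RingHom.id (MZ N)) i j (bext (ofH N) x)) =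
      Q.op (frameZ N) ħ (RingHom.id (MZ N)) i j (bext (ofH N) (π x)) := by
    intro i j x
    have h1 : ∀ c, extMap (ofH N) π (X.op (frameZ N) ħ (RingHom.id (MZ N)) i j
        (bext (ofH N) (incl c))) = Q.op (frameZ N) ħ (RingHom.id (MZ N)) i j (bext (ofH N) c) := by
      intro c
      induction c using Finsupp.induction_linear with
      | zero => rw [map_zero, bext_zero, op_zero, map_zero, bext_zero, op_zero]
      | add c d hc hd =>
        rw [map_add, bext_add, op_add, map_add, hc, hd, bext_add]
        exact (Q.op_add (frameZ N) ħ _ _).symm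
      | single s a =>
        rw [hincl, bext_single, op_single, map_smul, bext_single]
        refine Eq.trans ?_ (Q.op_single (frameZ N) ħ s _).symm
        rw [bext_id, bext_id]
    have h2 : x = (x - incl (π x)) + incl (π x) := (sub_add_cancel _ _).symm
    conv_lhs => rw [h2]
    rw [bext_add, op_add, map_add, h1, extMap_eq_zero.mpr, zero_add]
    rw [hker]
    exact hW.op_mem (hsub x) i j
  refine ⟨Q, Hom.ofBasis π hπh ?_, hsurj, hker⟩
  intro i j b
  refine Eq.trans ?_ (hL i j (Finsupp.single b 1))
  rw [bext_single, map_one, op_single, map_one, one_smul, bext_id]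

end PreMod
end EllipticO
end

noncomputable section
namespace EllipticO

theorem exists_extMap_eq {k K B C : Type} [Field k] [Field K] {j : k →+* K}
    {T : (B →₀ k) →ₗ[k] (C →₀ k)} {y : C →₀ K} (hy : y ∈ spanK j (LinearMap.range T)) :
    ∃ c, extMap j T c = y := by
  have h : spanK j (LinearMap.range T) ≤ LinearMap.range (extMap j T) := by
    rw [spanK, Submodule.span_le]
    rintro _ ⟨_, ⟨x, rfl⟩, rfl⟩
    exact ⟨bext j x, extMap_bext j T x⟩
  exact h hy

theorem homog_of_extMap {k K B C G : Type} [Field k] [Field K] (j : k →+* K)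
    {T : (B →₀ k) →ₗ[k] (C →₀ k)} (hinj : Function.Injective T) {wt : B → G} {wt' : C → G}
    (hT : ∀ b, Homog wt' (T (Finsupp.single b 1)) (wt b)) {y : B →₀ K} {μ : G}
    (hy : Homog wt' (extMap j T y) μ) : Homog wt y μ := by
  have h : y = wproj wt μ y := by
    refine extMap_injective j hinj ?_
    rw [← wproj_map (extMap j T) (fun x μ hx => homog_extMap j hT hx), hy.wproj_eq]
  rw [h]
  exact homog_wproj _ _

/-- A graded subspace has a homogeneous basis. -/
theorem exists_homog_basis {k B G : Type} [Field k] {wt : B → G} {W : Submodule k (B →₀ k)}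
    (hW : ∀ x ∈ W, ∀ μ, wproj wt μ x ∈ W) : ∃ (S : Type) (v : S → B →₀ k) (ω : S → G),
      LinearIndependent k v ∧ (∀ s, Homog wt (v s) (ω s)) ∧
      Submodule.span k (Set.range v) = W := by
  let P := {x : B →₀ k // x ∈ W ∧ ∃ μ, Homog wt x μ}
  obtain ⟨S, ι, -, hS, hli⟩ := exists_linearIndependent' k fun p : P => (p : B →₀ k)
  choose ω hω using fun s => (ι s).2.2
  refine ⟨S, _, ω, hli, hω, ?_⟩
  rw [hS]
  refine le_antisymm (Submodule.span_le.mpr ?_) ?_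
  · rintro _ ⟨p, rfl⟩
    exact p.2.1
  · intro x hx
    obtain ⟨t, ht⟩ := exists_sum_wproj (wt := wt) x
    rw [ht]
    exact sum_mem fun μ _ => Submodule.subset_span ⟨⟨_, hW x hx μ, μ, homog_wproj x μ⟩, rfl⟩

section SigmaInclusion

variable {k K ι : Type} [Field k] [Field K] {B : ι → Type}

/-- The inclusion of a summand of a direct sum of vector spaces with bases. -/
def sigmaIncl (a : ι) : (B a →₀ k) →ₗ[k] ((Σ i, B i) →₀ k) := Finsupp.lmapDomain k k (Sigma.mk a)

theorem sigmaIncl_single (a : ι) (b : B a) (g : k) :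
    sigmaIncl a (Finsupp.single b g) = Finsupp.single (⟨a, b⟩ : Σ i, B i) g :=
  Finsupp.mapDomain_single

theorem sigmaIncl_injective (a : ι) : Function.Injective (sigmaIncl (k := k) (B := B) a) :=
  Finsupp.mapDomain_injective sigma_mk_injective

theorem homog_sigmaIncl (a : ι) (x : B a →₀ k) :
    Homog (fun p : Σ i, B i => p.1) (sigmaIncl a x) a := by
  classical
  intro p hp
  have := Finsupp.mapDomain_support (Finsupp.mem_support_iff.mpr hp)
  obtain ⟨b, -, rfl⟩ := Finset.mem_image.mp this
  rfl

theorem extMap_sigmaIncl (j : k →+* K) (a : ι) (y : B a →₀ K) :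
    extMap j (sigmaIncl a) y = y.mapDomain (Sigma.mk a) := by
  rw [extMap, Finsupp.linearCombination_apply, Finsupp.mapDomain]
  refine Finsupp.sum_congr fun c _ => ?_
  rw [sigmaIncl_single, bext_single, map_one, Finsupp.smul_single, smul_eq_mul, mul_one]

end SigmaInclusion

section TriangularWeights

variable {k K : Type} [Field k] [Field K] {j : k →+* K} {ι G B S : Type} {wt : B → G}
  {D : ι → (B →₀ k) → (B →₀ K)} {v : S → B →₀ k} {ω : S → G} {F : S → ι → K} {h : S → ℕ}

theorem IsTriang.exists_apply_ne_zero (T : IsTriang j wt D v ω F h) (b : B) :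
    ∃ s, ω s = wt b ∧ v s b ≠ 0 := by
  by_contra hcon
  push Not at hcon
  have hb : Homog wt (Finsupp.single b (1 : k)) (wt b) := by
    intro c hc
    by_contra hne
    exact hc (Finsupp.single_eq_of_ne fun h => hne (by rw [h]))
  have h1 := mem_span_fiber T.homog T.span hb
  have h2 : ∀ x ∈ Submodule.span k (v '' {s | ω s = wt b}), x b = 0 := by
    intro x hx
    induction hx using Submodule.span_induction with
    | mem x hx =>
      obtain ⟨s, hs, rfl⟩ := hx
      exact hcon s hs
    | zero => rfl
    | add x y _ _ hx hy => rw [Finsupp.add_apply, hx, hy, add_zero]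
    | smul c x _ hx => rw [Finsupp.smul_apply, hx, smul_zero]
  have := h2 _ h1
  rw [Finsupp.single_eq_same] at this
  exact one_ne_zero this

theorem IsTriang.finite_wt (T : IsTriang j wt D v ω F h) (μ : G) : {b | wt b = μ}.Finite := by
  refine ((T.fin μ).biUnion fun s _ => (v s).support.finite_toSet).subset ?_
  rintro b rfl
  obtain ⟨s, hs, hb⟩ := T.exists_apply_ne_zero b
  exact Set.mem_biUnion hs (Finset.mem_coe.mpr (Finsupp.mem_support_iff.mpr hb))

theorem IsTriang.range_eq (T : IsTriang j wt D v ω F h) : Set.range ω = Set.range wt := by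
  ext μ
  constructor
  · rintro ⟨s, rfl⟩
    obtain ⟨b, hb⟩ := Finsupp.ne_iff.mp (T.li.ne_zero s)
    exact ⟨b, T.homog s b hb⟩
  · rintro ⟨b, rfl⟩
    obtain ⟨s, hs, -⟩ := T.exists_apply_ne_zero b
    exact ⟨s, hs⟩

end TriangularWeights

theorem card_compl {S : Type} {P : S → Prop} (A : Set S) (hP : {s | P s}.Finite) :
    Nat.card {s // P s} = Nat.card {s : A // P s} + Nat.card {s : {s // s ∉ A} // P s} := by
  classical
  have : Finite {s // P s} := hP.to_subtype
  rw [← Nat.card_congr (Equiv.sumCompl fun s : {s // P s} => (s : S) ∈ A), Nat.card_sum]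
  congr 1
  · exact Nat.card_congr ⟨fun s => ⟨⟨s.1.1, s.2⟩, s.1.2⟩, fun s => ⟨⟨s.1.1, s.2⟩, s.1.2⟩,
      fun _ => rfl, fun _ => rfl⟩
  · exact Nat.card_congr ⟨fun s => ⟨⟨s.1.1, s.2⟩, s.1.2⟩, fun s => ⟨⟨s.1.1, s.2⟩, s.1.2⟩,
      fun _ => rfl, fun _ => rfl⟩

theorem InCones.mono {N : ℕ} {A A' : Set (H N)} (h : InCones A') (hA : A ⊆ A') : InCones A := by
  obtain ⟨C, hC⟩ := h
  exact ⟨C, fun μ hμ => hC μ (hA hμ)⟩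

namespace PreMod

variable {N : ℕ} {τ ħ : ℂ} {X Y Q : PreMod N}

/-- A submodule is the image of an injective morphism. -/
theorem IsSub.exists_sub {W : Submodule (MH N) X.V} (hW : IsSub ħ X W) :
    ∃ (Y : PreMod N) (φ : Hom ħ Y X), Function.Injective φ.map ∧ LinearMap.range φ.map = W := by
  obtain ⟨S, v, ω, hli, hhom, hspan⟩ := exists_homog_basis hW.wproj
  let T : (S →₀ MH N) →ₗ[MH N] X.V := Finsupp.linearCombination (MH N) v
  have hTs : ∀ s, T (Finsupp.single s 1) = v s := fun s => by
    rw [Finsupp.linearCombination_single, one_smul]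
  have hinj : Function.Injective T := hli
  have hrange : LinearMap.range T = W := by rw [Finsupp.range_linearCombination, hspan]
  have hTh : ∀ s, Homog X.wt (T (Finsupp.single s 1)) (ω s) := fun s => by
    rw [hTs]; exact hhom s
  have hex : ∀ i j s, ∃ c, extMap (ofH N) T c =
      X.op (frameZ N) ħ (RingHom.id (MZ N)) i j (bext (ofH N) (v s)) := by
    intro i j s
    refine exists_extMap_eq ?_
    rw [hrange]
    refine hW.op_mem ?_ i j
    rw [← hspan]
    exact Submodule.subset_span ⟨s, rfl⟩
  choose L hL using hex
  let Y : PreMod N :=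
    { B := S
      wt := ω
      L := L
      L_wt := fun i j s s' h => by
        refine homog_of_extMap (ofH N) hinj hTh (y := L i j s) ?_ s' h
        rw [hL]
        exact HasWt.op (frameZ N) ħ (HasWt.bext (ofH N) (hhom s)) }
  refine ⟨Y, Hom.ofBasis T hTh ?_, hinj, hrange⟩
  intro i j s
  refine (hL i j s).trans ?_
  rw [hTs]

theorem inO_of_tri (hrll : X.RLL τ ħ) {S : Type} {v : S → X.V} {ω : S → H N}
    {f : S → Fin N → MCˣ} {h : S → ℕ} (T : X.Tri τ ħ v ω f h) (hc : InCones (Set.range ω)) :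
    X.InO τ ħ := by
  rw [T.range_eq] at hc
  exact inO_iff.mpr ⟨⟨T.finite_wt, hrll⟩, hc, S, v, ω, f, h, T⟩

theorem Tri.sub {S : Type} {v : S → X.V} {ω : S → H N}
    {f : S → Fin N → MCˣ} {h : S → ℕ} (T : X.Tri τ ħ v ω f h) (φ : Hom ħ Y X)
    (hφ : Function.Injective φ.map) : ∃ u : leading v ω h (LinearMap.range φ.map) → Y.V,
      Y.Tri τ ħ u (fun s => ω s) (fun s => f s) (fun s => h s) :=
  IsTriang.sub T (X.qminor_add τ ħ) (X.qminor_smul τ ħ) φ.map hφ φ.homog φ.extMap_qminor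

theorem Tri.quot {S : Type} {v : S → X.V} {ω : S → H N}
    {f : S → Fin N → MCˣ} {h : S → ℕ} (T : X.Tri τ ħ v ω f h) (π : Hom ħ X Q)
    (hπ : Function.Surjective π.map) :
    Q.Tri τ ħ (fun s : {s // s ∉ leading v ω h (LinearMap.ker π.map)} => π.map (v s))
      (fun s => ω s) (fun s => f s) (fun s => h s) :=
  IsTriang.quot T π.map hπ π.homog π.extMap_qminor

theorem InO.of_injective (hX : X.InO τ ħ) (φ : Hom ħ Y X) (hφ : Function.Injective φ.map) :
    Y.InO τ ħ := by
  obtain ⟨h1, h2, S, v, ω, f, h, T⟩ := inO_iff.mp hX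
  obtain ⟨u, hu⟩ := T.sub φ hφ
  refine inO_of_tri (φ.rll_of_injective hφ h1.rll) hu ((T.inCones h2).mono ?_)
  rintro _ ⟨s, rfl⟩
  exact ⟨s, rfl⟩

theorem InO.of_surjective (hX : X.InO τ ħ) (π : Hom ħ X Q) (hπ : Function.Surjective π.map) :
    Q.InO τ ħ := by
  obtain ⟨h1, h2, S, v, ω, f, h, T⟩ := inO_iff.mp hX
  refine inO_of_tri (π.rll_of_surjective hπ h1.rll) (T.quot π hπ) ((T.inCones h2).mono ?_)
  rintro _ ⟨s, rfl⟩
  exact ⟨s, rfl⟩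

/-- q-characters are additive on exact sequences. -/
theorem qc_exact (hX : X.InO τ ħ) (φ : Hom ħ Y X) (hφ : Function.Injective φ.map) (π : Hom ħ X Q)
    (hπ : Function.Surjective π.map) (hex : LinearMap.range φ.map = LinearMap.ker π.map) :
    qc τ ħ X = qc τ ħ Y + qc τ ħ Q := by
  classical
  obtain ⟨h1, h2, S, v, ω, f, h, T⟩ := inO_iff.mp hX
  obtain ⟨u, hu⟩ := T.sub φ hφ
  have hq := T.quot π hπ
  rw [← hex] at hq
  refine QRing.ext (funext fun a => ?_)
  change _ = (qc τ ħ Y).coeff a + (qc τ ħ Q).coeff a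
  rw [qc_coeff hX T, qc_coeff (hX.of_injective φ hφ) hu, qc_coeff (hX.of_surjective π hπ) hq,
    ← Nat.cast_add, Nat.cast_inj]
  set A := leading v ω h (LinearMap.range φ.map)
  exact card_compl A ((T.fin a.2).subset fun s hs => congrArg Prod.snd hs)

theorem qc_coeff_nonneg (hX : X.InO τ ħ) (a : EWt N) : 0 ≤ (qc τ ħ X).coeff a := by
  obtain ⟨h1, h2, S, v, ω, f, h, T⟩ := inO_iff.mp hX
  rw [qc_coeff hX T]
  exact Nat.cast_nonneg _

/-! ### Direct sums -/

section DirectSum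

variable {ι : Type} (M : ι → PreMod N)

/-- The basis vector of the direct sum given by one of a summand. -/
def dpair {M : ι → PreMod N} (a : ι) (b : (M a).B) : (dsum M).B := ⟨a, b⟩

/-- The inclusion of a summand, as a linear map. -/
def inclLin (a : ι) : (M a).V →ₗ[MH N] (dsum M).V :=
  sigmaIncl (k := MH N) (B := fun i => (M i).B) a

theorem inclLin_single (a : ι) (b : (M a).B) (g : MH N) :
    inclLin M a (Finsupp.single b g) = Finsupp.single (dpair a b) g :=
  sigmaIncl_single (k := MH N) (B := fun i => (M i).B) a b g

theorem extMap_inclLin (a : ι) (i j : Fin N) (b : (M a).B) :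
    extMap (ofH N) (inclLin M a) ((M a).L i j b) = (dsum M).L i j (dpair a b) :=
  extMap_sigmaIncl (B := fun i => (M i).B) (ofH N) a _

/-- The inclusion of a summand. -/
def inclHom (ħ : ℂ) (a : ι) : Hom ħ (M a) (dsum M) :=
  Hom.ofBasis (inclLin M a) (fun b => by
    rw [inclLin_single]
    exact (dsum M).hasWt_single (dpair a b) 1) (by
    intro i j b
    rw [extMap_inclLin, inclLin_single, bext_single, map_one, op_single, map_one, one_smul, bext_id])

theorem inclHom_single (a : ι) (b : (M a).B) (g : MH N) :
    (inclHom M ħ a).map (Finsupp.single b g) = Finsupp.single (dpair a b) g :=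
  inclLin_single M a b g

theorem inclHom_injective (a : ι) : Function.Injective (inclHom M ħ a).map :=
  sigmaIncl_injective (k := MH N) (B := fun i => (M i).B) a

theorem homog_inclHom (a : ι) (x : (M a).V) :
    Homog (fun p : Σ i, (M i).B => p.1) ((inclHom M ħ a).map x) a :=
  homog_sigmaIncl (k := MH N) (B := fun i => (M i).B) a x

theorem dpair_cases (p : (dsum M).B) : ∃ a b, p = dpair a b := ⟨p.1, p.2, rfl⟩

theorem rll_dsum (h : ∀ a, (M a).RLL τ ħ) : (dsum M).RLL τ ħ := by
  rw [rll_iff]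
  refine rllAt_of_basis _ ħ _ (isWtZero_RZW τ ħ) ?_
  intro p
  obtain ⟨a, b, rfl⟩ := dpair_cases M p
  have h1 := (inclHom M ħ a).rllAt_map (isPoint_atZ N) (isPoint_atW N)
    ((rll_iff ħ (M a) τ).mp (h a) (Finsupp.single b 1))
  rw [extMap_single, one_smul, inclHom_single, bext_single, map_one] at h1
  exact h1

variable {M}

theorem span_dsum {S : ι → Type} {v : ∀ a, S a → (M a).V}
    (h : ∀ a, Submodule.span (MH N) (Set.range (v a)) = ⊤) :
    Submodule.span (MH N) (Set.range fun s : Σ a, S a => (inclHom M ħ s.1).map (v s.1 s.2)) = ⊤ := by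
  rw [eq_top_iff]
  intro x _
  induction x using Finsupp.induction_linear with
  | zero => exact zero_mem _
  | add x y hx hy => exact add_mem (hx trivial) (hy trivial)
  | single p g =>
    obtain ⟨a, b, rfl⟩ := dpair_cases M p
    have h1 : (inclHom M ħ a).map (Finsupp.single b g) ∈
        (Submodule.span (MH N) (Set.range (v a))).map (inclHom M ħ a).map :=
      Submodule.mem_map_of_mem (by rw [h]; trivial)
    rw [Submodule.map_span, ← Set.range_comp, inclHom_single] at h1
    refine Submodule.span_mono ?_ h1
    rintro _ ⟨s, rfl⟩
    exact ⟨⟨a, s⟩, rfl⟩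

theorem linearIndependent_dsum {S : ι → Type} {v : ∀ a, S a → (M a).V}
    (h : ∀ a, LinearIndependent (MH N) (v a)) :
    LinearIndependent (MH N) fun s : Σ a, S a => (inclHom M ħ s.1).map (v s.1 s.2) :=
  linearIndependent_sigma (wt := fun p : Σ i, (M i).B => p.1)
    (u := fun a s => (inclHom M ħ a).map (v a s))
    (fun a => (h a).map' _ (LinearMap.ker_eq_bot.mpr (inclHom_injective M a)))
    (fun a _ => homog_inclHom M a _)

theorem tri_dsum {S : ι → Type} {v : ∀ a, S a → (M a).V} {ω : ∀ a, S a → H N}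
    {f : ∀ a, S a → Fin N → MCˣ} {h : ∀ a, S a → ℕ} (T : ∀ a, (M a).Tri τ ħ (v a) (ω a) (f a) (h a))
    (hfin : ∀ μ, {s : Σ a, S a | ω s.1 s.2 = μ}.Finite) :
    ∃ h' : (Σ a, S a) → ℕ, (dsum M).Tri τ ħ
      (fun s : Σ a, S a => (inclHom M ħ s.1).map (v s.1 s.2)) (fun s => ω s.1 s.2)
      (fun s => f s.1 s.2) h' := by
  refine IsTriang.of_rank (fun s : Σ a, S a => h s.1 s.2)
    (linearIndependent_dsum fun a => (T a).li)
    (fun s => (inclHom M ħ s.1).homog _ _ ((T s.1).homog s.2))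
    (span_dsum fun a => (T a).span) hfin ?_
  rintro l ⟨a, s⟩
  have h1 := extMap_mem_map (T := (inclHom M ħ a).map) ((T a).tri l s)
  rw [map_sub, map_smul, extMap_bext, (inclHom M ħ a).extMap_qminor, Submodule.map_span,
    Set.image_image] at h1
  refine spanK_mono _ (Submodule.span_mono ?_) h1
  rintro _ ⟨s', hs', rfl⟩
  exact ⟨⟨a, s'⟩, hs', rfl⟩

end DirectSum

end PreMod
end EllipticO
end

noncomputable section
namespace EllipticO

/-- Functions of `(w, λ)` and of `(z, λ)` are linearly disjoint over the functions of `λ`. -/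
theorem linear_disjoint_swap {N : ℕ} {α : Type} (s : Finset α) (κ h : α → MZ N)
    (hκ : ∀ g : α → MH N, ∑ t ∈ s, ofH N (g t) * κ t = 0 → ∀ t ∈ s, g t = 0)
    (h0 : ∑ t ∈ s, atW N (κ t) * atZ N (h t) = 0) : ∀ t ∈ s, h t = 0 := by
  let sw : MZW N →+* MZW N := pull (fun x : ℂ × ℂ × H N => (x.2.1, x.1, x.2.2)) (by fun_prop)
    (fun y => ⟨(y.2.1, y.1, y.2.2), rfl⟩)
  have hZ : ∀ f, sw (atZ N f) = atW N f := fun f => pull_pull _ _ _ _ _ _ f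
  have hW : ∀ f, sw (atW N f) = atZ N f := fun f => pull_pull _ _ _ _ _ _ f
  refine linear_disjoint s κ h hκ ?_
  have := congrArg sw h0
  rw [map_sum, map_zero] at this
  rw [← this]
  refine Finset.sum_congr rfl fun t _ => ?_
  rw [map_mul, hZ, hW]

theorem exists_ker_eq {k B : Type} [Field k] (W : Submodule k (B →₀ k)) :
    ∃ (C : Type) (π : (B →₀ k) →ₗ[k] (C →₀ k)), LinearMap.ker π = W := by
  let e := Module.Free.chooseBasis k ((B →₀ k) ⧸ W)
  exact ⟨_, e.repr.toLinearMap.comp W.mkQ, by rw [LinearEquiv.ker_comp, Submodule.ker_mkQ]⟩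

namespace PreMod

variable {N : ℕ} {τ ħ : ℂ} {X : PreMod N}

variable (ħ X) in
/-- The vector `L_{ij}(z) x`. -/
def lop (i j : Fin N) (x : X.V) : X.B →₀ MZ N :=
  X.op (frameZ N) ħ (RingHom.id (MZ N)) i j (bext (ofH N) x)

theorem lop_add (i j : Fin N) (x y : X.V) : X.lop ħ i j (x + y) = X.lop ħ i j x + X.lop ħ i j y := by
  rw [lop, bext_add, op_add]
  rfl

theorem lop_smul (i j : Fin N) (a : MH N) (x : X.V) :
    X.lop ħ i j (a • x) = ofH N (shift (ħ • ε j) a) • X.lop ħ i j x := by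
  rw [lop, bext_smul, op_smul, ofH_shift]
  rfl

theorem lop_zero (i j : Fin N) : X.lop ħ i j 0 = 0 := by
  rw [lop, bext_zero, op_zero]

theorem HasWt.lop {x : X.V} {μ : H N} (h : X.HasWt x μ) (i j : Fin N) :
    X.HasWt (X.lop ħ i j x) (μ + ε j - ε i) := (h.bext (ofH N)).op (frameZ N) ħ

theorem op_bext_bext {K : Type} [Field K] {F : Frame N K} {φ : MZ N →+* K} (hφ : F.IsPoint φ)
    (i j : Fin N) (x : X.V) : X.op F ħ φ i j (bext F.j x) = bext φ (X.lop ħ i j x) := by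
  rw [lop, bext_op ħ X hφ, bext_bext, show φ.comp (ofH N) = F.j from RingHom.ext hφ.ofH]

variable (ħ) in
/-- The vectors which `L_{nc}(z)` maps to the extension of scalars of `W`. -/
def into (W : Submodule (MH N) X.V) (n c : Fin N) : Submodule (MH N) X.V where
  carrier := {x | X.lop ħ n c x ∈ spanK (ofH N) W}
  add_mem' {x y} hx hy := by
    rw [Set.mem_ofPred_eq, lop_add]
    exact add_mem hx hy
  zero_mem' := by
    rw [Set.mem_ofPred_eq, lop_zero]
    exact zero_mem _
  smul_mem' a x hx := by
    rw [Set.mem_ofPred_eq, lop_smul]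
    exact Submodule.smul_mem _ _ hx

theorem mem_into {W : Submodule (MH N) X.V} {n c : Fin N} {x : X.V} :
    x ∈ into ħ W n c ↔ X.lop ħ n c x ∈ spanK (ofH N) W := Iff.rfl

theorem into_mono {W W' : Submodule (MH N) X.V} (h : W ≤ W') (n c : Fin N) :
    into ħ W n c ≤ into ħ W' n c := fun _ hx => spanK_mono _ h hx

section TwoVariables

variable {K : Type} [Field K] {F : Frame N K} {φ₁ φ₂ : MZ N →+* K}

theorem bext_mem_spanK_of_mem {W : Submodule (MH N) X.V} (h₁ : F.IsPoint φ₁) {u : X.B →₀ MZ N}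
    (hu : u ∈ spanK (ofH N) W) : bext φ₁ u ∈ spanK F.j W := by
  induction hu using Submodule.span_induction with
  | mem u hu =>
    obtain ⟨x, hx, rfl⟩ := hu
    rw [bext_bext, show φ₁.comp (ofH N) = F.j from RingHom.ext h₁.ofH]
    exact bext_mem_spanK.mpr hx
  | zero => rw [bext_zero]; exact zero_mem _
  | add x y _ _ hx hy => rw [bext_add]; exact add_mem hx hy
  | smul c x _ hx => rw [bext_smul]; exact Submodule.smul_mem _ _ hx

theorem op_mem_spanK (h₁ : F.IsPoint φ₁) {W W' : Submodule (MH N) X.V} {n c : Fin N}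
    (hW : W ≤ into ħ W' n c) {u : X.B →₀ K} (hu : u ∈ spanK F.j W) :
    X.op F ħ φ₁ n c u ∈ spanK F.j W' := by
  induction hu using Submodule.span_induction with
  | mem u hu =>
    obtain ⟨x, hx, rfl⟩ := hu
    rw [op_bext_bext h₁]
    exact bext_mem_spanK_of_mem h₁ (hW hx)
  | zero => rw [op_zero]; exact zero_mem _
  | add x y _ _ hx hy => rw [op_add]; exact add_mem hx hy
  | smul c x _ hx => rw [op_smul]; exact Submodule.smul_mem _ _ hx

theorem muL_mem_spanK {W : Submodule (MH N) X.V} (hW : ∀ x ∈ W, ∀ μ, wproj X.wt μ x ∈ W)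
    (g : K) {u : X.B →₀ K} (hu : u ∈ spanK F.j W) : muL F ħ X.wt g u ∈ spanK F.j W := by
  induction hu using Submodule.span_induction with
  | mem u hu =>
    obtain ⟨x, hx, rfl⟩ := hu
    obtain ⟨t, ht⟩ := exists_sum_wproj (wt := X.wt) x
    rw [ht, bext_sum, muL_sum]
    refine sum_mem fun μ _ => ?_
    have hw : X.HasWt (bext F.j (wproj X.wt μ x)) μ := HasWt.bext F.j (homog_wproj x μ)
    rw [hw.muL_eq]
    exact Submodule.smul_mem _ _ (bext_mem_spanK.mpr (hW x hx μ))
  | zero => rw [muL_zero]; exact zero_mem _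
  | add x y _ _ hx hy => rw [muL_add]; exact add_mem hx hy
  | smul c x _ hx => rw [muL_smul]; exact Submodule.smul_mem _ _ hx

/-- Coefficients of a vector depending on one variable inherit what an operator depending on
another variable does to it. -/
theorem coef_mem_into (h₁ : F.IsPoint φ₁) (h₂ : F.IsPoint φ₂)
    (hd : ∀ (I : Type) (s : Finset I) (κ h : I → MZ N),
      (∀ g : I → MH N, ∑ t ∈ s, ofH N (g t) * κ t = 0 → ∀ t ∈ s, g t = 0) →
      ∑ t ∈ s, φ₁ (κ t) * φ₂ (h t) = 0 → ∀ t ∈ s, h t = 0)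
    {W : Submodule (MH N) X.V} {n c : Fin N} {u : X.B →₀ MZ N}
    (h : X.op F ħ φ₂ n c (bext φ₁ u) ∈ spanK F.j W) {φ : MZ N →+ MH N} (hφ : IsCoef (ofH N) φ) :
    cvec φ u ∈ into ħ W n c := by
  obtain ⟨I, κ, s, ψ, -, hu, hκ⟩ := exists_decomposition (ofH N) u
  obtain ⟨C, π, hker⟩ := exists_ker_eq W
  have hmem : ∀ i ∈ s, cvec (ψ i) u ∈ into ħ W n c := by
    rw [← hker, ← extMap_eq_zero, hu, bext_sum, op_sum, map_sum] at h
    have hterm : ∀ i, extMap F.j π (X.op F ħ φ₂ n c (bext φ₁ (κ i • bext (ofH N) (cvec (ψ i) u)))) =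
        φ₁ (shift ((0, ħ • ε c) : ℂ × H N) (κ i)) •
          bext φ₂ (extMap (ofH N) π (X.lop ħ n c (cvec (ψ i) u))) := by
      intro i
      rw [bext_smul, bext_bext, show φ₁.comp (ofH N) = F.j from RingHom.ext h₁.ofH, op_smul,
        op_bext_bext h₂, map_smul, h₁.shift, bext_extMap,
        show φ₂.comp (ofH N) = F.j from RingHom.ext h₂.ofH]
    rw [Finset.sum_congr rfl fun i _ => hterm i] at h
    intro i hi
    rw [mem_into, ← hker, ← extMap_eq_zero]
    ext b
    refine hd I s (fun i => shift ((0, ħ • ε c) : ℂ × H N) (κ i))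
      (fun i => extMap (ofH N) π (X.lop ħ n c (cvec (ψ i) u)) b) ?_ ?_ i hi
    · intro g hg t ht
      have h1 := hκ (fun t => shift (-(ħ • ε c)) (g t)) ?_ t ht
      · exact (map_eq_zero _).mp h1
      · refine shift_injective ((0, ħ • ε c) : ℂ × H N) ?_
        rw [map_sum, map_zero, ← hg]
        refine Finset.sum_congr rfl fun t _ => ?_
        rw [map_mul, ← ofH_shift, shift_shift_neg]
    · have h1 := DFunLike.congr_fun h b
      rw [Finsupp.finsetSum_apply] at h1
      exact h1
  rw [hu, ← show ∑ i ∈ s, cvec φ (κ i • bext (ofH N) (cvec (ψ i) u)) = cvec φ (∑ i ∈ s, κ i •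
    bext (ofH N) (cvec (ψ i) u)) from (map_sum (⟨⟨cvec φ, cvec_zero φ⟩, cvec_add φ⟩ :
      (X.B →₀ MZ N) →+ (X.B →₀ MH N)) _ _).symm]
  refine sum_mem fun i hi => ?_
  rw [cvec_smul_bext hφ]
  exact Submodule.smul_mem _ _ (hmem i hi)

variable {R : Fin N → Fin N → Fin N → Fin N → K}

theorem sum_weightZero {M : Type} [AddCommMonoid M] {m n : Fin N} (f : Fin N → Fin N → M)
    (hf : ∀ p q, f p q ≠ 0 → (p = m ∧ q = n) ∨ (p = n ∧ q = m)) (h0 : m ≠ n → f n m = 0) :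
    ∑ p, ∑ q, f p q = f m n := by
  rw [Finset.sum_eq_single m, Finset.sum_eq_single n]
  · intro q _ hq
    by_contra h
    rcases hf _ _ h with h' | h'
    · exact hq h'.2
    · exact hq (h'.2.trans h'.1)
  · intro h; exact absurd (Finset.mem_univ _) h
  · intro p _ hp
    refine Finset.sum_eq_zero fun q _ => ?_
    by_contra h
    rcases hf _ _ h with h' | h'
    · exact hp h'.1
    · obtain ⟨rfl, rfl⟩ := h'
      exact h (h0 (Ne.symm hp))
  · intro h; exact absurd (Finset.mem_univ _) h

theorem muL_eq_zero {g : K} (hg : g ≠ 0) {y : X.B →₀ K} (h : muL F ħ X.wt g y = 0) : y = 0 := by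
  ext b
  have := DFunLike.congr_fun h b
  rw [muL_apply, Finsupp.zero_apply] at this
  exact (mul_eq_zero.mp this).resolve_left ((map_ne_zero _).mpr hg)

/-- The RLL relation on a vector annihilated by operators in a row. -/
theorem RLLAt.row_eq_zero (hR : IsWtZero R) {y : X.B →₀ K} (h : X.RLLAt F ħ φ₁ φ₂ R y)
    {n m c t : Fin N} (hne : R n m n m ≠ 0) (hc : X.op F ħ φ₁ n c y = 0)
    (ht : X.op F ħ φ₁ n t y = 0) (ht' : X.op F ħ φ₂ n t y = 0) :
    X.op F ħ φ₁ n c (X.op F ħ φ₂ m t y) = 0 := by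
  have h1 := h c t n m
  rw [Finset.sum_eq_zero (s := Finset.univ) (f := fun p => ∑ q, R p q c t •
    X.op F ħ φ₂ m q (X.op F ħ φ₁ n p y)), sum_weightZero] at h1
  · exact muL_eq_zero hne h1
  · intro p q hpq
    refine (hR n m p q fun h0 => hpq ?_).imp (fun h => ⟨h.1.symm, h.2.symm⟩)
      (fun h => ⟨h.2.symm, h.1.symm⟩)
    rw [h0, muL_zero_left]
  · intro _
    rw [ht', op_zero, muL_zero]
  · intro p _
    refine Finset.sum_eq_zero fun q _ => ?_
    by_cases h0 : R p q c t = 0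
    · rw [h0, zero_smul]
    · rcases hR p q c t h0 with ⟨rfl, rfl⟩ | ⟨rfl, rfl⟩
      · rw [hc, op_zero, smul_zero]
      · rw [ht, op_zero, smul_zero]

/-- The RLL relation on a vector mapped to a stable subspace by operators in a column. -/
theorem RLLAt.column_mem (hR : IsWtZero R) {y : X.B →₀ K} (h : X.RLLAt F ħ φ₁ φ₂ R y)
    {c t : Fin N} (hne : R t c t c ≠ 0) (P : Submodule K (X.B →₀ K))
    (hmu : ∀ g, ∀ u ∈ P, muL F ħ X.wt g u ∈ P) (h₁ : ∀ p, ∀ u ∈ P, X.op F ħ φ₁ p t u ∈ P)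
    (h₂ : ∀ p, ∀ u ∈ P, X.op F ħ φ₂ p t u ∈ P) (hc : ∀ p, X.op F ħ φ₁ p c y ∈ P)
    (hc' : ∀ p, X.op F ħ φ₂ p c y ∈ P) (n m : Fin N) :
    X.op F ħ φ₂ n c (X.op F ħ φ₁ m t y) ∈ P := by
  have hmem : ∑ p, ∑ q, R p q t c • X.op F ħ φ₂ n q (X.op F ħ φ₁ m p y) ∈ P := by
    rw [← h t c m n]
    exact sum_mem fun p _ => sum_mem fun q _ => hmu _ _ (h₁ _ _ (hc' q))
  rw [← Submodule.smul_mem_iff P hne]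
  by_cases htc : t = c
  · subst htc
    exact P.smul_mem _ (h₂ _ _ (hc m))
  have hswap : R c t t c • X.op F ħ φ₂ n t (X.op F ħ φ₁ m c y) ∈ P :=
    P.smul_mem _ (h₂ _ _ (hc m))
  have hsum : ∑ p, ∑ q, R p q t c • X.op F ħ φ₂ n q (X.op F ħ φ₁ m p y) =
      R t c t c • X.op F ħ φ₂ n c (X.op F ħ φ₁ m t y) +
        R c t t c • X.op F ħ φ₂ n t (X.op F ħ φ₁ m c y) := by
    have hz : ∀ p q, ¬(p = t ∧ q = c) → ¬(p = c ∧ q = t) → R p q t c = 0 := by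
      intro p q h1 h2
      by_contra h0
      exact (hR p q t c h0).elim h1 h2
    rw [← Finset.add_sum_erase _ _ (Finset.mem_univ t), ← Finset.add_sum_erase _ _
      (Finset.mem_univ c), Finset.sum_eq_zero (s := Finset.univ.erase c), add_zero]
    · congr 1
      rw [Finset.sum_eq_single c, Finset.sum_eq_single t]
      · intro q _ hq
        rw [hz _ _ (fun h => htc h.1.symm) (fun h => hq h.2), zero_smul]
      · intro h; exact absurd (Finset.mem_univ _) h
      · intro p hp hpc
        refine Finset.sum_eq_zero fun q _ => ?_
        rw [hz _ _ (fun h => (Finset.mem_erase.mp hp).1 h.1) (fun h => hpc h.1), zero_smul]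
      · intro h; exact absurd (Finset.mem_erase.mpr ⟨Ne.symm htc, Finset.mem_univ _⟩) h
    · intro q hq
      rw [hz _ _ (fun h => (Finset.mem_erase.mp hq).1 h.2) (fun h => htc h.1), zero_smul]
  rw [hsum] at hmem
  exact (Submodule.add_mem_iff_left P hswap).mp hmem

end TwoVariables

theorem RZW_diag_ne_zero (hτ : 0 < τ.im) (ħ : ℂ) (p q : Fin N) : RZW N τ ħ p q p q ≠ 0 := by
  refine (map_ne_zero (atZsubW N)).mpr ?_
  rw [Rcoef]
  by_cases h : p = q
  · subst h
    rw [if_pos rfl, if_pos ⟨rfl, rfl⟩]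
    exact one_ne_zero
  · rw [if_neg h, if_pos ⟨rfl, rfl⟩]
    exact div_ne_zero (mul_ne_zero (thZ_ne_zero hτ _) (thL_ne_zero hτ h _))
      (mul_ne_zero (thZ_ne_zero hτ _) (thL_ne_zero hτ h _))

end PreMod
end EllipticO
end

noncomputable section
namespace EllipticO

theorem ε_sub_apply {N : ℕ} (i j t : Fin N) :
    (ε i - ε j).1 t = (if t = i then (1 : ℂ) else 0) - (if t = j then (1 : ℂ) else 0) := by
  change ((if t = i then (1 : ℂ) else 0) - 1 / N) - ((if t = j then (1 : ℂ) else 0) - 1 / N) = _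
  ring

theorem ε_injective {N : ℕ} : Function.Injective (ε : Fin N → H N) := by
  intro i j h
  by_contra hne
  have := ε_sub_apply i j i
  rw [h, sub_self, if_pos rfl, if_neg hne, sub_zero] at this
  exact zero_ne_one this

theorem ε_sub_mem_QPlus {N : ℕ} {i j : Fin N} (h : i ≤ j) : ε i - ε j ∈ QPlus N := by
  obtain ⟨j, hj⟩ := j
  induction j with
  | zero =>
    have : i = ⟨0, hj⟩ := le_antisymm h (Nat.zero_le _)
    rw [this, sub_self]
    exact zero_mem _
  | succ j ih =>
    rcases h.eq_or_lt with rfl | h'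
    · rw [sub_self]
      exact zero_mem _
    · have h1 := ih (Nat.lt_of_succ_lt hj) (Nat.le_of_lt_succ h')
      have h2 : ε (⟨j, Nat.lt_of_succ_lt hj⟩ : Fin N) - ε ⟨j + 1, hj⟩ ∈ QPlus N :=
        AddSubmonoid.subset_closure ⟨_, _, rfl, rfl⟩
      have := add_mem h1 h2
      rwa [sub_add_sub_cancel] at this

theorem wproj_cvec {k K B G : Type} [Field k] [Field K] {wt : B → G} (φ : K →+ k) (y : B →₀ K)
    (μ : G) : wproj wt μ (cvec φ y) = cvec φ (wproj wt μ y) := by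
  ext b
  by_cases hb : wt b = μ
  · rw [wproj_apply_of_eq wt hb, cvec_apply, cvec_apply, wproj_apply_of_eq wt hb]
  · rw [wproj_apply_of_ne wt hb, cvec_apply, wproj_apply_of_ne wt hb, map_zero]

/-- The vectors all of whose homogeneous components belong to a subspace. -/
def gradedCore {k B G : Type} [Field k] (wt : B → G) (W : Submodule k (B →₀ k)) :
    Submodule k (B →₀ k) := ⨅ μ, W.comap (wproj wt μ)

theorem mem_gradedCore {k B G : Type} [Field k] {wt : B → G} {W : Submodule k (B →₀ k)}
    {x : B →₀ k} : x ∈ gradedCore wt W ↔ ∀ μ, wproj wt μ x ∈ W := by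
  rw [gradedCore, Submodule.mem_iInf]
  rfl

theorem Homog.cvec {k K B G : Type} [Field k] [Field K] {wt : B → G} (φ : K →+ k) {y : B →₀ K}
    {μ : G} (h : Homog wt y μ) : Homog wt (cvec φ y) μ := by
  intro b hb
  refine h b fun h0 => hb ?_
  rw [cvec_apply, h0, map_zero]

namespace PreMod

variable {N : ℕ} {τ ħ : ℂ} {X : PreMod N}

theorem lop_sum {α : Type} (i j : Fin N) (s : Finset α) (x : α → X.V) :
    X.lop ħ i j (∑ a ∈ s, x a) = ∑ a ∈ s, X.lop ħ i j (x a) := by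
  rw [lop, bext_sum, op_sum]
  rfl

theorem wproj_lop (i j : Fin N) (x : X.V) (μ : H N) :
    wproj X.wt (μ + ε j - ε i) (X.lop ħ i j x) = X.lop ħ i j (wproj X.wt μ x) := by
  induction x using Finsupp.induction_linear with
  | zero => simp only [map_zero, lop_zero]
  | add x y hx hy => rw [lop_add, map_add, hx, hy, map_add, lop_add]
  | single b a =>
    have h1 : Homog X.wt (Finsupp.single b a) (X.wt b) := X.hasWt_single b a
    have h2 : Homog X.wt (X.lop ħ i j (Finsupp.single b a)) (X.wt b + ε j - ε i) :=
      HasWt.lop h1 i j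
    by_cases h : X.wt b = μ
    · rw [← h, h1.wproj_eq, h2.wproj_eq]
    · rw [h1.wproj_eq_zero h, lop_zero, h2.wproj_eq_zero]
      intro h'
      exact h (add_right_cancel (sub_left_injective h'))

variable (ħ) in
/-- The closure of a subspace under the coefficients of the operators in a column. -/
def colClosure (W : Submodule (MH N) X.V) (t : Fin N) : Submodule (MH N) X.V :=
  sInf {W' | W ≤ W' ∧ ∀ m, W' ≤ into ħ W' m t}

theorem le_colClosure (W : Submodule (MH N) X.V) (t : Fin N) : W ≤ colClosure ħ W t :=
  le_sInf fun _ h => h.1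

theorem colClosure_le_into (W : Submodule (MH N) X.V) (m t : Fin N) :
    colClosure ħ W t ≤ into ħ (colClosure ħ W t) m t := by
  intro x hx
  refine mem_spanK_iff.mpr fun φ hφ => ?_
  rw [colClosure, Submodule.mem_sInf] at hx ⊢
  exact fun W' hW' => mem_spanK_iff.mp (hW'.2 m (hx W' hW')) φ hφ

theorem colClosure_le {W P : Submodule (MH N) X.V} {t : Fin N} (hW : W ≤ P)
    (h : ∀ x ∈ colClosure ħ W t, x ∈ P → ∀ m (φ : MZ N →+ MH N), IsCoef (ofH N) φ →
      cvec φ (X.lop ħ m t x) ∈ P) : colClosure ħ W t ≤ P := by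
  have : colClosure ħ W t ≤ P ⊓ colClosure ħ W t := by
    refine sInf_le ⟨le_inf hW (le_colClosure W t), fun m x hx => mem_spanK_iff.mpr fun φ hφ => ?_⟩
    exact ⟨h x hx.2 hx.1 m φ hφ, mem_spanK_iff.mp (colClosure_le_into W m t hx.2) φ hφ⟩
  exact this.trans inf_le_left

theorem wproj_colClosure {W : Submodule (MH N) X.V} {t : Fin N}
    (hW : ∀ x ∈ W, ∀ μ, wproj X.wt μ x ∈ W) : ∀ x ∈ colClosure ħ W t, ∀ μ,
      wproj X.wt μ x ∈ colClosure ħ W t := by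
  have key : colClosure ħ W t ≤ gradedCore X.wt (colClosure ħ W t) := by
    refine colClosure_le (fun x hx => ?_) fun x _ hx m φ hφ => ?_
    · rw [mem_gradedCore]
      intro μ
      have h1 := hW x hx μ
      exact le_colClosure W t h1
    · rw [mem_gradedCore] at hx ⊢
      intro μ
      have h1 : wproj X.wt (μ - ε t + ε m) x ∈ colClosure ħ W t := hx _
      have h2 := mem_spanK_iff.mp (colClosure_le_into W m t h1) φ hφ
      rw [← wproj_lop, ← wproj_cvec, show μ - ε t + ε m + ε t - ε m = μ by abel] at h2
      exact h2
  exact fun x hx μ => mem_gradedCore.mp (key hx) μ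

theorem mem_into_bot {n c : Fin N} {x : X.V} :
    x ∈ into ħ (⊥ : Submodule (MH N) X.V) n c ↔ X.lop ħ n c x = 0 := by
  rw [mem_into, spanK_bot, Submodule.mem_bot]

theorem colClosure_row (hτ : 0 < τ.im) (hX : X.RLL τ ħ) {W : Submodule (MH N) X.V} {t p : Fin N}
    (htp : t < p) (hW : ∀ c, c < p → W ≤ into ħ ⊥ p c) :
    ∀ c, c < p → colClosure ħ W t ≤ into ħ ⊥ p c := by
  have key : colClosure ħ W t ≤ ⨅ c : {c // c < p}, into ħ ⊥ p c := by
    refine colClosure_le (le_iInf fun c => hW c c.2) fun x _ hx m φ hφ => ?_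
    have hx : ∀ c < p, X.lop ħ p c x = 0 := fun c hc =>
      mem_into_bot.mp (Submodule.mem_iInf _ |>.mp hx ⟨c, hc⟩)
    refine Submodule.mem_iInf _ |>.mpr fun c => ?_
    refine coef_mem_into (F := frameZW N) (isPoint_atW N) (isPoint_atZ N)
      (fun I s κ h => linear_disjoint_swap s κ h) ?_ hφ
    rw [← op_bext_bext (isPoint_atW N), spanK_bot, Submodule.mem_bot]
    refine RLLAt.row_eq_zero (φ₂ := atW N) (isWtZero_RZW τ ħ) ((rll_iff ħ X τ).mp hX _)
      (RZW_diag_ne_zero hτ ħ _ _) ?_ ?_ ?_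
    · rw [op_bext_bext (isPoint_atZ N), hx c c.2, bext_zero]
    · rw [op_bext_bext (isPoint_atZ N), hx t htp, bext_zero]
    · rw [op_bext_bext (isPoint_atW N), hx t htp, bext_zero]
  exact fun c hc => key.trans (iInf_le (fun c : {c // c < p} => into ħ ⊥ p c) ⟨c, hc⟩)

theorem colClosure_column (hτ : 0 < τ.im) (hX : X.RLL τ ħ) {W : Submodule (MH N) X.V} {t c : Fin N}
    (hgr : ∀ x ∈ W, ∀ μ, wproj X.wt μ x ∈ W) (hW : ∀ n, W ≤ into ħ W n c) (n : Fin N) :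
    colClosure ħ W t ≤ into ħ (colClosure ħ W t) n c := by
  have key : colClosure ħ W t ≤ ⨅ n, into ħ (colClosure ħ W t) n c := by
    refine colClosure_le (le_iInf fun n => (hW n).trans (into_mono (le_colClosure W t) n c))
      fun x hx' hx m φ hφ => ?_
    have hx : ∀ n, X.lop ħ n c x ∈ spanK (ofH N) (colClosure ħ W t) := fun n =>
      Submodule.mem_iInf _ |>.mp hx n
    refine Submodule.mem_iInf _ |>.mpr fun n => ?_
    refine coef_mem_into (F := frameZW N) (isPoint_atZ N) (isPoint_atW N)
      (fun I s κ h => linear_disjoint s κ h) ?_ hφ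
    rw [← op_bext_bext (isPoint_atZ N)]
    refine RLLAt.column_mem (isWtZero_RZW τ ħ) ((rll_iff ħ X τ).mp hX _)
      (RZW_diag_ne_zero hτ ħ _ _) _ (fun g u => muL_mem_spanK (wproj_colClosure hgr) g)
      (fun p u => op_mem_spanK (isPoint_atZ N) (colClosure_le_into W p t))
      (fun p u => op_mem_spanK (isPoint_atW N) (colClosure_le_into W p t)) ?_ ?_ n m
    · intro p
      rw [op_bext_bext (isPoint_atZ N)]
      exact bext_mem_spanK_of_mem (isPoint_atZ N) (hx p)
    · intro p
      rw [op_bext_bext (isPoint_atW N)]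
      exact bext_mem_spanK_of_mem (isPoint_atW N) (hx p)
  exact key.trans (iInf_le _ n)

variable (X) in
/-- The weights strictly below `α`. -/
def lower (α : H N) : Submodule (MH N) X.V :=
  Finsupp.supported (MH N) (MH N) {b | α - X.wt b ∈ QPlus N ∧ X.wt b ≠ α}

theorem mem_lower {α : H N} {x : X.V} :
    x ∈ X.lower α ↔ ∀ b, x b ≠ 0 → α - X.wt b ∈ QPlus N ∧ X.wt b ≠ α := by
  rw [lower, Finsupp.mem_supported']
  exact forall_congr' fun b => not_imp_comm

theorem wproj_lower {α μ : H N} {x : X.V} (hx : x ∈ X.lower α) (h : wproj X.wt μ x ≠ 0) :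
    α - μ ∈ QPlus N ∧ μ ≠ α := by
  obtain ⟨b, hb⟩ := Finsupp.ne_iff.mp h
  have h1 := homog_wproj (wt := X.wt) x μ b hb
  have h2 := mem_lower.mp hx b (by rwa [wproj_apply_of_eq X.wt h1] at hb)
  rwa [h1] at h2

theorem HasWt.mem_lower {α μ : H N} {x : X.V} (hx : X.HasWt x μ) (h : α - μ ∈ QPlus N)
    (hne : μ ≠ α) : x ∈ X.lower α := by
  refine PreMod.mem_lower.mpr fun b hb => ?_
  rw [hx b hb]
  exact ⟨h, hne⟩

/-- A vector of weight `α`, annihilated by the `L_{ij}(z)` for `i > j` and an eigenvector of the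
`L_{kk}(z)`. -/
structure IsHighest (ħ : ℂ) (X : PreMod N) (v : X.V) (α : H N) : Prop where
  wt : X.HasWt v α
  upper : ∀ i j, j < i → X.lop ħ i j v = 0
  diag : ∀ k, X.lop ħ k k v ∈ spanK (ofH N) (Submodule.span (MH N) {v})

theorem lop_mem_lower {α : H N} {m t : Fin N} (h : m ≤ t) {x : X.V} (hx : x ∈ X.lower α)
    (φ : MZ N →+ MH N) : cvec φ (X.lop ħ m t x) ∈ X.lower α := by
  have hle := ε_sub_mem_QPlus h
  obtain ⟨s, hs⟩ := exists_sum_wproj (wt := X.wt) x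
  refine PreMod.mem_lower.mpr fun b hb => ?_
  rw [cvec_apply] at hb
  have h0 : X.lop ħ m t x b ≠ 0 := fun h => hb (by rw [h, map_zero])
  rw [hs, lop_sum, Finsupp.finsetSum_apply] at h0
  obtain ⟨μ, -, hμ⟩ := Finset.exists_ne_zero_of_sum_ne_zero h0
  have h1 := HasWt.lop (ħ := ħ) (homog_wproj (wt := X.wt) x μ) m t b hμ
  have h2 := wproj_lower hx (μ := μ) fun h => hμ (by rw [h, lop_zero]; rfl)
  have h3 : α - X.wt b = (α - μ) + (ε m - ε t) := by rw [h1]; abel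
  refine ⟨by rw [h3]; exact add_mem h2.1 hle, fun h4 => h2.2 ?_⟩
  rw [h4, sub_self] at h3
  have : -(α - μ) ∈ QPlus N := by rwa [← eq_neg_of_add_eq_zero_right h3.symm]
  exact (sub_eq_zero.mp (QPlus_antisymm h2.1 this)).symm

/-- The submodule generated by a highest vector. -/
theorem IsHighest.exists_isSub (hτ : 0 < τ.im) (hX : X.RLL τ ħ) {v : X.V} {α : H N}
    (hv : IsHighest ħ X v α) : ∃ U, IsSub ħ X U ∧ v ∈ U ∧
      U ≤ Submodule.span (MH N) {v} ⊔ X.lower α := by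
  have key : ∀ s ≤ N, ∃ U : Submodule (MH N) X.V, v ∈ U ∧
      (∀ x ∈ U, ∀ μ, EllipticO.wproj X.wt μ x ∈ U) ∧
      (∀ n c : Fin N, (c : ℕ) < s → U ≤ into ħ U n c) ∧
      (∀ p : Fin N, s ≤ p → ∀ c, c < p → U ≤ into ħ ⊥ p c) ∧
      U ≤ Submodule.span (MH N) {v} ⊔ X.lower α := by
    intro s
    induction s with
    | zero =>
      intro _
      refine ⟨Submodule.span (MH N) {v}, Submodule.mem_span_singleton_self v, ?_, ?_, ?_,
        le_sup_left⟩
      · intro x hx μ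
        obtain ⟨a, rfl⟩ := Submodule.mem_span_singleton.mp hx
        by_cases h : α = μ
        · subst h
          rwa [Homog.wproj_eq (hv.wt.smul a)]
        · rw [Homog.wproj_eq_zero (hv.wt.smul a) h]
          exact zero_mem _
      · intro n c hc
        exact absurd hc (Nat.not_lt_zero _)
      · intro p _ c hc
        rw [Submodule.span_singleton_le_iff_mem, mem_into_bot]
        exact hv.upper p c hc
    | succ s ih =>
      intro hs
      obtain ⟨U, h0, h1, h2, h3, h4⟩ := ih (Nat.le_of_succ_le hs)
      let t : Fin N := ⟨s, hs⟩
      have h3' : ∀ p : Fin N, s + 1 ≤ p → ∀ c, c < p → colClosure ħ U t ≤ into ħ ⊥ p c :=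
        fun p hp => colClosure_row hτ hX (t := t) hp (h3 p (Nat.le_of_succ_le hp))
      refine ⟨colClosure ħ U t, le_colClosure U t h0, wproj_colClosure h1, ?_, h3', ?_⟩
      · intro n c hc
        rcases (Nat.lt_succ_iff_lt_or_eq.mp hc) with hc | hc
        · exact colClosure_column hτ hX h1 (fun n => h2 n c hc) n
        · rw [show c = t from Fin.ext hc]
          exact colClosure_le_into U n t
      · refine colClosure_le h4 fun x hx hx' m φ hφ => ?_
        rcases lt_or_ge t m with htm | hmt
        · rw [mem_into_bot.mp (h3' m htm t htm hx), cvec_zero]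
          exact zero_mem _
        obtain ⟨y, hy, z, hz, rfl⟩ := Submodule.mem_sup.mp hx'
        obtain ⟨a, rfl⟩ := Submodule.mem_span_singleton.mp hy
        rw [lop_add, cvec_add]
        refine add_mem ?_ (Submodule.mem_sup_right (lop_mem_lower hmt hz φ))
        rw [lop_smul, cvec_smul]
        have hφ' := hφ.mul_right (ofH N (shift (ħ • ε t) a))
        rcases eq_or_ne m t with rfl | hne
        · exact Submodule.mem_sup_left (mem_spanK_iff.mp (hv.diag t) _ hφ')
        · refine Submodule.mem_sup_right (HasWt.mem_lower (Homog.cvec _ (hv.wt.lop m t)) ?_ ?_)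
          · rw [show α - (α + ε t - ε m) = ε m - ε t by abel]
            exact ε_sub_mem_QPlus hmt
          · intro h
            refine hne (ε_injective ?_)
            rw [add_sub_assoc, add_eq_left, sub_eq_zero] at h
            exact h.symm
  obtain ⟨U, h0, h1, h2, -, h4⟩ := key N le_rfl
  exact ⟨U, IsSub.of_op h1 fun x hx i j => h2 i j j.2 hx, h0, h4⟩

end PreMod
end EllipticO
end

noncomputable section
namespace EllipticO

theorem word_snoc {N : ℕ} {V : Type} [AddCommGroup V] {A : Fin N → Fin N → ℂ → V →+ V} {ħ : ℂ}
    (a : ℂ) {k : ℕ} (r c : Fin (k + 1) → Fin N) (x : V) :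
    word A ħ a r c x = word A ħ a (fun s => r s.castSucc) (fun s => c s.castSucc)
      (A (r (Fin.last k)) (c (Fin.last k)) (a + (k : ℕ) * ħ) x) := by
  unfold word
  rw [List.finRange_succ_last, List.foldr_append, List.foldr_map]
  rfl

section Injectivity

variable {k K : Type} [Field k] [Field K] {j : k →+* K} {ι G B S : Type} {wt : B → G}
  {D : ι → (B →₀ k) → (B →₀ K)} {v : S → B →₀ k} {ω : S → G} {F : S → ι → K} {h : S → ℕ}

theorem IsTriang.flag_zero {μ : G} : flag v ω h μ 0 = ⊥ := by
  rw [flag, show {s | ω s = μ ∧ h s < 0} = ∅ from by ext s; simp, Set.image_empty,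
    Submodule.span_empty]

/-- Semilinear extensions of triangular operators are injective on weight spaces. -/
theorem IsTriang.eq_zero_of_map (T : IsTriang j wt D v ω F h) {σ : K →+* K}
    {E : (B →₀ K) → (B →₀ K)} (hadd : ∀ x y, E (x + y) = E x + E y)
    (hsmul : ∀ c y, E (c • y) = σ c • E y) {l : ι} {μ : G} {γ : K} (hγ : γ ≠ 0)
    (hE : ∀ x, Homog wt x μ → E (bext j x) = γ • D l x) (hF : ∀ s, F s l ≠ 0) (n : ℕ)
    {y : B →₀ K} (hy : y ∈ spanK j (flag v ω h μ n)) (h0 : E y = 0) : y = 0 := by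
  have hflag : ∀ n, ∀ y ∈ spanK j (flag v ω h μ n), E y ∈ spanK j (flag v ω h μ n) := by
    intro n y hy
    rw [flag, spanK_span] at hy
    induction hy using Submodule.span_induction with
    | mem y hy =>
      obtain ⟨_, ⟨s, ⟨rfl, hs⟩, rfl⟩, rfl⟩ := hy
      rw [hE _ (T.homog s)]
      refine Submodule.smul_mem _ _ ?_
      have h1 := spanK_mono j (flag_mono hs.le) (T.tri l s)
      have h2 := Submodule.smul_mem _ (F s l) (bext_mem_spanK (j := j).mpr
        (mem_flag (ω := ω) (v := v) hs))
      have := add_mem h1 h2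
      rwa [sub_add_cancel] at this
    | zero =>
      have := hsmul 0 0
      rw [smul_zero, map_zero, zero_smul] at this
      rw [this]
      exact zero_mem _
    | add x y _ _ hx hy => rw [hadd]; exact add_mem hx hy
    | smul c x _ hx => rw [hsmul]; exact Submodule.smul_mem _ _ hx
  induction n generalizing y with
  | zero => rwa [flag_zero, spanK_bot, Submodule.mem_bot] at hy
  | succ n ih =>
    by_cases hs : ∃ s, ω s = μ ∧ h s = n
    · obtain ⟨s, rfl, rfl⟩ := hs
      have hsub : spanK j (flag v ω h (ω s) (h s + 1)) ≤
          Submodule.span K {bext j (v s)} ⊔ spanK j (flag v ω h (ω s) (h s)) := by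
        rw [flag, spanK_span, Submodule.span_le]
        rintro _ ⟨_, ⟨s', ⟨h1, h2⟩, rfl⟩, rfl⟩
        rcases (Nat.lt_succ_iff_lt_or_eq.mp h2) with h3 | h3
        · refine Submodule.mem_sup_right (bext_mem_spanK.mpr ?_)
          rw [← h1]
          exact mem_flag h3
        · obtain rfl := T.inj s' s h1 h3
          exact Submodule.mem_sup_left (Submodule.mem_span_singleton_self _)
      obtain ⟨_, hu, z, hz, rfl⟩ := Submodule.mem_sup.mp (hsub hy)
      obtain ⟨c, rfl⟩ := Submodule.mem_span_singleton.mp hu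
      by_cases hc : c = 0
      · subst hc
        rw [zero_smul, zero_add] at h0 ⊢
        exact ih hz h0
      exfalso
      rw [hadd, hsmul, hE _ (T.homog s)] at h0
      have h1 : σ c • γ • F s l • bext j (v s) ∈ spanK j (flag v ω h (ω s) (h s)) := by
        have h2 := add_mem (hflag _ z hz) (Submodule.smul_mem _ (σ c)
          (Submodule.smul_mem _ γ (T.tri l s)))
        rw [smul_sub, smul_sub, add_sub, add_comm, h0, zero_sub] at h2
        exact neg_mem_iff.mp h2
      rw [smul_smul, smul_smul, Submodule.smul_mem_iff _ (mul_ne_zero (mul_ne_zero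
        ((map_ne_zero σ).mpr hc) hγ) (hF s)), bext_mem_spanK] at h1
      exact T.notMem_flag s h1
    · refine ih (spanK_mono j (Submodule.span_mono (Set.image_mono ?_)) hy) h0
      rintro s ⟨h1, h2⟩
      exact ⟨h1, lt_of_le_of_ne (Nat.le_of_lt_succ h2) fun h3 => hs ⟨s, h1, h3⟩⟩

end Injectivity

section ThetaShift

variable {N : ℕ} {τ ħ : ℂ}

theorem ofH_thH (i j : Fin N) (c : ℂ) : ofH N (thH τ i j c) = thL τ i j c :=
  pull_ofEnt _ _ _ _ _

theorem thL_shift (i j : Fin N) (c : ℂ) (w : H N) :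
    shift ((0, w) : ℂ × H N) (thL τ i j c) = thL τ i j (c + ldiff i j w) := by
  refine (pull_ofEnt _ _ _ _ _).trans (ofEnt_congr (fun x => ?_) _ _)
  congr 1
  change (x.2.1 i + w.1 i - (x.2.1 j + w.1 j)) + c = (x.2.1 i - x.2.1 j) + (c + (w.1 i - w.1 j))
  ring

theorem ldiff_smul (i j : Fin N) (c : ℂ) (w : H N) : ldiff i j (c • w) = c * ldiff i j w := by
  change c * w.1 i - c * w.1 j = c * (w.1 i - w.1 j)
  ring

theorem minorWt_apply {l : ℕ} {t : Fin N} (h : N - l ≤ (t : ℕ)) :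
    (PreMod.minorWt N l).1 t = 1 - ∑ i : Fin N, if N - l ≤ (i : ℕ) then (1 / N : ℂ) else 0 := by
  have h1 : ∀ i : Fin N, (if N - l ≤ (i : ℕ) then (ε i : H N) else 0).1 t =
      (if t = i then 1 else 0) - if N - l ≤ (i : ℕ) then (1 / N : ℂ) else 0 := by
    intro i
    split_ifs with h2 h3 h3
    · rw [h3, ε_apply, if_pos rfl]
    · rw [ε_apply, if_neg h3]
    · subst h3; exact absurd h h2
    · rw [sub_zero]; rfl
  rw [PreMod.minorWt, AddSubmonoidClass.coe_finsetSum, Finset.sum_apply,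
    Finset.sum_congr rfl fun i _ => h1 i, Finset.sum_sub_distrib, Finset.sum_ite_eq,
    if_pos (Finset.mem_univ _)]

theorem ldiff_minorWt {l : ℕ} {i j : Fin N} (hi : N - l ≤ (i : ℕ)) (hj : N - l ≤ (j : ℕ)) :
    ldiff i j (PreMod.minorWt N l) = 0 := by
  rw [ldiff, minorWt_apply hi, minorWt_apply hj, sub_self]

/-- The factors `θ(λ_{kj} + v_{kj})`, `j > k`. -/
def thetaRow (τ : ℂ) (k : Fin N) (v : H N) : MZ N :=
  ∏ j : Fin N, if k < j then thL τ k j (ldiff k j v) else 1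

theorem Theta_succ {k : Fin N} {l : ℕ} (hk : (k : ℕ) + l + 1 = N) (v : H N) :
    PreMod.Theta τ (l + 1) v = PreMod.Theta τ l v * thetaRow τ k v := by
  classical
  have h1 : thetaRow τ k v = ∏ i : Fin N, if i = k then thetaRow τ k v else 1 := by
    rw [Finset.prod_ite_eq' Finset.univ k, if_pos (Finset.mem_univ _)]
  rw [h1, PreMod.Theta, PreMod.Theta, ← Finset.prod_mul_distrib]
  refine Finset.prod_congr rfl fun i _ => ?_
  by_cases hi : i = k
  · subst hi
    rw [if_pos rfl, thetaRow, Finset.prod_eq_one (f := fun j => if N - l ≤ (i : ℕ) ∧ i < j then _ else _),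
      one_mul]
    · refine Finset.prod_congr rfl fun j _ => ?_
      congr 1
      exact propext ⟨fun h => h.2, fun h => ⟨by omega, h⟩⟩
    · intro j _
      rw [if_neg]
      rintro ⟨h, -⟩
      omega
  · rw [if_neg hi, mul_one]
    refine Finset.prod_congr rfl fun j _ => ?_
    congr 1
    have : (i : ℕ) ≠ k := fun h => hi (Fin.ext h)
    refine propext (and_congr_left fun _ => ?_)
    omega

theorem Theta_zero (v : H N) : PreMod.Theta τ 0 v = 1 :=
  Finset.prod_eq_one fun i _ => Finset.prod_eq_one fun j _ => if_neg fun h => by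
    have := i.2; have := h.1; omega

theorem ofH_hatFactor (k : Fin N) (μ : H N) :
    ofH N (hatFactor τ ħ k μ) = thetaRow τ k 0 / thetaRow τ k (ħ • μ) := by
  rw [hatFactor, map_prod, thetaRow, thetaRow, ← Finset.prod_div_distrib]
  refine Finset.prod_congr rfl fun j _ => ?_
  split_ifs
  · rw [map_div₀, ofH_thH, ofH_thH, ldiff_smul, show ldiff k j (0 : H N) = 0 from sub_self 0]
  · rw [map_one, div_one]

theorem thetaRow_ne_zero (hτ : 0 < τ.im) (k : Fin N) (v : H N) : thetaRow τ k v ≠ 0 := by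
  refine Finset.prod_ne_zero_iff.mpr fun j _ => ?_
  split_ifs with h
  · exact thL_ne_zero hτ h.ne _
  · exact one_ne_zero

theorem hatFactor_ne_zero (hτ : 0 < τ.im) (k : Fin N) (μ : H N) : hatFactor τ ħ k μ ≠ 0 := by
  intro h
  have := ofH_hatFactor (τ := τ) (ħ := ħ) k μ
  rw [h, map_zero] at this
  exact div_ne_zero (thetaRow_ne_zero hτ k _) (thetaRow_ne_zero hτ k _) this.symm

theorem thetaRow_shift {k : Fin N} {l : ℕ} (hk : (k : ℕ) + l + 1 = N) (v : H N) :
    shift ((0, ħ • PreMod.minorWt N (l + 1)) : ℂ × H N) (thetaRow τ k v) = thetaRow τ k v := by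
  rw [thetaRow, map_prod]
  refine Finset.prod_congr rfl fun j _ => ?_
  split_ifs with h
  · rw [thL_shift, ldiff_smul, ldiff_minorWt, mul_zero, add_zero]
    · omega
    · have := Fin.lt_def.mp h; omega
  · exact map_one _

end ThetaShift

end EllipticO
end

noncomputable section
namespace EllipticO
namespace PreMod

variable {N : ℕ} {τ ħ : ℂ} {X : PreMod N}

/-- There is no weight of `X` above `μ`, except for `μ`. -/
def IsTop (X : PreMod N) (μ : H N) : Prop := ∀ b, X.wt b - μ ∈ QPlus N → X.wt b = μ

section GenericWords

variable {K : Type} [Field K] {F : Frame N K} {pt : ℂ → MZ N →+* K} {μ : H N}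

theorem IsTop.op_eq_zero (hμ : X.IsTop μ) {φ : MZ N →+* K} {i j : Fin N} (hij : j < i)
    {y : X.B →₀ K} (hy : X.HasWt y μ) : X.op F ħ φ i j y = 0 := by
  by_contra h
  obtain ⟨b, hb⟩ := Finsupp.ne_iff.mp h
  have h1 := hy.op F ħ (φ := φ) (i := i) (j := j) b hb
  have h2 : X.wt b = μ := by
    refine hμ b ?_
    rw [h1, show μ + ε j - ε i - μ = ε j - ε i by abel]
    exact ε_sub_mem_QPlus hij.le
  rw [h2, add_sub_assoc, left_eq_add, sub_eq_zero] at h1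
  exact hij.ne (ε_injective h1)

theorem IsTop.word_eq_zero (hμ : X.IsTop μ) {k : ℕ} (a : ℂ) {r c : Fin k → Fin N} (s : Fin k)
    (hs : c s < r s) (hs' : ∀ t, s < t → r t = c t) {y : X.B →₀ K} (hy : X.HasWt y μ) :
    word (X.opHom F ħ pt) ħ a r c y = 0 := by
  induction k generalizing a with
  | zero => exact s.elim0
  | succ k ih =>
    rw [word_succ, opHom_apply]
    cases s using Fin.cases with
    | zero =>
      refine hμ.op_eq_zero hs ?_
      have h1 := hy.word F ħ pt (a + ħ) (fun s => r s.succ) (fun s => c s.succ)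
      rwa [Finset.sum_congr rfl fun t _ => congrArg ε (hs' (Fin.succ t) (Fin.succ_pos t)),
        add_sub_cancel_right] at h1
    | succ s =>
      rw [ih (a + ħ) s hs fun t ht => hs' _ (Fin.succ_lt_succ_iff.mpr ht), op_zero]

theorem IsTop.altWord_eq (hμ : X.IsTop μ) {k : ℕ} {c : Fin k → Fin N}
    (hc : ∀ s t, s < t → c t < c s) {y : X.B →₀ K} (hy : X.HasWt y μ) :
    altWord (X.opHom F ħ pt) ħ c c y = word (X.opHom F ħ pt) ħ 0 c c y := by
  rw [altWord, Finset.sum_eq_single 1]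
  · rw [Equiv.Perm.sign_one, Units.val_one, one_smul]
    rfl
  · intro π _ hπ
    have hne : (Finset.univ.filter fun s => π s ≠ s).Nonempty := by
      by_contra h
      refine hπ (Equiv.ext fun s => ?_)
      by_contra h'
      exact h ⟨s, Finset.mem_filter.mpr ⟨Finset.mem_univ _, h'⟩⟩
    obtain ⟨s, hs, hmax⟩ := Finset.exists_max_image _ id hne
    have hs := (Finset.mem_filter.mp hs).2
    have hfix : ∀ t, s < t → π t = t := by
      intro t ht
      by_contra h
      exact absurd (hmax t (Finset.mem_filter.mpr ⟨Finset.mem_univ _, h⟩)) (not_le.mpr ht)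
    have hlt : π s < s := by
      refine lt_of_le_of_ne (not_lt.mp fun h => ?_) hs
      exact hs (π.injective (hfix _ h))
    rw [hμ.word_eq_zero 0 s (r := c ∘ π) (hc _ _ hlt) (fun t ht => congrArg c (hfix t ht)) hy,
      smul_zero]
  · intro h
    exact absurd (Finset.mem_univ _) h

end GenericWords

variable (ħ X) in
/-- `L_{NN}(z) L_{N-1,N-1}(z+ħ) ⋯ L_{N-l+1,N-l+1}(z+(l-1)ħ)`. -/
def diagWord {l : ℕ} (hl : l ≤ N) (y : X.B →₀ MZ N) : X.B →₀ MZ N :=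
  word (X.opHom (frameZ N) ħ (ptZ N)) ħ 0 (topIdx hl) (topIdx hl) y

theorem diagWord_add {l : ℕ} (hl : l ≤ N) (x y : X.B →₀ MZ N) :
    X.diagWord ħ hl (x + y) = X.diagWord ħ hl x + X.diagWord ħ hl y := by
  rw [diagWord, word_add]
  rfl

theorem diagWord_smul {l : ℕ} (hl : l ≤ N) (c : MZ N) (y : X.B →₀ MZ N) :
    X.diagWord ħ hl (c • y) =
      shift ((0, ħ • minorWt N l) : ℂ × H N) c • X.diagWord ħ hl y := by
  rw [diagWord, word_smul, sum_topIdx]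
  rfl

theorem diagWord_succ {k : Fin N} {l : ℕ} (hk : (k : ℕ) + l + 1 = N) (hl : l + 1 ≤ N)
    (hl' : l ≤ N) (y : X.B →₀ MZ N) : X.diagWord ħ hl y =
      X.diagWord ħ hl' (X.op (frameZ N) ħ (ptZ N ((l : ℕ) * ħ)) k k y) := by
  have h1 : topIdx hl (Fin.last l) = k := by
    refine Fin.ext ?_
    rw [topIdx, Fin.val_rev, Fin.val_castLE, Fin.val_last]
    omega
  rw [diagWord, word_snoc, h1, zero_add]
  rfl

theorem topIdx_lt {l : ℕ} (hl : l ≤ N) (s t : Fin l) (h : s < t) : topIdx hl t < topIdx hl s :=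
  Fin.rev_lt_rev.mpr h

theorem IsTop.diagWord_eq (hτ : 0 < τ.im) {μ : H N} (hμ : X.IsTop μ) {l : ℕ} (hl : l < N)
    {x : X.V} (hx : X.HasWt x μ) : X.diagWord ħ hl (bext (ofH N) x) =
      (Theta τ (l + 1) (ħ • μ) / Theta τ (l + 1) (0 : H N)) • X.qminor τ ħ ⟨l, hl⟩ x := by
  have h1 : X.alt ħ hl (bext (ofH N) x) = X.diagWord ħ hl (bext (ofH N) x) :=
    hμ.altWord_eq (topIdx_lt hl) (hx.bext _)
  have h2 := minor_ext τ ħ X ⟨l, hl⟩ hx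
  rw [minor_eq τ ħ X hl, ext_eq, h1] at h2
  rw [← h2, smul_smul, div_mul_div_cancel₀ (Theta_ne_zero hτ _ _), div_self (Theta_ne_zero hτ _ _),
    one_smul]

/-- `f_N(z) f_{N-1}(z+ħ) ⋯ f_{N-l+1}(z+(l-1)ħ)`. -/
def diagPart (ħ : ℂ) (l : ℕ) (f : Fin N → MCˣ) : MC :=
  ∏ t : Fin N, if (t : ℕ) < l then shift (((t : ℕ) : ℂ) * ħ) (f (Fin.rev t) : MC) else 1

theorem diagProd_eq_diagPart (l : Fin N) (f : Fin N → MCˣ) :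
    diagProd ħ l f = diagPart ħ (l + 1) f := by
  refine Finset.prod_congr rfl fun t _ => ?_
  congr 1
  exact propext (Fin.le_def.trans Nat.lt_succ_iff.symm)

theorem diagPart_zero (f : Fin N → MCˣ) : diagPart ħ 0 f = 1 :=
  Finset.prod_eq_one fun _ _ => if_neg (Nat.not_lt_zero _)

theorem diagPart_succ {k : Fin N} {l : ℕ} (hk : (k : ℕ) + l + 1 = N) (f : Fin N → MCˣ) :
    diagPart ħ (l + 1) f = diagPart ħ l f * shift ((l : ℕ) * ħ) (f k : MC) := by
  classical
  have h1 : shift ((l : ℕ) * ħ) (f k : MC) =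
      ∏ t : Fin N, if t = Fin.rev k then shift ((l : ℕ) * ħ) (f k : MC) else 1 := by
    rw [Finset.prod_ite_eq' Finset.univ, if_pos (Finset.mem_univ _)]
  rw [h1, diagPart, diagPart, ← Finset.prod_mul_distrib]
  refine Finset.prod_congr rfl fun t _ => ?_
  have hrev : (Fin.rev k : ℕ) = l := by rw [Fin.val_rev]; omega
  by_cases ht : t = Fin.rev k
  · have hl : (t : ℕ) = l := by rw [ht, hrev]
    rw [if_pos ht, if_pos (by omega), if_neg (by omega), one_mul, ht, Fin.rev_rev, hrev]
  · rw [if_neg ht, mul_one]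
    congr 1
    have : (t : ℕ) ≠ l := fun h => ht (Fin.ext (h.trans hrev.symm))
    exact propext (by omega)

/-- The eigenvalue of the product of the diagonal operators on a highest weight vector. -/
def wordEig (τ ħ : ℂ) (μ : H N) (f : Fin N → MCˣ) (l : ℕ) : MZ N :=
  Theta τ l (ħ • μ) / Theta τ l (0 : H N) * ofC N (diagPart ħ l f)

theorem wordEig_succ (hτ : 0 < τ.im) {k : Fin N} {l : ℕ} (hk : (k : ℕ) + l + 1 = N) (μ : H N)
    (f : Fin N → MCˣ) : ofH N (hatFactor τ ħ k μ) * wordEig τ ħ μ f (l + 1) =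
      ofC N (shift ((l : ℕ) * ħ) (f k : MC)) * wordEig τ ħ μ f l := by
  rw [ofH_hatFactor, wordEig, wordEig, Theta_succ hk, Theta_succ hk, diagPart_succ hk, map_mul]
  have h1 := thetaRow_ne_zero hτ k (0 : H N)
  have h2 := thetaRow_ne_zero hτ k (ħ • μ)
  have h3 := Theta_ne_zero hτ l (0 : H N)
  generalize Theta τ l (ħ • μ) = t1 at *
  generalize Theta τ l (0 : H N) = t2 at *
  generalize thetaRow τ k (0 : H N) = r1 at *
  generalize thetaRow τ k (ħ • μ) = r2 at *
  generalize ofC N (diagPart ħ l f) = q1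
  generalize ofC N (shift ((l : ℕ) * ħ) (f k : MC)) = q2
  field_simp

theorem shift_hatFactor {k : Fin N} {l : ℕ} (hk : (k : ℕ) + l + 1 = N) (μ : H N) :
    shift ((0, ħ • minorWt N (l + 1)) : ℂ × H N) (ofH N (hatFactor τ ħ k μ)) =
      ofH N (hatFactor τ ħ k μ) := by
  rw [ofH_hatFactor, map_div₀, thetaRow_shift hk, thetaRow_shift hk]

theorem wordEig_zero (μ : H N) (f : Fin N → MCˣ) : wordEig τ ħ μ f 0 = 1 := by
  rw [wordEig, Theta_zero, Theta_zero, diagPart_zero, map_one, div_one, mul_one]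

variable (τ ħ X) in
/-- The relations of a highest weight vector for the diagonal operators. -/
def IsEigen (v : X.V) (μ : H N) (f : Fin N → MCˣ) : Prop :=
  ∀ k, X.lop ħ k k (hatFactor τ ħ k μ • v) = ofC N (f k) • bext (ofH N) v

theorem op_ptZ (k : Fin N) (a : ℂ) (x : X.V) :
    X.op (frameZ N) ħ (ptZ N a) k k (bext (ofH N) x) = bext (ptZ N a) (X.lop ħ k k x) :=
  op_bext_bext (F := frameZ N) (isPoint_ptZ a) k k x

theorem bext_ptZ_smul (a : ℂ) (q : MC) (x : X.V) :
    bext (ptZ N a) (ofC N q • bext (ofH N) x) = ofC N (shift a q) • bext (ofH N) x := by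
  rw [bext_smul, bext_bext, show (ptZ N a).comp (ofH N) = ofH N from
    RingHom.ext (isPoint_ptZ a).ofH]
  congr 1
  exact ofC_shift a 0 q

theorem diagWord_ofC {l : ℕ} (hl : l ≤ N) (q : MC) (x : X.B →₀ MZ N) :
    X.diagWord ħ hl (ofC N q • x) = ofC N q • X.diagWord ħ hl x := by
  rw [diagWord_smul, ofC_shift, shift_zero]

theorem IsEigen.diagWord_eq (hτ : 0 < τ.im) {v : X.V} {μ : H N} {f : Fin N → MCˣ}
    (h : X.IsEigen τ ħ v μ f) {l : ℕ} (hl : l ≤ N) :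
    X.diagWord ħ hl (bext (ofH N) v) = wordEig τ ħ μ f l • bext (ofH N) v := by
  induction l with
  | zero => rw [wordEig_zero, one_smul]; rfl
  | succ l ih =>
    let k : Fin N := ⟨N - (l + 1), by omega⟩
    have hk : (k : ℕ) + l + 1 = N := by change N - (l + 1) + l + 1 = N; omega
    have h0 : ofH N (hatFactor τ ħ k μ) ≠ 0 := (map_ne_zero _).mpr (hatFactor_ne_zero hτ k μ)
    have h1 : ofH N (hatFactor τ ħ k μ) • X.diagWord ħ hl (bext (ofH N) v) =
        X.diagWord ħ hl (bext (ofH N) (hatFactor τ ħ k μ • v)) := by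
      rw [bext_smul, diagWord_smul, shift_hatFactor hk]
    rw [diagWord_succ hk hl (by omega) (bext (ofH N) (hatFactor τ ħ k μ • v)), op_ptZ, h k,
      bext_ptZ_smul, diagWord_ofC,
      ih (by omega), smul_smul, ← wordEig_succ hτ hk, ← smul_smul] at h1
    exact smul_right_injective _ h0 h1

theorem IsEigen.qminor_eq (hτ : 0 < τ.im) {v : X.V} {μ : H N} {f : Fin N → MCˣ}
    (hμ : X.IsTop μ) (hv : X.HasWt v μ) (h : X.IsEigen τ ħ v μ f) (l : Fin N) :
    X.qminor τ ħ l v = ofC N (diagProd ħ l f) • bext (ofH N) v := by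
  have h1 := h.diagWord_eq hτ l.2
  rw [hμ.diagWord_eq hτ l.2 hv, wordEig, ← smul_smul, diagProd_eq_diagPart] at *
  exact smul_right_injective _ (div_ne_zero (Theta_ne_zero hτ _ _) (Theta_ne_zero hτ _ _)) h1

section Tri

variable {S : Type} {v : S → X.V} {ω : S → H N} {f : S → Fin N → MCˣ} {h : S → ℕ}

theorem Tri.qminor_lowest (T : X.Tri τ ħ v ω f h) {s : S} (hs : ∀ t, ω t = ω s → h s ≤ h t)
    (l : Fin N) : X.qminor τ ħ l (v s) = ofC N (diagProd ħ l (f s)) • bext (ofH N) (v s) := by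
  have h1 := T.tri l s
  rw [show {s' | ω s' = ω s ∧ h s' < h s} = ∅ from Set.eq_empty_of_forall_notMem
    fun t ht => absurd (hs t ht.1) (not_le.mpr ht.2), Set.image_empty, Submodule.span_empty,
    spanK_bot, Submodule.mem_bot, sub_eq_zero] at h1
  exact h1

theorem Tri.exists_mem_flag_ext (T : X.Tri τ ħ v ω f h) {y : X.B →₀ MZ N} {μ : H N}
    (hy : X.HasWt y μ) : ∃ n, y ∈ spanK (ofH N) (flag v ω h μ n) := by
  obtain ⟨n, hn⟩ := (T.fin μ).image h |>.bddAbove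
  refine ⟨n + 1, ?_⟩
  rw [flag, spanK_span, Set.image_image]
  refine Submodule.span_mono (Set.image_mono ?_) (T.mem_span_bext hy)
  intro s hs
  exact ⟨hs, Nat.lt_succ_of_le (hn ⟨s, hs, rfl⟩)⟩

theorem Tri.diagWord_injective (hτ : 0 < τ.im) (T : X.Tri τ ħ v ω f h) {μ : H N}
    (hμ : X.IsTop μ) {l : ℕ} (hl : l ≤ N) {x y : X.B →₀ MZ N} (hx : X.HasWt x μ)
    (hy : X.HasWt y μ) (hxy : X.diagWord ħ hl x = X.diagWord ħ hl y) : x = y := by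
  cases l with
  | zero => exact hxy
  | succ l =>
    have hsub : X.HasWt (x - y) μ := by
      rw [sub_eq_add_neg, ← neg_one_smul (MZ N) y]
      exact hx.add (hy.smul _)
    obtain ⟨n, hn⟩ := T.exists_mem_flag_ext hsub
    refine sub_eq_zero.mp (IsTriang.eq_zero_of_map T (E := X.diagWord ħ hl) (l := ⟨l, hl⟩)
      (diagWord_add hl) (diagWord_smul hl)
      (div_ne_zero (Theta_ne_zero hτ (l + 1) (ħ • μ)) (Theta_ne_zero hτ (l + 1) (0 : H N)))
      (fun z hz => hμ.diagWord_eq hτ hl hz)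
      (fun s => (map_ne_zero _).mpr (diagProd_ne_zero _ _)) n hn ?_)
    have h1 := diagWord_add (ħ := ħ) hl (x - y) y
    rw [sub_add_cancel, hxy, right_eq_add] at h1
    exact h1

theorem Tri.isEigen (hτ : 0 < τ.im) (T : X.Tri τ ħ v ω f h) {s : S} (hμ : X.IsTop (ω s))
    (hs : ∀ t, ω t = ω s → h s ≤ h t) : X.IsEigen τ ħ (v s) (ω s) (f s) := by
  have hv : X.HasWt (v s) (ω s) := T.homog s
  have hword : ∀ l (hl : l ≤ N), X.diagWord ħ hl (bext (ofH N) (v s)) =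
      wordEig τ ħ (ω s) (f s) l • bext (ofH N) (v s) := by
    intro l hl
    cases l with
    | zero => rw [wordEig_zero, one_smul]; rfl
    | succ l =>
      rw [hμ.diagWord_eq hτ hl hv, T.qminor_lowest hs, smul_smul, diagProd_eq_diagPart]
      rfl
  intro k
  let l : ℕ := N - (k + 1)
  have hk : (k : ℕ) + l + 1 = N := by have := k.2; omega
  refine bext_injective (ptZ N ((l : ℕ) * ħ)) ?_
  rw [← op_ptZ, bext_ptZ_smul]
  have hw : X.HasWt (bext (ofH N) (hatFactor τ ħ k (ω s) • v s)) (ω s) :=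
    (hv.smul _).bext _
  have hw' := hw.op (frameZ N) ħ (φ := ptZ N ((l : ℕ) * ħ)) (i := k) (j := k)
  rw [add_sub_cancel_right] at hw'
  refine T.diagWord_injective hτ hμ (l := l) (by omega) hw' ((hv.bext _).smul _) ?_
  rw [← diagWord_succ hk (by omega), bext_smul, diagWord_smul, shift_hatFactor hk, hword,
    smul_smul, wordEig_succ hτ hk, diagWord_ofC, hword, smul_smul]

end Tri

end PreMod
end EllipticO
end

noncomputable section
namespace EllipticO

variable {N : ℕ}

theorem finite_above {S : Type} {ω : S → H N} (hc : InCones (Set.range ω))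
    (hf : ∀ μ, {s | ω s = μ}.Finite) (μ : H N) : {s | ω s - μ ∈ QPlus N}.Finite := by
  have h := finite_pairs_of_inCones (ω' := fun q : {q : H N // q ∈ QPlus N} => -q.1) hc
    ⟨{0}, ?_⟩ hf ?_ μ
  · refine (h.image Prod.fst).subset fun s hs => ⟨(s, ⟨_, hs⟩), ?_, rfl⟩
    change ω s + -(ω s - μ) = μ
    abel
  · rintro _ ⟨q, rfl⟩
    refine ⟨0, Finset.mem_singleton_self _, ?_⟩
    rw [sub_neg_eq_add, zero_add]
    exact q.2
  · intro μ
    refine Set.Subsingleton.finite fun q hq q' hq' => Subtype.ext ?_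
    have h1 : -q.1 = μ := hq
    have h2 : -q'.1 = μ := hq'
    exact neg_injective (h1.trans h2.symm)

namespace PreMod

variable {τ ħ : ℂ} {X Y : PreMod N}

theorem InO.eq_bot_or_eq_top (hX : X.InO τ ħ) (hirr : X.IsIrreducible τ ħ)
    {W : Submodule (MH N) X.V} (hW : IsSub ħ X W) : W = ⊥ ∨ W = ⊤ := by
  obtain ⟨Y, φ, hφ, rfl⟩ := hW.exists_sub
  by_cases hY : Nonempty Y.B
  · right
    exact LinearMap.range_eq_top.mpr (hirr.2 Y (hX.of_injective φ hφ).isRep φ hφ hY)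
  · left
    rw [not_nonempty_iff] at hY
    rw [LinearMap.range_eq_bot]
    refine LinearMap.ext fun x => ?_
    rw [Subsingleton.elim x 0, map_zero, map_zero]

theorem exists_highest_vector (hτ : 0 < τ.im) {d : EWt N}
    (h : HasHighestWeight τ ħ X d) : ∃ (v : X.V) (f : Fin N → MCˣ), v ≠ 0 ∧ IsHighest ħ X v d.2 ∧
      X.IsEigen τ ħ v d.2 f ∧ d = EWt.mk f d.2 := by
  obtain ⟨v, f, hv0, hv, h1, h2, hd⟩ := h
  have heig : X.IsEigen τ ħ v d.2 f := fun k => (actL_zero_eq ħ X _).symm.trans (h2 k)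
  refine ⟨v, f, hv0, ⟨X.mem_wtSpace_iff.mp hv, fun i j hij =>
    (actL_zero_eq ħ X _).symm.trans (h1 i j hij), fun k => ?_⟩, heig, hd⟩
  have h3 := heig k
  rw [lop_smul] at h3
  rw [← Submodule.smul_mem_iff _ ((map_ne_zero (ofH N)).mpr ((map_ne_zero
    (shift (ħ • ε k))).mpr (hatFactor_ne_zero (τ := τ) (ħ := ħ) hτ k d.2))), h3]
  exact Submodule.smul_mem _ _ (bext_mem_spanK.mpr (Submodule.mem_span_singleton_self v))

theorem IsEigen.hasHighestWeight {v : X.V} {μ : H N} {f : Fin N → MCˣ} (hv : v ≠ 0)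
    (hw : X.HasWt v μ) (hu : ∀ i j, j < i → X.lop ħ i j v = 0) (he : X.IsEigen τ ħ v μ f) :
    HasHighestWeight τ ħ X (EWt.mk f μ) :=
  ⟨v, f, hv, X.mem_wtSpace_iff.mpr hw, fun i j hij => (actL_zero_eq ħ X _).trans (hu i j hij),
    fun k => (actL_zero_eq ħ X _).trans (he k), rfl⟩

section TopVector

variable {S : Type} {v : S → X.V} {ω : S → H N} {f : S → Fin N → MCˣ} {h : S → ℕ}

/-- Above each weight there is a weight which is maximal, and a lowest basis vector in its weight
space. -/
theorem Tri.exists_isTop (T : X.Tri τ ħ v ω f h) (hc : InCones X.wts) (s₀ : S) :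
    ∃ s, X.IsTop (ω s) ∧ (∀ t, ω t = ω s → h s ≤ h t) ∧ ω s - ω s₀ ∈ QPlus N := by
  obtain ⟨s₁, hs₁, hmax⟩ := (finite_above (T.inCones hc) T.fin (ω s₀)).exists_maximalFor
    (fun s => ht (ω s)) _ ⟨s₀, by rw [Set.mem_ofPred_eq, sub_self]; exact zero_mem _⟩
  have htop : X.IsTop (ω s₁) := by
    intro b hb
    obtain ⟨s, hs, -⟩ := IsTriang.exists_apply_ne_zero T b
    rw [← hs] at hb ⊢
    rcases ht_nonneg_of_QPlus hb with h0 | h0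
    · exact sub_eq_zero.mp h0
    · have h1 : ω s - ω s₀ ∈ QPlus N := by
        have := add_mem hb hs₁
        rwa [sub_add_sub_cancel] at this
      have hle : ht (ω s₁) ≤ ht (ω s) := by rw [ht_sub] at h0; linarith
      have := hmax h1 hle
      rw [ht_sub] at h0
      exact absurd this (by dsimp only; linarith)
  obtain ⟨s, hs, hmin⟩ := (T.fin (ω s₁)).exists_minimalFor h _ ⟨s₁, rfl⟩
  have hs : ω s = ω s₁ := hs
  refine ⟨s, by rwa [hs], fun t ht => ?_, by rwa [hs]⟩
  by_contra hlt
  exact hlt (hmin (ht.trans hs) (not_le.mp hlt).le)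

theorem InO.exists_hasHighestWeight (hτ : 0 < τ.im) (hX : X.InO τ ħ) (hB : Nonempty X.B) :
    ∃ d, HasHighestWeight τ ħ X d := by
  obtain ⟨h1, h2, S, v, ω, f, h, T⟩ := inO_iff.mp hX
  obtain ⟨s₀, -, -⟩ := IsTriang.exists_apply_ne_zero T hB.some
  obtain ⟨s, hs, hmin, -⟩ := T.exists_isTop h2 s₀
  have hw : X.HasWt (v s) (ω s) := T.homog s
  exact ⟨_, (T.isEigen hτ hs hmin).hasHighestWeight (T.li.ne_zero s) hw
    fun i j hij => hs.op_eq_zero (F := frameZ N) hij (hw.bext _)⟩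

end TopVector

theorem HasWt.eq_zero_of_mem_lower {x : X.V} {α : H N} (hx : X.HasWt x α) (h : x ∈ X.lower α) :
    x = 0 := by
  ext b
  by_contra hb
  exact (PreMod.mem_lower.mp h b hb).2 (hx b hb)

section Irreducible

variable {α : H N} {v : X.V}

theorem IsHighest.mem_sup (hτ : 0 < τ.im) (hX : X.InO τ ħ) (hirr : X.IsIrreducible τ ħ)
    (hv : IsHighest ħ X v α) (hv0 : v ≠ 0) (x : X.V) :
    x ∈ Submodule.span (MH N) {v} ⊔ X.lower α := by
  obtain ⟨U, hU, hvU, hle⟩ := hv.exists_isSub hτ hX.isRep.rll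
  rcases hX.eq_bot_or_eq_top hirr hU with rfl | rfl
  · exact absurd ((Submodule.mem_bot _).mp hvU) hv0
  · exact hle trivial

theorem IsHighest.mem_span (hτ : 0 < τ.im) (hX : X.InO τ ħ) (hirr : X.IsIrreducible τ ħ)
    (hv : IsHighest ħ X v α) (hv0 : v ≠ 0) {x : X.V} (hx : X.HasWt x α) : ∃ a : MH N, x = a • v := by
  obtain ⟨y, hy, z, hz, rfl⟩ := Submodule.mem_sup.mp (hv.mem_sup hτ hX hirr hv0 x)
  obtain ⟨a, rfl⟩ := Submodule.mem_span_singleton.mp hy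
  refine ⟨a, ?_⟩
  have h1 : X.HasWt z α := by
    have := hx.add ((hv.wt.smul a).smul (-1))
    rwa [neg_one_smul, add_neg_cancel_comm] at this
  rw [h1.eq_zero_of_mem_lower hz, add_zero]

theorem IsHighest.wt_le (hτ : 0 < τ.im) (hX : X.InO τ ħ) (hirr : X.IsIrreducible τ ħ)
    (hv : IsHighest ħ X v α) (hv0 : v ≠ 0) (b : X.B) : α - X.wt b ∈ QPlus N := by
  obtain ⟨y, hy, z, hz, h⟩ := Submodule.mem_sup.mp
    (hv.mem_sup hτ hX hirr hv0 (Finsupp.single b 1))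
  obtain ⟨a, rfl⟩ := Submodule.mem_span_singleton.mp hy
  by_cases hzb : z b = 0
  · have h1 := DFunLike.congr_fun h b
    rw [Finsupp.add_apply, hzb, add_zero, Finsupp.single_eq_same] at h1
    have h2 := hv.wt.smul a b (by rw [h1]; exact one_ne_zero)
    rw [h2, sub_self]
    exact zero_mem _
  · exact (mem_lower.mp hz b hzb).1

theorem IsHighest.isTop (hτ : 0 < τ.im) (hX : X.InO τ ħ) (hirr : X.IsIrreducible τ ħ)
    (hv : IsHighest ħ X v α) (hv0 : v ≠ 0) : X.IsTop α := by
  intro b hb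
  have h1 := hv.wt_le hτ hX hirr hv0 b
  rw [← neg_sub] at h1
  exact sub_eq_zero.mp (QPlus_antisymm hb h1)

/-- The q-character of an irreducible module of highest weight `d`. -/
theorem qc_irreducible (hτ : 0 < τ.im) (hX : X.InO τ ħ) (hirr : X.IsIrreducible τ ħ)
    {d : EWt N} (hd : HasHighestWeight τ ħ X d) : (qc τ ħ X).coeff d = 1 ∧
      ∀ a, (qc τ ħ X).coeff a ≠ 0 → d.2 - a.2 ∈ QPlus N ∧ (a.2 = d.2 → a = d) := by
  obtain ⟨w, g, hw0, hw, he, hd⟩ := exists_highest_vector hτ hd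
  obtain ⟨h1, h2, S, v, ω, f, h, T⟩ := inO_iff.mp hX
  have htop := hw.isTop hτ hX hirr hw0
  have hsub : ∀ s s', ω s = d.2 → ω s' = d.2 → s = s' := by
    intro s s' hs hs'
    by_contra hne
    have hws : X.HasWt (v s) d.2 := by rw [← hs]; exact T.homog s
    have hws' : X.HasWt (v s') d.2 := by rw [← hs']; exact T.homog s'
    obtain ⟨a, ha⟩ := hw.mem_span hτ hX hirr hw0 hws
    obtain ⟨a', ha'⟩ := hw.mem_span hτ hX hirr hw0 hws'
    have ha0 : a ≠ 0 := fun h0 => T.li.ne_zero s (by rw [ha, h0, zero_smul])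
    have h3 : Finsupp.single s' a = Finsupp.single s a' := by
      refine T.li ?_
      rw [Finsupp.linearCombination_single, Finsupp.linearCombination_single, ha, ha', smul_smul,
        smul_smul, mul_comm]
    rcases (Finsupp.single_eq_single_iff _ _ _ _).mp h3 with h4 | h4
    · exact hne h4.1.symm
    · exact ha0 h4.1
  obtain ⟨b, hb⟩ := Finsupp.ne_iff.mp hw0
  obtain ⟨s, hs, -⟩ := IsTriang.exists_apply_ne_zero T b
  rw [hw.wt b hb] at hs
  have hws : X.HasWt (v s) d.2 := by rw [← hs]; exact T.homog s
  obtain ⟨a, ha⟩ := hw.mem_span hτ hX hirr hw0 hws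
  have ha0 : a ≠ 0 := fun h0 => T.li.ne_zero s (by rw [ha, h0, zero_smul])
  have hmk : EWt.mk (f s) (ω s) = d := by
    rw [hd, hs]
    refine congrArg (fun m => (Additive.ofMul m, d.2)) (mk_eq_of_rescale (ħ := ħ) (N := N)
      (a := 1) (a' := a) one_ne_zero ha0 fun l => ?_)
    have h3 := T.qminor_lowest (s := s) (fun t ht => by rw [hsub t s (ht.trans hs) hs]) l
    rw [ha, qminor_smul, he.qminor_eq hτ htop hw.wt, bext_smul, smul_smul, smul_smul] at h3
    have h4 : bext (ofH N) w ≠ 0 := fun h0 => hw0 (bext_injective (ofH N) (by rw [h0, bext_zero]))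
    have h5 := smul_left_injective (MZ N) h4 h3
    rw [map_one, one_mul, map_one, mul_one]
    exact h5.symm
  constructor
  · rw [qc_coeff hX T, Nat.cast_eq_one, Nat.card_eq_one_iff_unique]
    refine ⟨⟨fun t t' => Subtype.ext (hsub _ _ ?_ ?_)⟩, ⟨⟨s, hmk⟩⟩⟩
    · exact congrArg Prod.snd t.2
    · exact congrArg Prod.snd t'.2
  · intro c hc
    rw [qc_coeff hX T, Nat.cast_ne_zero, Nat.card_ne_zero] at hc
    obtain ⟨⟨t, rfl⟩⟩ := hc.1
    constructor
    · have : ω t ∈ Set.range X.wt := by rw [← T.range_eq]; exact ⟨t, rfl⟩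
      obtain ⟨b, hb⟩ := this
      change d.2 - ω t ∈ _
      rw [← hb]
      exact hw.wt_le hτ hX hirr hw0 b
    · intro ht
      rw [hsub t s ht hs, hmk]

end Irreducible

end PreMod
end EllipticO
end

noncomputable section
namespace EllipticO

theorem extMap_id {k K B : Type} [Field k] [Field K] (j : k →+* K) (y : B →₀ K) :
    extMap j LinearMap.id y = y := by
  induction y using Finsupp.induction_linear with
  | zero => rw [map_zero]
  | add y z hy hz => rw [map_add, hy, hz]
  | single b c =>
    rw [extMap_single, LinearMap.id_apply, bext_single, map_one, Finsupp.smul_single, smul_eq_mul,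
      mul_one]

theorem extMap_zero {k K B C : Type} [Field k] [Field K] (j : k →+* K) (y : B →₀ K) :
    extMap j (0 : (B →₀ k) →ₗ[k] (C →₀ k)) y = 0 := by
  rw [extMap_eq_zero, LinearMap.ker_zero, spanK_top]
  trivial

variable {N : ℕ}

/-- A linear form on the Cartan subalgebra is entire. -/
theorem differentiable_form (b : Fin N → ℂ) : Differentiable ℂ fun x : H N => ∑ t, b t * x.1 t := by
  have hl : ∀ k : Fin N, Differentiable ℂ (fun x : H N => x.1 k) := fun k =>
    ((ContinuousLinearMap.proj (R := ℂ) (φ := fun _ : Fin N => ℂ) k).comp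
      (cartan N).subtypeL).differentiable
  exact Differentiable.fun_sum fun t _ => (hl t).const_mul (b t)

/-- An exponential function of `λ` with prescribed multipliers. -/
theorem exists_multiplier {ħ : ℂ} (hħ : ħ ≠ 0) {κ : Fin N → ℂ} (h0 : ∀ i, κ i ≠ 0)
    (h1 : ∏ i, κ i = 1) : ∃ a : MH N, a ≠ 0 ∧
      ∀ i, shift (ħ • ε i) a = algebraMap ℂ (MH N) (κ i) * a := by
  classical
  obtain ⟨b, hb, hsum⟩ : ∃ b : Fin N → ℂ, (∀ i, Complex.exp (b i) = κ i) ∧ ∑ i, b i = 0 := by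
    rcases N.eq_zero_or_pos with rfl | hN
    · exact ⟨0, fun i => i.elim0, rfl⟩
    let z : Fin N := ⟨0, hN⟩
    let b : Fin N → ℂ := Function.update (fun i => Complex.log (κ i)) z
      (-∑ i ∈ Finset.univ.erase z, Complex.log (κ i))
    have hbz : b z = -∑ i ∈ Finset.univ.erase z, Complex.log (κ i) := Function.update_self _ _ _
    have hbi : ∀ i, i ≠ z → b i = Complex.log (κ i) := fun i hi => Function.update_of_ne hi _ _
    refine ⟨b, fun i => ?_, ?_⟩
    · by_cases hi : i = z
      · subst hi
        rw [hbz, Complex.exp_neg, Complex.exp_sum, Finset.prod_congr rfl fun i _ =>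
          Complex.exp_log (h0 i), inv_eq_iff_eq_inv]
        refine eq_inv_of_mul_eq_one_left ?_
        rw [Finset.prod_erase_mul _ _ (Finset.mem_univ _), h1]
      · rw [hbi i hi, Complex.exp_log (h0 i)]
    · rw [← Finset.add_sum_erase _ _ (Finset.mem_univ z), hbz, Finset.sum_congr rfl fun i hi =>
        hbi i (Finset.ne_of_mem_erase hi), neg_add_cancel]
  have hd : Differentiable ℂ fun x : H N => Complex.exp (∑ t, b t / ħ * x.1 t) :=
    (differentiable_form fun t => b t / ħ).cexp
  refine ⟨ofEnt _ hd, ofEnt_ne_zero (x := 0) (Complex.exp_ne_zero _), fun i => ?_⟩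
  have h2 : algebraMap ℂ (MH N) (κ i) = ofEnt (fun _ => κ i) (differentiable_const _) :=
    algebraMap_complex _
  have h3 : ofEnt (fun _ => κ i) (differentiable_const _) * ofEnt _ hd =
      ofEnt (fun x : H N => κ i * Complex.exp (∑ t, b t / ħ * x.1 t))
        ((differentiable_const _).mul hd) := (map_mul (algebraMap (Ent (H N)) (MH N)) _ _).symm
  rw [h2, h3]
  refine (pull_ofEnt _ _ _ _ _).trans (ofEnt_congr (fun x => ?_) _ _)
  beta_reduce
  rw [← hb i, ← Complex.exp_add]
  congr 1
  have h4 : ∀ t, b t / ħ * (x + ħ • ε i).1 t =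
      b t / ħ * x.1 t + ((if t = i then b t else 0) - b t * (1 / N)) := by
    intro t
    change b t / ħ * (x.1 t + ħ * ((if t = i then 1 else 0) - 1 / N)) = _
    split_ifs <;> (field_simp; try ring)
  rw [Finset.sum_congr rfl fun t _ => h4 t, Finset.sum_add_distrib, Finset.sum_sub_distrib,
    ← Finset.sum_mul, hsum, Finset.sum_ite_eq' Finset.univ, if_pos (Finset.mem_univ _), zero_mul,
    sub_zero, add_comm]

namespace PreMod

variable {τ ħ : ℂ} {X Y : PreMod N}

theorem IsHighest.smul {v : X.V} {α : H N} (h : IsHighest ħ X v α) {a : MH N} (ha : a ≠ 0) :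
    IsHighest ħ X (a • v) α := by
  refine ⟨h.wt.smul a, fun i j hij => ?_, fun k => ?_⟩
  · rw [lop_smul, h.upper i j hij, smul_zero]
  · rw [lop_smul, Submodule.span_singleton_smul_eq (IsUnit.mk0 a ha)]
    exact Submodule.smul_mem _ _ (h.diag k)

/-- The highest weight vector can be chosen to have prescribed eigenvalues in their class. -/
theorem exists_highest_vector_of_mk (hτ : 0 < τ.im) (hħ : ħ ≠ 0) {f : Fin N → MCˣ} {α : H N}
    (h : HasHighestWeight τ ħ X (EWt.mk f α)) :
    ∃ v : X.V, v ≠ 0 ∧ IsHighest ħ X v α ∧ X.IsEigen τ ħ v α f := by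
  obtain ⟨v, g, hv0, hv, he, hmk⟩ := exists_highest_vector hτ h
  have he : X.IsEigen τ ħ v α g := he
  have hfg : MGrp.mk g = MGrp.mk f := congrArg (fun d : EWt N => d.1.toMul) hmk.symm
  obtain ⟨k, hk, hkf⟩ := QuotientGroup.eq.mp hfg
  obtain ⟨a, ha, hshift⟩ := exists_multiplier (κ := fun i => (k i : ℂ)) hħ (fun i => (k i).ne_zero)
    (by rw [← Units.coe_prod, hk, Units.val_one])
  refine ⟨a • v, smul_ne_zero ha hv0, hv.smul ha, fun i => ?_⟩
  have h1 : (f i : MC) = g i * algebraMap ℂ MC (k i) := by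
    have h2 := congrArg Units.val (hkf i)
    rw [Pi.mul_apply, Pi.inv_apply, Units.val_mul, Units.inv_mul_eq_iff_eq_mul] at h2
    exact h2
  have h3 : ofC N (algebraMap ℂ MC (k i)) = ofH N (algebraMap ℂ (MH N) (k i)) :=
    (pull_const _ _ _ _).trans (pull_const _ _ _ _).symm
  rw [smul_comm, lop_smul, he i, hshift, bext_smul, smul_smul, smul_smul, h1, map_mul, map_mul, h3]
  congr 1
  ring

section Projections

variable {ι : Type} (M : ι → PreMod N)

/-- The projection to a summand of a direct sum of vector spaces with bases. -/
def sigmaProj {k : Type} [Field k] {B : ι → Type} (a : ι) : ((Σ i, B i) →₀ k) →ₗ[k] (B a →₀ k) :=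
  Finsupp.lcomapDomain (Sigma.mk a) sigma_mk_injective

theorem sigmaProj_comp_self {k : Type} [Field k] {B : ι → Type} (a : ι) :
    (sigmaProj (k := k) (B := B) a).comp (sigmaIncl a) = LinearMap.id :=
  LinearMap.ext fun x => Finsupp.ext fun b =>
    Finsupp.mapDomain_apply sigma_mk_injective x b

theorem sigmaProj_comp_ne {k : Type} [Field k] {B : ι → Type} {a a' : ι} (h : a ≠ a') :
    (sigmaProj (k := k) (B := B) a).comp (sigmaIncl a') = 0 :=
  LinearMap.ext fun x => Finsupp.ext fun b => Finsupp.mapDomain_of_notMem_range _ _ (by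
    rintro ⟨c, hc⟩
    exact h (congrArg Sigma.fst hc).symm)

/-- The projection to a summand, as a linear map. -/
def projLin (a : ι) : (dsum M).V →ₗ[MH N] (M a).V :=
  sigmaProj (k := MH N) (B := fun i => (M i).B) a

theorem projLin_incl (a : ι) (x : (M a).V) : projLin M a (inclLin M a x) = x :=
  LinearMap.congr_fun (sigmaProj_comp_self (k := MH N) (B := fun i => (M i).B) a) x

theorem projLin_incl_ne {a a' : ι} (h : a ≠ a') (x : (M a').V) :
    projLin M a (inclLin M a' x) = 0 :=
  LinearMap.congr_fun (sigmaProj_comp_ne (k := MH N) (B := fun i => (M i).B) h) x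

/-- The projection to a summand. -/
def projHom (ħ : ℂ) (a : ι) : Hom ħ (dsum M) (M a) :=
  Hom.ofBasis (projLin M a) (fun p => by
    obtain ⟨a', b, rfl⟩ := dpair_cases M p
    rw [← inclLin_single]
    by_cases h : a = a'
    · subst h
      rw [projLin_incl]
      exact (M a).hasWt_single b 1
    · rw [projLin_incl_ne M h]
      exact HasWt.zero _) (by
    intro i j p
    obtain ⟨a', b, rfl⟩ := dpair_cases M p
    rw [← extMap_inclLin, ← Hom.extMap_comp, ← inclLin_single]
    by_cases h : a = a'
    · subst h
      rw [projLin_incl, show (projLin M a).comp (inclLin M a) = LinearMap.id from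
        LinearMap.ext (projLin_incl M a), bext_single, map_one, op_single, map_one, one_smul,
        bext_id]
      exact extMap_id _ _
    · rw [projLin_incl_ne M h, show (projLin M a).comp (inclLin M a') = 0 from
        LinearMap.ext (projLin_incl_ne M h), bext_zero, op_zero]
      exact extMap_zero _ _)

theorem projHom_incl (a : ι) (x : (M a).V) :
    (projHom M ħ a).map ((inclHom M ħ a).map x) = x := projLin_incl M a x

theorem projHom_incl_ne {a a' : ι} (h : a ≠ a') (x : (M a').V) :
    (projHom M ħ a).map ((inclHom M ħ a').map x) = 0 := projLin_incl_ne M h x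

theorem eq_zero_of_projHom {x : (dsum M).V} (h : ∀ a, (projHom M ħ a).map x = 0) : x = 0 := by
  refine Finsupp.ext fun p => ?_
  obtain ⟨a, b, rfl⟩ := dpair_cases M p
  exact DFunLike.congr_fun (h a) b

end Projections

theorem Hom.map_lower (φ : Hom ħ X Y) {α : H N} {x : X.V} (hx : x ∈ X.lower α) :
    φ.map x ∈ Y.lower α := by
  obtain ⟨s, hs⟩ := exists_sum_wproj (wt := X.wt) x
  rw [hs, map_sum]
  refine sum_mem fun μ _ => ?_
  by_cases h : EllipticO.wproj X.wt μ x = 0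
  · rw [h, map_zero]
    exact zero_mem _
  · have h1 := wproj_lower hx h
    exact HasWt.mem_lower (φ.homog _ _ (homog_wproj x μ)) h1.1 h1.2

theorem Hom.lop_map (φ : Hom ħ X Y) (i j : Fin N) (x : X.V) :
    Y.lop ħ i j (φ.map x) = extMap (ofH N) φ.map (X.lop ħ i j x) := (φ.extMap_op_bext x).symm

/-- A highest weight vector of a direct sum, given by highest weight vectors with the same
eigenvalues. -/
theorem isHighest_sum (hτ : 0 < τ.im) {ι : Type} [Fintype ι] (M : ι → PreMod N) {α : H N}
    {f : Fin N → MCˣ} {v : ∀ a, (M a).V} (hv : ∀ a, IsHighest ħ (M a) (v a) α)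
    (he : ∀ a, (M a).IsEigen τ ħ (v a) α f) :
    IsHighest ħ (dsum M) (∑ a, (inclHom M ħ a).map (v a)) α := by
  refine ⟨HasWt.sum fun a _ => (inclHom M ħ a).homog _ _ (hv a).wt, fun i j hij => ?_, fun k => ?_⟩
  · rw [lop_sum]
    refine Finset.sum_eq_zero fun a _ => ?_
    rw [(inclHom M ħ a).lop_map, (hv a).upper i j hij, map_zero]
  · have h1 : (dsum M).lop ħ k k (hatFactor τ ħ k α • ∑ a, (inclHom M ħ a).map (v a)) =
        ofC N (f k) • bext (ofH N) (∑ a, (inclHom M ħ a).map (v a)) := by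
      rw [Finset.smul_sum, lop_sum, bext_sum, Finset.smul_sum]
      refine Finset.sum_congr rfl fun a _ => ?_
      rw [← map_smul, (inclHom M ħ a).lop_map, he a k, map_smul, extMap_bext]
    rw [lop_smul] at h1
    rw [← Submodule.smul_mem_iff _ ((map_ne_zero (ofH N)).mpr ((map_ne_zero
      (shift (ħ • ε k))).mpr (hatFactor_ne_zero (τ := τ) (ħ := ħ) hτ k α))), h1]
    exact Submodule.smul_mem _ _ (bext_mem_spanK.mpr (Submodule.mem_span_singleton_self _))

/-- A morphism to a module, one of whose components is bijective, from another module. -/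
theorem exists_hom_of_bijective {P : PreMod N} (p : Hom ħ P X) (hp : Function.Bijective p.map)
    (q : Hom ħ P Y) : ∃ φ : Hom ħ X Y, ∀ x, φ.map (p.map x) = q.map x := by
  let one : Hom ħ X X := Hom.ofBasis LinearMap.id (fun b => X.hasWt_single b 1) (by
    intro i j b
    rw [LinearMap.id_apply, bext_single, map_one, op_single, map_one, one_smul, bext_id]
    exact extMap_id _ _)
  obtain ⟨ψ, hψ⟩ := one.exists_lift p hp.1 (by
    rw [LinearMap.range_eq_top.mpr hp.2]
    exact le_top)
  refine ⟨q.comp ψ, fun x => ?_⟩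
  have h1 : ψ.map (p.map x) = x := hp.1 (hψ _)
  rw [Hom.comp_map, LinearMap.comp_apply, h1]

/-- Irreducible modules in `O` with the same highest weight are isomorphic. -/
theorem exists_iso (hτ : 0 < τ.im) (hħ : ħ ≠ 0) (hX : X.InO τ ħ) (hY : Y.InO τ ħ)
    (hiX : X.IsIrreducible τ ħ) (hiY : Y.IsIrreducible τ ħ) {d : EWt N}
    (hdX : HasHighestWeight τ ħ X d) (hdY : HasHighestWeight τ ħ Y d) :
    ∃ φ : Hom ħ X Y, Function.Bijective φ.map := by
  obtain ⟨f, hf⟩ := QuotientGroup.mk_surjective (s := constTuples N) d.1.toMul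
  have hd : d = EWt.mk f d.2 := Prod.ext (congrArg Additive.ofMul hf.symm) rfl
  let M : Bool → PreMod N := fun b => bif b then X else Y
  have hO : ∀ a, (M a).InO τ ħ := fun a => by cases a; exacts [hY, hX]
  have hirr : ∀ a, (M a).IsIrreducible τ ħ := fun a => by cases a; exacts [hiY, hiX]
  have hvec : ∀ a, ∃ v : (M a).V, v ≠ 0 ∧ IsHighest ħ (M a) v d.2 ∧ (M a).IsEigen τ ħ v d.2 f := by
    intro a
    refine exists_highest_vector_of_mk hτ hħ ?_
    rw [← hd]
    cases a
    exacts [hdY, hdX]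
  choose v hv0 hv he using hvec
  have hu := isHighest_sum hτ M hv he
  set u := ∑ a, (inclHom M ħ a).map (v a) with hudef
  have hproj : ∀ a, (projHom M ħ a).map u = v a := by
    intro a
    rw [hudef, map_sum, Finset.sum_eq_single a, projHom_incl]
    · intro a' _ h
      exact projHom_incl_ne M h.symm _
    · intro h
      exact absurd (Finset.mem_univ _) h
  obtain ⟨U, hU, huU, hUle⟩ := hu.exists_isSub hτ (rll_dsum M fun a => (hO a).isRep.rll)
  obtain ⟨P, ι, hι, hrange⟩ := hU.exists_sub
  obtain ⟨u', hu'⟩ : ∃ u', ι.map u' = u := by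
    rw [← hrange] at huU
    exact huU
  have hcomp : ∀ a x, (((projHom M ħ a).comp ι).map x) = (projHom M ħ a).map (ι.map x) :=
    fun a x => rfl
  have hker : ∀ a a', a ≠ a' → ∀ x, (projHom M ħ a).map (ι.map x) = 0 →
      (projHom M ħ a').map (ι.map x) = 0 := by
    intro a a' _ x hx
    rcases (hO a').eq_bot_or_eq_top (hirr a') (((projHom M ħ a').comp ι).isSub_map
      (((projHom M ħ a).comp ι).isSub_ker)) with h | h
    · have h1 := Submodule.mem_map_of_mem (f := ((projHom M ħ a').comp ι).map)
        (LinearMap.mem_ker.mpr ((hcomp a x).trans hx))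
      rw [h, Submodule.mem_bot] at h1
      exact h1
    · exfalso
      have hmem : v a' ∈ (⊤ : Submodule (MH N) (M a').V) := trivial
      rw [← h] at hmem
      obtain ⟨y, hy, hya⟩ := hmem
      have hy : (projHom M ħ a).map (ι.map y) = 0 := hy
      have hya : (projHom M ħ a').map (ι.map y) = v a' := hya
      have hyU : ι.map y ∈ U := by rw [← hrange]; exact ⟨y, rfl⟩
      obtain ⟨_, hc, z, hz, hcz⟩ := Submodule.mem_sup.mp (hUle hyU)
      obtain ⟨c, rfl⟩ := Submodule.mem_span_singleton.mp hc
      rw [← hcz, map_add, map_smul, hproj] at hy hya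
      have hza := (projHom M ħ a).map_lower hz
      have hza' := (projHom M ħ a').map_lower hz
      have h2 : c • v a = 0 := by
        refine ((hv a).wt.smul c).eq_zero_of_mem_lower ?_
        rw [eq_neg_of_add_eq_zero_left hy]
        exact neg_mem hza
      have hc0 : c = 0 := (smul_eq_zero.mp h2).resolve_right (hv0 a)
      rw [hc0, zero_smul, zero_add] at hya
      rw [hya] at hza'
      exact hv0 a' ((hv a').wt.eq_zero_of_mem_lower hza')
  have hbij : ∀ a, Function.Bijective ((projHom M ħ a).comp ι).map := by
    intro a
    constructor
    · rw [← LinearMap.ker_eq_bot, LinearMap.ker_eq_bot']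
      intro x hx
      refine (map_eq_zero_iff ι.map hι).mp (eq_zero_of_projHom (ħ := ħ) M fun a' => ?_)
      by_cases h : a = a'
      · subst h
        exact hx
      · exact hker a a' h x hx
    · rcases (hO a).eq_bot_or_eq_top (hirr a) ((projHom M ħ a).comp ι).isSub_range with h | h
      · refine absurd ?_ (hv0 a)
        have h1 := LinearMap.mem_range_self ((projHom M ħ a).comp ι).map u'
        rw [h, Submodule.mem_bot, hcomp, hu', hproj] at h1
        exact h1
      · exact LinearMap.range_eq_top.mp h
  obtain ⟨φ, hφ⟩ := exists_hom_of_bijective ((projHom M ħ true).comp ι) (hbij true)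
    ((projHom M ħ false).comp ι)
  refine ⟨φ, ?_⟩
  have h1 : φ.map ∘ ((projHom M ħ true).comp ι).map = ((projHom M ħ false).comp ι).map :=
    funext hφ
  have h2 : Function.Bijective (φ.map ∘ ((projHom M ħ true).comp ι).map) := by
    rw [h1]
    exact hbij false
  exact (Function.Bijective.of_comp_iff _ (hbij true)).mp h2

end PreMod
end EllipticO
end

noncomputable section
namespace EllipticO
namespace PreMod

variable {N : ℕ} {τ ħ : ℂ} {X Y : PreMod N}

/-- A module generated by a finite set of vectors has an irreducible quotient. -/
theorem exists_irreducible_quotient {G : Set Y.V} (hG : G.Finite)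
    (hgen : ∀ W, IsSub ħ Y W → G ⊆ W → W = ⊤) (hne : ∃ g ∈ G, g ≠ 0) :
    ∃ (Z Q : PreMod N) (φ : Hom ħ Z Y) (π : Hom ħ Y Q), Function.Injective φ.map ∧
      Function.Surjective π.map ∧ LinearMap.range φ.map = LinearMap.ker π.map ∧
      Q.IsIrreducible τ ħ ∧ ∃ g ∈ G, π.map g ≠ 0 := by
  have hfg : (Submodule.span (MH N) G).FG := Submodule.fg_span hG
  obtain ⟨W, hW, hmax⟩ : ∃ W, Maximal (fun W => IsSub ħ Y W ∧ ¬ G ⊆ W) W := by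
    have hbot : IsSub ħ Y ⊥ ∧ ¬ G ⊆ ((⊥ : Submodule (MH N) Y.V) : Set Y.V) := by
      obtain ⟨g, hg, hg0⟩ := hne
      exact ⟨isSub_bot, fun h => hg0 ((Submodule.mem_bot _).mp (h hg))⟩
    have hchain : ∀ C ⊆ {W | IsSub ħ Y W ∧ ¬ G ⊆ (W : Set Y.V)}, IsChain (· ≤ ·) C → ∀ W₀ ∈ C,
        ∃ P ∈ {W | IsSub ħ Y W ∧ ¬ G ⊆ (W : Set Y.V)}, ∀ W ∈ C, W ≤ P := by
      refine fun C hC hchain W₀ hW₀ => ⟨sSup C, ⟨IsSub.sSup_of_directed ⟨W₀, hW₀⟩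
        hchain.directedOn fun W hW => (hC hW).1, fun hsub => ?_⟩, fun W hW => le_sSup hW⟩
      have h1 := (Submodule.fg_iff_compact _).mp hfg
      rw [CompleteLattice.isCompactElement_iff_le_of_directed_sSup_le] at h1
      obtain ⟨W, hW, hle⟩ := h1 C ⟨W₀, hW₀⟩ hchain.directedOn (Submodule.span_le.mpr hsub)
      exact (hC hW).2 (Submodule.span_le.mp hle)
    obtain ⟨W, -, hW⟩ := zorn_le_nonempty₀ _ hchain ⊥ hbot
    exact ⟨W, hW⟩
  obtain ⟨Q, π, hπ, hker⟩ := hW.1.exists_quotient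
  obtain ⟨Z, φ, hφ, hrange⟩ := hW.1.exists_sub
  obtain ⟨g, hg, hgW⟩ := Set.not_subset.mp hW.2
  have hπg : π.map g ≠ 0 := by
    rw [← hker] at hgW
    exact hgW
  refine ⟨Z, Q, φ, π, hφ, hπ, hrange.trans hker.symm, ⟨?_, ?_⟩, g, hg, hπg⟩
  · by_contra hB
    rw [not_nonempty_iff] at hB
    exact hπg (Subsingleton.elim _ _)
  · intro P _ ι hι hP
    have hsub := π.isSub_comap ι.isSub_range
    have hle : W ≤ (LinearMap.range ι.map).comap π.map := by
      intro x hx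
      rw [← hker] at hx
      exact Submodule.mem_comap.mpr ⟨0, by rw [map_zero]; exact hx.symm⟩
    have htop : (LinearMap.range ι.map).comap π.map = ⊤ := by
      refine hgen _ hsub ?_
      by_contra h
      have h1 := hmax ⟨hsub, h⟩ hle
      obtain ⟨b⟩ := hP
      obtain ⟨y, hy⟩ := hπ (ι.map (Finsupp.single b 1))
      have hyW : y ∈ W := h1 (Submodule.mem_comap.mpr ⟨_, hy.symm⟩)
      rw [← hker, LinearMap.mem_ker, hy] at hyW
      have := hι (hyW.trans (map_zero ι.map).symm)
      exact one_ne_zero (Finsupp.single_eq_zero.mp this)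
    intro q
    obtain ⟨y, rfl⟩ := hπ q
    have : y ∈ (LinearMap.range ι.map).comap π.map := by rw [htop]; trivial
    exact this

theorem simpleMod_inO (d : HighestWeights N τ ħ) : (simpleMod d).InO τ ħ := d.2.choose_spec.1

theorem simpleMod_irreducible (d : HighestWeights N τ ħ) : (simpleMod d).IsIrreducible τ ħ :=
  d.2.choose_spec.2.1

theorem simpleMod_highest (d : HighestWeights N τ ħ) : HasHighestWeight τ ħ (simpleMod d) d :=
  d.2.choose_spec.2.2

theorem qc_coeff_ne_zero {S : Type} {v : S → X.V} {ω : S → H N} {f : S → Fin N → MCˣ}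
    {h : S → ℕ} (hX : X.InO τ ħ) (T : X.Tri τ ħ v ω f h) {a : EWt N}
    (ha : (qc τ ħ X).coeff a ≠ 0) : ∃ s, ω s = a.2 := by
  rw [qc_coeff hX T, Nat.cast_ne_zero, Nat.card_ne_zero] at ha
  obtain ⟨⟨s, rfl⟩⟩ := ha.1
  exact ⟨s, rfl⟩

/-- A module in `O` with a weight above `μ` has a simple subquotient with such a weight, which
occurs as a quotient of a submodule containing all the weight spaces above `μ`. -/
theorem exists_simple_subquotient (hτ : 0 < τ.im) (hħ : ħ ≠ 0) (hX : X.InO τ ħ) {μ : H N}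
    {a : EWt N} (ha : a.2 - μ ∈ QPlus N) (ha0 : (qc τ ħ X).coeff a ≠ 0) :
    ∃ (d : HighestWeights N τ ħ) (Y Z : PreMod N) (ι : Hom ħ Y X) (φ : Hom ħ Z Y)
      (π : Hom ħ Y (simpleMod d)), Function.Injective ι.map ∧ Function.Injective φ.map ∧
      Function.Surjective π.map ∧ LinearMap.range φ.map = LinearMap.ker π.map ∧
      d.1.2 - μ ∈ QPlus N ∧
      ∀ a : EWt N, a.2 - μ ∈ QPlus N → (qc τ ħ X).coeff a = (qc τ ħ Y).coeff a := by
  obtain ⟨h1, h2, S, v, ω, f, h, T⟩ := inO_iff.mp hX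
  obtain ⟨s₀, hs₀⟩ := qc_coeff_ne_zero hX T ha0
  let A : Set S := {s | ω s - μ ∈ QPlus N}
  have hA : A.Finite := finite_above (T.inCones h2) T.fin μ
  let W := sInf {W | IsSub ħ X W ∧ v '' A ⊆ W}
  have hW : IsSub ħ X W := IsSub.sInf fun W hW => hW.1
  have hAW : v '' A ⊆ W := fun x hx => Submodule.mem_sInf.mpr fun W hW => hW.2 hx
  obtain ⟨Y, ι, hι, hrange⟩ := hW.exists_sub
  have hlift : ∀ s ∈ A, ∃ y, ι.map y = v s := by
    intro s hs
    have h3 : v s ∈ W := hAW ⟨s, hs, rfl⟩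
    rw [← hrange] at h3
    exact h3
  choose! u hu using hlift
  have hgen : ∀ P, IsSub ħ Y P → u '' A ⊆ P → P = ⊤ := by
    intro P hP hAP
    have h3 : W ≤ P.map ι.map := by
      refine sInf_le ⟨ι.isSub_map hP, ?_⟩
      rintro _ ⟨s, hs, rfl⟩
      exact ⟨u s, hAP ⟨s, hs, rfl⟩, hu s hs⟩
    rw [eq_top_iff]
    intro y _
    have h4 : ι.map y ∈ W := by rw [← hrange]; exact ⟨y, rfl⟩
    obtain ⟨y', hy', hyy⟩ := h3 h4
    rwa [← hι hyy]
  have hs₀A : s₀ ∈ A := by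
    change ω s₀ - μ ∈ QPlus N
    rwa [hs₀]
  obtain ⟨Z, Q, φ, π, hφ, hπ, hex, hirr, _, ⟨s, hs, rfl⟩, hg⟩ :=
    exists_irreducible_quotient (τ := τ) (hA.image u) hgen ⟨u s₀, ⟨s₀, hs₀A, rfl⟩, fun h0 =>
      T.li.ne_zero s₀ (by rw [← hu s₀ hs₀A, h0, map_zero])⟩
  have hY := hX.of_injective ι hι
  have hQ := hY.of_surjective π hπ
  obtain ⟨d, hd⟩ := hQ.exists_hasHighestWeight hτ hirr.1
  let d' : HighestWeights N τ ħ := ⟨d, Q, hQ, hirr, hd⟩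
  obtain ⟨θ, hθ⟩ := exists_iso hτ hħ hQ (simpleMod_inO d') hirr (simpleMod_irreducible d') hd
    (simpleMod_highest d')
  refine ⟨d', Y, Z, ι, φ, θ.comp π, hι, hφ, hθ.2.comp hπ, ?_, ?_, ?_⟩
  · rw [hex, Hom.comp_map, LinearMap.ker_comp_of_ker_eq_bot _ (LinearMap.ker_eq_bot.mpr hθ.1)]
  · obtain ⟨w, g, hw0, hw, -, -⟩ := exists_highest_vector hτ hd
    have hwt : Q.HasWt (π.map (u s)) (ω s) := by
      refine π.homog _ _ ?_
      have h3 : EllipticO.wproj Y.wt (ω s) (u s) = u s := by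
        refine hι ?_
        rw [← wproj_map ι.map ι.homog, hu s hs]
        exact (T.homog s).wproj_eq
      rw [← h3]
      exact homog_wproj _ _
    obtain ⟨b, hb⟩ := Finsupp.ne_iff.mp hg
    have h3 := hw.wt_le hτ hQ hirr hw0 b
    rw [hwt b hb] at h3
    have := add_mem h3 hs
    rwa [sub_add_sub_cancel] at this
  · intro c hc
    obtain ⟨R, p, hp, hker⟩ := hW.exists_quotient
    have h3 := congrArg (fun χ => χ.coeff c) (qc_exact hX ι hι p hp (hrange.trans hker.symm))
    have h4 : (qc τ ħ R).coeff c = 0 := by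
      by_contra h0
      obtain ⟨⟨t, ht⟩, htc⟩ := qc_coeff_ne_zero (hX.of_surjective p hp) (T.quot p hp) h0
      have htc : ω t = c.2 := htc
      refine (T.quot p hp).li.ne_zero ⟨t, ht⟩ ?_
      have h5 : v t ∈ W := hAW ⟨t, by change ω t - μ ∈ QPlus N; rwa [htc], rfl⟩
      rw [← hker] at h5
      exact h5
    have h5 : (qc τ ħ X).coeff c = (qc τ ħ Y).coeff c + (qc τ ħ R).coeff c := h3
    rw [h5, h4, add_zero]

/-! ### Multiplicities and q-characters -/

variable (N τ ħ) in
/-- Formal sums of highest weights which are finite above each weight. -/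
def LocFinite (c : HighestWeights N τ ħ → ℤ) : Prop :=
  ∀ μ : H N, {d | c d ≠ 0 ∧ d.1.2 - μ ∈ QPlus N}.Finite

/-- The coefficient of an e-weight in a combination of q-characters of simple modules. -/
def simpleSum (c : HighestWeights N τ ħ → ℤ) (a : EWt N) : ℤ :=
  ∑ᶠ d, c d * (qc τ ħ (simpleMod d)).coeff a

theorem qc_simple_self (hτ : 0 < τ.im) (d : HighestWeights N τ ħ) :
    (qc τ ħ (simpleMod d)).coeff d = 1 :=
  (qc_irreducible hτ (simpleMod_inO d) (simpleMod_irreducible d) (simpleMod_highest d)).1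

theorem qc_simple_le (hτ : 0 < τ.im) {d : HighestWeights N τ ħ} {a : EWt N}
    (h : (qc τ ħ (simpleMod d)).coeff a ≠ 0) : d.1.2 - a.2 ∈ QPlus N ∧ (a.2 = d.1.2 → a = d) :=
  (qc_irreducible hτ (simpleMod_inO d) (simpleMod_irreducible d) (simpleMod_highest d)).2 a h

section LocFinite

variable {c c' : HighestWeights N τ ħ → ℤ}

theorem LocFinite.support (hτ : 0 < τ.im) (h : LocFinite N τ ħ c) (a : EWt N) :
    (Function.support fun d => c d * (qc τ ħ (simpleMod d)).coeff a).Finite :=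
  (h a.2).subset fun _ hd => ⟨left_ne_zero_of_mul hd, (qc_simple_le hτ (right_ne_zero_of_mul hd)).1⟩

theorem LocFinite.add (h : LocFinite N τ ħ c) (h' : LocFinite N τ ħ c') :
    LocFinite N τ ħ (c + c') := by
  refine fun μ => ((h μ).union (h' μ)).subset fun d hd => ?_
  by_cases h0 : c d = 0
  · refine Or.inr ⟨fun h1 => hd.1 ?_, hd.2⟩
    rw [Pi.add_apply, h0, h1, add_zero]
  · exact Or.inl ⟨h0, hd.2⟩

theorem LocFinite.neg (h : LocFinite N τ ħ c) : LocFinite N τ ħ (-c) :=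
  fun μ => (h μ).subset fun _ hd => ⟨neg_ne_zero.mp hd.1, hd.2⟩

theorem simpleSum_add (hτ : 0 < τ.im) (h : LocFinite N τ ħ c) (h' : LocFinite N τ ħ c') (a : EWt N) :
    simpleSum (c + c') a = simpleSum c a + simpleSum c' a := by
  rw [simpleSum, simpleSum, simpleSum, ← finsum_add_distrib (h.support hτ a) (h'.support hτ a)]
  exact finsum_congr fun d => add_mul _ _ _

theorem simpleSum_neg (a : EWt N) : simpleSum (-c) a = -simpleSum c a := by
  rw [simpleSum, simpleSum, ← finsum_neg_distrib]
  exact finsum_congr fun d => neg_mul _ _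

open Classical in
theorem simpleSum_single (d : HighestWeights N τ ħ) (a : EWt N) :
    simpleSum (Pi.single d 1) a = (qc τ ħ (simpleMod d)).coeff a := by
  rw [simpleSum, finsum_eq_single _ d, Pi.single_eq_same, one_mul]
  intro d' hd'
  rw [Pi.single_eq_of_ne hd', zero_mul]

open Classical in
theorem locFinite_single (d : HighestWeights N τ ħ) : LocFinite N τ ħ (Pi.single d 1) := by
  refine fun μ => (Set.finite_singleton d).subset fun d' hd' => ?_
  by_contra h
  exact hd'.1 (Pi.single_eq_of_ne h _)

/-- The q-characters of the simple modules are linearly independent. -/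
theorem LocFinite.eq_zero (hτ : 0 < τ.im) (h : LocFinite N τ ħ c) {μ : H N}
    (h0 : ∀ a : EWt N, a.2 - μ ∈ QPlus N → simpleSum c a = 0) {d : HighestWeights N τ ħ}
    (hd : d.1.2 - μ ∈ QPlus N) : c d = 0 := by
  by_contra hcd
  obtain ⟨e, he, hmax⟩ := (h μ).exists_maximalFor (fun e => ht e.1.2) _ ⟨d, hcd, hd⟩
  have h1 := h0 e.1 he.2
  rw [simpleSum, finsum_eq_single _ e, qc_simple_self hτ, mul_one] at h1
  · exact he.1 h1
  · intro e' hne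
    by_contra h2
    obtain ⟨h3, h4⟩ := qc_simple_le hτ (right_ne_zero_of_mul h2)
    rcases ht_nonneg_of_QPlus h3 with h5 | h5
    · exact hne (Subtype.ext (h4 (sub_eq_zero.mp h5).symm).symm)
    · have h6 := add_mem h3 he.2
      rw [sub_add_sub_cancel] at h6
      rw [ht_sub] at h5
      have h7 := hmax (j := e') ⟨left_ne_zero_of_mul h2, h6⟩ (by dsimp only; linarith)
      dsimp only at h7
      linarith

theorem LocFinite.ext (hτ : 0 < τ.im) (h : LocFinite N τ ħ c) (h' : LocFinite N τ ħ c') {μ : H N}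
    (h0 : ∀ a : EWt N, a.2 - μ ∈ QPlus N → simpleSum c a = simpleSum c' a)
    {d : HighestWeights N τ ħ} (hd : d.1.2 - μ ∈ QPlus N) : c d = c' d := by
  have h1 : (c + -c') d = 0 := (h.add h'.neg).eq_zero hτ (fun a ha => by
    rw [simpleSum_add hτ h h'.neg, simpleSum_neg, h0 a ha, add_neg_cancel]) hd
  exact add_neg_eq_zero.mp h1

end LocFinite

open Classical in
theorem exists_factors (hτ : 0 < τ.im) (hħ : ħ ≠ 0) (μ : H N) (A : Finset (EWt N)) (n : ℕ)
    {X : PreMod N} (hX : X.InO τ ħ)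
    (hA : ∀ a : EWt N, a.2 - μ ∈ QPlus N → (qc τ ħ X).coeff a ≠ 0 → a ∈ A)
    (hn : ∑ a ∈ A, (qc τ ħ X).coeff a ≤ n) :
    ∃ c : HighestWeights N τ ħ → ℕ, LocFinite N τ ħ (fun d => c d) ∧
      (∀ a : EWt N, a.2 - μ ∈ QPlus N → (qc τ ħ X).coeff a = simpleSum (fun d => (c d : ℤ)) a) ∧
      ∀ d, HasFactors τ ħ (simpleMod d) X (c d) := by
  by_cases hall : ∀ a : EWt N, a.2 - μ ∈ QPlus N → (qc τ ħ X).coeff a = 0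
  · refine ⟨0, fun μ => ?_, fun a ha => ?_, fun d => HasFactors.zero X⟩
    · simp
    · rw [hall a ha, simpleSum]
      simp
  push Not at hall
  obtain ⟨a, ha, ha0⟩ := hall
  induction n generalizing X a with
  | zero =>
    exfalso
    refine ha0 ?_
    rw [Nat.cast_zero] at hn
    have h1 := Finset.single_le_sum (fun a _ => qc_coeff_nonneg hX a) (hA a ha ha0)
    exact le_antisymm (h1.trans hn) (qc_coeff_nonneg hX a)
  | succ n ih =>
    obtain ⟨d, Y, Z, ι, φ, π, hι, hφ, hπ, hex, hd, hXY⟩ :=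
      exists_simple_subquotient hτ hħ hX ha ha0
    have hY := hX.of_injective ι hι
    have hZ := hY.of_injective φ hφ
    have hYZ : ∀ a, (qc τ ħ Y).coeff a = (qc τ ħ Z).coeff a + (qc τ ħ (simpleMod d)).coeff a :=
      fun a => congrArg (fun χ => χ.coeff a) (qc_exact hY φ hφ π hπ hex)
    have hle : ∀ a, (qc τ ħ Y).coeff a ≤ (qc τ ħ X).coeff a := by
      intro a
      obtain ⟨R, p, hp, hker⟩ := ι.isSub_range.exists_quotient
      have h3 : (qc τ ħ X).coeff a = (qc τ ħ Y).coeff a + (qc τ ħ R).coeff a :=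
        congrArg (fun χ => χ.coeff a) (qc_exact hX ι hι p hp hker.symm)
      have := qc_coeff_nonneg (hX.of_surjective p hp) a
      omega
    have hpos : ∀ a, 0 ≤ (qc τ ħ Z).coeff a := qc_coeff_nonneg hZ
    have hpos' : ∀ a, 0 ≤ (qc τ ħ (simpleMod d)).coeff a := qc_coeff_nonneg (simpleMod_inO d)
    have hdA : d.1 ∈ A := by
      refine hA _ hd ?_
      have h1 := hle d.1
      rw [hYZ, qc_simple_self hτ] at h1
      have := hpos d.1
      omega
    have hZA : ∀ a : EWt N, a.2 - μ ∈ QPlus N → (qc τ ħ Z).coeff a ≠ 0 → a ∈ A := by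
      intro a ha h0
      refine hA a ha ?_
      have h1 := hle a
      have h2 := hpos a
      have h3 := hpos' a
      rw [hYZ] at h1
      omega
    have hZn : ∑ a ∈ A, (qc τ ħ Z).coeff a ≤ n := by
      have h1 : ∑ a ∈ A, ((qc τ ħ Z).coeff a + (qc τ ħ (simpleMod d)).coeff a) ≤
          ∑ a ∈ A, (qc τ ħ X).coeff a :=
        Finset.sum_le_sum fun a _ => (hYZ a).symm.trans_le (hle a)
      have h2 := Finset.single_le_sum (fun a _ => hpos' a) hdA
      rw [qc_simple_self hτ] at h2
      rw [Finset.sum_add_distrib] at h1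
      push_cast at hn
      omega
    obtain ⟨c, hc, hsum, hfac⟩ : ∃ c : HighestWeights N τ ħ → ℕ, LocFinite N τ ħ (fun d => c d) ∧
        (∀ a : EWt N, a.2 - μ ∈ QPlus N →
          (qc τ ħ Z).coeff a = simpleSum (fun d => (c d : ℤ)) a) ∧
        ∀ d, HasFactors τ ħ (simpleMod d) Z (c d) := by
      by_cases hall : ∀ a : EWt N, a.2 - μ ∈ QPlus N → (qc τ ħ Z).coeff a = 0
      · refine ⟨0, fun μ => ?_, fun a ha => ?_, fun d => HasFactors.zero Z⟩
        · simp
        · rw [hall a ha, simpleSum]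
          simp
      · push Not at hall
        obtain ⟨a', ha', ha0'⟩ := hall
        exact ih hZ hZA hZn a' ha' ha0'
    have hcast : (fun e => ((c e + if e = d then 1 else 0 : ℕ) : ℤ)) =
        (fun e => (c e : ℤ)) + Pi.single d 1 := by
      funext e
      rw [Pi.add_apply, Pi.single_apply]
      push_cast
      rfl
    refine ⟨fun e => c e + if e = d then 1 else 0, ?_, fun a ha => ?_, fun e => ?_⟩
    · rw [hcast]
      exact hc.add (locFinite_single d)
    · rw [hcast, simpleSum_add hτ hc (locFinite_single d), simpleSum_single, ← hsum a ha, ← hYZ,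
        hXY a ha]
    · refine HasFactors.skip hY.isRep ι hι ?_
      beta_reduce
      by_cases he : e = d
      · subst he
        rw [if_pos rfl]
        exact HasFactors.step hZ.isRep φ hφ π hπ hex (hfac e)
      · rw [if_neg he]
        exact HasFactors.skip hZ.isRep φ hφ (hfac e)

theorem finite_support_above (hX : X.InO τ ħ) (μ : H N) :
    {a : EWt N | a.2 - μ ∈ QPlus N ∧ (qc τ ħ X).coeff a ≠ 0}.Finite := by
  obtain ⟨h1, h2, S, v, ω, f, h, T⟩ := inO_iff.mp hX
  refine ((finite_above (T.inCones h2) T.fin μ).image fun s => EWt.mk (f s) (ω s)).subset ?_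
  rintro a ⟨ha, h0⟩
  rw [qc_coeff hX T, Nat.cast_ne_zero, Nat.card_ne_zero] at h0
  obtain ⟨⟨s, rfl⟩⟩ := h0.1
  exact ⟨s, ha, rfl⟩

theorem InO.exists_factors (hτ : 0 < τ.im) (hħ : ħ ≠ 0) (hX : X.InO τ ħ) (μ : H N) :
    ∃ c : HighestWeights N τ ħ → ℕ, LocFinite N τ ħ (fun d => c d) ∧
      (∀ a : EWt N, a.2 - μ ∈ QPlus N → (qc τ ħ X).coeff a = simpleSum (fun d => (c d : ℤ)) a) ∧
      ∀ d, HasFactors τ ħ (simpleMod d) X (c d) :=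
  PreMod.exists_factors hτ hħ μ (finite_support_above hX μ).toFinset
    (∑ a ∈ (finite_support_above hX μ).toFinset, (qc τ ħ X).coeff a).toNat hX
    (fun _ ha h0 => (finite_support_above hX μ).mem_toFinset.mpr ⟨ha, h0⟩) (Int.self_le_toNat _)

open Classical in
theorem HasFactors.le (hτ : 0 < τ.im) (hħ : ħ ≠ 0) {d : HighestWeights N τ ħ} {n : ℕ}
    (hf : HasFactors τ ħ (simpleMod d) X n) (hX : X.InO τ ħ) {c : HighestWeights N τ ħ → ℕ}
    (hc : LocFinite N τ ħ (fun d => c d)) (hsum : ∀ a : EWt N, a.2 - d.1.2 ∈ QPlus N →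
      (qc τ ħ X).coeff a = simpleSum (fun d => (c d : ℤ)) a) : n ≤ c d := by
  have hdd : d.1.2 - d.1.2 ∈ QPlus N := by rw [sub_self]; exact zero_mem _
  induction hf generalizing c with
  | zero X => exact Nat.zero_le _
  | @skip X Y n hY φ hφ _ ih =>
    obtain ⟨Q, π, hπ, hker⟩ := φ.isSub_range.exists_quotient
    obtain ⟨cY, hcY, hsY, -⟩ := (hX.of_injective φ hφ).exists_factors hτ hħ d.1.2
    obtain ⟨cQ, hcQ, hsQ, -⟩ := (hX.of_surjective π hπ).exists_factors hτ hħ d.1.2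
    have h1 := ih (hX.of_injective φ hφ) hcY hsY
    have h2 := hc.ext hτ (hcY.add hcQ) (fun a ha => by
      rw [simpleSum_add hτ hcY hcQ, ← hsum a ha, ← hsY a ha, ← hsQ a ha]
      exact congrArg (fun χ => χ.coeff a) (qc_exact hX φ hφ π hπ hker.symm)) hdd
    rw [Pi.add_apply] at h2
    omega
  | @step X Y n hY φ hφ π hπ hex _ ih =>
    obtain ⟨cY, hcY, hsY, -⟩ := (hX.of_injective φ hφ).exists_factors hτ hħ d.1.2
    have h1 := ih (hX.of_injective φ hφ) hcY hsY
    have h2 := hc.ext hτ (hcY.add (locFinite_single d)) (fun a ha => by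
      rw [simpleSum_add hτ hcY (locFinite_single d), ← hsum a ha, ← hsY a ha, simpleSum_single]
      exact congrArg (fun χ => χ.coeff a) (qc_exact hX φ hφ π hπ hex)) hdd
    rw [Pi.add_apply, Pi.single_eq_same] at h2
    omega

theorem mult_eq (hτ : 0 < τ.im) (hħ : ħ ≠ 0) (hX : X.InO τ ħ) {μ : H N}
    {c : HighestWeights N τ ħ → ℕ} (hc : LocFinite N τ ħ (fun d => c d))
    (hsum : ∀ a : EWt N, a.2 - μ ∈ QPlus N → (qc τ ħ X).coeff a = simpleSum (fun d => (c d : ℤ)) a)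
    (hfac : ∀ d, HasFactors τ ħ (simpleMod d) X (c d)) {d : HighestWeights N τ ħ}
    (hd : d.1.2 - μ ∈ QPlus N) : mult τ ħ (simpleMod d) X = c d := by
  have hle : ∀ n, HasFactors τ ħ (simpleMod d) X n → n ≤ c d := fun n hn =>
    hn.le hτ hħ hX hc fun a ha => hsum a (by
      have := add_mem ha hd
      rwa [sub_add_sub_cancel] at this)
  exact (IsGreatest.csSup_eq ⟨hfac d, hle⟩ : sSup {n | HasFactors τ ħ (simpleMod d) X n} = c d)

/-- The q-character of an object of `O` is the sum of those of its composition factors. -/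
theorem qc_eq_simpleSum (hτ : 0 < τ.im) (hħ : ħ ≠ 0) (hX : X.InO τ ħ) (a : EWt N) :
    (qc τ ħ X).coeff a =
      simpleSum (fun d : HighestWeights N τ ħ => (mult τ ħ (simpleMod d) X : ℤ)) a := by
  obtain ⟨c, hc, hsum, hfac⟩ := hX.exists_factors hτ hħ a.2
  rw [hsum a (by rw [sub_self]; exact zero_mem _)]
  refine finsum_congr fun d => ?_
  by_cases h : (qc τ ħ (simpleMod d)).coeff a = 0
  · rw [h, mul_zero, mul_zero]
  · beta_reduce
    rw [mult_eq hτ hħ hX hc hsum hfac (qc_simple_le hτ h).1]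

theorem qc_ne_zero_of_mult (hτ : 0 < τ.im) (hħ : ħ ≠ 0) (hX : X.InO τ ħ)
    {d : HighestWeights N τ ħ} (h : mult τ ħ (simpleMod d) X ≠ 0) : (qc τ ħ X).coeff d ≠ 0 := by
  obtain ⟨c, hc, hsum, hfac⟩ := hX.exists_factors hτ hħ d.1.2
  have hdd : d.1.2 - d.1.2 ∈ QPlus N := by rw [sub_self]; exact zero_mem _
  rw [mult_eq hτ hħ hX hc hsum hfac hdd] at h
  rw [hsum d.1 hdd]
  have h1 := single_le_finsum d (hc.support hτ d.1) fun e =>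
    mul_nonneg (Nat.cast_nonneg (c e)) (qc_coeff_nonneg (simpleMod_inO e) d.1)
  rw [qc_simple_self hτ, mul_one] at h1
  rw [simpleSum]
  exact ((Nat.cast_pos.mpr (Nat.pos_of_ne_zero h)).trans_le h1).ne'

theorem locFinite_mult (hτ : 0 < τ.im) (hħ : ħ ≠ 0) (hX : X.InO τ ħ) :
    LocFinite N τ ħ fun d => (mult τ ħ (simpleMod d) X : ℤ) := by
  intro μ
  refine ((finite_support_above hX μ).preimage Subtype.val_injective.injOn).subset ?_
  rintro d ⟨h0, hd⟩
  exact ⟨hd, qc_ne_zero_of_mult hτ hħ hX (Nat.cast_ne_zero.mp h0)⟩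

end PreMod
end EllipticO
end

noncomputable section
namespace EllipticO
namespace PreMod

variable {N : ℕ} {τ ħ : ℂ}

/-! ### The trivial module -/

open Classical in
/-- The trivial one-dimensional module. -/
def triv (N : ℕ) : PreMod N where
  B := Unit
  wt _ := 0
  L i j _ := Finsupp.single () (if i = j then 1 else 0)
  L_wt i j b b' h := by
    by_cases hij : i = j
    · rw [hij, add_sub_cancel_right]
    · rw [if_neg hij, Finsupp.single_zero] at h
      exact absurd rfl h

/-- The basis vector of the trivial module. -/
def trivPt (N : ℕ) : (triv N).B := ()

open Classical in
theorem L_triv (i j : Fin N) : (triv N).L i j (trivPt N) =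
    Finsupp.single (trivPt N) (if i = j then 1 else 0) := rfl

open Classical in
theorem op_triv {K : Type} [Field K] (F : Frame N K) (φ : MZ N →+* K) (i j : Fin N) (a : K) :
    (triv N).op F ħ φ i j (Finsupp.single (trivPt N) a) =
      Finsupp.single (trivPt N) (F.T (ħ • ε j) a * if i = j then 1 else 0) := by
  rw [op_single, L_triv, bext_single, apply_ite φ, map_one, map_zero, Finsupp.smul_single,
    smul_eq_mul]

theorem hasWt_triv {K : Type} [Field K] (x : (triv N).B →₀ K) : (triv N).HasWt x 0 :=
  fun _ _ => rfl

theorem rllAt_triv {K : Type} [Field K] (F : Frame N K) (φ₁ φ₂ : MZ N →+* K)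
    (R : Fin N → Fin N → Fin N → Fin N → K) :
    (triv N).RLLAt F ħ φ₁ φ₂ R (Finsupp.single (trivPt N) 1) := by
  classical
  intro i j m n
  simp only [(hasWt_triv _).muL_eq, op_triv, smul_zero, F.T_zero, map_one, one_mul,
    Finsupp.smul_single, smul_eq_mul, apply_ite (F.T _), map_zero, ← Finsupp.single_finsetSum]
  congr 1
  simp

theorem hatFactor_zero (hτ : 0 < τ.im) (k : Fin N) : hatFactor τ ħ k 0 = 1 := by
  have h0 := hatFactor_ne_zero (ħ := ħ) hτ k (0 : H N)
  rw [hatFactor, Finset.prod_ne_zero_iff] at h0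
  refine Finset.prod_eq_one fun j hj => ?_
  have h1 := h0 j hj
  split_ifs at h1 ⊢ with h
  · have h2 : ħ * ldiff k j (0 : H N) = 0 := by
      change ħ * (0 - 0) = 0
      rw [sub_zero, mul_zero]
    rw [h2] at h1 ⊢
    exact div_self (div_ne_zero_iff.mp h1).1
  · rfl

theorem tri_triv (hτ : 0 < τ.im) : (triv N).Tri τ ħ (fun _ : Unit => Finsupp.single (trivPt N) 1)
    (fun _ => 0) (fun _ _ => 1) (fun _ => 0) := by
  have hE : (triv N).IsEigen τ ħ (Finsupp.single (trivPt N) 1) 0 fun _ => 1 := by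
    intro k
    rw [hatFactor_zero hτ, one_smul, lop, bext_single, map_one, op_triv, map_one, one_mul,
      if_pos rfl, Units.val_one, map_one, one_smul]
  refine ⟨?_, fun _ => hasWt_triv _, ?_, fun _ => Set.toFinite _, fun _ _ _ _ => rfl,
    fun l _ => ?_⟩
  · rw [linearIndependent_unique_iff]
    exact fun h => one_ne_zero (Finsupp.single_eq_zero.mp h)
  · rw [eq_top_iff]
    intro x _
    have : x = x (trivPt N) • Finsupp.single (trivPt N) 1 := by
      refine Finsupp.ext fun (_ : Unit) => ?_
      change _ = (_ • Finsupp.single (trivPt N) 1) (trivPt N)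
      rw [Finsupp.smul_apply, Finsupp.single_eq_same, smul_eq_mul, mul_one]
      rfl
    rw [this]
    exact Submodule.smul_mem _ _ (Submodule.subset_span ⟨(), rfl⟩)
  · rw [hE.qminor_eq hτ (fun _ _ => rfl) (hasWt_triv _) l, sub_self]
    exact zero_mem _

theorem triv_inO (hτ : 0 < τ.im) : (triv N).InO τ ħ := by
  refine inO_of_tri ?_ (tri_triv hτ) ⟨{0}, ?_⟩
  · rw [rll_iff]
    exact rllAt_of_basis _ ħ _ (isWtZero_RZW τ ħ) fun _ => rllAt_triv _ _ _ _
  · rintro _ ⟨_, rfl⟩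
    exact ⟨0, Finset.mem_singleton_self _, by rw [sub_self]; exact zero_mem _⟩

theorem qc_triv (hτ : 0 < τ.im) : qc τ ħ (triv N) = 1 := by
  classical
  refine QRing.ext (funext fun a => ?_)
  rw [qc_coeff (triv_inO hτ) (tri_triv hτ)]
  change _ = if a = 0 then (1 : ℤ) else 0
  have hmk : EWt.mk (fun _ : Fin N => 1) (0 : H N) = 0 := rfl
  split_ifs with h
  · subst h
    rw [Nat.cast_eq_one, Nat.card_eq_one_iff_unique]
    exact ⟨inferInstance, ⟨⟨(), hmk⟩⟩⟩
  · rw [Nat.cast_eq_zero, Nat.card_eq_zero]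
    exact Or.inl ⟨fun t => h (t.2.symm.trans hmk)⟩

/-! ### Direct sums of simple modules -/

/-- The direct sum of `n d` copies of each simple module `S(d)`. -/
abbrev nsum (n : HighestWeights N τ ħ → ℕ) : PreMod N :=
  dsum fun p : Σ d : HighestWeights N τ ħ, Fin (n d) => simpleMod p.1

variable (N τ ħ) in
/-- The coefficients of the elements of the completed Grothendieck group. -/
structure Admissible (c : HighestWeights N τ ħ → ℤ) : Prop where
  locFinite : LocFinite N τ ħ c
  cones : InCones {μ | ∃ d, d.1.2 = μ ∧ c d ≠ 0}

theorem _root_.EllipticO.InCones.union {A A' : Set (H N)} (h : InCones A) (h' : InCones A') :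
    InCones (A ∪ A') := by
  classical
  obtain ⟨C, hC⟩ := h
  obtain ⟨C', hC'⟩ := h'
  refine ⟨C ∪ C', ?_⟩
  rintro μ (hμ | hμ)
  · obtain ⟨ν, hν, h⟩ := hC μ hμ
    exact ⟨ν, Finset.mem_union_left _ hν, h⟩
  · obtain ⟨ν, hν, h⟩ := hC' μ hμ
    exact ⟨ν, Finset.mem_union_right _ hν, h⟩

section Admissible

variable {c c' : HighestWeights N τ ħ → ℤ}

theorem Admissible.mono (h : Admissible N τ ħ c) (hc : ∀ d, c' d ≠ 0 → c d ≠ 0) :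
    Admissible N τ ħ c' :=
  ⟨fun μ => (h.1 μ).subset fun d hd => ⟨hc d hd.1, hd.2⟩,
    h.2.mono fun _ ⟨d, hd, h0⟩ => ⟨d, hd, hc d h0⟩⟩

theorem Admissible.add (h : Admissible N τ ħ c) (h' : Admissible N τ ħ c') :
    Admissible N τ ħ (c + c') := by
  refine ⟨h.1.add h'.1, (h.2.union h'.2).mono ?_⟩
  rintro _ ⟨d, rfl, h0⟩
  by_cases h1 : c d = 0
  · exact Or.inr ⟨d, rfl, fun h2 => h0 (by rw [Pi.add_apply, h1, h2, add_zero])⟩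
  · exact Or.inl ⟨d, rfl, h1⟩

theorem Admissible.neg (h : Admissible N τ ħ c) : Admissible N τ ħ (-c) :=
  h.mono fun _ hd => neg_ne_zero.mp hd

end Admissible

/-- Triangular bases of all the simple modules. -/
theorem exists_simple_tri (N : ℕ) (τ ħ : ℂ) : ∃ (S : HighestWeights N τ ħ → Type)
    (v : ∀ d, S d → (simpleMod d).V) (ω : ∀ d, S d → H N) (f : ∀ d, S d → Fin N → MCˣ)
    (h : ∀ d, S d → ℕ), ∀ d, (simpleMod d).Tri τ ħ (v d) (ω d) (f d) (h d) := by
  choose _ _ S v ω f h T using fun d : HighestWeights N τ ħ => inO_iff.mp (simpleMod_inO d)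
  exact ⟨S, v, ω, f, h, T⟩

section Data

variable {n : HighestWeights N τ ħ → ℕ} {S : HighestWeights N τ ħ → Type}
  {v : ∀ d, S d → (simpleMod d).V} {ω : ∀ d, S d → H N} {f : ∀ d, S d → Fin N → MCˣ}
  {h : ∀ d, S d → ℕ}

theorem simple_weight_le (hτ : 0 < τ.im)
    (T : ∀ d, (simpleMod d).Tri τ ħ (v d) (ω d) (f d) (h d)) (d : HighestWeights N τ ħ) (s : S d) :
    d.1.2 - ω d s ∈ QPlus N := by
  refine (qc_simple_le hτ (a := EWt.mk (f d s) (ω d s)) ?_).1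
  rw [qc_coeff (simpleMod_inO d) (T d), Nat.cast_ne_zero, Nat.card_ne_zero]
  refine ⟨⟨⟨s, rfl⟩⟩, ((T d).fin (ω d s)).subset fun t ht => ?_⟩
  exact congrArg Prod.snd ht

theorem Admissible.finite_fiber (hτ : 0 < τ.im) (hn : Admissible N τ ħ fun d => n d)
    (T : ∀ d, (simpleMod d).Tri τ ħ (v d) (ω d) (f d) (h d)) (μ : H N) :
    {s : Σ p : Σ d, Fin (n d), S p.1 | ω s.1.1 s.2 = μ}.Finite := by
  refine ((hn.1 μ).biUnion fun d _ => Set.finite_iUnion fun i : Fin (n d) =>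
    ((T d).fin μ).image fun t => (⟨⟨d, i⟩, t⟩ : Σ p : Σ d, Fin (n d), S p.1)).subset ?_
  rintro ⟨⟨d, i⟩, t⟩ (ht : ω d t = μ)
  refine Set.mem_biUnion (x := d) ⟨?_, ?_⟩ (Set.mem_iUnion.mpr ⟨i, t, ht, rfl⟩)
  · exact Nat.cast_ne_zero.mpr (Fin.pos i).ne'
  · rw [← ht]
    exact simple_weight_le hτ T d t

theorem Admissible.nsum_inO (hτ : 0 < τ.im) (hn : Admissible N τ ħ fun d => n d) :
    (nsum n).InO τ ħ := by
  obtain ⟨S, v, ω, f, h, T⟩ := exists_simple_tri N τ ħ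
  obtain ⟨h', T'⟩ := tri_dsum (M := fun p : Σ d, Fin (n d) => simpleMod p.1)
    (fun p => T p.1) (hn.finite_fiber hτ T)
  refine inO_of_tri (rll_dsum _ fun p => (simpleMod_inO p.1).isRep.rll) T' ?_
  obtain ⟨C, hC⟩ := hn.2
  refine ⟨C, ?_⟩
  rintro _ ⟨⟨⟨d, i⟩, t⟩, rfl⟩
  obtain ⟨ν, hν, h⟩ := hC d.1.2 ⟨d, rfl, Nat.cast_ne_zero.mpr (Fin.pos i).ne'⟩
  refine ⟨ν, hν, ?_⟩
  have := add_mem h (simple_weight_le hτ T d t)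
  rwa [sub_add_sub_cancel] at this

end Data

theorem card_sigma_eq_finsum {D : Type} {A : D → Type} [Finite (Σ d, A d)] :
    (Nat.card (Σ d, A d) : ℤ) = ∑ᶠ d, (Nat.card (A d) : ℤ) := by
  classical
  have := Fintype.ofFinite (Σ d, A d)
  have hfin : ∀ d, Finite (A d) := fun d =>
    Finite.of_injective (fun a : A d => (⟨d, a⟩ : Σ d, A d)) sigma_mk_injective
  rw [finsum_eq_sum_of_support_subset (s := Finset.univ.image fun s : Σ d, A d => s.1),
    Nat.card_eq_fintype_card, ← Finset.card_univ,
    Finset.card_eq_sum_card_image (fun s : Σ d, A d => s.1), Nat.cast_sum]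
  · refine Finset.sum_congr rfl fun d _ => ?_
    rw [← Nat.card_congr (Equiv.sigmaSubtype d), Nat.card_eq_fintype_card, Fintype.card_subtype]
  · intro d hd
    obtain ⟨⟨a⟩, -⟩ := Nat.card_ne_zero.mp (Nat.cast_ne_zero.mp hd)
    exact Finset.mem_coe.mpr (Finset.mem_image.mpr ⟨⟨d, a⟩, Finset.mem_univ _, rfl⟩)

theorem Admissible.qc_nsum (hτ : 0 < τ.im) {n : HighestWeights N τ ħ → ℕ}
    (hn : Admissible N τ ħ fun d => n d) (a : EWt N) :
    (qc τ ħ (nsum n)).coeff a = simpleSum (fun d => (n d : ℤ)) a := by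
  obtain ⟨S, v, ω, f, h, T⟩ := exists_simple_tri N τ ħ
  have hfin := hn.finite_fiber hτ T
  obtain ⟨h', T'⟩ := tri_dsum (M := fun p : Σ d, Fin (n d) => simpleMod p.1)
    (fun p => T p.1) hfin
  rw [qc_coeff (hn.nsum_inO hτ) T']
  let e : {s : Σ p : Σ d, Fin (n d), S p.1 // EWt.mk (f s.1.1 s.2) (ω s.1.1 s.2) = a} ≃
      Σ d, Fin (n d) × {t : S d // EWt.mk (f d t) (ω d t) = a} :=
    { toFun := fun s => ⟨s.1.1.1, s.1.1.2, s.1.2, s.2⟩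
      invFun := fun s => ⟨⟨⟨s.1, s.2.1⟩, s.2.2.1⟩, s.2.2.2⟩
      left_inv := fun _ => rfl
      right_inv := fun _ => rfl }
  have h1 : Finite {s : Σ p : Σ d, Fin (n d), S p.1 // EWt.mk (f s.1.1 s.2) (ω s.1.1 s.2) = a} :=
    (hfin a.2).subset fun s hs => congrArg Prod.snd hs
  have h2 : Finite (Σ d, Fin (n d) × {t : S d // EWt.mk (f d t) (ω d t) = a}) :=
    Finite.of_equiv _ e
  refine (congrArg Nat.cast (Nat.card_congr e)).trans (card_sigma_eq_finsum.trans ?_)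
  refine finsum_congr fun d => ?_
  rw [qc_coeff (simpleMod_inO d) (T d), Nat.card_prod, Nat.card_fin, Nat.cast_mul]

theorem exists_highest_index (hτ : 0 < τ.im) (d : HighestWeights N τ ħ) :
    ∃ b, (simpleMod d).wt b = d.1.2 := by
  obtain ⟨S, v, ω, f, h, T⟩ := exists_simple_tri N τ ħ
  obtain ⟨s, hs⟩ := qc_coeff_ne_zero (simpleMod_inO d) (T d) (a := d)
    (by rw [qc_simple_self hτ]; exact one_ne_zero)
  obtain ⟨b, hb⟩ := Finsupp.ne_iff.mp ((T d).li.ne_zero s)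
  exact ⟨b, ((T d).homog s b hb).trans hs⟩

theorem admissible_of_nsum (hτ : 0 < τ.im) {n : HighestWeights N τ ħ → ℕ}
    {c : HighestWeights N τ ħ → ℤ} (hc : ∀ d, c d ≠ 0 → 0 < n d) (hX : (nsum n).InO τ ħ) :
    Admissible N τ ħ c := by
  choose b hb using exists_highest_index (N := N) (ħ := ħ) hτ
  constructor
  · intro μ
    refine ((finite_above (ω := (nsum n).wt) hX.cones hX.isRep.finite μ).image
      fun p => p.1.1).subset ?_
    rintro d ⟨h0, hd⟩
    refine ⟨⟨⟨d, 0, hc d h0⟩, b d⟩, ?_, rfl⟩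
    change (simpleMod d).wt (b d) - μ ∈ QPlus N
    rwa [hb]
  · refine hX.cones.mono ?_
    rintro _ ⟨d, rfl, h0⟩
    exact ⟨⟨⟨d, 0, hc d h0⟩, b d⟩, hb d⟩

theorem admissible_iff (hτ : 0 < τ.im) {c : HighestWeights N τ ħ → ℤ} :
    Admissible N τ ħ c ↔ (nsum fun d => (c d).natAbs).InO τ ħ :=
  ⟨fun h => Admissible.nsum_inO hτ (h.mono fun _ hd h0 => hd (by
    rw [h0, Int.natAbs_zero, Nat.cast_zero])), admissible_of_nsum hτ fun _ hd => Int.natAbs_pos.mpr hd⟩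

theorem admissible_mult (hτ : 0 < τ.im) (hħ : ħ ≠ 0) {X : PreMod N} (hX : X.InO τ ħ) :
    Admissible N τ ħ fun d => (mult τ ħ (simpleMod d) X : ℤ) :=
  ⟨locFinite_mult hτ hħ hX, (qc τ ħ X).cones.mono fun _ ⟨d, hd, h0⟩ =>
    ⟨d.1, hd, qc_ne_zero_of_mult hτ hħ hX (Nat.cast_ne_zero.mp h0)⟩⟩

end PreMod
end EllipticO
end

noncomputable section
namespace EllipticO
namespace KO

open PreMod

variable {N : ℕ} {τ ħ : ℂ}

theorem admissible (hτ : 0 < τ.im) (x : KO N τ ħ) : Admissible N τ ħ x.coeff :=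
  (admissible_iff hτ).mpr x.inO

/-- The element of the Grothendieck group with given coefficients. -/
def ofCoeff (hτ : 0 < τ.im) {c : HighestWeights N τ ħ → ℤ} (h : Admissible N τ ħ c) : KO N τ ħ :=
  ⟨c, (admissible_iff hτ).mp h⟩

theorem admissible_toNat (hτ : 0 < τ.im) (x : KO N τ ħ) :
    Admissible N τ ħ fun d => ((x.coeff d).toNat : ℤ) :=
  (x.admissible hτ).mono fun d hd h0 => hd (by rw [h0]; rfl)

theorem admissible_neg_toNat (hτ : 0 < τ.im) (x : KO N τ ħ) :
    Admissible N τ ħ fun d => ((-x.coeff d).toNat : ℤ) :=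
  (x.admissible hτ).mono fun d hd h0 => hd (by rw [h0]; rfl)

/-- An object whose class is the positive part of `x`. -/
def posPart (hτ : 0 < τ.im) (x : KO N τ ħ) : ObjO N τ ħ :=
  ⟨nsum fun d => (x.coeff d).toNat, (x.admissible_toNat hτ).nsum_inO hτ⟩

/-- An object whose class is the negative part of `x`. -/
def negPart (hτ : 0 < τ.im) (x : KO N τ ħ) : ObjO N τ ħ :=
  ⟨nsum fun d => (-x.coeff d).toNat, (x.admissible_neg_toNat hτ).nsum_inO hτ⟩

/-- The class of an object. -/
def cls (hτ : 0 < τ.im) (hħ : ħ ≠ 0) (X : ObjO N τ ħ) : KO N τ ħ :=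
  ofCoeff hτ (admissible_mult hτ hħ X.2)

/-- The q-character of an element of the Grothendieck group. -/
def char (hτ : 0 < τ.im) (x : KO N τ ħ) : QRing N :=
  qc τ ħ (x.posPart hτ).1 - qc τ ħ (x.negPart hτ).1

theorem char_coeff (hτ : 0 < τ.im) (x : KO N τ ħ) (a : EWt N) :
    (x.char hτ).coeff a = simpleSum x.coeff a := by
  have h1 := x.admissible_toNat hτ
  have h2 := x.admissible_neg_toNat hτ
  have h3 : x.coeff = (fun d => ((x.coeff d).toNat : ℤ)) + -fun d => ((-x.coeff d).toNat : ℤ) := by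
    funext d
    rw [Pi.add_apply, Pi.neg_apply]
    omega
  rw [h3, simpleSum_add hτ h1.1 h2.1.neg, simpleSum_neg, ← h1.qc_nsum hτ, ← h2.qc_nsum hτ]
  rfl

theorem char_add (hτ : 0 < τ.im) {x y z : KO N τ ħ} (h : ∀ d, z.coeff d = x.coeff d + y.coeff d) :
    z.char hτ = x.char hτ + y.char hτ := by
  refine QRing.ext (funext fun a => ?_)
  rw [char_coeff, show z.coeff = x.coeff + y.coeff from funext h,
    simpleSum_add hτ (x.admissible hτ).1 (y.admissible hτ).1, ← char_coeff hτ, ← char_coeff hτ]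
  rfl

theorem char_injective (hτ : 0 < τ.im) : Function.Injective (char (N := N) (ħ := ħ) hτ) := by
  intro x y hxy
  refine KO.ext (funext fun d => ?_)
  refine (x.admissible hτ).1.ext hτ (y.admissible hτ).1 (μ := d.1.2) (fun a _ => ?_)
    (by rw [sub_self]; exact zero_mem _)
  rw [← char_coeff hτ, ← char_coeff hτ, hxy]

theorem char_cls (hτ : 0 < τ.im) (hħ : ħ ≠ 0) (X : ObjO N τ ħ) :
    (cls hτ hħ X).char hτ = qc τ ħ X.1 := by
  refine QRing.ext (funext fun a => ?_)
  rw [char_coeff, qc_eq_simpleSum hτ hħ X.2]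
  rfl

theorem coeff_eq_cls_sub (hτ : 0 < τ.im) (hħ : ħ ≠ 0) (x : KO N τ ħ) (d : HighestWeights N τ ħ) :
    (cls hτ hħ (x.posPart hτ)).coeff d = x.coeff d + (cls hτ hħ (x.negPart hτ)).coeff d := by
  let y : KO N τ ħ := ofCoeff hτ ((x.admissible hτ).add ((cls hτ hħ (x.negPart hτ)).admissible hτ))
  have h1 : y.char hτ = (cls hτ hħ (x.posPart hτ)).char hτ := by
    rw [char_add hτ (x := x) (y := cls hτ hħ (x.negPart hτ)) fun d => rfl, char_cls, char_cls, char,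
      sub_add_cancel]
  exact congrArg (fun y => y.coeff d) (char_injective hτ h1).symm

variable (N ħ) in
/-- The group of q-characters of elements of the Grothendieck group. -/
def charGroup (hτ : 0 < τ.im) : AddSubgroup (QRing N) where
  carrier := Set.range (char (ħ := ħ) hτ)
  zero_mem' := by
    have h : Admissible N τ ħ 0 := ⟨fun μ => by simp, ∅, fun μ ⟨d, _, h0⟩ => absurd rfl h0⟩
    refine ⟨ofCoeff hτ h, QRing.ext (funext fun a => ?_)⟩
    rw [char_coeff]
    exact finsum_eq_zero_of_forall_eq_zero fun d => zero_mul _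
  add_mem' := by
    rintro _ _ ⟨x, rfl⟩ ⟨y, rfl⟩
    exact ⟨ofCoeff hτ ((x.admissible hτ).add (y.admissible hτ)), char_add hτ fun _ => rfl⟩
  neg_mem' := by
    rintro _ ⟨x, rfl⟩
    refine ⟨ofCoeff hτ (x.admissible hτ).neg, QRing.ext (funext fun a => ?_)⟩
    rw [char_coeff]
    change simpleSum (-x.coeff) a = -(x.char hτ).coeff a
    rw [simpleSum_neg, char_coeff]

theorem qc_mem_charGroup (hτ : 0 < τ.im) (hħ : ħ ≠ 0) (X : ObjO N τ ħ) :
    qc τ ħ X.1 ∈ charGroup N ħ hτ := ⟨cls hτ hħ X, char_cls hτ hħ X⟩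

variable (N) in
/-- The ring of q-characters of elements of the Grothendieck group. -/
def charRing (hτ : 0 < τ.im) (hħ : ħ ≠ 0) (hθ : theta τ ħ ≠ 0) : Subring (QRing N) where
  __ := charGroup N ħ hτ
  one_mem' := by
    have := qc_mem_charGroup hτ hħ ⟨triv N, triv_inO hτ⟩
    rwa [qc_triv hτ] at this
  mul_mem' := by
    rintro _ _ ⟨x, rfl⟩ ⟨y, rfl⟩
    have h : ∀ X Y : ObjO N τ ħ, qc τ ħ X.1 * qc τ ħ Y.1 ∈ charGroup N ħ hτ := fun X Y => by
      rw [← qc_tensor hτ hθ X.2 Y.2]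
      exact qc_mem_charGroup hτ hħ ⟨_, inO_tensor hτ hθ X.2 Y.2⟩
    rw [char, char, sub_mul, mul_sub, mul_sub]
    exact sub_mem (sub_mem (h _ _) (h _ _)) (sub_mem (h _ _) (h _ _))

variable (N) in
/-- The Grothendieck group is identified with its image under the q-character. -/
def charEquiv (hτ : 0 < τ.im) (hħ : ħ ≠ 0) (hθ : theta τ ħ ≠ 0) :
    KO N τ ħ ≃ charRing N hτ hħ hθ :=
  Equiv.ofBijective (fun x => ⟨x.char hτ, x, rfl⟩)
    ⟨fun _ _ h => char_injective hτ (congrArg Subtype.val h), fun ⟨_, x, hx⟩ => ⟨x, Subtype.ext hx⟩⟩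

/-- A ring structure on the Grothendieck group is determined by its addition and the products of
the classes of objects. -/
theorem isGrothendieckRing_unique (hτ : 0 < τ.im) (hħ : ħ ≠ 0)
    {hten : ∀ X Y : ObjO N τ ħ, (tensor ħ X.1 Y.1).InO τ ħ} {R R' : Ring (KO N τ ħ)}
    (hR : IsGrothendieckRing hten (cls hτ hħ) R) (hR' : IsGrothendieckRing hten (cls hτ hħ) R') :
    R' = R := by
  have hadd : ∀ x y : KO N τ ħ, R'.add x y = R.add x y := fun x y =>
    KO.ext (funext fun d => (hR'.1 x y d).trans (hR.1 x y d).symm)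
  refine Ring.ext (funext fun x => funext fun y => hadd x y) (funext fun x => funext fun y => ?_)
  have key : ∀ (A : Ring (KO N τ ħ)), IsGrothendieckRing hten (cls hτ hħ) A → ∀ x y : KO N τ ħ,
      A.add (A.mul x y) (A.add (cls hτ hħ ⟨_, hten (x.posPart hτ) (y.negPart hτ)⟩)
        (cls hτ hħ ⟨_, hten (x.negPart hτ) (y.posPart hτ)⟩)) =
      A.add (cls hτ hħ ⟨_, hten (x.posPart hτ) (y.posPart hτ)⟩)
        (cls hτ hħ ⟨_, hten (x.negPart hτ) (y.negPart hτ)⟩) := by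
    intro A hA x y
    have hsub : ∀ x : KO N τ ħ, cls hτ hħ (x.posPart hτ) = A.add x (cls hτ hħ (x.negPart hτ)) :=
      fun x => KO.ext (funext fun d => (coeff_eq_cls_sub hτ hħ x d).trans (hA.1 _ _ d).symm)
    rw [← hA.2, ← hA.2, ← hA.2, ← hA.2, hsub x, hsub y]
    generalize cls hτ hħ (x.negPart hτ) = p
    generalize cls hτ hħ (y.negPart hτ) = q
    change x * y + ((x + p) * q + p * (y + q)) = (x + p) * (y + q) + p * q
    noncomm_ring
  have h1 := key R hR x y
  have h2 := key R' hR' x y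
  rw [hadd, hadd, hadd] at h2
  have hcancel : ∀ a b c : KO N τ ħ, R.add a c = R.add b c → a = b := fun a b c h => by
    let := R
    exact add_right_cancel (show a + c = b + c from h)
  exact hcancel _ _ _ (h2.trans h1.symm)

end KO
end EllipticO
end

open EllipticO in
theorem corollary1p7 (N : ℕ) (hN : 0 < N) (τ ħ : ℂ) (hτ : 0 < τ.im)
    (hħ : ∀ a b : ℚ, ħ ≠ a + b * τ) :
    -- the dynamical tensor product of two objects of category `O` is in category `O`
    ∃ hten : ∀ X Y : ObjO N τ ħ, (PreMod.tensor ħ X.1 Y.1).InO τ ħ,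
      -- every object has exactly one q-character, and q-characters are multiplicative
      (∀ X : ObjO N τ ħ, ∃! χ : QRing N, IsQChar τ ħ X.1 χ) ∧
      (∀ X Y : ObjO N τ ħ, qc τ ħ (PreMod.tensor ħ X.1 Y.1) = qc τ ħ X.1 * qc τ ħ Y.1) ∧
      -- every object has a class in the completed Grothendieck group, given by multiplicities
      ∃ cls : ObjO N τ ħ → KO N τ ħ,
        (∀ (X : ObjO N τ ħ) (d : HighestWeights N τ ħ),
          (cls X).coeff d = PreMod.mult τ ħ (simpleMod d) X.1) ∧
        -- there is a unique ring structure with the addition of formal sums and `[X][Y] = [X ⊗ Y]`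
        ∃ R : Ring (KO N τ ħ), IsGrothendieckRing hten cls R ∧
          (∀ R' : Ring (KO N τ ħ), IsGrothendieckRing hten cls R' → R' = R) ∧
          -- `[X] ↦ qc(X)` is an injective morphism of rings, and the ring is commutative
          (∃ φ : KO N τ ħ →+* QRing N,
            (∀ X : ObjO N τ ħ, φ (cls X) = qc τ ħ X.1) ∧ Function.Injective φ) ∧
          (∀ x y : KO N τ ħ, x * y = y * x) := by
  have hθ := theta_ne_zero hτ hħ
  have hħ0 : ħ ≠ 0 := by simpa using hħ 0 0
  have hten : ∀ X Y : ObjO N τ ħ, (PreMod.tensor ħ X.1 Y.1).InO τ ħ := fun X Y =>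
    PreMod.inO_tensor hτ hθ X.2 Y.2
  have hqc : ∀ X Y : ObjO N τ ħ, qc τ ħ (PreMod.tensor ħ X.1 Y.1) = qc τ ħ X.1 * qc τ ħ Y.1 :=
    fun X Y => qc_tensor hτ hθ X.2 Y.2
  let R : CommRing (KO N τ ħ) := (KO.charEquiv N hτ hħ0 hθ).commRing
  let φ : KO N τ ħ →+* QRing N :=
    (KO.charRing N hτ hħ0 hθ).subtype.comp (KO.charEquiv N hτ hħ0 hθ).ringEquiv.toRingHom
  have hφ : ∀ x, φ x = x.char hτ := fun _ => rfl
  have hR : IsGrothendieckRing hten (KO.cls hτ hħ0) R.toRing := by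
    refine ⟨fun x y d => ?_, fun X Y => KO.char_injective hτ ?_⟩
    · let z : KO N τ ħ := KO.ofCoeff hτ ((x.admissible hτ).add (y.admissible hτ))
      have h : x + y = z := KO.char_injective hτ (by
        rw [KO.char_add hτ (x := x) (y := y) (z := z) fun _ => rfl, ← hφ, map_add, hφ, hφ])
      rw [h]
      rfl
    · rw [← hφ, map_mul, hφ, hφ, KO.char_cls, KO.char_cls, KO.char_cls, hqc]
  exact ⟨hten, fun X => existsUnique_isQChar X.2, hqc, KO.cls hτ hħ0, fun X d => rfl, R.toRing, hR,
    fun R' hR' => KO.isGrothendieckRing_unique hτ hħ0 hR hR',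
    ⟨φ, fun X => (hφ _).trans (KO.char_cls hτ hħ0 X), KO.char_injective hτ⟩, R.mul_comm⟩
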